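/- **Theorem.** Let $\Omega=(a_1,b_1)\times(a_2,b_2)\subset\mathbb R^2$ be a bounded open rectangle, $T>0$, $0<\alpha<1$, and let $\kappa:\mathbb R^2\to\mathbb R$ be measurable and bounded on $\Omega$. For a function $f$ of time put $${}_0^CD_t^{\alpha,\kappa(\mathbf x)}f(t)=e^{-\kappa(\mathbf x)t}\,\frac{1}{\Gamma(1-\alpha)}\int_0^t(t-\tau)^{-\alpha}\,\partial_\tau\big(e^{\kappa(\mathbf x)\tau}f(\tau)\big)\,d\tau .$$ Let $u\in H^1(0,T;L^2(\Omega))$ be a solution, with periodic boundary conditions and initial value $u(0,\cdot)=u_0$, of $${}_0^CD_t^{\alpha,\kappa(\mathbf x)}u(t,\mathbf x)=\Delta u(t,\mathbf x),\qquad (t,\mathbf x)\in(0,T]\times\Omega ;$$ that is, there is $\mathbf p\in L^2(0,T;L^2(\Omega)^2)$ such that, for almost every $t\in(0,T)$, $\mathbf p=\nabla u$ and ${}_0^CD_t^{\alpha,\kappa(\mathbf x)}u=\nabla\cdot\mathbf p$ hold in the sense of distributions on the torus (tested with smooth periodic functions). *Meshes.* A mesh $\Omega_h$ consists of the cells $\Omega_{ij}=(x_{i-1/2},x_{i+1/2})\times(y_{j-1/2},y_{j+1/2})$,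 $1\le i\le N_x$, $1\le j\le N_y$, given by partitions of $[a_1,b_1]$ and $[a_2,b_2]$; $h$ is the largest side length of a cell. The mesh is quasi-uniform with constant $\rho$ if $h\le\rho\,\ell$ for every side length $\ell$ of every cell. $H^r(\Omega_h)$ is the space of functions whose restriction to each cell $\Omega_{ij}$ lies in $H^r(\Omega_{ij})$, and $\|\cdot\|$ is given by $\|v\|^2=\sum_{i,j}\|v\|^2_{L^2(\Omega_{ij})}$. *Scheme.* Let $k\ge 0$ be an integer, let $Q^k$ be the polynomials of degree at most $k$ in each variable, and $V_h^k$ the functions whose restriction to each cell lies in $Q^k$. Let $\sigma_1,\sigma_2\in\mathbb R\setminus\{1/2\}$. A semi-discrete LDG solution is a pair $u_h\in H^1(0,T;V_h^k)$, $\mathbf p_h\in L^2(0,T;(V_h^k)^2)$ such that, for almost every $t\in(0,T)$, all cells $\Omega_{ij}$ and all $v\in Q^k$, $\mathbf w\in (Q^k)^2$, $$\big({}_0^CD_t^{\alpha,\kappa(\mathbf x)}u_h,v\big)_{\Omega_{ij}}+(\mathbf p_h,\nabla v)_{\Omega_{ij}}-\langle\widehat{\mathbf p_h}\cdot\mathbf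 n,v\rangle_{\partial\Omega_{ij}}=0,$$ $$(\mathbf p_h,\mathbf w)_{\Omega_{ij}}+(u_h,\nabla\cdot\mathbf w)_{\Omega_{ij}}-\langle\widehat{u_h},\mathbf w\cdot\mathbf n\rangle_{\partial\Omega_{ij}}=0,$$ and $(u_h(0),v)_{\Omega_{ij}}=(u_0,v)_{\Omega_{ij}}$. Here the test functions have their traces from inside $\Omega_{ij}$, $\mathbf n$ is the outward unit normal, and the numerical fluxes are the generalized alternating ones: on an edge $x=x_{i+1/2}$, $\widehat{u_h}=\sigma_1u_h^-+(1-\sigma_1)u_h^+$ and $\widehat{\mathbf p_h}=(1-\sigma_1)\mathbf p_h^-+\sigma_1\mathbf p_h^+$; on an edge $y=y_{j+1/2}$ the same with $\sigma_2$ in place of $\sigma_1$, where $^-$ and $^+$ denote the limits from the left/below and from the right/above, taken periodically at the boundary of $\Omega$. *Claim.* Let $s\ge k$ be an integer and $\rho\in\mathbb R$. Then there is a constant $C>0$, independent of the mesh (in particular of $h$) and of $u_h$, such that for every mesh $\Omega_h$ that is quasi-uniform with constant $\rho$ and for which $u\in H^1(0,T;H^{s+1}(\Omega_h)\cap H^2(\Omega_h))$,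 and for every semi-discrete LDG solution $(u_h,\mathbf p_h)$ on $\Omega_h$, $$\int_0^T\|u(t)-u_h(t)\|^2\,dt\le C\,h^{2k+2}.$$ -/

import Mathlib

open MeasureTheory Set
open scoped ContDiff

noncomputable section

namespace LDG

/-! ### Partial derivatives and fractional substantial derivatives -/

/-- The partial derivative in the first variable. -/
def dX (φ : ℝ × ℝ → ℝ) (z : ℝ × ℝ) : ℝ := deriv (fun ξ => φ (ξ, z.2)) z.1

/-- The partial derivative in the second variable. -/
def dY (φ : ℝ × ℝ → ℝ) (z : ℝ × ℝ) : ℝ := deriv (fun η => φ (z.1, η)) z.2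

/-- The Caputo derivative `(1 / Γ(1-α)) ∫₀ᵗ (t-τ)^{-α} f'(τ) dτ`. -/
def caputo (α : ℝ) (f : ℝ → ℝ) (t : ℝ) : ℝ :=
  (1 / Real.Gamma (1 - α)) * ∫ τ in (0 : ℝ)..t, (t - τ) ^ (-α) * deriv f τ

/-- The Caputo fractional substantial derivative `e^{-κt} D^α (e^{κt} f)` at one value of `κ`. -/
def substCaputo (α κ : ℝ) (f : ℝ → ℝ) (t : ℝ) : ℝ :=
  Real.exp (-κ * t) * caputo α (fun τ => Real.exp (κ * τ) * f τ) t

/-! ### Rectangle and meshes -/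

/-- The open rectangle `(a₁, b₁) × (a₂, b₂)`. -/
def rect (a₁ b₁ a₂ b₂ : ℝ) : Set (ℝ × ℝ) := Ioo a₁ b₁ ×ˢ Ioo a₂ b₂

/-- A tensor-product mesh of the rectangle: `Nx` columns and `Ny` rows of cells. -/
structure RectMesh (a₁ b₁ a₂ b₂ : ℝ) where
  Nx : ℕ
  Ny : ℕ
  Nx_pos : 0 < Nx
  Ny_pos : 0 < Ny
  x : Fin (Nx + 1) → ℝ
  y : Fin (Ny + 1) → ℝ
  x_strictMono : StrictMono x
  y_strictMono : StrictMono y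
  x_zero : x 0 = a₁
  x_last : x (Fin.last Nx) = b₁
  y_zero : y 0 = a₂
  y_last : y (Fin.last Ny) = b₂

namespace RectMesh

variable {a₁ b₁ a₂ b₂ : ℝ} (M : RectMesh a₁ b₁ a₂ b₂)

/-- Left end of the `i`-th interval in `x`. -/
def xL (i : Fin M.Nx) : ℝ := M.x i.castSucc
/-- Right end of the `i`-th interval in `x`. -/
def xR (i : Fin M.Nx) : ℝ := M.x i.succ
/-- Lower end of the `j`-th interval in `y`. -/
def yL (j : Fin M.Ny) : ℝ := M.y j.castSucc
/-- Upper end of the `j`-th interval in `y`. -/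
def yR (j : Fin M.Ny) : ℝ := M.y j.succ

/-- The open cell `Ω_{ij}`. -/
def cell (i : Fin M.Nx) (j : Fin M.Ny) : Set (ℝ × ℝ) :=
  rect (M.xL i) (M.xR i) (M.yL j) (M.yR j)

/-- The mesh size: the largest side length of a cell. -/
def h : ℝ := ⨆ ij : Fin M.Nx × Fin M.Ny,
  max (M.xR ij.1 - M.xL ij.1) (M.yR ij.2 - M.yL ij.2)

/-- Quasi-uniformity with constant `ρ`: every side of every cell is at least `h / ρ`. -/
def QuasiUniform (ρ : ℝ) : Prop :=
  (∀ i, M.h ≤ ρ * (M.xR i - M.xL i)) ∧ (∀ j, M.h ≤ ρ * (M.yR j - M.yL j))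

end RectMesh

/-! ### Sobolev spaces -/

/-- `g` is the weak derivative `∂_x^m ∂_y^n f` on the open set `K`. -/
def HasWeakDeriv (K : Set (ℝ × ℝ)) (m n : ℕ) (f g : ℝ × ℝ → ℝ) : Prop :=
  ∀ φ : ℝ × ℝ → ℝ, ContDiff ℝ ∞ φ → HasCompactSupport φ → tsupport φ ⊆ K →
    ∫ z in K, f z * (dX^[m] (dY^[n] φ)) z = (-1) ^ (m + n) * ∫ z in K, g z * φ z

/-- `f ∈ L²(0,T; L²(Ω))` with `Ω = (a₁, b₁) × (a₂, b₂)`, as a function of time and space. -/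
def MemL2 (a₁ b₁ a₂ b₂ T : ℝ) (f : ℝ → ℝ × ℝ → ℝ) : Prop :=
  MemLp (Function.uncurry f) 2
    ((volume.restrict (Ioo 0 T)).prod (volume.restrict (rect a₁ b₁ a₂ b₂)))

/-- `f'` is the weak time derivative of `f` on `(0,T)`, and `f` is the representative that is
absolutely continuous on `[0,T]` at almost every point of `Ω`. -/
def HasTimeDeriv (a₁ b₁ a₂ b₂ T : ℝ) (f f' : ℝ → ℝ × ℝ → ℝ) : Prop :=
  ∀ᵐ z ∂(volume.restrict (rect a₁ b₁ a₂ b₂)),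
    IntervalIntegrable (fun t => f' t z) volume 0 T ∧
    ∀ t ∈ Icc 0 T, f t z = f 0 z + ∫ τ in (0 : ℝ)..t, f' τ z

/-- `f ∈ H¹(0,T; L²(Ω))`. -/
def MemH1L2 (a₁ b₁ a₂ b₂ T : ℝ) (f : ℝ → ℝ × ℝ → ℝ) : Prop :=
  MemL2 a₁ b₁ a₂ b₂ T f ∧
    ∃ f', HasTimeDeriv a₁ b₁ a₂ b₂ T f f' ∧ MemL2 a₁ b₁ a₂ b₂ T f'

section Broken

variable {a₁ b₁ a₂ b₂ : ℝ}

/-- `f ∈ L²(0,T; H^r(Ω_h))`, where `H^r(Ω_h)` is the broken Sobolev space of the mesh: every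
cellwise weak derivative of order at most `r` exists and is square integrable over `(0,T) × Ω`. -/
def MemL2Broken (M : RectMesh a₁ b₁ a₂ b₂) (T : ℝ) (r : ℕ) (f : ℝ → ℝ × ℝ → ℝ) : Prop :=
  MemL2 a₁ b₁ a₂ b₂ T f ∧
    ∀ m n : ℕ, m + n ≤ r → ∃ g : ℝ → ℝ × ℝ → ℝ, MemL2 a₁ b₁ a₂ b₂ T g ∧
      ∀ᵐ t ∂(volume.restrict (Ioo 0 T)), ∀ i j, HasWeakDeriv (M.cell i j) m n (f t) (g t)

/-- `f ∈ H¹(0,T; H^r(Ω_h))`. -/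
def MemH1Broken (M : RectMesh a₁ b₁ a₂ b₂) (T : ℝ) (r : ℕ) (f : ℝ → ℝ × ℝ → ℝ) : Prop :=
  MemL2Broken M T r f ∧
    ∃ f', HasTimeDeriv a₁ b₁ a₂ b₂ T f f' ∧ MemL2Broken M T r f'

end Broken

/-! ### The exact solution -/

/-- Smooth test functions on the plane that are periodic with respect to the rectangle. -/
def IsPeriodicTest (a₁ b₁ a₂ b₂ : ℝ) (φ : ℝ × ℝ → ℝ) : Prop :=
  ContDiff ℝ ∞ φ ∧ (∀ x y, φ (x + (b₁ - a₁), y) = φ (x, y)) ∧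
    (∀ x y, φ (x, y + (b₂ - a₂)) = φ (x, y))

/-- `u` is a periodic solution of `D^{α,κ} u = Δ u` on `(0,T) × Ω` with initial value `u₀`:
for a flux `(p, q)` the first-order system `(p, q) = ∇u`, `D^{α,κ} u = ∇ · (p, q)` holds at almost
every time, in the sense of distributions on the torus. Testing with periodic functions (and not
only with functions of compact support in `Ω`) is what encodes the periodic boundary condition. -/
def IsExactSolution (a₁ b₁ a₂ b₂ T α : ℝ) (κ u₀ : ℝ × ℝ → ℝ) (u : ℝ → ℝ × ℝ → ℝ) : Prop :=
  MemH1L2 a₁ b₁ a₂ b₂ T u ∧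
  (∀ᵐ z ∂(volume.restrict (rect a₁ b₁ a₂ b₂)), u 0 z = u₀ z) ∧
  ∃ p q : ℝ → ℝ × ℝ → ℝ, MemL2 a₁ b₁ a₂ b₂ T p ∧ MemL2 a₁ b₁ a₂ b₂ T q ∧
    ∀ᵐ t ∂(volume.restrict (Ioo 0 T)), ∀ φ, IsPeriodicTest a₁ b₁ a₂ b₂ φ →
      ((∫ z in rect a₁ b₁ a₂ b₂, u t z * dX φ z) = -∫ z in rect a₁ b₁ a₂ b₂, p t z * φ z) ∧
      ((∫ z in rect a₁ b₁ a₂ b₂, u t z * dY φ z) = -∫ z in rect a₁ b₁ a₂ b₂, q t z * φ z) ∧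
      ((∫ z in rect a₁ b₁ a₂ b₂, substCaputo α (κ z) (fun τ => u τ z) t * φ z)
        = -∫ z in rect a₁ b₁ a₂ b₂, (p t z * dX φ z + q t z * dY φ z))

/-! ### The semi-discrete scheme -/

/-- `Q^k`: polynomials of degree at most `k` in each variable; `c m n` is the coefficient of
`x^m y^n`. -/
abbrev Qk (k : ℕ) : Type := Fin (k + 1) → Fin (k + 1) → ℝ

/-- The polynomial function on the plane with the given coefficients. -/
def Qk.eval {k : ℕ} (c : Qk k) (z : ℝ × ℝ) : ℝ :=
  ∑ m : Fin (k + 1), ∑ n : Fin (k + 1), c m n * z.1 ^ (m : ℕ) * z.2 ^ (n : ℕ)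

section Scheme

variable {a₁ b₁ a₂ b₂ : ℝ}

/-- The finite element space `V_h^k`: one polynomial of `Q^k` on each cell. The one-sided limits
of a piecewise polynomial at a cell boundary are the values of the cell polynomials there. -/
abbrev Vh (M : RectMesh a₁ b₁ a₂ b₂) (k : ℕ) : Type := Fin M.Nx → Fin M.Ny → Qk k

variable {M : RectMesh a₁ b₁ a₂ b₂} {k : ℕ}

/-- The weighted average `σ v⁻ + (1-σ) v⁺` on the right edge of cell `(i,j)`, at height `y`.
The right neighbour of the last column is, by periodicity, the first one. -/
def avgX (σ : ℝ) (v : Vh M k) (i : Fin M.Nx) (j : Fin M.Ny) (y : ℝ) : ℝ :=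
  σ * (v i j).eval (M.xR i, y)
    + (1 - σ) * (v (finRotate M.Nx i) j).eval (M.xL (finRotate M.Nx i), y)

/-- The weighted average `σ v⁻ + (1-σ) v⁺` on the upper edge of cell `(i,j)`, at abscissa `x`.
The upper neighbour of the last row is, by periodicity, the first one. -/
def avgY (σ : ℝ) (v : Vh M k) (i : Fin M.Nx) (j : Fin M.Ny) (x : ℝ) : ℝ :=
  σ * (v i j).eval (x, M.yR j)
    + (1 - σ) * (v i (finRotate M.Ny j)).eval (x, M.yL (finRotate M.Ny j))

/-- The boundary term `⟨f̂ n₁, w⟩` over the two vertical edges of cell `(i,j)` for the flux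
`f̂ = f^{(σ)}`, with the interior trace of the test polynomial `w`. The left edge of a cell is the
right edge of its left neighbour. -/
def bdryX (σ : ℝ) (f : Vh M k) (i : Fin M.Nx) (j : Fin M.Ny) (w : Qk k) : ℝ :=
  ∫ y in (M.yL j)..(M.yR j),
    (avgX σ f i j y * w.eval (M.xR i, y)
      - avgX σ f ((finRotate M.Nx).symm i) j y * w.eval (M.xL i, y))

/-- The boundary term `⟨f̂ n₂, w⟩` over the two horizontal edges of cell `(i,j)` for the flux
`f̂ = f^{(σ)}`, with the interior trace of the test polynomial `w`. -/
def bdryY (σ : ℝ) (f : Vh M k) (i : Fin M.Nx) (j : Fin M.Ny) (w : Qk k) : ℝ :=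
  ∫ x in (M.xL i)..(M.xR i),
    (avgY σ f i j x * w.eval (x, M.yR j)
      - avgY σ f i ((finRotate M.Ny).symm j) x * w.eval (x, M.yL j))

/-- `f ∈ H¹(0,T)`, for the continuous representative on `[0,T]`. -/
def MemH1Time (T : ℝ) (f : ℝ → ℝ) : Prop :=
  ∃ f' : ℝ → ℝ, MemLp f' 2 (volume.restrict (Ioo 0 T)) ∧
    ∀ t ∈ Icc 0 T, f t = f 0 + ∫ τ in (0 : ℝ)..t, f' τ

/-- `(u_h, (p_h, q_h)) ∈ H¹(0,T; V_h^k) × L²(0,T; V_h^k × V_h^k)` solves the semi-discrete LDG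
scheme with the generalized alternating fluxes: weights `σ₁`, `σ₂` in the averages of `u_h`, and
weights `1 - σ₁`, `1 - σ₂` in those of `(p_h, q_h)`. -/
structure IsLDGSolution (M : RectMesh a₁ b₁ a₂ b₂) (k : ℕ) (T α σ₁ σ₂ : ℝ)
    (κ u₀ : ℝ × ℝ → ℝ) (uh ph qh : ℝ → Vh M k) : Prop where
  uh_mem : ∀ i j m n, MemH1Time T (fun t => uh t i j m n)
  ph_mem : ∀ i j m n, MemLp (fun t => ph t i j m n) 2 (volume.restrict (Ioo 0 T))
  qh_mem : ∀ i j m n, MemLp (fun t => qh t i j m n) 2 (volume.restrict (Ioo 0 T))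
  evolution : ∀ᵐ t ∂(volume.restrict (Ioo 0 T)), ∀ i j, ∀ v : Qk k,
    (∫ z in M.cell i j, substCaputo α (κ z) (fun τ => (uh τ i j).eval z) t * v.eval z)
      + (∫ z in M.cell i j,
          ((ph t i j).eval z * dX v.eval z + (qh t i j).eval z * dY v.eval z))
      - (bdryX (1 - σ₁) (ph t) i j v + bdryY (1 - σ₂) (qh t) i j v) = 0
  gradient : ∀ᵐ t ∂(volume.restrict (Ioo 0 T)), ∀ i j, ∀ w₁ w₂ : Qk k,
    (∫ z in M.cell i j, ((ph t i j).eval z * w₁.eval z + (qh t i j).eval z * w₂.eval z))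
      + (∫ z in M.cell i j, (uh t i j).eval z * (dX w₁.eval z + dY w₂.eval z))
      - (bdryX σ₁ (uh t) i j w₁ + bdryY σ₂ (uh t) i j w₂) = 0
  initial : ∀ i j, ∀ v : Qk k,
    (∫ z in M.cell i j, (uh 0 i j).eval z * v.eval z) = ∫ z in M.cell i j, u₀ z * v.eval z

/-- The squared norm `‖f - v‖² = ∑ ‖f - v‖²_{L²(Ω_{ij})}` for `v ∈ V_h^k`. -/
def sqErr (f : ℝ × ℝ → ℝ) (v : Vh M k) : ℝ :=
  ∑ i, ∑ j, ∫ z in M.cell i j, (f z - (v i j).eval z) ^ 2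

end Scheme

end LDG

end

/-!
The proof is an energy argument against an elliptic projection.

*The scheme in operator form.* Integrating by parts in the second equation expresses the discrete
flux through `u_h`: it is the discrete gradient of `u_h`, with components `dxOp X σ₁` and
`dyOp Y σ₂`. The weights `σ` and `1 - σ` of the generalized alternating fluxes are adjoint
(`Mesh1.bform_swap`), so that the first equation becomes
`(D_t u_h, v) + (∇_h u_h, ∇_h v) = 0` (`IsLDGSolution.ae_operator_form`).

*The elliptic projection.* `R u` is the discrete solution of `(1 - Δ_h) R u = (1 - Δ) u`
(`ellipticProj`), where `1 - Δ_h` is the form `sform`. Its distance to the `L²` projection `P u` is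
estimated by duality (`exists_elliptic_estimate`): for `(1 - Δ_h) φ = R u - P u` the residual is a
sum of consistency errors `(∂_x F, w) - (D_x P F, w)`. Three facts make it of order `h^{k+1}`.

* If `F` and `∂_x F` are compatible across the cell interfaces (`IsConforming`), the consistency
  error involves only the projection errors of `F` and `∂_x F`, tested with a lifting of the jumps
  of `w` (`consistency_identity`); so it is small where the jumps of `w` are.
* For `σ ≠ 1/2` the jumps of a piecewise polynomial are bounded by its discrete derivative, with a
  gain of powers of `h`: the moments against the Legendre polynomials of the cells give a cyclic
  system for the jumps with coefficients `σ` and `1 - σ`, and `|σ| ≠ |1 - σ|`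
  (`Mesh1.exists_jump_le`, `Mesh1.exists_jump_le_deriv`).
* The operators `D_x` and `D_y` act on different tensor factors and commute, whence discrete
  elliptic regularity, a bound of the second discrete derivatives of `φ` (`regularity_x`).

Projection errors are estimated by Taylor expansion with integral remainder in each variable
(`exists_cell_estimate`).

*Coercivity in time.* With the weight `e^{-2Kt}`, `|κ| ≤ K`, the substantial derivative is coercive
up to the initial value (`exists_fracD_coercive`), because `k ∗ (g²)' ≤ 2 g (k ∗ g')` for the kernel
`k(r) = r^{-α}` (`integral_kernel_mul_le`). It is also bounded from `H¹(0,T)` to `L²(0,T)`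
(`exists_fracDxt_bound`). The error `u_h - R u` satisfies an energy inequality whose right-hand
side contains only `u - R u` (`IsLDGSolution.ae_energy_inequality`); its initial value is
`P u - R u`, which is of optimal order. This gives `exists_error_estimate`.

*The exact solution.* Broken and periodic weak derivatives are used through product test functions
`a(x) b(y)` only: these determine a function (`ae_eq_zero_of_tensor`) and give absolute continuity
on almost every line (`HasTensorDeriv.exists_eq_primitive`). The conformity relations for `u`, for
its gradient and for their time derivatives follow from the weak form on the torus
(`IsWeakPoisson.conforming`, `ae_conforming`). The constant depends on the norms of the broken
derivatives of `u`, which are the same on all meshes admitting them (`familySq_eq`).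
-/


noncomputable section

namespace LDG

open Finset (sum_congr mul_sum sum_add_distrib sum_le_sum sum_nonneg sum_sub_distrib sum_comm
  sum_mul sum_eq_single sum_eq_zero sum_neg_distrib)
open intervalIntegral (integral_of_le integral_eq_sub_of_hasDerivAt
  continuous_parametric_intervalIntegral_of_continuous' continuousOn_primitive_interval'
  integral_add_adjacent_intervals integral_same integral_mono_on integral_mul_deriv_eq_deriv_mul)
open Real (exp)

local notation:max "vol[" s "]" => Measure.restrict volume s

/-! ### Polynomials of one variable on an interval -/

/-- Coefficients of a polynomial of degree at most `k` in one variable. -/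
abbrev P1 (k : ℕ) : Type := Fin (k + 1) → ℝ

variable {k : ℕ}

/-- The polynomial function with the given coefficients. -/
def ev (c : P1 k) (x : ℝ) : ℝ := ∑ m : Fin (k + 1), c m * x ^ (m : ℕ)

/-- The coefficients of the derivative, as a polynomial of the same formal degree. -/
def dc (c : P1 k) : P1 k :=
  fun m => if h : (m : ℕ) + 1 < k + 1 then ((m : ℕ) + 1) * c ⟨m + 1, h⟩ else 0

lemma ev_add (c d : P1 k) (x : ℝ) : ev (c + d) x = ev c x + ev d x := by
  simp [ev, add_mul, sum_add_distrib]

lemma ev_smul (r : ℝ) (c : P1 k) (x : ℝ) : ev (r • c) x = r * ev c x := by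
  simp [ev, mul_sum, mul_assoc]

lemma ev_sub (c d : P1 k) (x : ℝ) : ev (c - d) x = ev c x - ev d x := by
  simp [ev, sub_mul, sum_sub_distrib]

lemma ev_sum {ι : Type*} (s : Finset ι) (r : ι → ℝ) (c : ι → P1 k) (x : ℝ) :
    ev (fun m => ∑ n ∈ s, r n * c n m) x = ∑ n ∈ s, r n * ev (c n) x := by
  simp only [ev, sum_mul, mul_sum]
  rw [sum_comm]
  simp [mul_assoc]

@[simp] lemma ev_zero (x : ℝ) : ev (0 : P1 k) x = 0 := by simp [ev]

lemma dc_add (c d : P1 k) : dc (c + d) = dc c + dc d := by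
  ext m; simp only [dc, Pi.add_apply]; split_ifs <;> ring

lemma dc_smul (r : ℝ) (c : P1 k) : dc (r • c) = r • dc c := by
  ext m; simp only [dc, Pi.smul_apply, smul_eq_mul]; split_ifs <;> ring

lemma dc_sum {ι : Type*} (s : Finset ι) (r : ι → ℝ) (c : ι → P1 k) :
    dc (fun m => ∑ n ∈ s, r n * c n m) = fun m => ∑ n ∈ s, r n * dc (c n) m := by
  ext m; simp only [dc]; split_ifs
  · rw [mul_sum]; exact sum_congr rfl fun _ _ => by ring
  · simp

lemma ev_dc (c : P1 k) (x : ℝ) :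
    ev (dc c) x = ∑ m : Fin (k + 1), c m * ((m : ℕ) * x ^ ((m : ℕ) - 1)) := by
  rw [Fin.sum_univ_succ]
  simp only [ev, dc]
  rw [Fin.sum_univ_castSucc]
  simp only [Fin.val_castSucc, Fin.val_last, lt_irrefl, dite_false, zero_mul, add_zero,
    Fin.val_zero, Nat.cast_zero, mul_zero, zero_add, Fin.val_succ, Nat.add_sub_cancel]
  refine sum_congr rfl fun i _ => ?_
  have : (i : ℕ) + 1 < k + 1 := by omega
  rw [dif_pos this]
  have h2 : (⟨(i : ℕ) + 1, this⟩ : Fin (k + 1)) = i.succ := by ext; simp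
  rw [h2]; push_cast; ring

lemma hasDerivAt_ev (c : P1 k) (x : ℝ) : HasDerivAt (ev c) (ev (dc c) x) x := by
  rw [ev_dc]
  unfold ev
  refine HasDerivAt.fun_sum fun m _ => ?_
  exact (hasDerivAt_pow (m : ℕ) x).const_mul (c m)

lemma contDiff_ev (c : P1 k) : ContDiff ℝ ∞ (ev c) := by
  unfold ev; fun_prop

@[fun_prop] lemma continuous_ev (c : P1 k) : Continuous (ev c) := (contDiff_ev c).continuous

lemma continuous_ev_uncurry : Continuous (fun p : P1 k × ℝ => ev p.1 p.2) := by
  unfold ev; fun_prop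

lemma exists_ev_eq (p : Polynomial ℝ) (hp : p.natDegree ≤ k) :
    ∃ c : P1 k, ∀ x, ev c x = p.eval x := by
  refine ⟨fun m => p.coeff m, fun x => ?_⟩
  rw [Polynomial.eval_eq_sum_range' (Nat.lt_succ_of_le hp), ev]
  exact Fin.sum_univ_eq_sum_range (fun m => p.coeff m * x ^ m) (k + 1)

/-- The polynomial with the given coefficients. -/
def toPoly (c : P1 k) : Polynomial ℝ := ∑ m : Fin (k + 1), Polynomial.monomial m (c m)

lemma eval_toPoly (c : P1 k) (x : ℝ) : (toPoly c).eval x = ev c x := by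
  simp [toPoly, Polynomial.eval_finsetSum, ev]

lemma natDegree_toPoly (c : P1 k) : (toPoly c).natDegree ≤ k := by
  refine Polynomial.natDegree_sum_le_of_forall_le _ _ fun m _ => ?_
  exact (Polynomial.natDegree_monomial_le _).trans (by omega)

lemma coeff_toPoly (c : P1 k) (m : Fin (k + 1)) : (toPoly c).coeff m = c m := by
  simp [toPoly, Polynomial.finsetSum_coeff, Polynomial.coeff_monomial, Fin.val_inj]

lemma toPoly_dc (c : P1 k) : toPoly (dc c) = Polynomial.derivative (toPoly c) := by
  refine Polynomial.funext fun x => ?_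
  rw [eval_toPoly]
  refine (hasDerivAt_ev c x).unique ?_
  have : ev c = fun x => (toPoly c).eval x := funext fun x => (eval_toPoly c x).symm
  rw [this]
  exact Polynomial.hasDerivAt _ _

lemma natDegree_toPoly_dc (c : P1 k) (hk : 0 < k) : (toPoly (dc c)).natDegree < k := by
  rw [toPoly_dc]
  refine lt_of_le_of_lt (Polynomial.natDegree_derivative_le _) ?_
  have := natDegree_toPoly c
  omega

lemma exists_ev_affine (c : P1 k) (a b : ℝ) : ∃ c' : P1 k, ∀ s, ev c' s = ev c (a + b * s) := by
  obtain ⟨c', hc'⟩ := exists_ev_eq (k := k)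
    ((toPoly c).comp (Polynomial.C a + Polynomial.C b * Polynomial.X)) (by
      refine Polynomial.natDegree_comp_le.trans ?_
      have h1 : (Polynomial.C a + Polynomial.C b * Polynomial.X).natDegree ≤ 1 := by
        compute_degree
      calc _ ≤ (toPoly c).natDegree * 1 := Nat.mul_le_mul_left _ h1
        _ ≤ k := by simpa using natDegree_toPoly c)
  refine ⟨c', fun s => ?_⟩
  rw [hc', Polynomial.eval_comp, eval_toPoly]; simp

lemma eq_zero_of_ev_eq_zero {c : P1 k} {L R : ℝ} (hLR : L < R)
    (h : ∀ x ∈ Icc L R, ev c x = 0) : c = 0 := by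
  have : toPoly c = 0 := by
    refine Polynomial.eq_zero_of_infinite_isRoot _ ((Icc_infinite hLR).mono fun x hx => ?_)
    simp [Polynomial.IsRoot, eval_toPoly, h x hx]
  ext m
  rw [← coeff_toPoly c m, this]; simp

lemma eq_zero_of_integral_sq_eq_zero {c : P1 k} {L R : ℝ} (hLR : L < R)
    (h : ∫ x in L..R, ev c x ^ 2 = 0) : c = 0 := by
  refine eq_zero_of_ev_eq_zero hLR fun x hx => ?_
  have hc : Continuous fun x => ev c x ^ 2 := by fun_prop
  by_contra hne
  have := intervalIntegral.integral_pos hLR hc.continuousOn (fun y _ => sq_nonneg _)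
    ⟨x, hx, by positivity⟩
  linarith

/-- Equivalence of norms on polynomials of degree at most `k`, in the form of a pointwise bound of
the polynomial and its derivative by its `L²(0,1)` norm. -/
lemma exists_sup_le_unit (k : ℕ) : ∃ C : ℝ, 0 < C ∧ ∀ c : P1 k, ∀ s ∈ Icc (0 : ℝ) 1,
    ev c s ^ 2 ≤ C * (∫ x in (0 : ℝ)..1, ev c x ^ 2) ∧
    ev (dc c) s ^ 2 ≤ C * (∫ x in (0 : ℝ)..1, ev c x ^ 2) := by
  set Q : P1 k → ℝ := fun c => ∫ x in (0 : ℝ)..1, ev c x ^ 2 with hQ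
  have hQc : Continuous Q := by
    refine continuous_parametric_intervalIntegral_of_continuous' ?_ 0 1
    exact continuous_ev_uncurry.pow 2
  have hsph : IsCompact (Metric.sphere (0 : P1 k) 1) := isCompact_sphere _ _
  have hne : (Metric.sphere (0 : P1 k) 1).Nonempty :=
    NormedSpace.sphere_nonempty.2 zero_le_one
  obtain ⟨c₀, hc₀, hmin⟩ := hsph.exists_isMinOn hne hQc.continuousOn
  have hc₀n : ‖c₀‖ = 1 := by simpa using hc₀
  have hnn : ∀ c, 0 ≤ Q c := fun c =>
    intervalIntegral.integral_nonneg zero_le_one fun x _ => sq_nonneg _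
  have hpos : 0 < Q c₀ := by
    refine lt_of_le_of_ne (hnn _) fun h => ?_
    have := eq_zero_of_integral_sq_eq_zero (c := c₀) zero_lt_one h.symm
    simp [this] at hc₀n
  have hQs : ∀ (r : ℝ) c, Q (r • c) = r ^ 2 * Q c := by
    intro r c
    simp only [hQ, ev_smul, mul_pow, intervalIntegral.integral_const_mul]
  have hlow : ∀ c, Q c₀ * ‖c‖ ^ 2 ≤ Q c := by
    intro c
    rcases eq_or_ne c 0 with rfl | hc
    · simpa using hnn 0
    have hn : ‖c‖ ≠ 0 := norm_ne_zero_iff.2 hc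
    have h1 : Q c₀ ≤ Q (‖c‖⁻¹ • c) := hmin (by simp [norm_smul, hn])
    rw [hQs] at h1
    have h2 := mul_le_mul_of_nonneg_right h1 (sq_nonneg ‖c‖)
    calc _ ≤ _ := h2
      _ = Q c := by field_simp
  have hup : ∀ (c : P1 k), ∀ s ∈ Icc (0 : ℝ) 1, |ev c s| ≤ (k + 1) * ‖c‖ := by
    intro c s hs
    refine (Finset.abs_sum_le_sum_abs _ _).trans ?_
    calc ∑ m : Fin (k + 1), |c m * s ^ (m : ℕ)| ≤ ∑ m : Fin (k + 1), ‖c‖ := by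
          refine sum_le_sum fun m _ => ?_
          rw [abs_mul]
          have h1 : |c m| ≤ ‖c‖ := norm_le_pi_norm c m
          have h2 : |s ^ (m : ℕ)| ≤ 1 := by
            rw [abs_of_nonneg (pow_nonneg hs.1 _)]; exact pow_le_one₀ hs.1 hs.2
          calc |c m| * |s ^ (m : ℕ)| ≤ ‖c‖ * 1 := by gcongr
            _ = _ := mul_one _
      _ = (k + 1) * ‖c‖ := by simp
  have hd : ∀ c : P1 k, ‖dc c‖ ≤ (k + 1) * ‖c‖ := by
    intro c
    refine (pi_norm_le_iff_of_nonneg (by positivity)).2 fun m => ?_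
    simp only [dc]
    split_ifs with h
    · rw [norm_mul]
      have h1 : ‖c ⟨m + 1, h⟩‖ ≤ ‖c‖ := norm_le_pi_norm c _
      have h2 : ‖((m : ℕ) : ℝ) + 1‖ ≤ k + 1 := by
        rw [Real.norm_of_nonneg (by positivity)]
        exact_mod_cast h.le
      gcongr
    · simp only [norm_zero]; positivity
  refine ⟨((k + 1) * (k + 1)) ^ 2 / Q c₀, by positivity, fun c s hs => ⟨?_, ?_⟩⟩
  · rw [div_mul_eq_mul_div, le_div_iff₀ hpos]
    have h1 : ev c s ^ 2 ≤ ((k + 1) * ‖c‖) ^ 2 := sq_le_sq.2 (by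
      rw [abs_of_nonneg (by positivity : (0 : ℝ) ≤ (k + 1) * ‖c‖)]; exact hup c s hs)
    calc ev c s ^ 2 * Q c₀ ≤ ((k + 1) * ‖c‖) ^ 2 * Q c₀ := by gcongr
      _ = (k + 1) ^ 2 * (Q c₀ * ‖c‖ ^ 2) := by ring
      _ ≤ (k + 1) ^ 2 * Q c := by gcongr; exact hlow c
      _ ≤ ((k + 1) * (k + 1)) ^ 2 * Q c := by
          have : (1 : ℝ) ≤ (k + 1) ^ 2 := by
            have : (0 : ℝ) ≤ k := by positivity
            nlinarith
          have h3 := hnn c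
          calc ((k : ℝ) + 1) ^ 2 * Q c = (1 * (k + 1) ^ 2) * Q c := by ring
            _ ≤ ((k + 1) ^ 2 * (k + 1) ^ 2) * Q c := by gcongr
            _ = _ := by ring
  · rw [div_mul_eq_mul_div, le_div_iff₀ hpos]
    have h0 : |ev (dc c) s| ≤ (k + 1) * ((k + 1) * ‖c‖) :=
      (hup _ s hs).trans (by gcongr; exact hd c)
    have h1 : ev (dc c) s ^ 2 ≤ ((k + 1) * ((k + 1) * ‖c‖)) ^ 2 := sq_le_sq.2 (by
      rw [abs_of_nonneg (by positivity : (0 : ℝ) ≤ (k + 1) * ((k + 1) * ‖c‖))]; exact h0)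
    calc ev (dc c) s ^ 2 * Q c₀ ≤ ((k + 1) * ((k + 1) * ‖c‖)) ^ 2 * Q c₀ := by gcongr
      _ = ((k + 1) * (k + 1)) ^ 2 * (Q c₀ * ‖c‖ ^ 2) := by ring
      _ ≤ ((k + 1) * (k + 1)) ^ 2 * Q c := by gcongr; exact hlow c

lemma integral_affine {f : ℝ → ℝ} {L R : ℝ} (hLR : L < R) :
    ∫ x in L..R, f x = (R - L) * ∫ s in (0 : ℝ)..1, f (L + (R - L) * s) := by
  have h := intervalIntegral.integral_comp_add_mul (a := 0) (b := 1) f (sub_pos.2 hLR).ne' L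
  rw [h]
  simp [sub_ne_zero.2 hLR.ne']

/-- Inverse inequalities on an interval. -/
lemma exists_inverse_ineq (k : ℕ) : ∃ C : ℝ, 0 < C ∧ ∀ L R : ℝ, L < R → ∀ c : P1 k,
    (∀ x ∈ Icc L R, ev c x ^ 2 ≤ C / (R - L) * ∫ x in L..R, ev c x ^ 2) ∧
    (∫ x in L..R, ev (dc c) x ^ 2) ≤ C / (R - L) ^ 2 * ∫ x in L..R, ev c x ^ 2 := by
  obtain ⟨C, hC, h⟩ := exists_sup_le_unit k
  refine ⟨C, hC, fun L R hLR c => ?_⟩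
  have hp : 0 < R - L := sub_pos.2 hLR
  obtain ⟨c', hc'⟩ := exists_ev_affine c L (R - L)
  have hd : ∀ s, ev (dc c') s = (R - L) * ev (dc c) (L + (R - L) * s) := by
    intro s
    refine (hasDerivAt_ev c' s).unique ?_
    have h1 : HasDerivAt (fun s => L + (R - L) * s) (R - L) s := by
      simpa using ((hasDerivAt_id s).const_mul (R - L)).const_add L
    have h2 := (hasDerivAt_ev c (L + (R - L) * s)).comp s h1
    rw [show ev c' = ev c ∘ fun s => L + (R - L) * s from funext hc', mul_comm]
    exact h2
  have hI : ∫ x in L..R, ev c x ^ 2 = (R - L) * ∫ s in (0 : ℝ)..1, ev c' s ^ 2 := by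
    rw [integral_affine hLR]; simp_rw [hc']
  constructor
  · intro x hx
    have hs : (x - L) / (R - L) ∈ Icc (0 : ℝ) 1 :=
      ⟨div_nonneg (by linarith [hx.1]) hp.le, (div_le_one hp).2 (by linarith [hx.2])⟩
    have h1 := (h c' _ hs).1
    rw [hc', mul_div_cancel₀ _ hp.ne', add_sub_cancel] at h1
    rw [hI]
    calc _ ≤ _ := h1
      _ = _ := by field_simp
  · have h2 : ∫ x in L..R, ev (dc c) x ^ 2
        = (R - L) * ∫ s in (0 : ℝ)..1, ((R - L)⁻¹ * ev (dc c') s) ^ 2 := by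
      rw [integral_affine hLR]; simp_rw [hd]; simp [hp.ne']
    have h3 : ∫ s in (0 : ℝ)..1, ((R - L)⁻¹ * ev (dc c') s) ^ 2
        ≤ ∫ s in (0 : ℝ)..1, (R - L)⁻¹ ^ 2 * (C * ∫ x in (0 : ℝ)..1, ev c' x ^ 2) := by
      refine integral_mono_on zero_le_one
        (by apply Continuous.intervalIntegrable; fun_prop)
        (by apply Continuous.intervalIntegrable; fun_prop) fun s hs => ?_
      rw [mul_pow]
      gcongr
      exact (h c' s hs).2
    rw [intervalIntegral.integral_const] at h3
    rw [h2, hI]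
    refine (mul_le_mul_of_nonneg_left h3 hp.le).trans (le_of_eq ?_)
    simp only [sub_zero, smul_eq_mul, one_mul]
    field_simp

/-! ### Legendre polynomials -/

lemma integral_mul_iterate_derivative (f : Polynomial ℝ) (n : ℕ)
    (h0 : ∀ i < n, (Polynomial.derivative^[i] f).eval 0 = 0)
    (h1 : ∀ i < n, (Polynomial.derivative^[i] f).eval 1 = 0) (q : Polynomial ℝ) :
    ∫ x in (0 : ℝ)..1, q.eval x * (Polynomial.derivative^[n] f).eval x
      = (-1) ^ n * ∫ x in (0 : ℝ)..1, (Polynomial.derivative^[n] q).eval x * f.eval x := by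
  induction n generalizing q with
  | zero => simp
  | succ n ih =>
    have hp := integral_mul_deriv_eq_deriv_mul (a := 0) (b := 1)
      (u := fun x => q.eval x) (v := fun x => (Polynomial.derivative^[n] f).eval x)
      (u' := fun x => (Polynomial.derivative q).eval x)
      (v' := fun x => (Polynomial.derivative^[n + 1] f).eval x)
      (fun x _ => q.hasDerivAt x)
      (fun x _ => by
        rw [Function.iterate_succ_apply']
        exact (Polynomial.derivative^[n] f).hasDerivAt x)
      (Polynomial.continuous _).continuousOn.intervalIntegrable
      (Polynomial.continuous _).continuousOn.intervalIntegrable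
    rw [hp, h0 n (by omega), h1 n (by omega),
      ih (fun i hi => h0 i (by omega)) (fun i hi => h1 i (by omega)),
      Function.iterate_succ_apply]
    ring

lemma exists_legendre_unit (k : ℕ) : ∃ l : P1 k, ev l 0 = 1 ∧ ev l 1 = (-1) ^ k ∧
    ∀ c : P1 k, ∫ x in (0 : ℝ)..1, ev (dc c) x * ev l x = 0 := by
  set p : Polynomial ℝ := (Polynomial.shiftedLegendre k).map (Int.castRingHom ℝ) with hp
  have hev : ∀ x, p.eval x = Polynomial.aeval x (Polynomial.shiftedLegendre k) := by
    intro x; rw [hp, Polynomial.eval_map, Polynomial.aeval_def]; rfl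
  obtain ⟨l, hl⟩ := exists_ev_eq p (k := k)
    ((Polynomial.natDegree_map_le).trans (Polynomial.natDegree_shiftedLegendre k).le)
  have hp0 : p.eval 0 = 1 := by
    rw [← Polynomial.coeff_zero_eq_eval_zero, hp, Polynomial.coeff_map,
      Polynomial.coeff_shiftedLegendre]
    simp
  refine ⟨l, by rw [hl, hp0], ?_, fun c => ?_⟩
  · rw [hl, hev, Polynomial.shiftedLegendre_eval_symm, sub_self, ← hev, hp0, mul_one]
  rcases Nat.eq_zero_or_pos k with rfl | hk
  · have : dc c = 0 := by ext m; simp [dc]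
    simp [this]
  set f : Polynomial ℝ := Polynomial.X ^ k * (1 - Polynomial.X) ^ k with hf
  have hrod : (k.factorial : ℝ) • p = Polynomial.derivative^[k] f := by
    have h := congrArg (Polynomial.map (Int.castRingHom ℝ))
      (Polynomial.factorial_mul_shiftedLegendre_eq k)
    rw [← Polynomial.iterate_derivative_map] at h
    simp only [Polynomial.map_mul, Polynomial.map_pow, Polynomial.map_sub, Polynomial.map_X,
      Polynomial.map_one, Polynomial.map_natCast] at h
    rw [hf, ← h, Polynomial.smul_eq_C_mul]
    simp [hp]
  have hv : ∀ (r : Polynomial ℝ) (a : ℝ), r.eval a = 0 → r ^ k ∣ f →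
      ∀ i < k, (Polynomial.derivative^[i] f).eval a = 0 := by
    intro r a hr hd i hi
    obtain ⟨s, hs⟩ := Polynomial.pow_sub_dvd_iterate_derivative_of_pow_dvd i hd
    rw [hs, Polynomial.eval_mul, Polynomial.eval_pow, hr, zero_pow (by omega), zero_mul]
  have hpar := integral_mul_iterate_derivative f k
    (hv Polynomial.X 0 (by simp) (Dvd.intro _ rfl))
    (hv (1 - Polynomial.X) 1 (by simp) (Dvd.intro_left _ rfl)) (toPoly (dc c))
  rw [Polynomial.iterate_derivative_eq_zero (natDegree_toPoly_dc c hk), ← hrod] at hpar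
  simp only [Polynomial.eval_smul, smul_eq_mul, Polynomial.eval_zero, zero_mul,
    intervalIntegral.integral_zero, mul_zero, eval_toPoly] at hpar
  have h2 : (k.factorial : ℝ) * ∫ x in (0 : ℝ)..1, ev (dc c) x * ev l x = 0 := by
    rw [← intervalIntegral.integral_const_mul]
    refine Eq.trans ?_ hpar
    refine intervalIntegral.integral_congr fun x _ => ?_
    simp only [hl]; ring
  exact (mul_eq_zero.1 h2).resolve_left (by positivity)

/-- The Legendre polynomial of degree `k` on an interval, normalised at the left end: it is
orthogonal to all derivatives, that is, to all polynomials of degree less than `k`. -/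
lemma exists_legendre (k : ℕ) : ∃ C : ℝ, 0 < C ∧ ∀ L R : ℝ, L < R → ∃ l : P1 k,
    ev l L = 1 ∧ ev l R = (-1) ^ k ∧ (∀ c : P1 k, ∫ x in L..R, ev (dc c) x * ev l x = 0) ∧
    (∫ x in L..R, ev l x ^ 2) ≤ C * (R - L) := by
  obtain ⟨l₀, h0, h1, h2⟩ := exists_legendre_unit k
  have hI : 0 ≤ ∫ x in (0 : ℝ)..1, ev l₀ x ^ 2 :=
    intervalIntegral.integral_nonneg zero_le_one fun _ _ => sq_nonneg _
  refine ⟨(∫ x in (0 : ℝ)..1, ev l₀ x ^ 2) + 1, by positivity, fun L R hLR => ?_⟩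
  have hp : 0 < R - L := sub_pos.2 hLR
  obtain ⟨l, hl⟩ := exists_ev_affine l₀ (-L / (R - L)) (1 / (R - L))
  have hl' : ∀ s, ev l (L + (R - L) * s) = ev l₀ s := by
    intro s; rw [hl]; congr 1; field_simp; ring
  refine ⟨l, ?_, ?_, fun c => ?_, ?_⟩
  · simpa [h0] using hl' 0
  · simpa [h1] using hl' 1
  · obtain ⟨c', hc'⟩ := exists_ev_affine c L (R - L)
    have hd : ∀ s, ev (dc c) (L + (R - L) * s) = (R - L)⁻¹ * ev (dc c') s := by
      intro s
      rw [eq_inv_mul_iff_mul_eq₀ hp.ne']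
      refine HasDerivAt.unique ?_ (hasDerivAt_ev c' s)
      have h1 : HasDerivAt (fun s => L + (R - L) * s) (R - L) s := by
        simpa using ((hasDerivAt_id s).const_mul (R - L)).const_add L
      have h2 := (hasDerivAt_ev c (L + (R - L) * s)).comp s h1
      rw [show ev c' = ev c ∘ fun s => L + (R - L) * s from funext hc', mul_comm]
      exact h2
    rw [integral_affine hLR]
    simp_rw [hl', hd, mul_assoc]
    rw [intervalIntegral.integral_const_mul, h2]; simp
  · rw [integral_affine hLR]
    simp_rw [hl']
    nlinarith

/-! ### The Cauchy–Schwarz inequality and the Riesz representation -/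

lemma sq_integral_mul_le {α : Type*} [MeasurableSpace α] {μ : Measure α} {f g : α → ℝ}
    (hf : MemLp f 2 μ) (hg : MemLp g 2 μ) :
    (∫ x, f x * g x ∂μ) ^ 2 ≤ (∫ x, f x ^ 2 ∂μ) * ∫ x, g x ^ 2 ∂μ := by
  have hfg : Integrable (fun x => f x * g x) μ := hf.integrable_mul hg
  have hff := hf.integrable_sq
  have hgg := hg.integrable_sq
  have h : ∀ t : ℝ, 0 ≤ (∫ x, g x ^ 2 ∂μ) * (t * t) + 2 * (∫ x, f x * g x ∂μ) * t
      + ∫ x, f x ^ 2 ∂μ := by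
    intro t
    have h1 : ∫ x, (f x + t * g x) ^ 2 ∂μ
        = (∫ x, g x ^ 2 ∂μ) * (t * t) + 2 * (∫ x, f x * g x ∂μ) * t + ∫ x, f x ^ 2 ∂μ := by
      have : ∀ x, (f x + t * g x) ^ 2 = (t * t) * g x ^ 2 + (2 * t) * (f x * g x) + f x ^ 2 :=
        fun x => by ring
      simp_rw [this]
      have h2 : Integrable (fun x => (t * t) * g x ^ 2 + (2 * t) * (f x * g x)) μ :=
        (hgg.const_mul _).add (hfg.const_mul _)
      rw [integral_add h2 hff, integral_add (hgg.const_mul _) (hfg.const_mul _),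
        integral_const_mul, integral_const_mul]
      ring
    rw [← h1]
    exact integral_nonneg fun x => sq_nonneg _
  have := discrim_le_zero h
  unfold discrim at this
  nlinarith

lemma memLp_two_of_continuous {f : ℝ → ℝ} (hf : Continuous f) (L R : ℝ) :
    MemLp f 2 vol[Ioc L R] := by
  rw [memLp_two_iff_integrable_sq hf.aestronglyMeasurable]
  exact ((hf.pow 2).integrableOn_Icc).mono_set Ioc_subset_Icc_self

lemma sq_intervalIntegral_mul_le {f g : ℝ → ℝ} (hf : Continuous f) (hg : Continuous g) {L R : ℝ}
    (hLR : L ≤ R) :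
    (∫ x in L..R, f x * g x) ^ 2 ≤ (∫ x in L..R, f x ^ 2) * ∫ x in L..R, g x ^ 2 := by
  simp only [integral_of_le hLR]
  exact sq_integral_mul_le (memLp_two_of_continuous hf L R) (memLp_two_of_continuous hg L R)

section Riesz

variable {V : Type*} [AddCommGroup V] [Module ℝ V] [FiniteDimensional ℝ V]

/-- The Riesz isomorphism of a definite bilinear form on a finite-dimensional space. -/
def riesz (B : V →ₗ[ℝ] V →ₗ[ℝ] ℝ) (hB : ∀ v, B v v = 0 → v = 0) : (V →ₗ[ℝ] ℝ) →ₗ[ℝ] V :=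
  ((LinearMap.linearEquivOfInjective B (by
      rw [← LinearMap.ker_eq_bot, LinearMap.ker_eq_bot']
      intro v hv
      exact hB v (by rw [hv]; rfl)) (Subspace.dual_finrank_eq).symm).symm : _ ≃ₗ[ℝ] _)

lemma riesz_apply (B : V →ₗ[ℝ] V →ₗ[ℝ] ℝ) (hB : ∀ v, B v v = 0 → v = 0) (l : V →ₗ[ℝ] ℝ) (v : V) :
    B (riesz B hB l) v = l v := by
  have h := (LinearMap.linearEquivOfInjective B (by
      rw [← LinearMap.ker_eq_bot, LinearMap.ker_eq_bot']
      intro v hv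
      exact hB v (by rw [hv]; rfl)) (Subspace.dual_finrank_eq).symm).apply_symm_apply l
  exact congrArg (fun l' : V →ₗ[ℝ] ℝ => l' v) h

end Riesz

/-! ### The discrete derivative in one variable -/

/-- A finite family of intervals with a cyclic neighbour relation. The discrete theory does not
need that an interval ends where the next one begins. -/
structure Mesh1 (ι : Type) where
  L : ι → ℝ
  R : ι → ℝ
  lt : ∀ i, L i < R i
  next : Equiv.Perm ι

variable {ι : Type} {k : ℕ}

/-- One polynomial of degree at most `k` on each interval. -/
abbrev V1 (ι : Type) (k : ℕ) : Type := ι → P1 k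

namespace Mesh1

variable (X : Mesh1 ι)

/-- The jump (right limit minus left limit) at the right end of the `i`-th interval. -/
def jump (a : V1 ι k) (i : ι) : ℝ := ev (a (X.next i)) (X.L (X.next i)) - ev (a i) (X.R i)

/-- The weighted average `σ a⁻ + (1-σ) a⁺` at the right end of the `i`-th interval. -/
def flux (σ : ℝ) (a : V1 ι k) (i : ι) : ℝ :=
  σ * ev (a i) (X.R i) + (1 - σ) * ev (a (X.next i)) (X.L (X.next i))

lemma flux_add (σ : ℝ) (a b : V1 ι k) (i : ι) :
    X.flux σ (a + b) i = X.flux σ a i + X.flux σ b i := by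
  simp only [flux, Pi.add_apply, ev_add]; ring

lemma flux_smul (σ r : ℝ) (a : V1 ι k) (i : ι) : X.flux σ (r • a) i = r * X.flux σ a i := by
  simp only [flux, Pi.smul_apply, ev_smul]; ring

variable [Fintype ι]

/-- The `L²` inner product of piecewise polynomials. -/
def ip : V1 ι k →ₗ[ℝ] V1 ι k →ₗ[ℝ] ℝ :=
  LinearMap.mk₂ ℝ (fun a b => ∑ i, ∫ x in X.L i..X.R i, ev (a i) x * ev (b i) x)
    (fun a a' b => by
      rw [← sum_add_distrib]
      refine sum_congr rfl fun i _ => ?_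
      rw [← intervalIntegral.integral_add (by apply Continuous.intervalIntegrable; fun_prop)
        (by apply Continuous.intervalIntegrable; fun_prop)]
      simp only [Pi.add_apply, ev_add, add_mul])
    (fun r a b => by
      simp only [Pi.smul_apply, ev_smul, mul_assoc, intervalIntegral.integral_const_mul,
        smul_eq_mul, mul_sum])
    (fun a b b' => by
      rw [← sum_add_distrib]
      refine sum_congr rfl fun i _ => ?_
      rw [← intervalIntegral.integral_add (by apply Continuous.intervalIntegrable; fun_prop)
        (by apply Continuous.intervalIntegrable; fun_prop)]
      simp only [Pi.add_apply, ev_add, mul_add])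
    (fun r a b => by
      simp only [Pi.smul_apply, ev_smul, mul_left_comm _ r, intervalIntegral.integral_const_mul,
        smul_eq_mul, mul_sum])

lemma ip_apply (a b : V1 ι k) :
    X.ip a b = ∑ i, ∫ x in X.L i..X.R i, ev (a i) x * ev (b i) x := rfl

lemma ip_comm (a b : V1 ι k) : X.ip a b = X.ip b a := by
  simp only [ip_apply, mul_comm]

lemma ip_self (a : V1 ι k) : X.ip a a = ∑ i, ∫ x in X.L i..X.R i, ev (a i) x ^ 2 := by
  simp only [ip_apply, pow_two]

lemma ip_definite (a : V1 ι k) (h : X.ip a a = 0) : a = 0 := by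
  rw [ip_self, Finset.sum_eq_zero_iff_of_nonneg] at h
  · funext i
    exact eq_zero_of_integral_sq_eq_zero (X.lt i) (h i (Finset.mem_univ i))
  · intro i _
    exact intervalIntegral.integral_nonneg (X.lt i).le fun _ _ => sq_nonneg _

/-- The bilinear form of the discrete derivative with numerical flux of weight `σ`. -/
def bform (σ : ℝ) : V1 ι k →ₗ[ℝ] V1 ι k →ₗ[ℝ] ℝ :=
  LinearMap.mk₂ ℝ (fun a b => ∑ i, (-(∫ x in X.L i..X.R i, ev (a i) x * ev (dc (b i)) x)
      + (X.flux σ a i * ev (b i) (X.R i) - X.flux σ a (X.next.symm i) * ev (b i) (X.L i))))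
    (fun a a' b => by
      rw [← sum_add_distrib]
      refine sum_congr rfl fun i _ => ?_
      have : ∫ x in X.L i..X.R i, ev ((a + a') i) x * ev (dc (b i)) x
          = (∫ x in X.L i..X.R i, ev (a i) x * ev (dc (b i)) x)
            + ∫ x in X.L i..X.R i, ev (a' i) x * ev (dc (b i)) x := by
        rw [← intervalIntegral.integral_add (by apply Continuous.intervalIntegrable; fun_prop)
          (by apply Continuous.intervalIntegrable; fun_prop)]
        simp only [Pi.add_apply, ev_add, add_mul]
      rw [this, flux_add, flux_add]; ring)
    (fun r a b => by
      simp only [flux_smul, smul_eq_mul, mul_sum]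
      refine sum_congr rfl fun i _ => ?_
      simp only [Pi.smul_apply, ev_smul, mul_assoc, intervalIntegral.integral_const_mul]; ring)
    (fun a b b' => by
      rw [← sum_add_distrib]
      refine sum_congr rfl fun i _ => ?_
      have : ∫ x in X.L i..X.R i, ev (a i) x * ev (dc ((b + b') i)) x
          = (∫ x in X.L i..X.R i, ev (a i) x * ev (dc (b i)) x)
            + ∫ x in X.L i..X.R i, ev (a i) x * ev (dc (b' i)) x := by
        rw [← intervalIntegral.integral_add (by apply Continuous.intervalIntegrable; fun_prop)
          (by apply Continuous.intervalIntegrable; fun_prop)]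
        simp only [Pi.add_apply, dc_add, ev_add, mul_add]
      rw [this, Pi.add_apply, ev_add, ev_add]; ring)
    (fun r a b => by
      simp only [smul_eq_mul, mul_sum]
      refine sum_congr rfl fun i _ => ?_
      simp only [Pi.smul_apply, dc_smul, ev_smul, mul_left_comm _ r,
        intervalIntegral.integral_const_mul]; ring)

lemma bform_apply (σ : ℝ) (a b : V1 ι k) :
    X.bform σ a b = ∑ i, (-(∫ x in X.L i..X.R i, ev (a i) x * ev (dc (b i)) x)
      + (X.flux σ a i * ev (b i) (X.R i) - X.flux σ a (X.next.symm i) * ev (b i) (X.L i))) := rfl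

/-- The discrete derivative with numerical flux of weight `σ`. -/
def D (σ : ℝ) : V1 ι k →ₗ[ℝ] V1 ι k := (riesz X.ip X.ip_definite) ∘ₗ (X.bform σ)

lemma ip_D (σ : ℝ) (a b : V1 ι k) : X.ip (X.D σ a) b = X.bform σ a b :=
  riesz_apply X.ip X.ip_definite (X.bform σ a) b

lemma integral_parts (a b : P1 k) (L R : ℝ) :
    ∫ x in L..R, ev a x * ev (dc b) x
      = ev a R * ev b R - ev a L * ev b L - ∫ x in L..R, ev (dc a) x * ev b x :=
  integral_mul_deriv_eq_deriv_mul (fun x _ => hasDerivAt_ev a x)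
    (fun x _ => hasDerivAt_ev b x) (continuous_ev _).continuousOn.intervalIntegrable
    (continuous_ev _).continuousOn.intervalIntegrable

lemma sum_flux_mul_jump (σ : ℝ) (a b : V1 ι k) :
    ∑ i, (X.flux σ a i * ev (b i) (X.R i) - X.flux σ a (X.next.symm i) * ev (b i) (X.L i))
      = -∑ i, X.flux σ a i * X.jump b i := by
  rw [sum_sub_distrib, ← Equiv.sum_comp X.next
    (fun i => X.flux σ a (X.next.symm i) * ev (b i) (X.L i)), ← sum_sub_distrib,
    ← sum_neg_distrib]
  refine sum_congr rfl fun i _ => ?_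
  simp only [Equiv.symm_apply_apply, jump]; ring

/-- Discrete integration by parts: the weights `σ` and `1 - σ` belong to adjoint fluxes. -/
lemma bform_swap (σ : ℝ) (a b : V1 ι k) : X.bform σ a b = -X.bform (1 - σ) b a := by
  rw [eq_neg_iff_add_eq_zero, bform_apply, bform_apply, sum_add_distrib,
    sum_add_distrib, sum_flux_mul_jump, sum_flux_mul_jump]
  have h1 : ∀ i, -(∫ x in X.L i..X.R i, ev (a i) x * ev (dc (b i)) x)
      = (∫ x in X.L i..X.R i, ev (b i) x * ev (dc (a i)) x)
        - (ev (a i) (X.R i) * ev (b i) (X.R i) - ev (a i) (X.L i) * ev (b i) (X.L i)) := by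
    intro i; rw [integral_parts]
    simp only [mul_comm]; ring
  simp only [h1]
  rw [sum_sub_distrib, sum_sub_distrib (f := fun i => ev (a i) (X.R i) * _),
    ← Equiv.sum_comp X.next (fun i => ev (a i) (X.L i) * ev (b i) (X.L i)),
    sum_neg_distrib]
  have h2 : ∑ i, X.flux σ a i * X.jump b i + ∑ i, X.flux (1 - σ) b i * X.jump a i
      + (∑ i, ev (a i) (X.R i) * ev (b i) (X.R i)
        - ∑ i, ev (a (X.next i)) (X.L (X.next i)) * ev (b (X.next i)) (X.L (X.next i))) = 0 := by
    rw [← sum_sub_distrib, ← sum_add_distrib, ← sum_add_distrib]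
    refine sum_eq_zero fun i _ => ?_
    simp only [flux, jump]; ring
  linarith

lemma ip_D_left (σ : ℝ) (a b : V1 ι k) : X.ip (X.D σ a) b = -X.ip a (X.D (1 - σ) b) := by
  rw [ip_D, bform_swap, ← ip_D, ip_comm]

/-- The discrete derivative on one interval: the classical derivative plus the two jumps. -/
lemma integral_D_mul (σ : ℝ) (a : V1 ι k) (i : ι) (b : P1 k) :
    ∫ x in X.L i..X.R i, ev (X.D σ a i) x * ev b x
      = (∫ x in X.L i..X.R i, ev (dc (a i)) x * ev b x)
        + (1 - σ) * X.jump a i * ev b (X.R i)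
        + σ * X.jump a (X.next.symm i) * ev b (X.L i) := by
  classical
  have h := X.ip_D σ a (Pi.single i b)
  rw [ip_apply, bform_apply, sum_eq_single i, sum_eq_single i] at h
  · rw [Pi.single_eq_same] at h
    rw [h, integral_parts]
    simp only [flux, jump, Equiv.apply_symm_apply]
    ring
  · intro j _ hj
    have : dc (0 : P1 k) = 0 := by ext; simp [dc]
    simp [Pi.single_eq_of_ne hj, this]
  · simp
  · intro j _ hj; simp [Pi.single_eq_of_ne hj]
  · simp

end Mesh1

lemma sum_cyclic_sq_ge [Fintype ι] (π : Equiv.Perm ι) (J : ι → ℝ) (c d : ℝ) :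
    (|c| - |d|) ^ 2 * ∑ i, J i ^ 2 ≤ ∑ i, (c * J i + d * J (π i)) ^ 2 := by
  have h1 : ∑ i, J (π i) ^ 2 = ∑ i, J i ^ 2 := Equiv.sum_comp π (fun i => J i ^ 2)
  have h2 : ∀ i, (c ^ 2 - |c| * |d|) * J i ^ 2 + (d ^ 2 - |c| * |d|) * J (π i) ^ 2
      ≤ (c * J i + d * J (π i)) ^ 2 := by
    intro i
    have h3 : -(|c| * |d| * (|J i| * |J (π i)|)) ≤ c * d * (J i * J (π i)) := by
      have := neg_abs_le (c * d * (J i * J (π i)))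
      rwa [abs_mul, abs_mul, abs_mul] at this
    have h4 : 2 * (|J i| * |J (π i)|) ≤ J i ^ 2 + J (π i) ^ 2 := by
      have := sq_nonneg (|J i| - |J (π i)|)
      nlinarith [sq_abs (J i), sq_abs (J (π i))]
    have h5 : 0 ≤ |c| * |d| := by positivity
    nlinarith [mul_le_mul_of_nonneg_left h4 h5]
  calc _ = (c ^ 2 - |c| * |d|) * ∑ i, J i ^ 2 + (d ^ 2 - |c| * |d|) * ∑ i, J (π i) ^ 2 := by
        rw [h1]
        linear_combination (∑ i, J i ^ 2) * (sq_abs c + sq_abs d)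
    _ = ∑ i, ((c ^ 2 - |c| * |d|) * J i ^ 2 + (d ^ 2 - |c| * |d|) * J (π i) ^ 2) := by
        rw [sum_add_distrib, mul_sum, mul_sum]
    _ ≤ _ := sum_le_sum fun i _ => h2 i

lemma abs_ne_of_ne_half {σ : ℝ} (hσ : σ ≠ 1 / 2) : |1 - σ| ≠ |σ| := by
  intro h
  rcases abs_eq_abs.1 h with h | h
  · exact hσ (by linarith)
  · linarith

/-- Stability of the jumps. Testing with the Legendre polynomial of each interval gives a cyclic
system for the jumps, which is invertible since `|1 - σ| ≠ |σ|`. -/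
lemma exists_jump_le_of_moment (k : ℕ) {σ : ℝ} (hσ : σ ≠ 1 / 2) : ∃ C : ℝ, 0 < C ∧
    ∀ {ι : Type} [Fintype ι] (X : Mesh1 ι) (a : V1 ι k) (q : ι → ℝ),
      (∀ (i : ι) (l : P1 k), (∀ c : P1 k, ∫ x in X.L i..X.R i, ev (dc c) x * ev l x = 0) →
        (∫ x in X.L i..X.R i, ev (X.D σ a i) x * ev l x) ^ 2
          ≤ q i * ∫ x in X.L i..X.R i, ev l x ^ 2) → (∀ i, 0 ≤ q i) →
      ∑ i, X.jump a i ^ 2 ≤ C * ∑ i, q i * (X.R i - X.L i) := by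
  obtain ⟨C, hC, hl⟩ := exists_legendre k
  have hne : (|1 - σ| - |σ|) ≠ 0 := sub_ne_zero.2 (abs_ne_of_ne_half hσ)
  have hpos : 0 < (|1 - σ| - |σ|) ^ 2 := by positivity
  refine ⟨C / (|1 - σ| - |σ|) ^ 2, by positivity, fun {ι} _ X a q hq hq0 => ?_⟩
  rw [div_mul_eq_mul_div, le_div_iff₀ hpos, mul_comm]
  choose l h1 h2 h3 h4 using fun i => hl (X.L i) (X.R i) (X.lt i)
  have hs := sum_cyclic_sq_ge X.next.symm (X.jump a) ((1 - σ) * (-1) ^ k) σ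
  have habs : |(1 - σ) * (-1) ^ k| = |1 - σ| := by simp [abs_mul]
  rw [habs] at hs
  refine hs.trans ?_
  rw [mul_sum]
  refine sum_le_sum fun i _ => ?_
  have h5 := X.integral_D_mul σ a i (l i)
  rw [h3, h1, h2] at h5
  have h6 : (1 - σ) * (-1) ^ k * X.jump a i + σ * X.jump a (X.next.symm i)
      = ∫ x in X.L i..X.R i, ev (X.D σ a i) x * ev (l i) x := by rw [h5]; ring
  rw [h6]
  calc _ ≤ q i * ∫ x in X.L i..X.R i, ev (l i) x ^ 2 := hq i (l i) (h3 i)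
    _ ≤ q i * (C * (X.R i - X.L i)) := mul_le_mul_of_nonneg_left (h4 i) (hq0 i)
    _ = _ := by ring

/-- The jumps are controlled by the discrete derivative. -/
lemma exists_jump_le (k : ℕ) {σ : ℝ} (hσ : σ ≠ 1 / 2) : ∃ C : ℝ, 0 < C ∧
    ∀ {ι : Type} [Fintype ι] (X : Mesh1 ι) (h : ℝ), (∀ i, X.R i - X.L i ≤ h) → ∀ a : V1 ι k,
      ∑ i, X.jump a i ^ 2 ≤ C * h * ∑ i, ∫ x in X.L i..X.R i, ev (X.D σ a i) x ^ 2 := by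
  obtain ⟨C, hC, hJ⟩ := exists_jump_le_of_moment k hσ
  refine ⟨C, hC, fun {ι} _ X h hh a => ?_⟩
  have hn : ∀ i, 0 ≤ ∫ x in X.L i..X.R i, ev (X.D σ a i) x ^ 2 := fun i =>
    intervalIntegral.integral_nonneg (X.lt i).le fun _ _ => sq_nonneg _
  refine (hJ X a (fun i => ∫ x in X.L i..X.R i, ev (X.D σ a i) x ^ 2) (fun i l _ => ?_) hn).trans ?_
  · exact sq_intervalIntegral_mul_le (continuous_ev _) (continuous_ev _) (X.lt i).le
  · rw [mul_assoc, mul_sum _ _ h]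
    refine mul_le_mul_of_nonneg_left (sum_le_sum fun i _ => ?_) hC.le
    rw [mul_comm]
    exact mul_le_mul_of_nonneg_right (hh i) (hn i)

lemma integral_sub_left_sq_le (c : P1 k) {L R : ℝ} (hLR : L < R) :
    ∫ x in L..R, (ev c x - ev c L) ^ 2 ≤ (R - L) ^ 2 * ∫ x in L..R, ev (dc c) x ^ 2 := by
  have hpt : ∀ x ∈ Icc L R, (ev c x - ev c L) ^ 2 ≤ (R - L) * ∫ x in L..R, ev (dc c) x ^ 2 := by
    intro x hx
    have h1 : ∫ y in L..x, ev (dc c) y * 1 = ev c x - ev c L := by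
      simp only [mul_one]
      exact integral_eq_sub_of_hasDerivAt (fun y _ => hasDerivAt_ev c y)
        (continuous_ev _).continuousOn.intervalIntegrable
    rw [← h1]
    refine (sq_intervalIntegral_mul_le (continuous_ev _) continuous_const hx.1).trans ?_
    have h2 : ∫ y in L..x, ev (dc c) y ^ 2 ≤ ∫ y in L..R, ev (dc c) y ^ 2 := by
      refine intervalIntegral.integral_mono_interval le_rfl hx.1 hx.2
        (.of_forall fun _ => sq_nonneg _)
        (by apply Continuous.intervalIntegrable; fun_prop)
    have h3 : 0 ≤ ∫ y in L..x, ev (dc c) y ^ 2 :=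
      intervalIntegral.integral_nonneg hx.1 fun _ _ => sq_nonneg _
    simp only [one_pow, intervalIntegral.integral_const, smul_eq_mul, mul_one]
    rw [mul_comm]
    exact mul_le_mul (by linarith [hx.2]) h2 h3 (by linarith)
  have := integral_mono_on (μ := volume) hLR.le
    (f := fun x => (ev c x - ev c L) ^ 2)
    (g := fun _ => (R - L) * ∫ x in L..R, ev (dc c) x ^ 2)
    (by apply Continuous.intervalIntegrable; fun_prop)
    (by apply Continuous.intervalIntegrable; fun_prop) hpt
  refine this.trans (le_of_eq ?_)
  simp only [intervalIntegral.integral_const, smul_eq_mul]; ring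

/-- For `k ≥ 1` the Legendre moments of the discrete derivative see only its oscillation on each
interval, which gains a power of the mesh size for the jumps. -/
lemma exists_jump_le_deriv {k : ℕ} (hk : 0 < k) {σ : ℝ} (hσ : σ ≠ 1 / 2) : ∃ C : ℝ, 0 < C ∧
    ∀ {ι : Type} [Fintype ι] (X : Mesh1 ι) (h : ℝ), (∀ i, X.R i - X.L i ≤ h) → ∀ a : V1 ι k,
      ∑ i, X.jump a i ^ 2 ≤ C * h ^ 3 * ∑ i, ∫ x in X.L i..X.R i, ev (dc (X.D σ a i)) x ^ 2 := by
  obtain ⟨C, hC, hJ⟩ := exists_jump_le_of_moment k hσ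
  refine ⟨C, hC, fun {ι} _ X h hh a => ?_⟩
  have hn : ∀ i, 0 ≤ ∫ x in X.L i..X.R i, ev (dc (X.D σ a i)) x ^ 2 := fun i =>
    intervalIntegral.integral_nonneg (X.lt i).le fun _ _ => sq_nonneg _
  refine (hJ X a (fun i => (X.R i - X.L i) ^ 2 *
    ∫ x in X.L i..X.R i, ev (dc (X.D σ a i)) x ^ 2) (fun i l hl => ?_)
    (fun i => mul_nonneg (sq_nonneg _) (hn i))).trans ?_
  · have h1 : ∫ x in X.L i..X.R i, ev l x = 0 := by
      set c : P1 k := fun m => if (m : ℕ) = 1 then 1 else 0 with hc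
      have hev : ∀ x, ev c x = x := by
        intro x
        rw [ev, sum_eq_single (⟨1, by omega⟩ : Fin (k + 1))]
        · simp [hc]
        · intro m _ hm
          have : (m : ℕ) ≠ 1 := fun h => hm (Fin.ext h)
          simp [hc, this]
        · simp
      have hd : ∀ x, ev (dc c) x = 1 := by
        intro x
        refine (hasDerivAt_ev c x).unique ?_
        rw [show ev c = id from funext hev]
        exact hasDerivAt_id x
      simpa [hd] using hl c
    have h2 : ∫ x in X.L i..X.R i, ev (X.D σ a i) x * ev l x
        = ∫ x in X.L i..X.R i, (ev (X.D σ a i) x - ev (X.D σ a i) (X.L i)) * ev l x := by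
      simp only [sub_mul]
      rw [intervalIntegral.integral_sub (by apply Continuous.intervalIntegrable; fun_prop)
        (by apply Continuous.intervalIntegrable; fun_prop), intervalIntegral.integral_const_mul,
        h1, mul_zero, sub_zero]
    rw [h2]
    refine (sq_intervalIntegral_mul_le (by fun_prop) (continuous_ev _) (X.lt i).le).trans ?_
    refine mul_le_mul_of_nonneg_right (integral_sub_left_sq_le _ (X.lt i)) ?_
    exact intervalIntegral.integral_nonneg (X.lt i).le fun _ _ => sq_nonneg _
  · rw [mul_assoc, mul_sum _ _ (h ^ 3)]
    refine mul_le_mul_of_nonneg_left (sum_le_sum fun i _ => ?_) hC.le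
    have h0 : 0 < X.R i - X.L i := sub_pos.2 (X.lt i)
    calc _ = (X.R i - X.L i) ^ 3 * ∫ x in X.L i..X.R i, ev (dc (X.D σ a i)) x ^ 2 := by ring
      _ ≤ _ := mul_le_mul_of_nonneg_right (pow_le_pow_left₀ h0.le (hh i) 3) (hn i)

/-- The broken derivative is controlled by the discrete derivative on quasi-uniform meshes. -/
lemma exists_deriv_le (k : ℕ) {σ : ℝ} (hσ : σ ≠ 1 / 2) (ρ : ℝ) : ∃ C : ℝ, 0 < C ∧
    ∀ {ι : Type} [Fintype ι] (X : Mesh1 ι) (h : ℝ), (∀ i, X.R i - X.L i ≤ h) →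
      (∀ i, h ≤ ρ * (X.R i - X.L i)) → ∀ a : V1 ι k,
      ∑ i, ∫ x in X.L i..X.R i, ev (dc (a i)) x ^ 2
        ≤ C * ∑ i, ∫ x in X.L i..X.R i, ev (X.D σ a i) x ^ 2 := by
  obtain ⟨C₁, hC₁, hJ⟩ := exists_jump_le k hσ
  obtain ⟨C₂, hC₂, hI⟩ := exists_inverse_ineq k
  refine ⟨3 + 3 * ((1 - σ) ^ 2 + σ ^ 2) * C₂ * |ρ| * C₁, by positivity,
    fun {ι} _ X h hh hρ a => ?_⟩
  set A : ι → ℝ := fun i => ∫ x in X.L i..X.R i, ev (dc (a i)) x ^ 2 with hA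
  set G : ι → ℝ := fun i => ∫ x in X.L i..X.R i, ev (X.D σ a i) x ^ 2 with hG
  have hA0 : ∀ i, 0 ≤ A i := fun i =>
    intervalIntegral.integral_nonneg (X.lt i).le fun _ _ => sq_nonneg _
  have hG0 : ∀ i, 0 ≤ G i := fun i =>
    intervalIntegral.integral_nonneg (X.lt i).le fun _ _ => sq_nonneg _
  rcases isEmpty_or_nonempty ι with hemp | ⟨⟨i₀⟩⟩
  · simp
  have hh0 : 0 < h := lt_of_lt_of_le (sub_pos.2 (X.lt i₀)) (hh i₀)
  have key : ∀ i, A i ≤ 3 * G i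
      + 3 * ((1 - σ) ^ 2 * X.jump a i ^ 2 + σ ^ 2 * X.jump a (X.next.symm i) ^ 2)
        * (C₂ * |ρ| / h) := by
    intro i
    have hp : 0 < X.R i - X.L i := sub_pos.2 (X.lt i)
    have h1 := X.integral_D_mul σ a i (dc (a i))
    have h2 : A i = (∫ x in X.L i..X.R i, ev (X.D σ a i) x * ev (dc (a i)) x)
        - (1 - σ) * X.jump a i * ev (dc (a i)) (X.R i)
        - σ * X.jump a (X.next.symm i) * ev (dc (a i)) (X.L i) := by
      rw [h1]; simp only [hA, pow_two]; ring
    have h3 := sq_intervalIntegral_mul_le (continuous_ev (X.D σ a i)) (continuous_ev (dc (a i)))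
      (X.lt i).le
    have hbd : C₂ / (X.R i - X.L i) ≤ C₂ * |ρ| / h := by
      rw [div_le_div_iff₀ hp hh0, mul_assoc]
      refine mul_le_mul_of_nonneg_left ?_ hC₂.le
      exact (hρ i).trans (mul_le_mul_of_nonneg_right (le_abs_self ρ) hp.le)
    have h4 : ev (dc (a i)) (X.R i) ^ 2 ≤ C₂ * |ρ| / h * A i :=
      ((hI _ _ (X.lt i) (dc (a i))).1 _ (right_mem_Icc.2 (X.lt i).le)).trans
        (mul_le_mul_of_nonneg_right hbd (hA0 i))
    have h5 : ev (dc (a i)) (X.L i) ^ 2 ≤ C₂ * |ρ| / h * A i :=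
      ((hI _ _ (X.lt i) (dc (a i))).1 _ (left_mem_Icc.2 (X.lt i).le)).trans
        (mul_le_mul_of_nonneg_right hbd (hA0 i))
    have h6 : A i ^ 2 ≤ 3 * (G i * A i + ((1 - σ) * X.jump a i) ^ 2 * (C₂ * |ρ| / h * A i)
        + (σ * X.jump a (X.next.symm i)) ^ 2 * (C₂ * |ρ| / h * A i)) := by
      set p := ∫ x in X.L i..X.R i, ev (X.D σ a i) x * ev (dc (a i)) x
      set q := (1 - σ) * X.jump a i * ev (dc (a i)) (X.R i) with hq
      set r := σ * X.jump a (X.next.symm i) * ev (dc (a i)) (X.L i) with hr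
      have hq2 : q ^ 2 ≤ ((1 - σ) * X.jump a i) ^ 2 * (C₂ * |ρ| / h * A i) := by
        rw [hq, mul_pow]; exact mul_le_mul_of_nonneg_left h4 (sq_nonneg _)
      have hr2 : r ^ 2 ≤ (σ * X.jump a (X.next.symm i)) ^ 2 * (C₂ * |ρ| / h * A i) := by
        rw [hr, mul_pow]; exact mul_le_mul_of_nonneg_left h5 (sq_nonneg _)
      have hp2 : p ^ 2 ≤ G i * A i := h3
      have : A i ^ 2 ≤ 3 * (p ^ 2 + q ^ 2 + r ^ 2) := by
        rw [h2]; nlinarith [sq_nonneg (p + q), sq_nonneg (p + r), sq_nonneg (q - r)]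
      linarith
    rcases (hA0 i).eq_or_lt with h0 | h0
    · rw [← h0]
      have := hG0 i
      positivity
    · refine le_of_mul_le_mul_right ?_ h0
      calc A i * A i = A i ^ 2 := by ring
        _ ≤ _ := h6
        _ = _ := by ring
  have hsum := sum_le_sum fun i (_ : i ∈ Finset.univ) => key i
  have hperm : ∑ i, X.jump a (X.next.symm i) ^ 2 = ∑ i, X.jump a i ^ 2 :=
    Equiv.sum_comp X.next.symm (fun i => X.jump a i ^ 2)
  refine hsum.trans ?_
  rw [sum_add_distrib, ← mul_sum, ← sum_mul, ← mul_sum,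
    sum_add_distrib, ← mul_sum, ← mul_sum, hperm]
  have h7 : (C₂ * |ρ| / h) * ∑ i, X.jump a i ^ 2 ≤ C₂ * |ρ| * C₁ * ∑ i, G i := by
    calc _ ≤ (C₂ * |ρ| / h) * (C₁ * h * ∑ i, G i) :=
          mul_le_mul_of_nonneg_left (hJ X h hh a) (by positivity)
      _ = _ := by field_simp
  calc _ = 3 * ∑ i, G i + 3 * ((1 - σ) ^ 2 + σ ^ 2)
        * ((C₂ * |ρ| / h) * ∑ i, X.jump a i ^ 2) := by ring
    _ ≤ 3 * ∑ i, G i + 3 * ((1 - σ) ^ 2 + σ ^ 2) * (C₂ * |ρ| * C₁ * ∑ i, G i) := by gcongr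
    _ = _ := by ring

/-! ### Tensor-product polynomials and their slices -/

section Slices

variable {k : ℕ}

/-- The polynomial `x ↦ c(x, y)`. -/
def slx (c : Qk k) (y : ℝ) : P1 k := fun m => ev (c m) y

/-- Exchange of the two variables in `Q^k`. -/
def Qk.swap (c : Qk k) : Qk k := fun m n => c n m

lemma eval_eq_slx (c : Qk k) (x y : ℝ) : c.eval (x, y) = ev (slx c y) x := by
  simp only [Qk.eval, ev, slx, sum_mul]
  exact sum_congr rfl fun m _ => sum_congr rfl fun n _ => by ring

lemma eval_swap (c : Qk k) (x y : ℝ) : c.swap.eval (x, y) = c.eval (y, x) := by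
  simp only [Qk.eval, Qk.swap]
  rw [sum_comm]
  exact sum_congr rfl fun m _ => sum_congr rfl fun n _ => by ring

@[fun_prop] lemma continuous_eval (c : Qk k) : Continuous c.eval := by
  unfold Qk.eval; fun_prop

lemma eval_add (c d : Qk k) (z : ℝ × ℝ) : (c + d).eval z = c.eval z + d.eval z := by
  simp [Qk.eval, add_mul, sum_add_distrib]

lemma eval_smul (r : ℝ) (c : Qk k) (z : ℝ × ℝ) : (r • c).eval z = r * c.eval z := by
  simp [Qk.eval, mul_sum, mul_assoc]

lemma eval_sub (c d : Qk k) (z : ℝ × ℝ) : (c - d).eval z = c.eval z - d.eval z := by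
  simp [Qk.eval, sub_mul, sum_sub_distrib]

@[simp] lemma eval_zero (z : ℝ × ℝ) : (0 : Qk k).eval z = 0 := by simp [Qk.eval]

/-- The coefficients of `∂_x c`. -/
def dcx (c : Qk k) : Qk k := fun m n => dc (fun m' => c m' n) m

lemma slx_eq_sum (c : Qk k) (y : ℝ) :
    slx c y = fun m => ∑ n : Fin (k + 1), y ^ (n : ℕ) * c m n := by
  funext m; simp only [slx, ev, mul_comm]

lemma slx_dcx (c : Qk k) (y : ℝ) : slx (dcx c) y = dc (slx c y) := by
  rw [slx_eq_sum c y, dc_sum Finset.univ (fun n : Fin (k + 1) => y ^ (n : ℕ))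
    (fun n m => c m n), slx_eq_sum]
  rfl

lemma dX_eval (c : Qk k) : dX c.eval = (dcx c).eval := by
  funext ⟨x, y⟩
  rw [eval_eq_slx, slx_dcx]
  simp only [dX, eval_eq_slx]
  exact (hasDerivAt_ev _ _).deriv

lemma dY_eval (c : Qk k) : dY c.eval = fun z => (dcx c.swap).eval (z.2, z.1) := by
  funext ⟨x, y⟩
  rw [← dX_eval]
  simp only [dX, dY, eval_swap]

lemma slx_add (c d : Qk k) (y : ℝ) : slx (c + d) y = slx c y + slx d y := by
  funext m; simp [slx, ev_add]

lemma slx_smul (r : ℝ) (c : Qk k) (y : ℝ) : slx (r • c) y = r • slx c y := by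
  funext m; simp [slx, ev_smul]

end Slices

lemma integrableOn_rect {f : ℝ × ℝ → ℝ} (hf : Continuous f) (L R L' R' : ℝ) :
    IntegrableOn f (rect L R L' R') := by
  have h : IntegrableOn f (Icc L R ×ˢ Icc L' R') :=
    hf.continuousOn.integrableOn_compact (isCompact_Icc.prod isCompact_Icc)
  exact h.mono_set (prod_mono Ioo_subset_Icc_self Ioo_subset_Icc_self)

lemma integral_rect_of_integrable {f : ℝ × ℝ → ℝ} {L R L' R' : ℝ} (hLR : L ≤ R) (hLR' : L' ≤ R')
    (hf : IntegrableOn f (rect L R L' R')) :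
    ∫ z in rect L R L' R', f z = ∫ y in L'..R', ∫ x in L..R, f (x, y) := by
  simp only [integral_of_le hLR, integral_of_le hLR',
    integral_Ioc_eq_integral_Ioo]
  have h : Integrable f (vol[Ioo L R].prod vol[Ioo L' R']) := by
    rw [Measure.prod_restrict, ← Measure.volume_eq_prod]; exact hf
  rw [rect, Measure.volume_eq_prod, ← Measure.prod_restrict, integral_prod_symm _ h]

lemma integral_rect {f : ℝ × ℝ → ℝ} (hf : Continuous f) {L R L' R' : ℝ} (hLR : L ≤ R)
    (hLR' : L' ≤ R') :
    ∫ z in rect L R L' R', f z = ∫ y in L'..R', ∫ x in L..R, f (x, y) :=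
  integral_rect_of_integrable hLR hLR' (integrableOn_rect hf L R L' R')

/-- Exchange of variables in an integral over a rectangle. -/
lemma integral_rect_swap (f : ℝ × ℝ → ℝ) (L R L' R' : ℝ) :
    ∫ z in rect L R L' R', f z = ∫ z in rect L' R' L R, f z.swap := by
  have h := (Measure.measurePreserving_swap (μ := (volume : Measure ℝ))
    (ν := (volume : Measure ℝ))).setIntegral_preimage_emb
    (MeasurableEquiv.prodComm (α := ℝ) (β := ℝ)).measurableEmbedding f (rect L R L' R')
  rw [← Measure.volume_eq_prod] at h
  rw [← h]
  congr 2
  ext z; simp [rect]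

/-! ### Piecewise polynomials on a tensor-product mesh -/

variable {ι κ : Type} {k : ℕ}

/-- One polynomial of `Q^k` on each cell of a tensor-product mesh. -/
abbrev V2 (ι κ : Type) (k : ℕ) : Type := ι → κ → Qk k

/-- Exchange of the two variables for piecewise polynomials. -/
def V2.swap (v : V2 ι κ k) : V2 κ ι k := fun j i => (v i j).swap

/-- The one-variable piecewise polynomial `x ↦ v(x, y)` in the row `j`. -/
def sx (v : V2 ι κ k) (j : κ) (y : ℝ) : V1 ι k := fun i => slx (v i j) y

lemma sx_add (v w : V2 ι κ k) (j : κ) (y : ℝ) : sx (v + w) j y = sx v j y + sx w j y :=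
  funext fun _ => slx_add _ _ _

lemma sx_smul (r : ℝ) (v : V2 ι κ k) (j : κ) (y : ℝ) : sx (r • v) j y = r • sx v j y :=
  funext fun _ => slx_smul _ _ _

variable (X : Mesh1 ι) (Y : Mesh1 κ)

/-- The cell `(i, j)` of the tensor-product mesh. -/
def cellXY (i : ι) (j : κ) : Set (ℝ × ℝ) := rect (X.L i) (X.R i) (Y.L j) (Y.R j)

variable [Fintype ι]

lemma continuous_ip_sx (v w : V2 ι κ k) (j : κ) (j' : κ) :
    Continuous fun y => X.ip (sx v j y) (sx w j' y) := by
  simp only [Mesh1.ip_apply]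
  refine continuous_finsetSum _ fun i _ => ?_
  refine continuous_parametric_intervalIntegral_of_continuous' ?_ _ _
  simp only [Function.uncurry_def, sx, ← eval_eq_slx]
  fun_prop

lemma sum_cell_eq (v w : V2 ι κ k) (j : κ) :
    ∑ i, ∫ z in cellXY X Y i j, (v i j).eval z * (w i j).eval z
      = ∫ y in Y.L j..Y.R j, X.ip (sx v j y) (sx w j y) := by
  simp only [Mesh1.ip_apply]
  rw [intervalIntegral.integral_finsetSum]
  · refine sum_congr rfl fun i _ => ?_
    rw [cellXY, integral_rect (by fun_prop) (X.lt i).le (Y.lt j).le]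
    simp only [eval_eq_slx, sx]
  · intro i _
    refine Continuous.intervalIntegrable ?_ _ _
    refine continuous_parametric_intervalIntegral_of_continuous' ?_ _ _
    simp only [Function.uncurry_def, sx, ← eval_eq_slx]
    fun_prop

variable [Fintype κ]

/-- The `L²` inner product of piecewise polynomials. -/
def ip2 : V2 ι κ k →ₗ[ℝ] V2 ι κ k →ₗ[ℝ] ℝ :=
  LinearMap.mk₂ ℝ (fun v w => ∑ i, ∑ j, ∫ z in cellXY X Y i j, (v i j).eval z * (w i j).eval z)
    (fun v v' w => by
      simp only [← sum_add_distrib]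
      refine sum_congr rfl fun i _ => sum_congr rfl fun j _ => ?_
      rw [cellXY, ← integral_add (integrableOn_rect (by fun_prop) _ _ _ _)
        (integrableOn_rect (by fun_prop) _ _ _ _)]
      simp only [Pi.add_apply, eval_add, add_mul])
    (fun r v w => by
      simp only [Pi.smul_apply, eval_smul, mul_assoc, integral_const_mul,
        smul_eq_mul, mul_sum])
    (fun v w w' => by
      simp only [← sum_add_distrib]
      refine sum_congr rfl fun i _ => sum_congr rfl fun j _ => ?_
      rw [cellXY, ← integral_add (integrableOn_rect (by fun_prop) _ _ _ _)
        (integrableOn_rect (by fun_prop) _ _ _ _)]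
      simp only [Pi.add_apply, eval_add, mul_add])
    (fun r v w => by
      simp only [Pi.smul_apply, eval_smul, mul_left_comm _ r, integral_const_mul,
        smul_eq_mul, mul_sum])

lemma ip2_apply (v w : V2 ι κ k) :
    ip2 X Y v w = ∑ i, ∑ j, ∫ z in cellXY X Y i j, (v i j).eval z * (w i j).eval z := rfl

lemma ip2_comm (v w : V2 ι κ k) : ip2 X Y v w = ip2 X Y w v := by
  simp only [ip2_apply, mul_comm]

lemma ip2_self (v : V2 ι κ k) :
    ip2 X Y v v = ∑ i, ∑ j, ∫ z in cellXY X Y i j, (v i j).eval z ^ 2 := by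
  simp only [ip2_apply, pow_two]

lemma ip2_self_nonneg (v : V2 ι κ k) : 0 ≤ ip2 X Y v v := by
  rw [ip2_self]
  exact sum_nonneg fun _ _ => sum_nonneg fun _ _ => integral_nonneg fun _ =>
    sq_nonneg _

lemma ip2_eq_sum_ip (v w : V2 ι κ k) :
    ip2 X Y v w = ∑ j, ∫ y in Y.L j..Y.R j, X.ip (sx v j y) (sx w j y) := by
  rw [ip2_apply, sum_comm]
  exact sum_congr rfl fun j _ => sum_cell_eq X Y v w j

lemma ip2_swap (v w : V2 ι κ k) : ip2 Y X v.swap w.swap = ip2 X Y v w := by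
  rw [ip2_apply, ip2_apply, sum_comm]
  refine sum_congr rfl fun i _ => sum_congr rfl fun j _ => ?_
  rw [cellXY, cellXY, integral_rect_swap]
  refine integral_congr_ae (.of_forall fun z => ?_)
  obtain ⟨x, y⟩ := z
  simp only [V2.swap, Prod.swap_prod_mk, eval_swap]

lemma ip2_definite (v : V2 ι κ k) (h : ip2 X Y v v = 0) : v = 0 := by
  have hj := h
  rw [ip2_eq_sum_ip, Finset.sum_eq_zero_iff_of_nonneg] at hj
  · funext i j
    have hnn : ∀ y, 0 ≤ X.ip (sx v j y) (sx v j y) := fun y => by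
      rw [Mesh1.ip_self]
      exact sum_nonneg fun i _ =>
        intervalIntegral.integral_nonneg (X.lt i).le fun _ _ => sq_nonneg _
    have h0 : ∀ y ∈ Icc (Y.L j) (Y.R j), sx v j y = 0 := by
      intro y hy
      refine X.ip_definite _ ?_
      by_contra hne
      have := intervalIntegral.integral_pos (Y.lt j)
        (continuous_ip_sx X v v j j).continuousOn (fun y _ => hnn y)
        ⟨y, hy, lt_of_le_of_ne (hnn y) (Ne.symm hne)⟩
      linarith [hj j (Finset.mem_univ j)]
    funext m
    exact eq_zero_of_ev_eq_zero (Y.lt j) fun y hy =>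
      congrFun (congrFun (h0 y hy) i) m
  · intro j _
    refine intervalIntegral.integral_nonneg (Y.lt j).le fun y _ => ?_
    rw [Mesh1.ip_self]
    exact sum_nonneg fun i _ =>
      intervalIntegral.integral_nonneg (X.lt i).le fun _ _ => sq_nonneg _

lemma sq_ip2_le (v w : V2 ι κ k) : ip2 X Y v w ^ 2 ≤ ip2 X Y v v * ip2 X Y w w := by
  have h : ∀ t : ℝ, 0 ≤ ip2 X Y w w * (t * t) + 2 * ip2 X Y v w * t + ip2 X Y v v := by
    intro t
    have := ip2_self_nonneg X Y (v + t • w)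
    simp only [map_add, map_smul, LinearMap.add_apply, LinearMap.smul_apply, smul_eq_mul,
      ip2_comm X Y w v] at this
    linarith
  have := discrim_le_zero h
  unfold discrim at this
  nlinarith

/-! ### The discrete gradient on a tensor-product mesh -/

section Operators

variable {ι κ : Type} {k : ℕ}

/-- The discrete derivative in the first variable. -/
def dxOp [Fintype ι] (X : Mesh1 ι) (σ : ℝ) : V2 ι κ k →ₗ[ℝ] V2 ι κ k where
  toFun v := fun i j m n => X.D σ (fun i' m' => v i' j m' n) i m
  map_add' v w := by
    funext i j m n
    exact congrFun (congrFun (map_add (X.D σ) (fun i' m' => v i' j m' n)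
      (fun i' m' => w i' j m' n)) i) m
  map_smul' r v := by
    funext i j m n
    exact congrFun (congrFun (map_smul (X.D σ) r (fun i' m' => v i' j m' n)) i) m

/-- The discrete derivative in the second variable. -/
def dyOp [Fintype κ] (Y : Mesh1 κ) (σ : ℝ) : V2 ι κ k →ₗ[ℝ] V2 ι κ k where
  toFun v := (dxOp Y σ v.swap).swap
  map_add' v w := by
    rw [show V2.swap (v + w) = v.swap + w.swap from rfl, map_add]; rfl
  map_smul' r v := by
    rw [show V2.swap (r • v) = r • v.swap from rfl, map_smul]; rfl

lemma swap_dyOp [Fintype κ] (Y : Mesh1 κ) (σ : ℝ) (v : V2 ι κ k) :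
    (dyOp Y σ v).swap = dxOp Y σ v.swap := rfl

lemma swap_dxOp [Fintype ι] (X : Mesh1 ι) (σ : ℝ) (v : V2 ι κ k) :
    (dxOp X σ v).swap = dyOp X σ v.swap := rfl

lemma sx_eq_sum (v : V2 ι κ k) (j : κ) (y : ℝ) :
    sx v j y = ∑ n : Fin (k + 1), y ^ (n : ℕ) • (fun i m => v i j m n : V1 ι k) := by
  funext i m
  simp only [sx, slx_eq_sum, Finset.sum_apply, Pi.smul_apply, smul_eq_mul]

variable [Fintype ι] (X : Mesh1 ι)

lemma sx_dxOp (σ : ℝ) (v : V2 ι κ k) (j : κ) (y : ℝ) :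
    sx (dxOp X σ v) j y = X.D σ (sx v j y) := by
  rw [sx_eq_sum v, map_sum, sx_eq_sum]
  simp only [map_smul]
  rfl

lemma linear_expand {κ : Type} [Fintype κ] (l : V1 κ k →ₗ[ℝ] ℝ) :
    ∃ t : κ → Fin (k + 1) → ℝ, ∀ w, l w = ∑ j, ∑ n, t j n * w j n := by
  classical
  refine ⟨fun j n => l (Pi.single j (Pi.single n 1)), fun w => ?_⟩
  have hw : w = ∑ j, ∑ n, w j n • (Pi.single j (Pi.single n 1) : V1 κ k) := by
    funext j n
    simp [Finset.sum_apply, Pi.single_apply, apply_ite, ite_apply]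
  conv_lhs => rw [hw]
  simp only [map_sum, map_smul, smul_eq_mul, mul_comm]

/-- Discrete derivatives in different variables commute, being operators on different tensor
factors. -/
lemma dxOp_dyOp [Fintype κ] (Y : Mesh1 κ) (σ τ : ℝ) (v : V2 ι κ k) :
    dxOp X σ (dyOp Y τ v) = dyOp Y τ (dxOp X σ v) := by
  funext i j m n
  obtain ⟨t, ht⟩ := linear_expand
    ((LinearMap.proj n ∘ₗ LinearMap.proj j ∘ₗ Y.D τ : V1 κ k →ₗ[ℝ] ℝ))
  have h1 : (dyOp Y τ (dxOp X σ v)) i j m n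
      = ∑ j', ∑ n', t j' n' * X.D σ (fun i' m' => v i' j' m' n') i m :=
    ht (fun j' n' => X.D σ (fun i' m' => v i' j' m' n') i m)
  have h2 : (fun i' m' => (dyOp Y τ v) i' j m' n : V1 ι k)
      = ∑ j', ∑ n', t j' n' • (fun i' m' => v i' j' m' n' : V1 ι k) := by
    funext i' m'
    simp only [Finset.sum_apply, Pi.smul_apply, smul_eq_mul]
    exact ht (fun j' n' => v i' j' m' n')
  have h3 : (dxOp X σ (dyOp Y τ v)) i j m n
      = X.D σ (fun i' m' => (dyOp Y τ v) i' j m' n : V1 ι k) i m := rfl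
  rw [h1, h3, h2]
  simp only [map_sum, map_smul, Finset.sum_apply, Pi.smul_apply, smul_eq_mul]

variable [Fintype κ] (Y : Mesh1 κ)

lemma ip2_dxOp_left (σ : ℝ) (v w : V2 ι κ k) :
    ip2 X Y (dxOp X σ v) w = -ip2 X Y v (dxOp X (1 - σ) w) := by
  simp only [ip2_eq_sum_ip, sx_dxOp, Mesh1.ip_D_left, intervalIntegral.integral_neg,
    sum_neg_distrib]

lemma ip2_dyOp_left (σ : ℝ) (v w : V2 ι κ k) :
    ip2 X Y (dyOp Y σ v) w = -ip2 X Y v (dyOp Y (1 - σ) w) := by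
  rw [← ip2_swap, swap_dyOp, ip2_dxOp_left, ← swap_dyOp, ip2_swap]

/-- The form `(v, w) + (∇_h v, ∇_h w)` of the discrete operator `1 - Δ_h`. -/
def sform (σ₁ σ₂ : ℝ) : V2 ι κ k →ₗ[ℝ] V2 ι κ k →ₗ[ℝ] ℝ :=
  ip2 X Y + (ip2 X Y).compl₁₂ (dxOp X σ₁) (dxOp X σ₁) + (ip2 X Y).compl₁₂ (dyOp Y σ₂) (dyOp Y σ₂)

lemma sform_apply (σ₁ σ₂ : ℝ) (v w : V2 ι κ k) :
    sform X Y σ₁ σ₂ v w = ip2 X Y v w + ip2 X Y (dxOp X σ₁ v) (dxOp X σ₁ w)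
      + ip2 X Y (dyOp Y σ₂ v) (dyOp Y σ₂ w) := rfl

lemma sform_comm (σ₁ σ₂ : ℝ) (v w : V2 ι κ k) :
    sform X Y σ₁ σ₂ v w = sform X Y σ₁ σ₂ w v := by
  simp only [sform_apply, ip2_comm X Y v, ip2_comm X Y (dxOp X σ₁ v),
    ip2_comm X Y (dyOp Y σ₂ v)]

lemma sform_swap (σ₁ σ₂ : ℝ) (v w : V2 ι κ k) :
    sform Y X σ₂ σ₁ v.swap w.swap = sform X Y σ₁ σ₂ v w := by
  simp only [sform_apply, ← swap_dyOp, ← swap_dxOp, ip2_swap]; ring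

lemma sform_definite (σ₁ σ₂ : ℝ) (v : V2 ι κ k) (h : sform X Y σ₁ σ₂ v v = 0) : v = 0 := by
  refine ip2_definite X Y v ?_
  rw [sform_apply] at h
  linarith [ip2_self_nonneg X Y v, ip2_self_nonneg X Y (dxOp X σ₁ v),
    ip2_self_nonneg X Y (dyOp Y σ₂ v)]

/-- Discrete elliptic regularity: if `(1 - Δ_h) φ = e`, then the first and the repeated second
discrete derivatives of `φ` are bounded by `e`. The cross term of the two second derivatives has
a sign, because the discrete derivatives in `x` and `y` commute. -/
lemma regularity_x (σ₁ σ₂ : ℝ) {φ e : V2 ι κ k}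
    (h : ∀ v, sform X Y σ₁ σ₂ φ v = ip2 X Y e v) :
    ip2 X Y (dxOp X σ₁ φ) (dxOp X σ₁ φ) ≤ ip2 X Y e e ∧
    ip2 X Y (dxOp X (1 - σ₁) (dxOp X σ₁ φ)) (dxOp X (1 - σ₁) (dxOp X σ₁ φ)) ≤ ip2 X Y e e := by
  set w := dxOp X σ₁ φ with hw
  set A := dxOp X (1 - σ₁) w with hA
  have cs1 := sq_ip2_le X Y e φ
  have cs2 := sq_ip2_le X Y e A
  have he := ip2_self_nonneg X Y e
  have hφ := ip2_self_nonneg X Y φ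
  have hww := ip2_self_nonneg X Y w
  have hAA := ip2_self_nonneg X Y A
  have hy := ip2_self_nonneg X Y (dyOp Y σ₂ φ)
  have hyw := ip2_self_nonneg X Y (dyOp Y σ₂ w)
  have h1 := h φ
  have h2 := h A
  rw [sform_apply] at h1 h2
  have e1 : ip2 X Y φ A = -ip2 X Y w w := by
    have := ip2_dxOp_left X Y σ₁ φ w
    rw [← hw, ← hA] at this; linarith
  have e2 : ip2 X Y (dxOp X σ₁ φ) (dxOp X σ₁ A) = -ip2 X Y A A := by
    have := ip2_dxOp_left X Y σ₁ A w
    rw [← hA] at this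
    rw [← hw, ip2_comm]; linarith
  have e3 : ip2 X Y (dyOp Y σ₂ φ) (dyOp Y σ₂ A) = -ip2 X Y (dyOp Y σ₂ w) (dyOp Y σ₂ w) := by
    rw [hA, ← dxOp_dyOp X Y]
    have h3 := ip2_dxOp_left X Y σ₁ (dyOp Y σ₂ φ) (dyOp Y σ₂ w)
    rw [dxOp_dyOp, ← hw] at h3
    linarith
  rw [e1, e2, e3] at h2
  rw [← hw] at h1
  constructor
  · nlinarith
  · nlinarith

end Operators

/-! ### Stability of jumps on a tensor-product mesh -/

section Stability

variable {ι κ : Type} {k : ℕ}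

/-- The broken derivative in the first variable. -/
def dcX (v : V2 ι κ k) : V2 ι κ k := fun i j => dcx (v i j)

@[fun_prop] lemma continuous_ev_slx (c : Qk k) (x : ℝ) : Continuous fun y => ev (slx c y) x := by
  simp only [← eval_eq_slx]; fun_prop

lemma continuous_jump (X : Mesh1 ι) (v : V2 ι κ k) (j : κ) (i : ι) :
    Continuous fun y => X.jump (sx v j y) i := by
  simp only [Mesh1.jump, sx]; fun_prop

lemma sx_dcX (v : V2 ι κ k) (j : κ) (y : ℝ) : sx (dcX v) j y = fun i => dc (sx v j y i) := by
  funext i; exact slx_dcx _ _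

variable [Fintype ι] [Fintype κ] (X : Mesh1 ι) (Y : Mesh1 κ)

/-- The squared norm of the jumps across the vertical edges. -/
def jumpSq (v : V2 ι κ k) : ℝ := ∑ j, ∫ y in Y.L j..Y.R j, ∑ i, X.jump (sx v j y) i ^ 2

lemma sum_row_mono {f g : κ → ℝ → ℝ} (hf : ∀ j, Continuous (f j)) (hg : ∀ j, Continuous (g j))
    (h : ∀ j y, f j y ≤ g j y) :
    ∑ j, ∫ y in Y.L j..Y.R j, f j y ≤ ∑ j, ∫ y in Y.L j..Y.R j, g j y :=
  sum_le_sum fun j _ => integral_mono_on (Y.lt j).le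
    ((hf j).intervalIntegrable _ _) ((hg j).intervalIntegrable _ _) fun y _ => h j y

lemma exists_jumpSq_le (k : ℕ) {σ : ℝ} (hσ : σ ≠ 1 / 2) : ∃ C : ℝ, 0 < C ∧
    ∀ {ι κ : Type} [Fintype ι] [Fintype κ] (X : Mesh1 ι) (Y : Mesh1 κ) (h : ℝ),
      (∀ i, X.R i - X.L i ≤ h) → ∀ v : V2 ι κ k,
      jumpSq X Y v ≤ C * h * ip2 X Y (dxOp X σ v) (dxOp X σ v) := by
  obtain ⟨C, hC, hJ⟩ := exists_jump_le k hσ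
  refine ⟨C, hC, fun {ι κ} _ _ X Y h hh v => ?_⟩
  rw [ip2_eq_sum_ip, mul_sum]
  simp only [← intervalIntegral.integral_const_mul]
  refine sum_row_mono Y (fun j => ?_) (fun j => ?_) fun j y => ?_
  · exact continuous_finsetSum _ fun i _ => (continuous_jump X v j i).pow 2
  · exact continuous_const.mul (continuous_ip_sx X _ _ _ _)
  · rw [Mesh1.ip_self, sx_dxOp]; exact hJ X h hh _

lemma exists_jumpSq_le_deriv {k : ℕ} (hk : 0 < k) {σ : ℝ} (hσ : σ ≠ 1 / 2) : ∃ C : ℝ, 0 < C ∧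
    ∀ {ι κ : Type} [Fintype ι] [Fintype κ] (X : Mesh1 ι) (Y : Mesh1 κ) (h : ℝ),
      (∀ i, X.R i - X.L i ≤ h) → ∀ v : V2 ι κ k,
      jumpSq X Y v ≤ C * h ^ 3 * ip2 X Y (dcX (dxOp X σ v)) (dcX (dxOp X σ v)) := by
  obtain ⟨C, hC, hJ⟩ := exists_jump_le_deriv hk hσ
  refine ⟨C, hC, fun {ι κ} _ _ X Y h hh v => ?_⟩
  rw [ip2_eq_sum_ip, mul_sum]
  simp only [← intervalIntegral.integral_const_mul]
  refine sum_row_mono Y (fun j => ?_) (fun j => ?_) fun j y => ?_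
  · exact continuous_finsetSum _ fun i _ => (continuous_jump X v j i).pow 2
  · exact continuous_const.mul (continuous_ip_sx X _ _ _ _)
  · rw [Mesh1.ip_self, sx_dcX, sx_dxOp]; exact hJ X h hh _

lemma exists_dcX_le (k : ℕ) {σ : ℝ} (hσ : σ ≠ 1 / 2) (ρ : ℝ) : ∃ C : ℝ, 0 < C ∧
    ∀ {ι κ : Type} [Fintype ι] [Fintype κ] (X : Mesh1 ι) (Y : Mesh1 κ) (h : ℝ),
      (∀ i, X.R i - X.L i ≤ h) → (∀ i, h ≤ ρ * (X.R i - X.L i)) → ∀ v : V2 ι κ k,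
      ip2 X Y (dcX v) (dcX v) ≤ C * ip2 X Y (dxOp X σ v) (dxOp X σ v) := by
  obtain ⟨C, hC, hJ⟩ := exists_deriv_le k hσ ρ
  refine ⟨C, hC, fun {ι κ} _ _ X Y h hh hρ v => ?_⟩
  rw [ip2_eq_sum_ip, ip2_eq_sum_ip, mul_sum]
  simp only [← intervalIntegral.integral_const_mul]
  refine sum_row_mono Y (fun j => ?_) (fun j => ?_) fun j y => ?_
  · exact continuous_ip_sx X _ _ _ _
  · exact continuous_const.mul (continuous_ip_sx X _ _ _ _)
  · rw [Mesh1.ip_self, Mesh1.ip_self, sx_dcX, sx_dxOp]; exact hJ X h hh hρ _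

end Stability

/-! ### Integral operators in one variable of a product -/

section Kernel

open scoped ENNReal

variable {β : Type*} [MeasurableSpace β] {μ : Measure ℝ} {ν : Measure β}

lemma ae_prod_snd {P : β → Prop} (h : ∀ᵐ y ∂ν, P y) : ∀ᵐ p ∂(μ.prod ν), P p.2 :=
  Measure.quasiMeasurePreserving_snd.ae h

lemma lintegral_mul_sq_le {k f : ℝ → ℝ≥0∞} (hk : Measurable k) (hf : Measurable f) :
    (∫⁻ s, k s * f s ∂μ) ^ 2 ≤ (∫⁻ s, k s ∂μ) * ∫⁻ s, k s * f s ^ 2 ∂μ := by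
  have hq : Measurable fun s => k s ^ (1 / 2 : ℝ) := hk.pow_const _
  have h := ENNReal.lintegral_mul_le_Lp_mul_Lq μ Real.HolderConjugate.two_two
    (f := fun s => k s ^ (1 / 2 : ℝ)) (g := fun s => k s ^ (1 / 2 : ℝ) * f s)
    hq.aemeasurable (hq.mul hf).aemeasurable
  have e1 : ∀ a : ℝ≥0∞, a ^ (1 / 2 : ℝ) * a ^ (1 / 2 : ℝ) = a := fun a => by
    rw [← ENNReal.rpow_add_of_nonneg _ _ (by norm_num) (by norm_num)]; norm_num
  have e2 : ∀ a : ℝ≥0∞, (a ^ (1 / 2 : ℝ)) ^ (2 : ℝ) = a := fun a => by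
    rw [← ENNReal.rpow_mul]; norm_num
  simp only [Pi.mul_apply, ← mul_assoc, e1, e2, ENNReal.mul_rpow_of_nonneg _ _ zero_le_two] at h
  calc (∫⁻ s, k s * f s ∂μ) ^ 2 ≤ ((∫⁻ s, k s ∂μ) ^ (1 / 2 : ℝ)
        * (∫⁻ s, k s * f s ^ (2 : ℝ) ∂μ) ^ (1 / 2 : ℝ)) ^ 2 := by gcongr
    _ = _ := by
      rw [mul_pow, pow_two, pow_two, e1, e1]
      simp only [ENNReal.rpow_two]

variable [SFinite μ] [SFinite ν]

lemma ae_ae_swap {f g : ℝ × β → ℝ} (h : f =ᵐ[μ.prod ν] g) :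
    ∀ᵐ y ∂ν, ∀ᵐ s ∂μ, f (s, y) = g (s, y) := by
  have h1 : ∀ᵐ p ∂(ν.prod μ), f p.swap = g p.swap :=
    (Measure.measurePreserving_swap (μ := ν) (ν := μ)).quasiMeasurePreserving.ae h
  exact Measure.ae_ae_of_ae_prod h1

lemma kernel_congr (k : ℝ → ℝ → ℝ) {f g : ℝ × β → ℝ} (h : f =ᵐ[μ.prod ν] g) :
    (fun p : ℝ × β => ∫ s, k p.1 s * f (s, p.2) ∂μ)
      =ᵐ[μ.prod ν] fun p => ∫ s, k p.1 s * g (s, p.2) ∂μ := by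
  filter_upwards [ae_prod_snd (ae_ae_swap h)] with p hp
  refine integral_congr_ae ?_
  filter_upwards [hp] with s hs
  rw [hs]

lemma stronglyMeasurable_kernel {k : ℝ → ℝ → ℝ} (hk : Measurable (Function.uncurry k))
    {f : ℝ × β → ℝ} (hf : StronglyMeasurable f) :
    StronglyMeasurable (fun p : ℝ × β => ∫ s, k p.1 s * f (s, p.2) ∂μ) := by
  refine StronglyMeasurable.integral_prod_right'
    (f := fun q : (ℝ × β) × ℝ => k q.1.1 q.2 * f (q.2, q.1.2)) ?_
  refine StronglyMeasurable.mul ?_ ?_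
  · exact (hk.comp ((measurable_fst.comp measurable_fst).prodMk measurable_snd)).stronglyMeasurable
  · exact hf.comp_measurable (measurable_snd.prodMk (measurable_snd.comp measurable_fst))

lemma aestronglyMeasurable_kernel {k : ℝ → ℝ → ℝ} (hk : Measurable (Function.uncurry k))
    {f : ℝ × β → ℝ} (hf : AEStronglyMeasurable f (μ.prod ν)) :
    AEStronglyMeasurable (fun p : ℝ × β => ∫ s, k p.1 s * f (s, p.2) ∂μ) (μ.prod ν) :=
  ⟨_, stronglyMeasurable_kernel hk hf.stronglyMeasurable_mk, kernel_congr k hf.ae_eq_mk⟩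

/-- Schur's test for an integral operator in the first variable, on measurable functions. -/
lemma schur_lintegral {k : ℝ → ℝ → ℝ} (hk : Measurable (Function.uncurry k)) {A : ℝ≥0∞}
    (hA : ∀ t, ∫⁻ s, ‖k t s‖ₑ ∂μ ≤ A) (hB : ∀ s, ∫⁻ t, ‖k t s‖ₑ ∂μ ≤ A)
    {f : ℝ × β → ℝ} (hf : Measurable f) :
    ∫⁻ p, (∫⁻ s, ‖k p.1 s‖ₑ * ‖f (s, p.2)‖ₑ ∂μ) ^ 2 ∂(μ.prod ν)
      ≤ A ^ 2 * ∫⁻ p, ‖f p‖ₑ ^ 2 ∂(μ.prod ν) := by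
  have hk1 : ∀ t, Measurable fun s => ‖k t s‖ₑ := fun t =>
    (hk.comp (measurable_const.prodMk measurable_id)).enorm
  have hf1 : ∀ y, Measurable fun s => ‖f (s, y)‖ₑ := fun y =>
    (hf.comp (measurable_id.prodMk measurable_const)).enorm
  have hm3 : Measurable fun q : ℝ × ℝ × β => ‖k q.2.1 q.1‖ₑ * ‖f (q.1, q.2.2)‖ₑ ^ 2 :=
    ((hk.comp ((measurable_fst.comp measurable_snd).prodMk measurable_fst)).enorm).mul
      ((hf.comp (measurable_fst.prodMk (measurable_snd.comp measurable_snd))).enorm.pow_const 2)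
  have hm3' : Measurable fun q : (ℝ × β) × ℝ => ‖k q.1.1 q.2‖ₑ * ‖f (q.2, q.1.2)‖ₑ ^ 2 :=
    hm3.comp measurable_swap
  calc ∫⁻ p, (∫⁻ s, ‖k p.1 s‖ₑ * ‖f (s, p.2)‖ₑ ∂μ) ^ 2 ∂(μ.prod ν)
      ≤ ∫⁻ p, A * ∫⁻ s, ‖k p.1 s‖ₑ * ‖f (s, p.2)‖ₑ ^ 2 ∂μ ∂(μ.prod ν) := by
        refine lintegral_mono fun p => ?_
        refine (lintegral_mul_sq_le (hk1 _) (hf1 _)).trans ?_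
        gcongr
        exact hA _
    _ = A * ∫⁻ p, ∫⁻ s, ‖k p.1 s‖ₑ * ‖f (s, p.2)‖ₑ ^ 2 ∂μ ∂(μ.prod ν) :=
        lintegral_const_mul _ hm3'.lintegral_prod_right'
    _ = A * ∫⁻ s, ∫⁻ p, ‖k p.1 s‖ₑ * ‖f (s, p.2)‖ₑ ^ 2 ∂(μ.prod ν) ∂μ := by
        rw [lintegral_lintegral_swap]
        exact hm3'.aemeasurable
    _ = A * ∫⁻ s, (∫⁻ t, ‖k t s‖ₑ ∂μ) * ∫⁻ y, ‖f (s, y)‖ₑ ^ 2 ∂ν ∂μ := by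
        congr 1
        refine lintegral_congr fun s => ?_
        refine lintegral_prod_mul (f := fun t => ‖k t s‖ₑ) (g := fun y => ‖f (s, y)‖ₑ ^ 2) ?_ ?_
        · exact (hk.comp (measurable_id.prodMk measurable_const)).enorm.aemeasurable
        · exact ((hf.comp (measurable_const.prodMk measurable_id)).enorm.pow_const 2).aemeasurable
    _ ≤ A * ∫⁻ s, A * ∫⁻ y, ‖f (s, y)‖ₑ ^ 2 ∂ν ∂μ := by
        gcongr with s
        exact hB s
    _ = A * (A * ∫⁻ s, ∫⁻ y, ‖f (s, y)‖ₑ ^ 2 ∂ν ∂μ) := by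
        rw [lintegral_const_mul]
        exact (hf.enorm.pow_const 2).lintegral_prod_right'
    _ = _ := by
        rw [lintegral_prod _ (hf.enorm.pow_const 2).aemeasurable, pow_two, mul_assoc]

lemma memLp_two_iff_lintegral {α : Type*} [MeasurableSpace α] {m : Measure α} {f : α → ℝ}
    (hf : AEStronglyMeasurable f m) : MemLp f 2 m ↔ ∫⁻ x, ‖f x‖ₑ ^ 2 ∂m < ⊤ := by
  rw [memLp_two_iff_integrable_sq hf, Integrable,
    and_iff_right (show AEStronglyMeasurable (fun x => f x ^ 2) m from hf.pow 2),
    HasFiniteIntegral]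
  simp only [enorm_pow]

lemma integral_sq_eq_toReal {α : Type*} [MeasurableSpace α] {m : Measure α} {f : α → ℝ}
    (hf : AEStronglyMeasurable f m) :
    ∫ x, f x ^ 2 ∂m = (∫⁻ x, ‖f x‖ₑ ^ 2 ∂m).toReal := by
  rw [integral_eq_lintegral_of_nonneg_ae (.of_forall fun _ => sq_nonneg _)
    (hf.pow 2)]
  congr 1
  refine lintegral_congr fun x => ?_
  rw [← Real.enorm_eq_ofReal (sq_nonneg _), enorm_pow]

/-- Schur's test: an integral operator in the first variable, whose kernel has absolute integral at
most `A` in each variable, maps `L²` to itself with norm at most `A`. -/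
lemma schur_test {k : ℝ → ℝ → ℝ} (hk : Measurable (Function.uncurry k)) {A : ℝ} (hA0 : 0 ≤ A)
    (hA : ∀ t, ∫⁻ s, ‖k t s‖ₑ ∂μ ≤ ENNReal.ofReal A)
    (hB : ∀ s, ∫⁻ t, ‖k t s‖ₑ ∂μ ≤ ENNReal.ofReal A)
    {f : ℝ × β → ℝ} (hf : MemLp f 2 (μ.prod ν)) :
    MemLp (fun p : ℝ × β => ∫ s, k p.1 s * f (s, p.2) ∂μ) 2 (μ.prod ν) ∧
    ∫ p, (∫ s, k p.1 s * f (s, p.2) ∂μ) ^ 2 ∂(μ.prod ν) ≤ A ^ 2 * ∫ p, f p ^ 2 ∂(μ.prod ν) ∧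
    ∀ᵐ p ∂(μ.prod ν), Integrable (fun s => k p.1 s * f (s, p.2)) μ := by
  have hKm := aestronglyMeasurable_kernel (μ := μ) hk hf.1
  set g := hf.1.mk f with hg
  have hgm : Measurable g := hf.1.stronglyMeasurable_mk.measurable
  have hfg : f =ᵐ[μ.prod ν] g := hf.1.ae_eq_mk
  have hfin : ∫⁻ p, ‖f p‖ₑ ^ 2 ∂(μ.prod ν) < ⊤ := (memLp_two_iff_lintegral hf.1).1 hf
  have hgf : ∫⁻ p, ‖g p‖ₑ ^ 2 ∂(μ.prod ν) = ∫⁻ p, ‖f p‖ₑ ^ 2 ∂(μ.prod ν) :=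
    lintegral_congr_ae (by filter_upwards [hfg] with p hp; rw [hp])
  have hS := schur_lintegral (ν := ν) hk hA hB hgm
  rw [hgf] at hS
  have hle : ∫⁻ p, ‖∫ s, k p.1 s * f (s, p.2) ∂μ‖ₑ ^ 2 ∂(μ.prod ν)
      ≤ ENNReal.ofReal A ^ 2 * ∫⁻ p, ‖f p‖ₑ ^ 2 ∂(μ.prod ν) := by
    refine le_trans (lintegral_mono_ae ?_) hS
    filter_upwards [kernel_congr (μ := μ) k hfg] with p hp
    rw [hp]
    gcongr
    refine (enorm_integral_le_lintegral_enorm _).trans (le_of_eq ?_)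
    simp only [enorm_mul]
  have hlt : ENNReal.ofReal A ^ 2 * ∫⁻ p, ‖f p‖ₑ ^ 2 ∂(μ.prod ν) < ⊤ :=
    ENNReal.mul_lt_top (by finiteness) hfin
  refine ⟨(memLp_two_iff_lintegral hKm).2 (hle.trans_lt hlt), ?_, ?_⟩
  · rw [integral_sq_eq_toReal hKm, integral_sq_eq_toReal hf.1]
    refine (ENNReal.toReal_mono hlt.ne hle).trans (le_of_eq ?_)
    rw [ENNReal.toReal_mul, ENNReal.toReal_pow, ENNReal.toReal_ofReal hA0]
  · have hm : Measurable fun p : ℝ × β => (∫⁻ s, ‖k p.1 s‖ₑ * ‖g (s, p.2)‖ₑ ∂μ) ^ 2 := by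
      refine Measurable.pow_const ?_ 2
      refine Measurable.lintegral_prod_right'
        (f := fun q : (ℝ × β) × ℝ => ‖k q.1.1 q.2‖ₑ * ‖g (q.2, q.1.2)‖ₑ) ?_
      exact ((hk.comp ((measurable_fst.comp measurable_fst).prodMk measurable_snd)).enorm).mul
        (hgm.comp (measurable_snd.prodMk (measurable_snd.comp measurable_fst))).enorm
    filter_upwards [ae_lt_top hm (hS.trans_lt hlt).ne, ae_prod_snd (ae_ae_swap hfg)] with p hp hq
    have hi : Integrable (fun s => k p.1 s * g (s, p.2)) μ := by
      refine ⟨((hk.comp (measurable_const.prodMk measurable_id)).mul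
        (hgm.comp (measurable_id.prodMk measurable_const))).aestronglyMeasurable, ?_⟩
      rw [HasFiniteIntegral]
      simp only [enorm_mul]
      exact (ENNReal.pow_lt_top_iff.1 hp).resolve_right two_ne_zero
    refine hi.congr ?_
    filter_upwards [hq] with s hs
    rw [hs]

end Kernel

/-! ### Primitives of integrable functions -/

/-- Integration by parts for primitives of integrable functions. -/
lemma integral_parts_of_primitive {f f' g g' : ℝ → ℝ} {a b : ℝ} (hab : a ≤ b)
    (hf' : IntervalIntegrable f' volume a b) (hg' : IntervalIntegrable g' volume a b)
    (hf : ∀ x ∈ Icc a b, f x = f a + ∫ s in a..x, f' s)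
    (hg : ∀ x ∈ Icc a b, g x = g a + ∫ s in a..x, g' s) :
    ∫ x in a..b, f x * g' x = f b * g b - f a * g a - ∫ x in a..b, f' x * g x := by
  have hac : ∀ {p p' : ℝ → ℝ}, IntervalIntegrable p' volume a b →
      AbsolutelyContinuousOnInterval (fun x => p a + ∫ s in a..x, p' s) a b := by
    intro p p' hp'
    have h1 := hp'.absolutelyContinuousOnInterval_intervalIntegral (c := a) left_mem_uIcc
    have h0 : AbsolutelyContinuousOnInterval (fun _ : ℝ => p a) a b :=
      ContDiffOn.absolutelyContinuousOnInterval contDiffOn_const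
    exact h0.fun_add h1
  have hder : ∀ {p p' : ℝ → ℝ}, IntervalIntegrable p' volume a b →
      ∀ᵐ x, x ∈ uIoc a b → deriv (fun x => p a + ∫ s in a..x, p' s) x = p' x := by
    intro p p' hp'
    filter_upwards [hp'.ae_hasDerivAt_integral] with x hx hxm
    exact ((hx (uIoc_subset_uIcc hxm) a left_mem_uIcc).const_add (p a)).deriv
  have hmem : ∀ x, x ∈ uIoc a b → x ∈ Icc a b := fun x hx => by
    rw [uIoc_of_le hab] at hx; exact Ioc_subset_Icc_self hx
  have h := AbsolutelyContinuousOnInterval.integral_mul_deriv_eq_deriv_mul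
    (hac (p := f) hf') (hac (p := g) hg')
  simp only [integral_same, add_zero] at h
  rw [← hf b (right_mem_Icc.2 hab), ← hg b (right_mem_Icc.2 hab)] at h
  have e1 : ∫ x in a..b, f x * g' x
      = ∫ x in a..b, (f a + ∫ s in a..x, f' s) * deriv (fun x => g a + ∫ s in a..x, g' s) x := by
    refine intervalIntegral.integral_congr_ae ?_
    filter_upwards [hder (p := g) hg'] with x hx hxm
    rw [hx hxm, ← hf x (hmem x hxm)]
  have e2 : ∫ x in a..b, f' x * g x
      = ∫ x in a..b, deriv (fun x => f a + ∫ s in a..x, f' s) x * (g a + ∫ s in a..x, g' s) := by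
    refine intervalIntegral.integral_congr_ae ?_
    filter_upwards [hder (p := f) hf'] with x hx hxm
    rw [hx hxm, ← hg x (hmem x hxm)]
  rw [e1, e2, h]

lemma ae_eq_zero_of_primitive_eq_zero {f : ℝ → ℝ} {a b : ℝ} (hab : a ≤ b)
    (hf : IntervalIntegrable f volume a b) (h : ∀ x ∈ Icc a b, ∫ s in a..x, f s = 0) :
    ∀ᵐ x ∂vol[Ioo a b], f x = 0 := by
  rw [ae_restrict_iff' measurableSet_Ioo]
  filter_upwards [hf.ae_hasDerivAt_integral] with x hx hxm
  have h1 := hx (by rw [uIcc_of_le hab]; exact Ioo_subset_Icc_self hxm) a left_mem_uIcc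
  have h2 : (fun x => ∫ s in a..x, f s) =ᶠ[nhds x] fun _ => 0 := by
    filter_upwards [Icc_mem_nhds hxm.1 hxm.2] with y hy using h y hy
  exact (h1.congr_of_eventuallyEq h2.symm).unique (hasDerivAt_const x 0)

/-! ### Weak derivatives tested with products -/

/-- Smooth functions of one variable with compact support in `(L, R)`. -/
def IsTest (L R : ℝ) (a : ℝ → ℝ) : Prop :=
  ContDiff ℝ ∞ a ∧ ∃ l r, L < l ∧ r < R ∧ ∀ x, x ∉ Icc l r → a x = 0

/-- Bounded pointwise limits on `(L, R)` of smooth functions with compact support in `(L, R)`. -/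
def IsTestLimit (L R : ℝ) (d : ℝ → ℝ) : Prop :=
  ∃ (dn : ℕ → ℝ → ℝ) (C : ℝ), (∀ n, IsTest L R (dn n)) ∧ (∀ n x, |dn n x| ≤ C) ∧
    ∀ x ∈ Ioo L R, Filter.Tendsto (fun n => dn n x) Filter.atTop (nhds (d x))

/-- `G` is the weak derivative of `F` in the first variable on a rectangle, tested with products
`a(x) b(y)` only. -/
def HasTensorDeriv (L R L' R' : ℝ) (F G : ℝ × ℝ → ℝ) : Prop :=
  ∀ a b, IsTest L R a → IsTest L' R' b →
    ∫ z in rect L R L' R', F z * (deriv a z.1 * b z.2)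
      = -∫ z in rect L R L' R', G z * (a z.1 * b z.2)

variable {L R L' R' : ℝ}

lemma IsTest.add {a b : ℝ → ℝ} (ha : IsTest L R a) (hb : IsTest L R b) :
    IsTest L R (fun x => a x + b x) := by
  obtain ⟨ha, l, r, hl, hr, h⟩ := ha
  obtain ⟨hb, l', r', hl', hr', h'⟩ := hb
  refine ⟨ha.add hb, min l l', max r r', lt_min hl hl', max_lt hr hr', fun x hx => ?_⟩
  have h1 : x ∉ Icc l r := fun h => hx ⟨(min_le_left _ _).trans h.1, h.2.trans (le_max_left _ _)⟩
  have h2 : x ∉ Icc l' r' := fun h =>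
    hx ⟨(min_le_right _ _).trans h.1, h.2.trans (le_max_right _ _)⟩
  simp only [h x h1, h' x h2, add_zero]

lemma IsTest.const_mul {a : ℝ → ℝ} (c : ℝ) (ha : IsTest L R a) :
    IsTest L R (fun x => c * a x) := by
  obtain ⟨ha, l, r, hl, hr, h⟩ := ha
  exact ⟨contDiff_const.mul ha, l, r, hl, hr, fun x hx => by simp only [h x hx, mul_zero]⟩

lemma IsTest.deriv {a : ℝ → ℝ} (ha : IsTest L R a) : IsTest L R (deriv a) := by
  obtain ⟨ha, l, r, hl, hr, h⟩ := ha
  refine ⟨(contDiff_infty_iff_deriv.1 ha).2, l, r, hl, hr, fun x hx => ?_⟩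
  have : a =ᶠ[nhds x] fun _ => 0 := by
    filter_upwards [isClosed_Icc.isOpen_compl.mem_nhds hx] with y hy using h y hy
  rw [this.deriv_eq, deriv_const]

lemma IsTest.mono {l r : ℝ} {a : ℝ → ℝ} (ha : IsTest l r a) (hl : L ≤ l) (hr : r ≤ R) :
    IsTest L R a := by
  obtain ⟨ha, p, q, hp, hq, h⟩ := ha
  exact ⟨ha, p, q, hl.trans_lt hp, hq.trans_le hr, h⟩

lemma IsTestLimit.add {d e : ℝ → ℝ} (hd : IsTestLimit L R d) (he : IsTestLimit L R e) :
    IsTestLimit L R (fun x => d x + e x) := by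
  obtain ⟨dn, C, h1, h2, h3⟩ := hd
  obtain ⟨en, C', h1', h2', h3'⟩ := he
  refine ⟨fun n x => dn n x + en n x, C + C', fun n => (h1 n).add (h1' n), fun n x => ?_,
    fun x hx => (h3 x hx).add (h3' x hx)⟩
  exact (abs_add_le _ _).trans (add_le_add (h2 n x) (h2' n x))

lemma IsTestLimit.zero : IsTestLimit L R (fun _ => 0) :=
  ⟨fun _ _ => 0, 0, fun _ => ⟨contDiff_const, L + 1, R - 1, by linarith, by linarith,
    fun _ _ => rfl⟩, fun _ _ => by simp, fun _ _ => tendsto_const_nhds⟩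

lemma IsTestLimit.sum {ι : Type*} (s : Finset ι) {d : ι → ℝ → ℝ}
    (h : ∀ i ∈ s, IsTestLimit L R (d i)) : IsTestLimit L R (fun x => ∑ i ∈ s, d i x) := by
  classical
  induction s using Finset.induction_on with
  | empty => simpa using IsTestLimit.zero
  | insert i s hi ih =>
    simp only [Finset.sum_insert hi]
    exact (h i (Finset.mem_insert_self i s)).add
      (ih fun j hj => h j (Finset.mem_insert_of_mem hj))

/-- Smooth cutoff functions increasing to the indicator function of `(l, r)`. -/
def cutoff (l r : ℝ) (n : ℕ) (x : ℝ) : ℝ :=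
  Real.smoothTransition ((n + 1) * (x - l) - 1) * Real.smoothTransition ((n + 1) * (r - x) - 1)

lemma isTest_cutoff_mul {l r : ℝ} (hl : L ≤ l) (hr : r ≤ R) {f : ℝ → ℝ}
    (hf : ContDiff ℝ ∞ f) (n : ℕ) :
    IsTest L R (fun x => cutoff l r n x * f x) := by
  have hn : (0 : ℝ) < n + 1 := by positivity
  refine ⟨?_, l + 1 / (n + 1), r - 1 / (n + 1), ?_, ?_, fun x hx => ?_⟩
  · refine ContDiff.mul ?_ hf
    unfold cutoff
    refine ContDiff.mul ?_ ?_
    · exact Real.smoothTransition.contDiff.comp (by fun_prop)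
    · exact Real.smoothTransition.contDiff.comp (by fun_prop)
  · have : 0 < 1 / ((n : ℝ) + 1) := by positivity
    linarith
  · have : 0 < 1 / ((n : ℝ) + 1) := by positivity
    linarith
  · simp only [mem_Icc, not_and_or, not_le] at hx
    have key : ∀ t : ℝ, t < 1 / (n + 1) → (n + 1) * t - 1 ≤ 0 := by
      intro t ht
      rw [lt_div_iff₀ hn] at ht
      linarith
    rcases hx with hx | hx
    · simp only [cutoff]
      rw [Real.smoothTransition.zero_of_nonpos (key (x - l) (by linarith))]; simp
    · simp only [cutoff]
      rw [Real.smoothTransition.zero_of_nonpos (x := (n + 1) * (r - x) - 1)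
        (key (r - x) (by linarith))]
      simp

lemma isTestLimit_indicator {l r : ℝ} (hl : L ≤ l) (hr : r ≤ R) {f : ℝ → ℝ} (hf : ContDiff ℝ ∞ f) :
    IsTestLimit L R ((Ioo l r).indicator f) := by
  obtain ⟨C, hC⟩ := (isCompact_Icc (a := l) (b := r)).exists_bound_of_continuousOn
    hf.continuous.continuousOn
  have hout : ∀ (n : ℕ) (x : ℝ), x ∉ Ioo l r → cutoff l r n x = 0 := by
    intro n x hx
    have hn : (0 : ℝ) < n + 1 := by positivity
    simp only [mem_Ioo, not_and_or, not_lt] at hx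
    rcases hx with hx | hx
    · rw [cutoff, Real.smoothTransition.zero_of_nonpos (by nlinarith)]; simp
    · rw [cutoff, Real.smoothTransition.zero_of_nonpos (x := (n + 1) * (r - x) - 1)
        (by nlinarith)]; simp
  refine ⟨fun n x => cutoff l r n x * f x, max C 0, fun n => isTest_cutoff_mul hl hr hf n,
    fun n x => ?_, fun x _ => ?_⟩
  · by_cases hx : x ∈ Ioo l r
    · rw [abs_mul]
      have h1 : |cutoff l r n x| ≤ 1 := by
        rw [cutoff, abs_of_nonneg (mul_nonneg (Real.smoothTransition.nonneg _)
          (Real.smoothTransition.nonneg _))]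
        exact mul_le_one₀ (Real.smoothTransition.le_one _) (Real.smoothTransition.nonneg _)
          (Real.smoothTransition.le_one _)
      calc |cutoff l r n x| * |f x| ≤ 1 * C := by
            gcongr; exact hC x (Ioo_subset_Icc_self hx)
        _ ≤ _ := by rw [one_mul]; exact le_max_left _ _
    · simp only [hout n x hx, zero_mul, abs_zero]; exact le_max_right _ _
  · by_cases hx : x ∈ Ioo l r
    · rw [indicator_of_mem hx]
      refine tendsto_const_nhds.congr' ?_
      have h1 : Filter.Tendsto (fun n : ℕ => ((n : ℝ) + 1) * (x - l)) Filter.atTop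
          Filter.atTop :=
        (Filter.tendsto_atTop_add_const_right _ 1 tendsto_natCast_atTop_atTop).atTop_mul_const
          (sub_pos.2 hx.1)
      have h2 : Filter.Tendsto (fun n : ℕ => ((n : ℝ) + 1) * (r - x)) Filter.atTop
          Filter.atTop :=
        (Filter.tendsto_atTop_add_const_right _ 1 tendsto_natCast_atTop_atTop).atTop_mul_const
          (sub_pos.2 hx.2)
      filter_upwards [h1.eventually_ge_atTop 2, h2.eventually_ge_atTop 2] with n hn1 hn2
      rw [cutoff, Real.smoothTransition.one_of_one_le (by linarith),
        Real.smoothTransition.one_of_one_le (by linarith)]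
      simp
    · rw [indicator_of_notMem hx]
      simp only [hout _ x hx, zero_mul]
      exact tendsto_const_nhds

lemma exists_isTest_integral_eq_one (hLR : L < R) :
    ∃ χ : ℝ → ℝ, IsTest L R χ ∧ ∫ x in L..R, χ x = 1 := by
  have hp : 0 < R - L := sub_pos.2 hLR
  set b : ContDiffBump ((L + R) / 2) := ⟨(R - L) / 8, (R - L) / 4, by positivity, by linarith⟩
    with hb
  have hz : ∀ x, x ∉ Icc (L + (R - L) / 4) (R - (R - L) / 4) → b.normed volume x = 0 := by
    intro x hx
    have h1 : x ∉ Function.support (b.normed volume) := by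
      rw [b.support_normed_eq, Real.ball_eq_Ioo]
      intro h
      refine hx ⟨?_, ?_⟩
      · have := h.1; simp only [hb] at this; linarith
      · have := h.2; simp only [hb] at this; linarith
    simpa using h1
  refine ⟨b.normed volume, ⟨b.contDiff_normed, _, _, by linarith, by linarith, hz⟩, ?_⟩
  rw [integral_of_le hLR.le, setIntegral_eq_integral_of_forall_compl_eq_zero]
  · exact b.integral_normed
  · intro x hx
    refine hz x fun h => hx ⟨by linarith [h.1], by linarith [h.2]⟩

lemma IsTest.exists_bound {a : ℝ → ℝ} (ha : IsTest L R a) : ∃ C, 0 ≤ C ∧ ∀ x, |a x| ≤ C := by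
  obtain ⟨hc, l, r, hl, hr, h⟩ := ha
  obtain ⟨C, hC⟩ := (isCompact_Icc (a := l) (b := r)).exists_bound_of_continuousOn
    hc.continuous.continuousOn
  refine ⟨max C 0, le_max_right _ _, fun x => ?_⟩
  by_cases hx : x ∈ Icc l r
  · exact (hC x hx).trans (le_max_left _ _)
  · rw [h x hx, abs_zero]; exact le_max_right _ _

/-- The primitive of a test function with vanishing integral is a test function. -/
lemma IsTest.primitive_and_deriv {e : ℝ → ℝ} (hLR : L < R) (he : IsTest L R e)
    (h0 : ∫ x in L..R, e x = 0) :
    IsTest L R (fun x => ∫ s in L..x, e s) ∧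
      _root_.deriv (fun x => ∫ s in L..x, e s) = e := by
  obtain ⟨hc, l, r, hl, hr, h⟩ := he
  have hd : ∀ x, HasDerivAt (fun x => ∫ s in L..x, e s) (e x) x := fun x =>
    intervalIntegral.integral_hasDerivAt_right (hc.continuous.intervalIntegrable _ _)
      hc.continuous.stronglyMeasurable.stronglyMeasurableAtFilter hc.continuous.continuousAt
  have hde : _root_.deriv (fun x => ∫ s in L..x, e s) = e := funext fun x => (hd x).deriv
  refine ⟨⟨contDiff_infty_iff_deriv.2 ⟨fun x => (hd x).differentiableAt, by rw [hde]; exact hc⟩,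
    min l R, max r L, lt_min hl hLR, max_lt hr hLR, fun x hx => ?_⟩, hde⟩
  simp only [mem_Icc, not_and_or, not_le] at hx
  rcases hx with hx | hx
  · refine intervalIntegral.integral_zero_ae (.of_forall fun s hs => ?_)
    refine h s fun hs' => ?_
    rcases mem_uIoc.1 hs with hs | hs
    · exact absurd (hs'.1.trans hs.2) (not_le.2 (hx.trans_le (min_le_left _ _)))
    · linarith [hs'.1, hs.2]
  · have h2 : ∫ s in x..R, e s = 0 := by
      refine intervalIntegral.integral_zero_ae (.of_forall fun s hs => ?_)
      refine h s fun hs' => ?_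
      rcases mem_uIoc.1 hs with hs | hs
      · exact absurd (hs.1.le.trans hs'.2) (not_le.2 ((le_max_left _ _).trans_lt hx))
      · linarith [hs'.2, hs.1]
    have h3 := integral_add_adjacent_intervals
      (hc.continuous.intervalIntegrable (μ := volume) L x)
      (hc.continuous.intervalIntegrable (μ := volume) x R)
    rw [h2, h0, add_zero] at h3
    exact h3

/-- The weak derivative on a rectangle may be tested with products of bounded functions: `d` with
vanishing integral in the first variable in place of the derivative, and `b` in the second. -/
lemma HasTensorDeriv.extend {F G : ℝ × ℝ → ℝ} (h : HasTensorDeriv L R L' R' F G) (hLR : L < R)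
    (hF : IntegrableOn F (rect L R L' R')) (hG : IntegrableOn G (rect L R L' R'))
    {d b : ℝ → ℝ} (hd : IsTestLimit L R d) (hd0 : ∫ x in L..R, d x = 0)
    (hb : IsTestLimit L' R' b) :
    ∫ z in rect L R L' R', F z * (d z.1 * b z.2)
      = -∫ z in rect L R L' R', G z * ((∫ s in L..z.1, d s) * b z.2) := by
  obtain ⟨dn, C, hd1, hd2, hd3⟩ := hd
  obtain ⟨bn, B, hb1, hb2, hb3⟩ := hb
  obtain ⟨χ, hχ, hχ1⟩ := exists_isTest_integral_eq_one hLR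
  obtain ⟨Cχ, hCχ0, hCχ⟩ := hχ.exists_bound
  have hC0 : 0 ≤ C := (abs_nonneg _).trans (hd2 0 0)
  have hB0 : 0 ≤ B := (abs_nonneg _).trans (hb2 0 0)
  have hint : ∀ x ∈ Icc L R, Filter.Tendsto (fun n => ∫ s in L..x, dn n s) Filter.atTop
      (nhds (∫ s in L..x, d s)) := by
    intro x hx
    refine intervalIntegral.tendsto_integral_filter_of_dominated_convergence (fun _ => C)
      (.of_forall fun n => (hd1 n).1.continuous.aestronglyMeasurable)
      (.of_forall fun n => .of_forall fun s _ => hd2 n s)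
      (by simp) ?_
    have hne : ∀ᵐ s : ℝ, s ≠ R := by simp [ae_iff, measure_singleton]
    filter_upwards [hne] with s hs hsm
    rw [uIoc_of_le hx.1] at hsm
    exact hd3 s ⟨hsm.1, lt_of_le_of_ne (hsm.2.trans hx.2) hs⟩
  set m : ℕ → ℝ := fun n => ∫ s in L..R, dn n s with hm
  have hm0 : Filter.Tendsto m Filter.atTop (nhds 0) := by
    simpa [hd0] using hint R (right_mem_Icc.2 hLR.le)
  have hmb : ∀ n, |m n| ≤ C * (R - L) := by
    intro n
    have := intervalIntegral.norm_integral_le_of_norm_le_const (a := L) (b := R) (f := dn n)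
      (C := C) fun x _ => hd2 n x
    rwa [abs_of_pos (sub_pos.2 hLR)] at this
  set e : ℕ → ℝ → ℝ := fun n x => dn n x + -m n * χ x with he
  have heT : ∀ n, IsTest L R (e n) := fun n => (hd1 n).add (hχ.const_mul _)
  have hesplit : ∀ n x, ∫ s in L..x, e n s = (∫ s in L..x, dn n s) + -m n * ∫ s in L..x, χ s := by
    intro n x
    simp only [he]
    rw [intervalIntegral.integral_add ((hd1 n).1.continuous.intervalIntegrable _ _)
      ((hχ.const_mul _).1.continuous.intervalIntegrable _ _), intervalIntegral.integral_const_mul]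
  have he0 : ∀ n, ∫ s in L..R, e n s = 0 := by
    intro n; rw [hesplit, hχ1]; simp [hm]
  have heb : ∀ n x, |e n x| ≤ C + C * (R - L) * Cχ := by
    intro n x
    refine (abs_add_le _ _).trans (add_le_add (hd2 n x) ?_)
    rw [abs_mul, abs_neg]
    exact mul_le_mul (hmb n) (hCχ x) (abs_nonneg _) (mul_nonneg hC0 (sub_pos.2 hLR).le)
  set E := C + C * (R - L) * Cχ with hE
  have hE0 : 0 ≤ E := (abs_nonneg _).trans (heb 0 0)
  have hcont : ∀ n, Continuous fun x => ∫ s in L..x, e n s := fun n =>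
    ((heT n).primitive_and_deriv hLR (he0 n)).1.1.continuous
  have hAb : ∀ n, ∀ x ∈ Ioo L R, |∫ s in L..x, e n s| ≤ E * (R - L) := by
    intro n x hx
    have := intervalIntegral.norm_integral_le_of_norm_le_const (a := L) (b := x) (f := e n)
      (C := E) fun x _ => heb n x
    rw [abs_of_pos (sub_pos.2 hx.1)] at this
    exact this.trans (mul_le_mul_of_nonneg_left (by linarith [hx.2]) hE0)
  have hmeas : MeasurableSet (rect L R L' R') := measurableSet_Ioo.prod measurableSet_Ioo
  have hl1 : Filter.Tendsto (fun n => ∫ z in rect L R L' R', F z * (e n z.1 * bn n z.2))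
      Filter.atTop (nhds (∫ z in rect L R L' R', F z * (d z.1 * b z.2))) := by
    refine tendsto_integral_of_dominated_convergence (fun z => |F z| * (E * B)) (fun n => ?_)
      (hF.abs.mul_const _) (fun n => ?_) ?_
    · refine hF.1.mul (Continuous.aestronglyMeasurable ?_)
      exact ((heT n).1.continuous.comp continuous_fst).mul
        ((hb1 n).1.continuous.comp continuous_snd)
    · refine .of_forall fun z => ?_
      rw [norm_mul, norm_mul]
      gcongr
      · exact le_rfl
      · exact heb n z.1
      · exact hb2 n z.2
    · refine ae_restrict_of_forall_mem hmeas fun z hz => ?_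
      refine Filter.Tendsto.const_mul _ (Filter.Tendsto.mul ?_ (hb3 _ hz.2))
      simpa [he] using (hd3 _ hz.1).add ((hm0.neg).mul_const (χ z.1))
  have hl2 : Filter.Tendsto
      (fun n => ∫ z in rect L R L' R', G z * ((∫ s in L..z.1, e n s) * bn n z.2))
      Filter.atTop (nhds (∫ z in rect L R L' R', G z * ((∫ s in L..z.1, d s) * b z.2))) := by
    refine tendsto_integral_of_dominated_convergence (fun z => |G z| * ((E * (R - L)) * B))
      (fun n => ?_) (hG.abs.mul_const _) (fun n => ?_) ?_
    · refine hG.1.mul (Continuous.aestronglyMeasurable ?_)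
      exact ((hcont n).comp continuous_fst).mul ((hb1 n).1.continuous.comp continuous_snd)
    · refine ae_restrict_of_forall_mem hmeas fun z hz => ?_
      rw [norm_mul, norm_mul]
      gcongr
      · exact le_rfl
      · exact hAb n z.1 hz.1
      · exact hb2 n z.2
    · refine ae_restrict_of_forall_mem hmeas fun z hz => ?_
      refine Filter.Tendsto.const_mul _ (Filter.Tendsto.mul ?_ (hb3 _ hz.2))
      simp only [hesplit]
      simpa using (hint _ (Ioo_subset_Icc_self hz.1)).add
        ((hm0.neg).mul_const (∫ s in L..z.1, χ s))
  refine tendsto_nhds_unique hl1 (hl2.neg.congr fun n => ?_)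
  obtain ⟨hp1, hp2⟩ := (heT n).primitive_and_deriv hLR (he0 n)
  have := h _ _ hp1 (hb1 n)
  rw [hp2] at this
  rw [this]

/-! ### Absolute continuity on lines and Taylor expansion in one variable -/

section Prim

variable {β : Type*} [MeasurableSpace β] {ν : Measure β} {L R L' R' : ℝ}

lemma integral_step_mul (f : ℝ → ℝ) {t : ℝ} (ht : t ∈ Icc L R) :
    ∫ s in Ioo L R, (if s < t then 1 else 0) * f s = ∫ s in L..t, f s := by
  have h1 : ∀ s, (if s < t then (1 : ℝ) else 0) * f s = (Iio t).indicator f s := by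
    intro s; by_cases h : s < t <;> simp [indicator, h]
  simp only [h1]
  rw [setIntegral_indicator measurableSet_Iio, integral_of_le ht.1,
    integral_Ioc_eq_integral_Ioo]
  congr 2
  ext s
  simp only [mem_inter_iff, mem_Ioo, mem_Iio]
  exact ⟨fun h => ⟨h.1.1, h.2⟩, fun h => ⟨⟨h.1, h.2.trans_le ht.2⟩, h.2⟩⟩

lemma measurable_step : Measurable (Function.uncurry fun t s : ℝ => if s < t then (1 : ℝ) else 0) :=
  Measurable.ite (measurableSet_lt measurable_snd measurable_fst) measurable_const measurable_const

lemma lintegral_step_le {p : ℝ → Prop} [DecidablePred p] :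
    ∫⁻ s in Ioo L R, ‖(if p s then (1 : ℝ) else 0)‖ₑ ≤ ENNReal.ofReal (R - L) := by
  calc _ ≤ ∫⁻ s in Ioo L R, 1 := lintegral_mono fun s => by split_ifs <;> simp
    _ = _ := by simp

lemma kernel_step_ae [SFinite ν] (f : ℝ × β → ℝ) :
    (fun p : ℝ × β => ∫ s in Ioo L R, (if s < p.1 then 1 else 0) * f (s, p.2))
      =ᵐ[vol[Ioo L R].prod ν] fun p => ∫ s in L..p.1, f (s, p.2) := by
  have h : ∀ᵐ p ∂(vol[Ioo L R].prod ν), p.1 ∈ Ioo L R :=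
    Measure.quasiMeasurePreserving_fst.ae (ae_restrict_mem measurableSet_Ioo)
  filter_upwards [h] with p hp
  exact integral_step_mul (fun s => f (s, p.2)) (Ioo_subset_Icc_self hp)

/-- The primitive in the first variable of a square integrable function. -/
lemma memLp_primitive [SFinite ν] (hLR : L ≤ R) {f : ℝ × β → ℝ}
    (hf : MemLp f 2 (vol[Ioo L R].prod ν)) :
    MemLp (fun p : ℝ × β => ∫ s in L..p.1, f (s, p.2)) 2 (vol[Ioo L R].prod ν) ∧
    ∫ p, (∫ s in L..p.1, f (s, p.2)) ^ 2 ∂(vol[Ioo L R].prod ν)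
      ≤ (R - L) ^ 2 * ∫ p, f p ^ 2 ∂(vol[Ioo L R].prod ν) := by
  obtain ⟨h1, h2, -⟩ := schur_test (μ := vol[Ioo L R]) measurable_step
    (sub_nonneg.2 hLR) (fun t => lintegral_step_le) (fun s => lintegral_step_le) hf
  refine ⟨(memLp_congr_ae (kernel_step_ae f)).1 h1, le_of_eq_of_le (integral_congr_ae ?_) h2⟩
  filter_upwards [kernel_step_ae (L := L) (R := R) (ν := ν) f] with p hp
  rw [hp]

lemma ae_integrable_slice [IsFiniteMeasure ν] {f : ℝ × β → ℝ}
    (hf : MemLp f 2 (vol[Ioo L R].prod ν)) :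
    ∀ᵐ y ∂ν, IntegrableOn (fun s => f (s, y)) (Ioo L R) :=
  (hf.integrable one_le_two).prod_left_ae

lemma intervalIntegrable_of_Ioo {f : ℝ → ℝ} (hLR : L ≤ R) (hf : IntegrableOn f (Ioo L R)) :
    IntervalIntegrable f volume L R := by
  rw [intervalIntegrable_iff_integrableOn_Ioc_of_le hLR, integrableOn_Ioc_iff_integrableOn_Ioo]
  exact hf

lemma ae_eq_zero_of_ae_ae [SFinite ν] {μ : Measure ℝ} [SFinite μ] {f : ℝ × β → ℝ}
    (hf : AEStronglyMeasurable f (μ.prod ν)) (h : ∀ᵐ y ∂ν, ∀ᵐ s ∂μ, f (s, y) = 0) :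
    ∀ᵐ p ∂(μ.prod ν), f p = 0 := by
  have h1 : ∫⁻ p, ‖f p‖ₑ ∂(μ.prod ν) = 0 := by
    rw [lintegral_prod_symm _ hf.enorm]
    rw [lintegral_congr_ae (g := fun _ => 0), lintegral_zero]
    filter_upwards [h] with y hy
    rw [lintegral_congr_ae (g := fun _ => 0), lintegral_zero]
    filter_upwards [hy] with s hs
    simp [hs]
  rw [lintegral_eq_zero_iff' hf.enorm] at h1
  filter_upwards [h1] with p hp
  simpa using hp

lemma memLp_of_comp_snd [SFinite ν] {μ : Measure ℝ} [SFinite μ] [NeZero μ] {c : β → ℝ}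
    (hc : MemLp (fun p : ℝ × β => c p.2) 2 (μ.prod ν)) : MemLp c 2 ν := by
  obtain ⟨x, hx⟩ := (hc.1.prodMk_left).exists
  have h2 := hc.integrable_sq.prod_right_ae
  obtain ⟨x', hx'⟩ := h2.exists
  exact (memLp_two_iff_integrable_sq hx).2 hx'

lemma restrict_rect : (volume : Measure (ℝ × ℝ)).restrict (rect L R L' R')
    = vol[Ioo L R].prod vol[Ioo L' R'] := by
  rw [rect, Measure.volume_eq_prod, Measure.prod_restrict]

/-- A function on a rectangle vanishes almost everywhere if its integrals over all rectangles with
a common corner do. -/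
lemma ae_eq_zero_of_rect (hLR : L < R) (hLR' : L' < R') {Z : ℝ × ℝ → ℝ}
    (hZ : IntegrableOn Z (rect L R L' R'))
    (h : ∀ r ∈ Ioo L R, ∀ r' ∈ Icc L' R', ∫ y in L'..r', ∫ x in L..r, Z (x, y) = 0) :
    ∀ᵐ z ∂vol[rect L R L' R'], Z z = 0 := by
  rw [IntegrableOn, restrict_rect] at hZ
  rw [restrict_rect]
  have hslice : ∀ᵐ y ∂vol[Ioo L' R'], IntegrableOn (fun s => Z (s, y)) (Ioo L R) :=
    hZ.prod_left_ae
  have hr : ∀ r ∈ Ioo L R, ∀ᵐ y ∂vol[Ioo L' R'], ∫ x in L..r, Z (x, y) = 0 := by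
    intro r hr
    refine ae_eq_zero_of_primitive_eq_zero hLR'.le (intervalIntegrable_of_Ioo hLR'.le ?_) (h r hr)
    have h1 : Integrable Z (vol[Ioo L r].prod vol[Ioo L' R']) := by
      refine hZ.mono_measure ?_
      rw [Measure.prod_restrict, Measure.prod_restrict]
      exact Measure.restrict_mono (prod_mono (Ioo_subset_Ioo_right hr.2.le) le_rfl) le_rfl
    have h2 := h1.integral_prod_right
    refine h2.congr (.of_forall fun y => ?_)
    simp only [integral_of_le hr.1.le, integral_Ioc_eq_integral_Ioo]
  have hq : ∀ᵐ y ∂vol[Ioo L' R'], ∀ q : ℚ, (q : ℝ) ∈ Ioo L R →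
      ∫ x in L..(q : ℝ), Z (x, y) = 0 := by
    rw [ae_all_iff]
    intro q
    by_cases hq : (q : ℝ) ∈ Ioo L R
    · filter_upwards [hr q hq] with y hy _ using hy
    · exact .of_forall fun y h => absurd h hq
  refine ae_eq_zero_of_ae_ae hZ.1 ?_
  filter_upwards [hslice, hq] with y hy1 hy2
  have hii := intervalIntegrable_of_Ioo hLR.le hy1
  refine ae_eq_zero_of_primitive_eq_zero hLR.le hii ?_
  have hcont : ContinuousOn (fun x => ∫ s in L..x, Z (s, y)) (Icc L R) := by
    have := continuousOn_primitive_interval' hii left_mem_uIcc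
    rwa [uIcc_of_le hLR.le] at this
  have hdense : Icc L R ⊆ closure (Ioo L R ∩ range ((↑) : ℚ → ℝ)) := by
    rw [← closure_Ioo hLR.ne]
    exact closure_minimal (Rat.denseRange_cast.open_subset_closure_inter isOpen_Ioo)
      isClosed_closure
  intro x hx
  have hsub : Ioo L R ∩ range ((↑) : ℚ → ℝ) ⊆ Icc L R :=
    inter_subset_left.trans Ioo_subset_Icc_self
  have hz : ∀ t ∈ Ioo L R ∩ range ((↑) : ℚ → ℝ), (fun x => ∫ s in L..x, Z (s, y)) t = 0 := by
    rintro t ⟨ht, q, rfl⟩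
    exact hy2 q ht
  have hcw : ContinuousWithinAt (fun x => ∫ s in L..x, Z (s, y))
      (Ioo L R ∩ range ((↑) : ℚ → ℝ)) x := (hcont x hx).mono hsub
  have hne : (nhdsWithin x (Ioo L R ∩ range ((↑) : ℚ → ℝ))).NeBot :=
    mem_closure_iff_nhdsWithin_neBot.1 (hdense hx)
  refine tendsto_nhds_unique hcw ((tendsto_const_nhds (x := (0 : ℝ))).congr' ?_)
  filter_upwards [self_mem_nhdsWithin] with t ht
  exact (hz t ht).symm

/-! ### Uniqueness for product test functions -/

lemma measurableSet_rect (L R L' R' : ℝ) : MeasurableSet (rect L R L' R') :=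
  measurableSet_Ioo.prod measurableSet_Ioo

lemma integral_testLimit_fst {H : ℝ × ℝ → ℝ} (hH : IntegrableOn H (rect L R L' R'))
    (h : ∀ a, IsTest L R a → ∫ z in rect L R L' R', H z * a z.1 = 0) {d : ℝ → ℝ}
    (hd : IsTestLimit L R d) : ∫ z in rect L R L' R', H z * d z.1 = 0 := by
  obtain ⟨dn, C, h1, h2, h3⟩ := hd
  have hlim : Filter.Tendsto (fun n => ∫ z in rect L R L' R', H z * dn n z.1) Filter.atTop
      (nhds (∫ z in rect L R L' R', H z * d z.1)) := by
    refine tendsto_integral_of_dominated_convergence (fun z => ‖H z‖ * C) (fun n => ?_)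
      (hH.norm.mul_const _) (fun n => ?_) ?_
    · exact hH.1.mul ((h1 n).1.continuous.comp continuous_fst).aestronglyMeasurable
    · refine .of_forall fun z => ?_
      rw [norm_mul]
      exact mul_le_mul_of_nonneg_left (h2 n z.1) (norm_nonneg _)
    · exact ae_restrict_of_forall_mem (measurableSet_rect _ _ _ _) fun z hz =>
        (h3 _ hz.1).const_mul _
  simp only [h _ (h1 _)] at hlim
  exact (tendsto_nhds_unique hlim tendsto_const_nhds)

lemma IntegrableOn.rect_swap {H : ℝ × ℝ → ℝ} (hH : IntegrableOn H (rect L R L' R')) :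
    IntegrableOn (fun z => H z.swap) (rect L' R' L R) := by
  rw [IntegrableOn, restrict_rect] at hH ⊢
  exact hH.swap

lemma integral_testLimit_snd {H : ℝ × ℝ → ℝ} (hH : IntegrableOn H (rect L R L' R'))
    (h : ∀ b, IsTest L' R' b → ∫ z in rect L R L' R', H z * b z.2 = 0) {d : ℝ → ℝ}
    (hd : IsTestLimit L' R' d) : ∫ z in rect L R L' R', H z * d z.2 = 0 := by
  rw [integral_rect_swap]
  refine integral_testLimit_fst (IntegrableOn.rect_swap hH) (fun b hb => ?_) hd
  have := h b hb
  rwa [integral_rect_swap] at this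

lemma IsTest.integrable_mul_fst {a : ℝ → ℝ} (ha : IsTest L R a) {l r l' r' : ℝ} {H : ℝ × ℝ → ℝ}
    (hH : IntegrableOn H (rect l r l' r')) :
    IntegrableOn (fun z => H z * a z.1) (rect l r l' r') := by
  obtain ⟨C, -, hC⟩ := ha.exists_bound
  exact Integrable.mul_bdd (c := C) hH
    (ha.1.continuous.comp continuous_fst).aestronglyMeasurable
    (.of_forall fun z => hC z.1)

lemma IsTest.integrable_mul_snd {b : ℝ → ℝ} (hb : IsTest L' R' b) {l r l' r' : ℝ}
    {H : ℝ × ℝ → ℝ} (hH : IntegrableOn H (rect l r l' r')) :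
    IntegrableOn (fun z => H z * b z.2) (rect l r l' r') := by
  obtain ⟨C, -, hC⟩ := hb.exists_bound
  exact Integrable.mul_bdd (c := C) hH
    (hb.1.continuous.comp continuous_snd).aestronglyMeasurable
    (.of_forall fun z => hC z.2)

/-- An integrable function on a rectangle is determined by its integrals against products of test
functions. -/
lemma ae_eq_zero_of_tensor (hLR : L < R) (hLR' : L' < R') {Z : ℝ × ℝ → ℝ}
    (hZ : IntegrableOn Z (rect L R L' R'))
    (h : ∀ a b, IsTest L R a → IsTest L' R' b →
      ∫ z in rect L R L' R', Z z * (a z.1 * b z.2) = 0) :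
    ∀ᵐ z ∂vol[rect L R L' R'], Z z = 0 := by
  refine ae_eq_zero_of_rect hLR hLR' hZ fun r hr r' hr' => ?_
  set d : ℝ → ℝ := (Ioo L r).indicator fun _ => 1 with hd
  set b : ℝ → ℝ := (Ioo L' r').indicator fun _ => 1 with hb
  have hdl : IsTestLimit L R d := isTestLimit_indicator le_rfl hr.2.le contDiff_const
  have hbl : IsTestLimit L' R' b := isTestLimit_indicator le_rfl hr'.2 contDiff_const
  have hZd : IntegrableOn (fun z => Z z * d z.1) (rect L R L' R') := by
    refine Integrable.mul_bdd (c := 1) hZ ?_ (.of_forall fun z => ?_)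
    · exact ((measurable_const.indicator measurableSet_Ioo).comp
        measurable_fst).aestronglyMeasurable
    · simp only [hd, indicator]; split_ifs <;> simp
  have h1 : ∀ b, IsTest L' R' b → ∫ z in rect L R L' R', Z z * d z.1 * b z.2 = 0 := by
    intro b hb
    have := integral_testLimit_fst (hb.integrable_mul_snd hZ) (fun a ha => by
      rw [← h a b ha hb]; congr 1; funext z; ring) hdl
    rw [← this]; congr 1; funext z; ring
  have h2 := integral_testLimit_snd hZd h1 hbl
  have h3 : ∀ z, Z z * d z.1 * b z.2 = (rect L r L' r').indicator Z z := by
    intro z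
    by_cases hz1 : z.1 ∈ Ioo L r <;> by_cases hz2 : z.2 ∈ Ioo L' r'
    · rw [hd, hb, indicator_of_mem hz1, indicator_of_mem hz2,
        indicator_of_mem (show z ∈ rect L r L' r' from ⟨hz1, hz2⟩)]; ring
    · rw [hb, indicator_of_notMem hz2,
        indicator_of_notMem (show z ∉ rect L r L' r' from fun h => hz2 h.2)]; ring
    · rw [hd, indicator_of_notMem hz1,
        indicator_of_notMem (show z ∉ rect L r L' r' from fun h => hz1 h.1)]; ring
    · rw [hd, indicator_of_notMem hz1,
        indicator_of_notMem (show z ∉ rect L r L' r' from fun h => hz1 h.1)]; ring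
  have hsub : rect L r L' r' ⊆ rect L R L' R' :=
    prod_mono (Ioo_subset_Ioo_right hr.2.le) (Ioo_subset_Ioo_right hr'.2)
  simp only [h3] at h2
  rw [setIntegral_indicator (measurableSet_rect _ _ _ _), inter_eq_right.2 hsub,
    integral_rect_of_integrable hr.1.le hr'.1 (hZ.mono_set hsub)] at h2
  exact h2

lemma IsTest.integrableOn_mul {a f : ℝ → ℝ} (ha : IsTest L R a) (hf : IntegrableOn f (Ioo L R)) :
    IntegrableOn (fun x => f x * a x) (Ioo L R) := by
  obtain ⟨C, -, hC⟩ := ha.exists_bound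
  exact Integrable.mul_bdd (c := C) hf ha.1.continuous.aestronglyMeasurable (ae_of_all _ hC)

/-- A function with a weak derivative in the first variable is, up to a null set, a primitive of
that derivative on almost every line. -/
lemma HasTensorDeriv.exists_eq_primitive {F G : ℝ × ℝ → ℝ} (h : HasTensorDeriv L R L' R' F G)
    (hLR : L < R) (hLR' : L' < R') (hF : MemLp F 2 vol[rect L R L' R'])
    (hG : MemLp G 2 vol[rect L R L' R']) :
    ∃ c : ℝ → ℝ, MemLp c 2 vol[Ioo L' R'] ∧
      ∀ᵐ z ∂vol[rect L R L' R'], F z = c z.2 + ∫ s in L..z.1, G (s, z.2) := by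
  have hp : 0 < R - L := sub_pos.2 hLR
  have : NeZero vol[Ioo L R] := ⟨by
    rw [Ne, Measure.restrict_eq_zero, Real.volume_Ioo]
    simpa using hp⟩
  obtain ⟨χ, hχ, hχ1⟩ := exists_isTest_integral_eq_one hLR
  rw [integral_of_le hLR.le, integral_Ioc_eq_integral_Ioo] at hχ1
  simp only [restrict_rect] at hF hG ⊢
  set H : ℝ × ℝ → ℝ := fun z => F z - ∫ s in L..z.1, G (s, z.2) with hH
  have hHm : MemLp H 2 (vol[Ioo L R].prod vol[Ioo L' R']) :=
    hF.sub (memLp_primitive hLR.le hG).1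
  set c : ℝ → ℝ := fun y => ∫ s in Ioo L R, H (s, y) * χ s with hc
  have hcm : MemLp (fun p : ℝ × ℝ => c p.2) 2
      (vol[Ioo L R].prod vol[Ioo L' R']) := by
    obtain ⟨C, -, hC⟩ := hχ.exists_bound
    have hχH : MemLp (fun z => H z * χ z.1) 2
        (vol[Ioo L R].prod vol[Ioo L' R']) := by
      refine MemLp.of_le_mul (c := C) hHm
        (hHm.1.mul (hχ.1.continuous.comp continuous_fst).aestronglyMeasurable)
        (ae_of_all _ fun z => ?_)
      rw [norm_mul, mul_comm]
      exact mul_le_mul_of_nonneg_right (hC _) (norm_nonneg _)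
    simpa only [if_true, one_mul] using
      (schur_test (k := fun _ _ => if True then 1 else 0) measurable_const hp.le
        (fun t => lintegral_step_le) (fun s => lintegral_step_le) hχH).1
  refine ⟨c, memLp_of_comp_snd hcm, ?_⟩
  have hZi : IntegrableOn (fun z => H z - c z.2) (rect L R L' R') := by
    rw [IntegrableOn, restrict_rect]; exact (hHm.sub hcm).integrable one_le_two
  have hFi : IntegrableOn F (rect L R L' R') := by
    rw [IntegrableOn, restrict_rect]; exact hF.integrable one_le_two
  have hGi : IntegrableOn G (rect L R L' R') := by
    rw [IntegrableOn, restrict_rect]; exact hG.integrable one_le_two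
  have key := ae_eq_zero_of_tensor hLR hLR' hZi fun a b ha hb => by
    -- `d` has mean zero, so that its primitive is a test function
    set m := ∫ x in Ioo L R, a x with hm
    set d : ℝ → ℝ := fun x => a x + -m * χ x with hd
    have hdT : IsTest L R d := ha.add (hχ.const_mul _)
    have hii : ∀ {f : ℝ → ℝ}, IsTest L R f → IntegrableOn f (Ioo L R) := fun hf =>
      (hf.1.continuous.integrableOn_Icc).mono_set Ioo_subset_Icc_self
    have hd0 : ∫ x in L..R, d x = 0 := by
      rw [integral_of_le hLR.le, integral_Ioc_eq_integral_Ioo,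
        integral_add (hii ha) (hii (hχ.const_mul _)), integral_const_mul, hχ1]
      ring
    obtain ⟨hA, hA'⟩ := hdT.primitive_and_deriv hLR hd0
    set A : ℝ → ℝ := fun x => ∫ s in L..x, d s with hAdef
    have h1 := h A b hA hb
    rw [hA'] at h1
    have hi : ∀ {f a : _} , IsTest L R a → IntegrableOn f (rect L R L' R') →
        IntegrableOn (fun z : ℝ × ℝ => f z * (a z.1 * b z.2)) (rect L R L' R') := fun ha hf => by
      simpa only [mul_assoc] using hb.integrable_mul_snd (ha.integrable_mul_fst hf)
    rw [eq_neg_iff_add_eq_zero, ← integral_add (hi hdT hFi) (hi hA hGi)] at h1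
    rw [← h1]
    have j1 := hi ha hZi
    have j2 := (hi hdT hFi).add (hi hA hGi)
    rw [IntegrableOn, restrict_rect] at j1 j2
    rw [restrict_rect]
    refine (integral_prod_symm _ j1).trans
      (Eq.trans (integral_congr_ae ?_) (integral_prod_symm _ j2).symm)
    filter_upwards [ae_integrable_slice hF, ae_integrable_slice hG] with y hFy hGy
    have hGy' := intervalIntegrable_of_Ioo hLR.le hGy
    have hparts := integral_parts_of_primitive (f := fun x => ∫ s in L..x, G (s, y))
      (f' := fun x => G (x, y)) (g := A) (g' := d) hLR.le hGy'
      (hdT.1.continuous.intervalIntegrable _ _) (fun x _ => by simp) (fun x _ => by simp [hAdef])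
    simp only [hAdef, hd0, mul_zero, integral_same, sub_zero, zero_sub,
      integral_of_le hLR.le, integral_Ioc_eq_integral_Ioo] at hparts
    have hPi : IntegrableOn (fun x => ∫ s in L..x, G (s, y)) (Ioo L R) := by
      have := (continuousOn_primitive_interval' hGy'
        left_mem_uIcc).integrableOn_compact (μ := volume) isCompact_uIcc
      rw [uIcc_of_le hLR.le] at this
      exact this.mono_set Ioo_subset_Icc_self
    have hHi : IntegrableOn (fun x => H (x, y)) (Ioo L R) := hFy.sub hPi
    have e1 : ∫ x in Ioo L R, H (x, y) * d x
        = (∫ x in Ioo L R, F (x, y) * d x) + ∫ x in Ioo L R, G (x, y) * A x := by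
      simp only [hH, sub_mul]
      rw [integral_sub (hdT.integrableOn_mul hFy) (hdT.integrableOn_mul hPi), hparts,
        sub_neg_eq_add]
    have e2 : ∫ x in Ioo L R, H (x, y) * d x = (∫ x in Ioo L R, H (x, y) * a x) - m * c y := by
      have : ∀ x, H (x, y) * d x = H (x, y) * a x - m * (H (x, y) * χ x) := fun x => by
        simp only [hd]; ring
      simp only [this]
      rw [integral_sub (ha.integrableOn_mul hHi) ((hχ.integrableOn_mul hHi).const_mul _),
        integral_const_mul]
    have e3 : ∫ x in Ioo L R, (H (x, y) - c y) * a x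
        = (∫ x in Ioo L R, H (x, y) * a x) - m * c y := by
      simp only [sub_mul]
      rw [integral_sub (ha.integrableOn_mul hHi) ((hii ha).const_mul _), integral_const_mul,
          mul_comm]
    simp only [Pi.add_apply, ← mul_assoc, ← add_mul]
    rw [integral_mul_const, integral_mul_const, e3, ← e2, e1,
      integral_add (hdT.integrableOn_mul hFy) (hA.integrableOn_mul hGy)]
  rw [restrict_rect] at key
  filter_upwards [key] with z hz
  simp only [hH] at hz
  linarith

end Prim

/-! ### Polynomial approximation on a rectangle -/

section Approximation

variable {L R L' R' : ℝ} {k : ℕ}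

lemma exists_ev_pow (L : ℝ) {l : ℕ} (hl : l ≤ k) : ∃ c : P1 k, ∀ x, ev c x = (x - L) ^ l :=
  (exists_ev_eq ((Polynomial.X - Polynomial.C L) ^ l)
    (by simpa [Polynomial.natDegree_pow] using hl)).imp fun c hc x => by rw [hc]; simp

/-- A polynomial in `x` of degree at most `k` whose coefficients are functions of `y`. -/
abbrev CoefFun (k : ℕ) : Type := ℝ → P1 k

lemma memLp_coef_mul {c f : ℝ → ℝ} (hc : MemLp c 2 vol[Ioo L' R'])
    (hf : Continuous f) :
    MemLp (fun z : ℝ × ℝ => c z.2 * f z.1) 2 vol[rect L R L' R'] := by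
  rw [restrict_rect]
  obtain ⟨C, hC⟩ := (isCompact_Icc (a := L) (b := R)).exists_bound_of_continuousOn hf.continuousOn
  have h1 : MemLp (fun z : ℝ × ℝ => c z.2) 2
      (vol[Ioo L R].prod vol[Ioo L' R']) := hc.comp_snd _
  refine MemLp.of_le_mul (c := C) h1 (h1.1.mul (by fun_prop)) ?_
  filter_upwards [Measure.quasiMeasurePreserving_fst.ae (ae_restrict_mem measurableSet_Ioo)]
    with p hp
  rw [norm_mul, mul_comm]
  exact mul_le_mul_of_nonneg_right (hC _ (Ioo_subset_Icc_self hp)) (norm_nonneg _)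

lemma memLp_rect_poly {q : CoefFun k}
    (hq : ∀ m, MemLp (fun y => q y m) 2 vol[Ioo L' R']) :
    MemLp (fun z : ℝ × ℝ => ev (q z.2) z.1) 2 vol[rect L R L' R'] :=
  memLp_finsetSum _ fun m _ => memLp_coef_mul (f := fun x => x ^ (m : ℕ)) (hq m) (by fun_prop)

lemma memLp_dc {q : CoefFun k}
    (hq : ∀ m, MemLp (fun y => q y m) 2 vol[Ioo L' R']) :
    ∀ m, MemLp (fun y => dc (q y) m) 2 vol[Ioo L' R'] := by
  intro m
  simp only [dc]
  split_ifs with h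
  · exact (hq _).const_mul _
  · exact MemLp.zero'

/-- Taylor expansion in `x`, with coefficients depending on `y`, of a function with `m` weak
derivatives in `x`; the second bound is for its `x`-derivative. -/
lemma exists_taylor_coeff (hLR : L < R) (hLR' : L' < R') (m : ℕ)
    (g : ℕ → ℝ × ℝ → ℝ) (hg : ∀ j ≤ m, MemLp (g j) 2 vol[rect L R L' R'])
    (hd : ∀ j < m, HasTensorDeriv L R L' R' (g j) (g (j + 1))) :
    ∃ a : ℕ → ℝ → ℝ, (∀ l, MemLp (a l) 2 vol[Ioo L' R']) ∧
      ∫ z in rect L R L' R', (g 0 z - ∑ l ∈ Finset.range m, a l z.2 * (z.1 - L) ^ l) ^ 2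
        ≤ (R - L) ^ (2 * m) * ∫ z in rect L R L' R', g m z ^ 2 ∧
      (1 ≤ m → ∫ z in rect L R L' R',
          (g 1 z - ∑ l ∈ Finset.range m, a l z.2 * (l * (z.1 - L) ^ (l - 1))) ^ 2
        ≤ (R - L) ^ (2 * (m - 1)) * ∫ z in rect L R L' R', g m z ^ 2) := by
  induction m generalizing g with
  | zero => exact ⟨fun _ _ => 0, fun n => MemLp.zero', by simp, by omega⟩
  | succ m ih =>
    obtain ⟨a, ha, hb, -⟩ := ih (fun j => g (j + 1))
      (fun j hj => hg (j + 1) (by omega)) (fun j hj => hd (j + 1) (by omega))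
    obtain ⟨c, hc, hrep⟩ := (hd 0 (by omega)).exists_eq_primitive hLR hLR' (hg 0 (by omega))
      (hg 1 (by omega))
    -- integrate the expansion of the derivative
    refine ⟨fun l y => if l = 0 then c y else a (l - 1) y / l, fun l => ?_, ?_, fun _ => ?_⟩
    · by_cases hl : l = 0
      · simpa only [hl, if_true] using hc
      · simpa only [hl, if_false, div_eq_mul_inv] using (ha (l - 1)).mul_const _
    · have hdiff := (hg 1 (by omega)).sub (memLp_finsetSum (Finset.range m)
        fun l _ => memLp_coef_mul (L := L) (R := R) (f := fun x => (x - L) ^ l) (ha l)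
          (by fun_prop))
      have h1 := hg 1 (by omega)
      rw [restrict_rect] at h1 hdiff
      have hb2 := (memLp_primitive hLR.le hdiff).2
      rw [← restrict_rect] at hb2
      refine le_trans (le_of_eq ?_) (hb2.trans
        ((mul_le_mul_of_nonneg_left hb (sq_nonneg _)).trans (le_of_eq (by ring))))
      refine integral_congr_ae ?_
      have hsl := ae_prod_snd (μ := vol[Ioo L R]) (ae_integrable_slice h1)
      rw [← restrict_rect] at hsl
      filter_upwards [hrep, hsl, ae_restrict_mem (measurableSet_rect _ _ _ _)] with z hz hi hzm
      have hi' : IntervalIntegrable (fun s => g 1 (s, z.2)) volume L z.1 :=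
        intervalIntegrable_of_Ioo hzm.1.1.le (hi.mono_set (Ioo_subset_Ioo_right hzm.1.2.le))
      have hci : ∀ l : ℕ, IntervalIntegrable (fun s => a l z.2 * (s - L) ^ l) volume L z.1 :=
        fun l => by apply Continuous.intervalIntegrable; fun_prop
      simp only [Pi.sub_apply]
      rw [intervalIntegral.integral_sub hi' (by
          apply Continuous.intervalIntegrable; fun_prop),
        intervalIntegral.integral_finsetSum fun l _ => hci l, hz, Finset.sum_range_succ']
      have h3 : ∀ l : ℕ, ∫ s in L..z.1, (s - L) ^ l = (z.1 - L) ^ (l + 1) / (l + 1) := fun l => by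
        rw [intervalIntegral.integral_comp_sub_right (fun s => s ^ l), integral_pow]
        simp
      simp only [intervalIntegral.integral_const_mul, h3, Nat.succ_ne_zero, if_true, if_false,
        Nat.add_sub_cancel, pow_zero, mul_one, Nat.cast_add, Nat.cast_one, div_mul_eq_mul_div,
        mul_div_assoc]
      ring
    · simp only [Finset.sum_range_succ', Nat.add_sub_cancel]
      refine le_of_eq_of_le (integral_congr_ae (ae_of_all _ fun z => ?_)) hb
      simp only [Nat.succ_ne_zero, if_true, if_false, Nat.cast_zero, zero_mul, mul_zero, add_zero]
      congr 2
      refine sum_congr rfl fun l _ => ?_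
      rw [← mul_assoc, div_mul_cancel₀ _ (Nat.cast_ne_zero.2 l.succ_ne_zero)]
lemma exists_taylor (hLR : L < R) (hLR' : L' < R') (m : ℕ) (hm : m ≤ k + 1)
    (g : ℕ → ℝ × ℝ → ℝ) (hg : ∀ j ≤ m, MemLp (g j) 2 vol[rect L R L' R'])
    (hd : ∀ j < m, HasTensorDeriv L R L' R' (g j) (g (j + 1))) :
    ∃ q : CoefFun k, (∀ n, MemLp (fun y => q y n) 2 vol[Ioo L' R']) ∧
      ∫ z in rect L R L' R', (g 0 z - ev (q z.2) z.1) ^ 2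
        ≤ (R - L) ^ (2 * m) * ∫ z in rect L R L' R', g m z ^ 2 ∧
      (1 ≤ m → ∫ z in rect L R L' R', (g 1 z - ev (dc (q z.2)) z.1) ^ 2
        ≤ (R - L) ^ (2 * (m - 1)) * ∫ z in rect L R L' R', g m z ^ 2) := by
  obtain ⟨a, ha, hb, hb'⟩ := exists_taylor_coeff hLR hLR' m g hg hd
  choose! e he using fun l (hl : l ≤ k) => exists_ev_pow (k := k) L hl
  set q : CoefFun k := fun y n => ∑ l ∈ Finset.range m, a l y * e l n with hqdef
  have hq : ∀ y x, ev (q y) x = ∑ l ∈ Finset.range m, a l y * (x - L) ^ l := fun y x => by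
    rw [hqdef, ev_sum]
    refine sum_congr rfl fun l hl => ?_
    rw [he l (by have := Finset.mem_range.1 hl; omega)]
  refine ⟨q, fun n => memLp_finsetSum _ fun l _ => (ha l).mul_const _,
    by simpa only [hq] using hb, fun hm1 => ?_⟩
  have hdq : ∀ y x, ev (dc (q y)) x
      = ∑ l ∈ Finset.range m, a l y * (l * (x - L) ^ (l - 1)) := fun y x => by
    refine (hasDerivAt_ev _ x).unique ?_
    rw [show ev (q y) = _ from funext (hq y)]
    refine HasDerivAt.fun_sum fun l _ => ?_
    simpa using (((hasDerivAt_id x).sub_const L).pow l).const_mul (a l y)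
  simpa only [hdq] using hb' hm1

/-- The single interval `(L, R)` as a mesh. -/
def Mesh1.unit (L R : ℝ) (h : L < R) : Mesh1 Unit where
  L _ := L
  R _ := R
  lt _ := h
  next := Equiv.refl _

lemma exists_projection (hLR : L < R) (w : ℝ → ℝ) (hw : IntegrableOn w (Ioo L R)) :
    ∃ c : P1 k, ∀ b : P1 k, ∫ y in Ioo L R, ev c y * ev b y = ∫ y in Ioo L R, w y * ev b y := by
  have hi : ∀ b : P1 k, IntegrableOn (fun y => w y * ev b y) (Ioo L R) := by
    intro b
    obtain ⟨C, hC⟩ := (isCompact_Icc (a := L) (b := R)).exists_bound_of_continuousOn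
      (continuous_ev b).continuousOn
    refine Integrable.mul_bdd (c := C) hw (continuous_ev b).aestronglyMeasurable ?_
    exact ae_restrict_of_forall_mem measurableSet_Ioo fun y hy => hC y (Ioo_subset_Icc_self hy)
  let l : V1 Unit k →ₗ[ℝ] ℝ :=
    { toFun := fun b => ∫ y in Ioo L R, w y * ev (b ()) y
      map_add' := fun b b' => by
        rw [← integral_add (hi _) (hi _)]
        simp only [Pi.add_apply, ev_add, mul_add]
      map_smul' := fun r b => by
        simp only [Pi.smul_apply, ev_smul, mul_left_comm _ r, integral_const_mul,
          smul_eq_mul, RingHom.id_apply] }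
  refine ⟨riesz (Mesh1.unit L R hLR).ip (Mesh1.unit L R hLR).ip_definite l (), fun b => ?_⟩
  have h := riesz_apply (Mesh1.unit L R hLR).ip (Mesh1.unit L R hLR).ip_definite l (fun _ => b)
  simp only [Mesh1.ip_apply, Finset.univ_unique, Finset.sum_singleton] at h
  rw [← integral_Ioc_eq_integral_Ioo, ← integral_of_le hLR.le]
  exact h

lemma integral_sq_sub_le {α : Type*} [MeasurableSpace α] {μ : Measure α} {f g p : α → ℝ}
    (hf : MemLp f 2 μ) (hg : MemLp g 2 μ) (hp : MemLp p 2 μ) :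
    ∫ x, (f x - g x) ^ 2 ∂μ ≤ 2 * (∫ x, (f x - p x) ^ 2 ∂μ) + 2 * ∫ x, (p x - g x) ^ 2 ∂μ := by
  have h1 : Integrable (fun x => (f x - p x) ^ 2) μ := (hf.sub hp).integrable_sq
  have h2 : Integrable (fun x => (p x - g x) ^ 2) μ := (hp.sub hg).integrable_sq
  rw [← integral_const_mul, ← integral_const_mul,
    ← integral_add (h1.const_mul 2) (h2.const_mul 2)]
  refine integral_mono (hf.sub hg).integrable_sq ((h1.const_mul 2).add (h2.const_mul 2))
    fun x => ?_
  change (f x - g x) ^ 2 ≤ 2 * (f x - p x) ^ 2 + 2 * (p x - g x) ^ 2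
  nlinarith [sq_nonneg ((f x - p x) - (p x - g x))]

lemma memLp_ev (c : P1 k) : MemLp (ev c) 2 vol[Ioo L R] :=
  (memLp_two_of_continuous (continuous_ev c) L R).mono_measure
    (Measure.restrict_mono Ioo_subset_Ioc_self le_rfl)

lemma memLp_eval (c : Qk k) : MemLp c.eval 2 vol[rect L R L' R'] := by
  rw [memLp_two_iff_integrable_sq (continuous_eval c).aestronglyMeasurable]
  exact integrableOn_rect ((continuous_eval c).pow 2) _ _ _ _

/-- Approximation by `Q^k` from separate approximations by polynomials in `x` (with coefficients
depending on `y`) and by polynomials in `y` (with coefficients depending on `x`): project the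
former in `y`. -/
lemma exists_approx_of_separate (hLR' : L' < R') {F : ℝ × ℝ → ℝ}
    (hF : MemLp F 2 vol[rect L R L' R'])
    {q p : CoefFun k} (hq : ∀ m, MemLp (fun y => q y m) 2 vol[Ioo L' R'])
    (hp : ∀ m, MemLp (fun x => p x m) 2 vol[Ioo L R]) :
    ∃ r : Qk k, ∫ z in rect L R L' R', (F z - r.eval z) ^ 2
      ≤ 6 * (∫ z in rect L R L' R', (F z - ev (p z.1) z.2) ^ 2)
        + 4 * ∫ z in rect L R L' R', (F z - ev (q z.2) z.1) ^ 2 := by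
  obtain ⟨r, hr⟩ : ∃ r : Qk k, ∀ m (b : P1 k), ∫ y in Ioo L' R', ev (r m) y * ev b y
      = ∫ y in Ioo L' R', q y m * ev b y := by
    choose r hr using fun m => exists_projection (k := k) hLR' (fun y => q y m)
      ((hq m).integrable one_le_two)
    exact ⟨r, hr⟩
  refine ⟨r, ?_⟩
  have hqm := memLp_rect_poly (L := L) (R := R) hq
  have hpm : MemLp (fun z : ℝ × ℝ => ev (p z.1) z.2) 2 vol[rect L R L' R'] := by
    have h1 := memLp_rect_poly (L := L') (R := R') hp
    rw [restrict_rect] at h1 ⊢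
    exact h1.comp_measurePreserving Measure.measurePreserving_swap
  have hrm : MemLp r.eval 2 vol[rect L R L' R'] := memLp_eval r
  have h1 := integral_sq_sub_le hF hrm hpm
  have h2 := integral_sq_sub_le hpm hqm hF
  have h3 : ∫ z in rect L R L' R', (ev (p z.1) z.2 - r.eval z) ^ 2
      ≤ ∫ z in rect L R L' R', (ev (p z.1) z.2 - ev (q z.2) z.1) ^ 2 := by
    have hi1 := (hpm.sub hrm).integrable_sq
    have hi2 := (hpm.sub hqm).integrable_sq
    simp only [Pi.sub_apply] at hi1 hi2
    rw [restrict_rect] at hi1 hi2 ⊢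
    rw [integral_prod _ hi1, integral_prod _ hi2]
    refine integral_mono hi1.integral_prod_left hi2.integral_prod_left fun x => ?_
    -- on the line through `x`, `r` is the projection of `q`, and `p` is a polynomial
    set c : P1 k := fun n => ∑ m : Fin (k + 1), x ^ (m : ℕ) * r m n with hc
    have hrc : ∀ y, r.eval (x, y) = ev c y := by
      intro y
      rw [hc, ev_sum, Qk.eval]
      simp only [ev, mul_sum]
      exact sum_congr rfl fun _ _ => sum_congr rfl fun _ _ => by ring
    have hqx : MemLp (fun y => ev (q y) x) 2 vol[Ioo L' R'] := by
      unfold ev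
      exact memLp_finsetSum _ fun m _ => (hq m).mul_const _
    have horth : ∫ y in Ioo L' R', (ev (p x) y - ev c y) * ev (p x - c) y
        = ∫ y in Ioo L' R', (ev (p x) y - ev (q y) x) * ev (p x - c) y := by
      have e1 : ∫ y in Ioo L' R', ev c y * ev (p x - c) y
          = ∫ y in Ioo L' R', ev (q y) x * ev (p x - c) y := by
        have e2 : ∀ y, ev c y * ev (p x - c) y
            = ∑ m : Fin (k + 1), x ^ (m : ℕ) * (ev (r m) y * ev (p x - c) y) := fun y => by
          conv_lhs => rw [hc, ev_sum, sum_mul]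
          exact sum_congr rfl fun _ _ => by ring
        have e3 : ∀ y, ev (q y) x * ev (p x - c) y
            = ∑ m : Fin (k + 1), x ^ (m : ℕ) * (q y m * ev (p x - c) y) := fun y => by
          rw [ev, sum_mul]
          exact sum_congr rfl fun _ _ => by ring
        simp only [e2, e3]
        rw [integral_finsetSum, integral_finsetSum]
        · refine sum_congr rfl fun m _ => ?_
          rw [integral_const_mul, integral_const_mul, hr]
        · intro m _
          exact ((hq m).integrable_mul (memLp_ev _)).const_mul _
        · intro m _
          exact ((memLp_ev (r m)).integrable_mul (memLp_ev _)).const_mul _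
      have i1 : ∀ b b' : P1 k, IntegrableOn (fun y => ev b y * ev b' y) (Ioo L' R') := fun b b' =>
        (memLp_ev b).integrable_mul (memLp_ev b')
      have i2 : IntegrableOn (fun y => ev (q y) x * ev (p x - c) y) (Ioo L' R') :=
        hqx.integrable_mul (memLp_ev _)
      simp only [sub_mul]
      rw [integral_sub (i1 _ _) (i1 _ _), integral_sub (i1 _ _) i2, e1]
    have hcs := sq_integral_mul_le (((memLp_ev (p x)).sub hqx)) (memLp_ev (L := L') (R := R')
      (p x - c))
    simp only [Pi.sub_apply] at hcs
    rw [← horth] at hcs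
    simp only [hrc]
    simp only [ev_sub, ← pow_two] at hcs
    set α := ∫ y in Ioo L' R', (ev (p x) y - ev c y) ^ 2 with hα
    set β := ∫ y in Ioo L' R', (ev (p x) y - ev (q y) x) ^ 2 with hβ
    have hα0 : 0 ≤ α := integral_nonneg fun _ => sq_nonneg _
    have hβ0 : 0 ≤ β := integral_nonneg fun _ => sq_nonneg _
    by_contra hlt
    rw [not_le] at hlt
    nlinarith
  have h4 : ∫ z in rect L R L' R', (ev (p z.1) z.2 - F z) ^ 2
      = ∫ z in rect L R L' R', (F z - ev (p z.1) z.2) ^ 2 := by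
    congr 1; funext z; ring
  rw [h4] at h2
  linarith

end Approximation

/-! ### The projection onto `Q^k` on one cell -/

section CellProjection

variable {L R L' R' : ℝ} {k : ℕ}

lemma rect_swap_integral_sq (f : ℝ × ℝ → ℝ) :
    ∫ z in rect L R L' R', f z.swap ^ 2 = ∫ z in rect L' R' L R, f z ^ 2 := by
  rw [integral_rect_swap]; simp only [Prod.swap_swap]

lemma integral_sub_projection_le {F : ℝ × ℝ → ℝ}
    (hF : MemLp F 2 vol[rect L R L' R']) {P : Qk k}
    (hP : ∀ w : Qk k, ∫ z in rect L R L' R', P.eval z * w.eval z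
      = ∫ z in rect L R L' R', F z * w.eval z) (r : Qk k) :
    ∫ z in rect L R L' R', (F z - P.eval z) ^ 2 ≤ ∫ z in rect L R L' R', (F z - r.eval z) ^ 2 := by
  have hm : ∀ c : Qk k, MemLp c.eval 2 vol[rect L R L' R'] := memLp_eval
  have i1 : IntegrableOn (fun z => (F z - P.eval z) ^ 2) (rect L R L' R') :=
    (hF.sub (hm P)).integrable_sq
  have i2 : IntegrableOn (fun z => (F z - P.eval z) * (P - r).eval z) (rect L R L' R') :=
    (hF.sub (hm P)).integrable_mul (hm _)
  have i3 : IntegrableOn (fun z => (P - r).eval z ^ 2) (rect L R L' R') := (hm _).integrable_sq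
  have i4 : IntegrableOn (fun z => F z * (P - r).eval z) (rect L R L' R') :=
    hF.integrable_mul (hm _)
  have i5 : IntegrableOn (fun z => P.eval z * (P - r).eval z) (rect L R L' R') :=
    (hm P).integrable_mul (hm _)
  have h0 : ∫ z in rect L R L' R', (F z - P.eval z) * (P - r).eval z = 0 := by
    simp only [sub_mul]
    rw [integral_sub i4 i5, hP, sub_self]
  have h1 : ∀ z, (F z - r.eval z) ^ 2
      = (F z - P.eval z) ^ 2 + 2 * ((F z - P.eval z) * (P - r).eval z) + (P - r).eval z ^ 2 :=
    fun z => by rw [eval_sub]; ring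
  simp only [h1]
  have i12 : IntegrableOn (fun z => (F z - P.eval z) ^ 2
      + 2 * ((F z - P.eval z) * (P - r).eval z)) (rect L R L' R') := i1.add (i2.const_mul 2)
  rw [integral_add i12 i3, integral_add i1 (i2.const_mul 2), integral_const_mul, h0]
  have : 0 ≤ ∫ z in rect L R L' R', (P - r).eval z ^ 2 := integral_nonneg fun _ => sq_nonneg _
  linarith

/-- The inverse inequality in `x` for polynomials in `x` with coefficients depending on `y`. -/
lemma exists_inverse_ineq_rect (k : ℕ) : ∃ C : ℝ, 0 < C ∧ ∀ L R L' R' : ℝ, L < R →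
    ∀ q : CoefFun k, (∀ m, MemLp (fun y => q y m) 2 vol[Ioo L' R']) →
      ∫ z in rect L R L' R', ev (dc (q z.2)) z.1 ^ 2
        ≤ C / (R - L) ^ 2 * ∫ z in rect L R L' R', ev (q z.2) z.1 ^ 2 := by
  obtain ⟨C, hC, h⟩ := exists_inverse_ineq k
  refine ⟨C, hC, fun L R L' R' hLR q hq => ?_⟩
  have i1 := (memLp_rect_poly (L := L) (R := R) hq).integrable_sq
  have i2 := (memLp_rect_poly (L := L) (R := R) (memLp_dc hq)).integrable_sq
  rw [restrict_rect] at i1 i2 ⊢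
  rw [integral_prod_symm _ i1, integral_prod_symm _ i2, ← integral_const_mul]
  refine integral_mono i2.integral_prod_right (i1.integral_prod_right.const_mul _) fun y => ?_
  have := (h L R hLR (q y)).2
  simpa only [integral_of_le hLR.le, integral_Ioc_eq_integral_Ioo] using this

/-- Approximation by the projection onto `Q^k` on a cell, for a function with `n + 1 ≤ k + 1`
weak derivatives in each variable. The functions `g'` are the derivatives in the second variable
with the two variables exchanged. -/
lemma exists_cell_estimate (k : ℕ) (ρ : ℝ) : ∃ C : ℝ, 0 < C ∧ ∀ n ≤ k, ∀ L R L' R' h : ℝ,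
    L < R → L' < R' → R - L ≤ h → R' - L' ≤ h → h ≤ ρ * (R - L) → ∀ g g' : ℕ → ℝ × ℝ → ℝ,
    (∀ j ≤ n + 1, MemLp (g j) 2 vol[rect L R L' R']) →
    (∀ j ≤ n + 1, MemLp (g' j) 2 vol[rect L' R' L R]) →
    (∀ j < n + 1, HasTensorDeriv L R L' R' (g j) (g (j + 1))) →
    (∀ j < n + 1, HasTensorDeriv L' R' L R (g' j) (g' (j + 1))) →
    (∀ z, g' 0 z = g 0 z.swap) →
    ∀ P : Qk k, (∀ w : Qk k, ∫ z in rect L R L' R', P.eval z * w.eval z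
      = ∫ z in rect L R L' R', g 0 z * w.eval z) →
    ∫ z in rect L R L' R', (g 0 z - P.eval z) ^ 2 ≤ C * h ^ (2 * n + 2)
      * ((∫ z in rect L R L' R', g (n + 1) z ^ 2) + ∫ z in rect L' R' L R, g' (n + 1) z ^ 2) ∧
    ∫ z in rect L R L' R', (g 1 z - (dcx P).eval z) ^ 2 ≤ C * h ^ (2 * n)
      * ((∫ z in rect L R L' R', g (n + 1) z ^ 2)
        + ∫ z in rect L' R' L R, g' (n + 1) z ^ 2) := by
  obtain ⟨C, hC, hinv⟩ := exists_inverse_ineq_rect k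
  refine ⟨10 + 2 + 44 * C * ρ ^ 2, by positivity,
    fun n hn L R L' R' h hLR hLR' hR hR' hρ g g' hg hg' hd hd' h0 P hP => ?_⟩
  have hl : 0 < R - L := sub_pos.2 hLR
  have hh : 0 < h := hl.trans_le hR
  obtain ⟨q, hq, hq0, hq1⟩ := exists_taylor (k := k) hLR hLR' (n + 1) (by omega) g hg hd
  obtain ⟨p, hp, hp0, -⟩ := exists_taylor (k := k) hLR' hLR (n + 1) (by omega) g' hg' hd'
  specialize hq1 (by omega)
  rw [Nat.add_sub_cancel] at hq1
  set N1 := ∫ z in rect L R L' R', g (n + 1) z ^ 2 with hN1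
  set N2 := ∫ z in rect L' R' L R, g' (n + 1) z ^ 2 with hN2
  have hN1' : 0 ≤ N1 := integral_nonneg fun _ => sq_nonneg _
  have hN2' : 0 ≤ N2 := integral_nonneg fun _ => sq_nonneg _
  have hp0' : ∫ z in rect L R L' R', (g 0 z - ev (p z.1) z.2) ^ 2
      ≤ (R' - L') ^ (2 * (n + 1)) * N2 := by
    rw [integral_rect_swap]
    simp only [← h0, Prod.fst_swap, Prod.snd_swap]
    exact hp0
  obtain ⟨r, hr⟩ := exists_approx_of_separate hLR' (hg 0 (by omega)) hq hp
  have hbest := integral_sub_projection_le (hg 0 (by omega)) hP r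
  have e1 : (R - L) ^ (2 * (n + 1)) * N1 ≤ h ^ (2 * n + 2) * N1 :=
    mul_le_mul_of_nonneg_right (by
      rw [show 2 * n + 2 = 2 * (n + 1) by ring]
      exact pow_le_pow_left₀ hl.le hR _) hN1'
  have e2 : (R' - L') ^ (2 * (n + 1)) * N2 ≤ h ^ (2 * n + 2) * N2 :=
    mul_le_mul_of_nonneg_right (by
      rw [show 2 * n + 2 = 2 * (n + 1) by ring]
      exact pow_le_pow_left₀ (sub_pos.2 hLR').le hR' _) hN2'
  have e3 : (R - L) ^ (2 * n) * N1 ≤ h ^ (2 * n) * N1 :=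
    mul_le_mul_of_nonneg_right (pow_le_pow_left₀ hl.le hR _) hN1'
  have hH : 0 ≤ h ^ (2 * n + 2) := by positivity
  have hH' : 0 ≤ h ^ (2 * n) := by positivity
  have main : ∫ z in rect L R L' R', (g 0 z - P.eval z) ^ 2
      ≤ 10 * h ^ (2 * n + 2) * (N1 + N2) := by
    nlinarith [mul_nonneg hH hN1', mul_nonneg hH hN2']
  refine ⟨main.trans ?_, ?_⟩
  · have : 0 ≤ (2 + 44 * C * ρ ^ 2) * (h ^ (2 * n + 2) * (N1 + N2)) := by positivity
    nlinarith
  · have hqm := memLp_rect_poly (L := L) (R := R) hq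
    have hqd := memLp_rect_poly (L := L) (R := R) (memLp_dc hq)
    have hPm : MemLp P.eval 2 vol[rect L R L' R'] := memLp_eval P
    have t1 := integral_sq_sub_le (hg 1 (by omega)) (memLp_eval (dcx P)) hqd
    have t2 := integral_sq_sub_le hqm hPm (hg 0 (by omega))
    have hs : ∀ m, MemLp (fun y => slx P y m) 2 vol[Ioo L' R'] :=
      fun m => memLp_ev _
    have t3 := hinv L R L' R' hLR (fun y => q y - slx P y) (fun m => (hq m).sub (hs m))
    have e4 : ∀ z : ℝ × ℝ, ev (dc (q z.2 - slx P z.2)) z.1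
        = ev (dc (q z.2)) z.1 - (dcx P).eval z := fun z => by
      have : q z.2 = (q z.2 - slx P z.2) + slx P z.2 := by simp
      conv_rhs => rw [this, dc_add, ev_add, ← slx_dcx, ← eval_eq_slx]
      ring
    have e5 : ∀ z : ℝ × ℝ, ev (q z.2 - slx P z.2) z.1 = ev (q z.2) z.1 - P.eval z := fun z => by
      rw [ev_sub, ← eval_eq_slx]
    simp only [e4, e5] at t3
    have e6 : ∫ z in rect L R L' R', (ev (q z.2) z.1 - g 0 z) ^ 2
        = ∫ z in rect L R L' R', (g 0 z - ev (q z.2) z.1) ^ 2 := by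
      congr 1; funext z; ring
    rw [e6] at t2
    have t4 : ∫ z in rect L R L' R', (ev (q z.2) z.1 - P.eval z) ^ 2
        ≤ 22 * h ^ (2 * n + 2) * (N1 + N2) := by
      nlinarith [mul_nonneg hH hN1', mul_nonneg hH hN2']
    have t5 : C / (R - L) ^ 2 * h ^ 2 ≤ C * ρ ^ 2 := by
      rw [div_mul_eq_mul_div, div_le_iff₀ (by positivity), mul_assoc, ← mul_pow]
      exact mul_le_mul_of_nonneg_left (pow_le_pow_left₀ hh.le hρ 2) hC.le
    have t6 : C / (R - L) ^ 2 * (22 * h ^ (2 * n + 2) * (N1 + N2))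
        ≤ 22 * C * ρ ^ 2 * (h ^ (2 * n) * (N1 + N2)) := by
      have := mul_le_mul_of_nonneg_right t5
        (show 0 ≤ 22 * (h ^ (2 * n) * (N1 + N2)) by positivity)
      calc _ = C / (R - L) ^ 2 * h ^ 2 * (22 * (h ^ (2 * n) * (N1 + N2))) := by ring
        _ ≤ _ := this.trans (le_of_eq (by ring))
    have t7 := t3.trans ((mul_le_mul_of_nonneg_left t4 (by positivity)).trans t6)
    nlinarith [mul_nonneg hH' hN1', mul_nonneg hH' hN2']

end CellProjection

/-! ### The projection onto the finite element space -/

section Projection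

variable {ι κ : Type} [Fintype ι] [Fintype κ] {k : ℕ} (X : Mesh1 ι) (Y : Mesh1 κ)

/-- The functional `w ↦ ∑ ∫ F w` on piecewise polynomials, given by the moments of `F`. -/
def mom (F : ℝ × ℝ → ℝ) : V2 ι κ k →ₗ[ℝ] ℝ where
  toFun w := ∑ i, ∑ j, ∑ m : Fin (k + 1), ∑ n : Fin (k + 1),
    w i j m n * ∫ z in cellXY X Y i j, F z * (z.1 ^ (m : ℕ) * z.2 ^ (n : ℕ))
  map_add' v w := by simp only [Pi.add_apply, add_mul, sum_add_distrib]
  map_smul' r v := by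
    simp only [Pi.smul_apply, smul_eq_mul, mul_assoc, mul_sum, RingHom.id_apply]

variable {X Y}

/-- Square integrability on every cell. -/
def CellL2 (X : Mesh1 ι) (Y : Mesh1 κ) (F : ℝ × ℝ → ℝ) : Prop :=
  ∀ i j, MemLp F 2 vol[cellXY X Y i j]

lemma mom_apply {F : ℝ × ℝ → ℝ} (hF : CellL2 X Y F) (w : V2 ι κ k) :
    mom X Y F w = ∑ i, ∑ j, ∫ z in cellXY X Y i j, F z * (w i j).eval z := by
  refine sum_congr rfl fun i _ => sum_congr rfl fun j _ => ?_
  have hi : ∀ m n : Fin (k + 1), IntegrableOn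
      (fun z : ℝ × ℝ => F z * (z.1 ^ (m : ℕ) * z.2 ^ (n : ℕ))) (cellXY X Y i j) := by
    intro m n
    have hc : Continuous fun z : ℝ × ℝ => z.1 ^ (m : ℕ) * z.2 ^ (n : ℕ) := by fun_prop
    exact (hF i j).integrable_mul ((memLp_two_iff_integrable_sq hc.aestronglyMeasurable).2
      (integrableOn_rect (hc.pow 2) _ _ _ _))
  have he : ∀ z, F z * (w i j).eval z = ∑ m : Fin (k + 1), ∑ n : Fin (k + 1),
      w i j m n * (F z * (z.1 ^ (m : ℕ) * z.2 ^ (n : ℕ))) := fun z => by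
    simp only [Qk.eval, mul_sum]
    exact sum_congr rfl fun _ _ => sum_congr rfl fun _ _ => by ring
  simp only [he]
  rw [integral_finsetSum _ fun m _ => integrable_finsetSum _ fun n _ => (hi m n).const_mul _]
  refine sum_congr rfl fun m _ => ?_
  rw [integral_finsetSum _ fun n _ => (hi m n).const_mul _]
  exact sum_congr rfl fun n _ => (integral_const_mul _ _).symm

variable (X Y) in
/-- The `L²` projection onto piecewise polynomials. -/
def proj (k : ℕ) (F : ℝ × ℝ → ℝ) : V2 ι κ k := riesz (ip2 X Y) (ip2_definite X Y) (mom X Y F)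

lemma ip2_proj (F : ℝ × ℝ → ℝ) (w : V2 ι κ k) : ip2 X Y (proj X Y k F) w = mom X Y F w :=
  riesz_apply _ _ _ _

lemma integral_proj_mul {F : ℝ × ℝ → ℝ} (hF : CellL2 X Y F) (i : ι) (j : κ) (w : Qk k) :
    ∫ z in cellXY X Y i j, (proj X Y k F i j).eval z * w.eval z
      = ∫ z in cellXY X Y i j, F z * w.eval z := by
  classical
  have h := ip2_proj (X := X) (Y := Y) F (Pi.single i (Pi.single j w))
  rw [mom_apply hF, ip2_apply, sum_eq_single i, sum_eq_single j,
    sum_eq_single i, sum_eq_single j] at h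
  · simpa only [Pi.single_eq_same] using h
  all_goals first
    | (intro b _ hb; simp [Pi.single_eq_of_ne hb])
    | simp

variable (X Y) in
/-- The squared `L²` norm over all cells. -/
def cellSq (F : ℝ × ℝ → ℝ) : ℝ := ∑ i, ∑ j, ∫ z in cellXY X Y i j, F z ^ 2

/-- `g j` is the `j`-th broken weak derivative of `g 0` in the first variable, for `j ≤ n`. -/
structure DerivChain (X : Mesh1 ι) (Y : Mesh1 κ) (n : ℕ) (g : ℕ → ℝ × ℝ → ℝ) : Prop where
  memLp : ∀ l ≤ n, CellL2 X Y (g l)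
  deriv : ∀ l < n, ∀ i j, HasTensorDeriv (X.L i) (X.R i) (Y.L j) (Y.R j) (g l) (g (l + 1))

/-- The mesh parameter `h` bounds all side lengths from above, and, up to the factor `ρ`, from
below. -/
structure QuasiUnif (X : Mesh1 ι) (ρ h : ℝ) : Prop where
  le : ∀ i, X.R i - X.L i ≤ h
  ge : ∀ i, h ≤ ρ * (X.R i - X.L i)

/-- The error of the `L²` projection and of its broken derivative in the first variable. -/
lemma exists_proj_estimate (k : ℕ) (ρ : ℝ) : ∃ C : ℝ, 0 < C ∧ ∀ n ≤ k,
    ∀ {ι κ : Type} [Fintype ι] [Fintype κ] (X : Mesh1 ι) (Y : Mesh1 κ) (h : ℝ),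
    QuasiUnif X ρ h → QuasiUnif Y ρ h → ∀ g g' : ℕ → ℝ × ℝ → ℝ,
    DerivChain X Y (n + 1) g → DerivChain Y X (n + 1) g' → (∀ z, g' 0 z = g 0 z.swap) →
    (∑ i, ∑ j, ∫ z in cellXY X Y i j, (g 0 z - (proj X Y k (g 0) i j).eval z) ^ 2)
      ≤ C * h ^ (2 * n + 2) * (cellSq X Y (g (n + 1)) + cellSq Y X (g' (n + 1))) ∧
    (∑ i, ∑ j, ∫ z in cellXY X Y i j, (g 1 z - (dcX (proj X Y k (g 0)) i j).eval z) ^ 2)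
      ≤ C * h ^ (2 * n) * (cellSq X Y (g (n + 1)) + cellSq Y X (g' (n + 1))) := by
  obtain ⟨C, hC, hcell⟩ := exists_cell_estimate k ρ
  refine ⟨C, hC, fun n hn {ι κ} _ _ X Y h hX hY g g' hg hg' h0 => ?_⟩
  have hc := fun i j => hcell n hn (X.L i) (X.R i) (Y.L j) (Y.R j) h (X.lt i) (Y.lt j) (hX.le i)
    (hY.le j) (hX.ge i) g g' (fun l hl => hg.memLp l hl i j) (fun l hl => hg'.memLp l hl j i)
    (fun l hl => hg.deriv l hl i j) (fun l hl => hg'.deriv l hl j i) h0 (proj X Y k (g 0) i j)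
    (integral_proj_mul (hg.memLp 0 (by omega)) i j)
  have e : cellSq Y X (g' (n + 1)) = ∑ i, ∑ j, ∫ z in cellXY Y X j i, g' (n + 1) z ^ 2 :=
    sum_comm
  rw [e, cellSq]
  simp only [← sum_add_distrib, mul_sum]
  exact ⟨sum_le_sum fun i _ => sum_le_sum fun j _ => (hc i j).1,
    sum_le_sum fun i _ => sum_le_sum fun j _ => (hc i j).2⟩

end Projection

/-! ### Lifting of jumps -/

section JumpLift

variable {ι κ : Type} {k : ℕ}

namespace Mesh1

variable (X : Mesh1 ι)

/-- The piecewise linear function which, when subtracted from a piecewise polynomial with jumps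
`J`, removes the jumps: both one-sided limits become the average of weight `1 - σ` on the left. -/
def lift (σ : ℝ) (J : ι → ℝ) (i : ι) (x : ℝ) : ℝ :=
  -σ * J i * ((x - X.L i) / (X.R i - X.L i))
    + (1 - σ) * J (X.next.symm i) * ((X.R i - x) / (X.R i - X.L i))

/-- The derivative of `lift`. -/
def liftDeriv (σ : ℝ) (J : ι → ℝ) (i : ι) : ℝ :=
  -(σ * J i + (1 - σ) * J (X.next.symm i)) / (X.R i - X.L i)

lemma hasDerivAt_lift (σ : ℝ) (J : ι → ℝ) (i : ι) (x : ℝ) :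
    HasDerivAt (X.lift σ J i) (X.liftDeriv σ J i) x := by
  have h1 := ((((hasDerivAt_id x).sub_const (X.L i)).div_const (X.R i - X.L i)).const_mul
    (-σ * J i)).add ((((hasDerivAt_id x).const_sub (X.R i)).div_const (X.R i - X.L i)).const_mul
    ((1 - σ) * J (X.next.symm i)))
  refine h1.congr_deriv ?_
  simp only [liftDeriv]; ring

@[fun_prop] lemma continuous_lift (σ : ℝ) (J : ι → ℝ) (i : ι) : Continuous (X.lift σ J i) := by
  unfold lift; fun_prop

lemma lift_R (σ : ℝ) (J : ι → ℝ) (i : ι) : X.lift σ J i (X.R i) = -σ * J i := by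
  have := (sub_pos.2 (X.lt i)).ne'
  simp [lift, div_self this]

lemma lift_L (σ : ℝ) (J : ι → ℝ) (i : ι) :
    X.lift σ J i (X.L i) = (1 - σ) * J (X.next.symm i) := by
  have := (sub_pos.2 (X.lt i)).ne'
  simp [lift, div_self this]

lemma sq_lift_le (σ : ℝ) (J : ι → ℝ) (i : ι) {x : ℝ} (hx : x ∈ Icc (X.L i) (X.R i)) :
    X.lift σ J i x ^ 2
      ≤ 2 * (σ ^ 2 + (1 - σ) ^ 2) * (J i ^ 2 + J (X.next.symm i) ^ 2) := by
  have hp := sub_pos.2 (X.lt i)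
  have h1 : 0 ≤ (x - X.L i) / (X.R i - X.L i) := div_nonneg (by linarith [hx.1]) hp.le
  have h2 : (x - X.L i) / (X.R i - X.L i) ≤ 1 := by rw [div_le_one hp]; linarith [hx.2]
  have h3 : 0 ≤ (X.R i - x) / (X.R i - X.L i) := div_nonneg (by linarith [hx.2]) hp.le
  have h4 : (X.R i - x) / (X.R i - X.L i) ≤ 1 := by rw [div_le_one hp]; linarith [hx.1]
  set r := (x - X.L i) / (X.R i - X.L i)
  set l := (X.R i - x) / (X.R i - X.L i)
  have hr : r ^ 2 ≤ 1 := by nlinarith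
  have hl : l ^ 2 ≤ 1 := by nlinarith
  set A := J i; set B := J (X.next.symm i)
  have e1 : X.lift σ J i x ^ 2 ≤ 2 * (σ ^ 2 * A ^ 2 * r ^ 2)
      + 2 * ((1 - σ) ^ 2 * B ^ 2 * l ^ 2) := by
    simp only [lift]
    nlinarith [sq_nonneg (-σ * A * r - (1 - σ) * B * l)]
  have e2 : σ ^ 2 * A ^ 2 * r ^ 2 ≤ σ ^ 2 * A ^ 2 * 1 :=
    mul_le_mul_of_nonneg_left hr (by positivity)
  have e3 : (1 - σ) ^ 2 * B ^ 2 * l ^ 2 ≤ (1 - σ) ^ 2 * B ^ 2 * 1 :=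
    mul_le_mul_of_nonneg_left hl (by positivity)
  have e4 : 0 ≤ σ ^ 2 * B ^ 2 := by positivity
  have e5 : 0 ≤ (1 - σ) ^ 2 * A ^ 2 := by positivity
  nlinarith

lemma sq_liftDeriv_le (σ : ℝ) (J : ι → ℝ) (i : ι) :
    X.liftDeriv σ J i ^ 2 ≤ 2 * (σ ^ 2 + (1 - σ) ^ 2) * (J i ^ 2 + J (X.next.symm i) ^ 2)
      / (X.R i - X.L i) ^ 2 := by
  rw [liftDeriv, div_pow]
  gcongr
  set A := J i; set B := J (X.next.symm i)
  have e4 : 0 ≤ σ ^ 2 * B ^ 2 := by positivity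
  have e5 : 0 ≤ (1 - σ) ^ 2 * A ^ 2 := by positivity
  nlinarith [sq_nonneg (σ * A - (1 - σ) * B)]

variable [Fintype ι]

lemma sum_sq_add_symm (J : ι → ℝ) :
    ∑ i, (J i ^ 2 + J (X.next.symm i) ^ 2) = 2 * ∑ i, J i ^ 2 := by
  rw [sum_add_distrib, Equiv.sum_comp X.next.symm (fun i => J i ^ 2)]; ring

lemma bform_eq_lift (σ : ℝ) (p b : V1 ι k) :
    X.bform σ p b = ∑ i, ∫ x in X.L i..X.R i,
      (ev (p i) x * (X.liftDeriv σ (X.jump b) i - ev (dc (b i)) x)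
        + ev (dc (p i)) x * X.lift σ (X.jump b) i x) := by
  have h1 : ∀ i, ∫ x in X.L i..X.R i,
      (ev (p i) x * (X.liftDeriv σ (X.jump b) i - ev (dc (b i)) x)
        + ev (dc (p i)) x * X.lift σ (X.jump b) i x)
      = -(∫ x in X.L i..X.R i, ev (p i) x * ev (dc (b i)) x)
        + (ev (p i) (X.R i) * (-σ * X.jump b i)
          - ev (p i) (X.L i) * ((1 - σ) * X.jump b (X.next.symm i))) := by
    intro i
    have h2 : ∫ x in X.L i..X.R i, (ev (dc (p i)) x * X.lift σ (X.jump b) i x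
        + ev (p i) x * X.liftDeriv σ (X.jump b) i)
        = ev (p i) (X.R i) * X.lift σ (X.jump b) i (X.R i)
          - ev (p i) (X.L i) * X.lift σ (X.jump b) i (X.L i) :=
      intervalIntegral.integral_deriv_mul_eq_sub (fun x _ => hasDerivAt_ev _ _)
        (fun x _ => X.hasDerivAt_lift _ _ _ _) ((continuous_ev _).intervalIntegrable _ _)
        (continuous_const.intervalIntegrable _ _)
    rw [lift_R, lift_L] at h2
    rw [← h2, ← intervalIntegral.integral_neg, ← intervalIntegral.integral_add]
    · congr 1; funext x; ring
    all_goals apply Continuous.intervalIntegrable; fun_prop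
  simp only [h1]
  rw [bform_apply, sum_add_distrib, sum_add_distrib, sum_flux_mul_jump]
  congr 1
  rw [sum_sub_distrib, ← Equiv.sum_comp X.next
    (fun i => ev (p i) (X.L i) * ((1 - σ) * X.jump b (X.next.symm i))),
    ← sum_sub_distrib, ← sum_neg_distrib]
  refine sum_congr rfl fun i _ => ?_
  simp only [Equiv.symm_apply_apply, flux]; ring

end Mesh1

variable (X : Mesh1 ι)

/-- The lifting of the jumps of `w` across vertical edges, on the cell `(i, j)`. -/
def liftX (σ : ℝ) (w : V2 ι κ k) (i : ι) (j : κ) (z : ℝ × ℝ) : ℝ :=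
  X.lift σ (X.jump (sx w j z.2)) i z.1

/-- The derivative of `liftX` in the first variable. -/
def liftXDeriv (σ : ℝ) (w : V2 ι κ k) (i : ι) (j : κ) (z : ℝ × ℝ) : ℝ :=
  X.liftDeriv σ (X.jump (sx w j z.2)) i

@[fun_prop] lemma continuous_liftX (σ : ℝ) (w : V2 ι κ k) (i : ι) (j : κ) :
    Continuous (liftX X σ w i j) := by
  have h := fun i' => (continuous_jump X w j i').comp (continuous_snd (X := ℝ))
  simp only [Function.comp_def] at h
  unfold liftX Mesh1.lift
  exact ((continuous_const.mul (h _)).mul (by fun_prop)).add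
    ((continuous_const.mul (h _)).mul (by fun_prop))

@[fun_prop] lemma continuous_liftXDeriv (σ : ℝ) (w : V2 ι κ k) (i : ι) (j : κ) :
    Continuous (liftXDeriv X σ w i j) := by
  have h := fun i' => (continuous_jump X w j i').comp (continuous_snd (X := ℝ))
  simp only [Function.comp_def] at h
  unfold liftXDeriv Mesh1.liftDeriv
  exact ((continuous_const.mul (h _)).add (continuous_const.mul (h _))).neg.div_const _

variable [Fintype ι] [Fintype κ] (Y : Mesh1 κ)

lemma ip2_dxOp_eq_lift (σ : ℝ) (p w : V2 ι κ k) :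
    ip2 X Y (dxOp X σ p) w = ∑ i, ∑ j, ∫ z in cellXY X Y i j,
      ((p i j).eval z * (liftXDeriv X σ w i j z - (dcX w i j).eval z)
        + (dcX p i j).eval z * liftX X σ w i j z) := by
  rw [ip2_eq_sum_ip, sum_comm]
  refine sum_congr rfl fun j _ => ?_
  simp only [sx_dxOp, Mesh1.ip_D, Mesh1.bform_eq_lift]
  have hc : ∀ i, Continuous fun z : ℝ × ℝ =>
      (p i j).eval z * (liftXDeriv X σ w i j z - (dcX w i j).eval z)
        + (dcX p i j).eval z * liftX X σ w i j z := fun i => by fun_prop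
  have he : ∀ i x y, ev (sx p j y i) x * (X.liftDeriv σ (X.jump (sx w j y)) i
      - ev (dc (sx w j y i)) x) + ev (dc (sx p j y i)) x * X.lift σ (X.jump (sx w j y)) i x
      = (p i j).eval (x, y) * (liftXDeriv X σ w i j (x, y) - (dcX w i j).eval (x, y))
        + (dcX p i j).eval (x, y) * liftX X σ w i j (x, y) := fun i x y => by
    simp only [sx, dcX, eval_eq_slx, slx_dcx, liftX, liftXDeriv]
  simp only [he]
  rw [intervalIntegral.integral_finsetSum]
  · exact sum_congr rfl fun i _ =>
      (integral_rect (hc i) (X.lt i).le (Y.lt j).le).symm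
  · intro i _
    apply Continuous.intervalIntegrable
    refine continuous_parametric_intervalIntegral_of_continuous' ?_ _ _
    exact (hc i).comp (by fun_prop : Continuous fun p : ℝ × ℝ => (p.2, p.1))

lemma sum_integral_le_jumpSq (c : ℝ) (w : V2 ι κ k) {f : ι → κ → ℝ × ℝ → ℝ}
    (hf : ∀ i j, Continuous (f i j))
    (h : ∀ i j, ∀ z ∈ cellXY X Y i j, f i j z ≤ c / (X.R i - X.L i)
      * (X.jump (sx w j z.2) i ^ 2 + X.jump (sx w j z.2) (X.next.symm i) ^ 2)) :
    ∑ i, ∑ j, ∫ z in cellXY X Y i j, f i j z ≤ 2 * c * jumpSq X Y w := by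
  have hJ := fun i' j => continuous_jump X w j i'
  rw [sum_comm, jumpSq, mul_sum]
  refine sum_le_sum fun j _ => ?_
  rw [← intervalIntegral.integral_const_mul]
  have e : ∀ y, 2 * c * ∑ i, X.jump (sx w j y) i ^ 2
      = ∑ i, c * (X.jump (sx w j y) i ^ 2 + X.jump (sx w j y) (X.next.symm i) ^ 2) := fun y => by
    rw [← mul_sum, Mesh1.sum_sq_add_symm]; ring
  simp only [e]
  rw [intervalIntegral.integral_finsetSum fun i _ => by
    apply Continuous.intervalIntegrable
    exact continuous_const.mul (((hJ i j).pow 2).add ((hJ _ j).pow 2))]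
  refine sum_le_sum fun i _ => ?_
  have hp := sub_pos.2 (X.lt i)
  have hg : Continuous fun z : ℝ × ℝ => c / (X.R i - X.L i)
      * (X.jump (sx w j z.2) i ^ 2 + X.jump (sx w j z.2) (X.next.symm i) ^ 2) :=
    continuous_const.mul ((((hJ i j).pow 2).add ((hJ _ j).pow 2)).comp continuous_snd)
  have h1 : ∫ z in cellXY X Y i j, f i j z ≤ ∫ z in cellXY X Y i j, c / (X.R i - X.L i)
      * (X.jump (sx w j z.2) i ^ 2 + X.jump (sx w j z.2) (X.next.symm i) ^ 2) :=
    setIntegral_mono_on (integrableOn_rect (hf i j) _ _ _ _) (integrableOn_rect hg _ _ _ _)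
      (measurableSet_Ioo.prod measurableSet_Ioo) (h i j)
  refine h1.trans (le_of_eq ?_)
  rw [cellXY, integral_rect hg (X.lt i).le (Y.lt j).le]
  refine intervalIntegral.integral_congr fun y _ => ?_
  simp only [intervalIntegral.integral_const, smul_eq_mul]
  field_simp

end JumpLift

/-! ### The consistency error of the discrete derivative -/

section Consistency

variable {ι κ : Type} [Fintype ι] [Fintype κ] {k : ℕ} {X : Mesh1 ι} {Y : Mesh1 κ}

lemma sq_sum_integral_mul_le {f g : ι → κ → ℝ × ℝ → ℝ}
    (hf : ∀ i j, MemLp (f i j) 2 vol[cellXY X Y i j])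
    (hg : ∀ i j, MemLp (g i j) 2 vol[cellXY X Y i j]) :
    (∑ i, ∑ j, ∫ z in cellXY X Y i j, f i j z * g i j z) ^ 2
      ≤ (∑ i, ∑ j, ∫ z in cellXY X Y i j, f i j z ^ 2)
        * ∑ i, ∑ j, ∫ z in cellXY X Y i j, g i j z ^ 2 := by
  simp only [← Fintype.sum_prod_type']
  have h0 : ∀ (f : ι → κ → ℝ × ℝ → ℝ) (p : ι × κ),
      0 ≤ ∫ z in cellXY X Y p.1 p.2, f p.1 p.2 z ^ 2 := fun f p =>
    integral_nonneg fun _ => sq_nonneg _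
  have h1 : |∑ p : ι × κ, ∫ z in cellXY X Y p.1 p.2, f p.1 p.2 z * g p.1 p.2 z|
      ≤ ∑ p : ι × κ, Real.sqrt (∫ z in cellXY X Y p.1 p.2, f p.1 p.2 z ^ 2)
        * Real.sqrt (∫ z in cellXY X Y p.1 p.2, g p.1 p.2 z ^ 2) := by
    refine (Finset.abs_sum_le_sum_abs _ _).trans (sum_le_sum fun p _ => ?_)
    rw [← Real.sqrt_mul (h0 f p)]
    exact Real.abs_le_sqrt (sq_integral_mul_le (hf _ _) (hg _ _))
  have h2 := Finset.sum_mul_sq_le_sq_mul_sq Finset.univ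
    (fun p : ι × κ => Real.sqrt (∫ z in cellXY X Y p.1 p.2, f p.1 p.2 z ^ 2))
    (fun p : ι × κ => Real.sqrt (∫ z in cellXY X Y p.1 p.2, g p.1 p.2 z ^ 2))
  simp only [Real.sq_sqrt (h0 _ _)] at h2
  refine le_trans ?_ h2
  rw [← sq_abs]
  exact pow_le_pow_left₀ (abs_nonneg _) h1 2

lemma memLp_rect_of_continuous {f : ℝ × ℝ → ℝ} (hf : Continuous f) (L R L' R' : ℝ) :
    MemLp f 2 vol[rect L R L' R'] :=
  (memLp_two_iff_integrable_sq hf.aestronglyMeasurable).2 (integrableOn_rect (hf.pow 2) _ _ _ _)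

/-- `Fx` is the derivative of `F` in the first variable across the vertical edges too: the pair
satisfies the rule of integration by parts with the functions `w - liftX w`, which are continuous
in the first variable and periodic. -/
def IsConforming (X : Mesh1 ι) (Y : Mesh1 κ) (k : ℕ) (σ : ℝ) (F Fx : ℝ × ℝ → ℝ) : Prop :=
  ∀ w : V2 ι κ k, ∑ i, ∑ j, ∫ z in cellXY X Y i j,
    (F z * ((dcX w i j).eval z - liftXDeriv X σ w i j z)
      + Fx z * ((w i j).eval z - liftX X σ w i j z)) = 0

lemma consistency_identity {σ : ℝ} {F Fx : ℝ × ℝ → ℝ} (hF : CellL2 X Y F) (hFx : CellL2 X Y Fx)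
    (hc : IsConforming X Y k σ F Fx) (w : V2 ι κ k) :
    mom X Y Fx w - ip2 X Y (dxOp X σ (proj X Y k F)) w
      = (∑ i, ∑ j, ∫ z in cellXY X Y i j,
          (F z - (proj X Y k F i j).eval z) * liftXDeriv X σ w i j z)
        + ∑ i, ∑ j, ∫ z in cellXY X Y i j,
          (Fx z - (dcX (proj X Y k F) i j).eval z) * liftX X σ w i j z := by
  set P := proj X Y k F with hP
  have hm : ∀ {f : ℝ × ℝ → ℝ}, Continuous f → ∀ i j,
      MemLp f 2 vol[cellXY X Y i j] := fun hf i j =>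
    memLp_rect_of_continuous hf _ _ _ _
  have hp := ip2_proj (X := X) (Y := Y) F (dcX w)
  rw [← hP, ip2_apply, mom_apply hF] at hp
  have hc' := hc w
  rw [mom_apply hFx, ip2_dxOp_eq_lift]
  have key : ∀ i j, (∫ z in cellXY X Y i j, Fx z * (w i j).eval z)
      - (∫ z in cellXY X Y i j, ((P i j).eval z * (liftXDeriv X σ w i j z - (dcX w i j).eval z)
        + (dcX P i j).eval z * liftX X σ w i j z))
      = (∫ z in cellXY X Y i j, (F z - (P i j).eval z) * liftXDeriv X σ w i j z)
        + (∫ z in cellXY X Y i j, (Fx z - (dcX P i j).eval z) * liftX X σ w i j z)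
        + (∫ z in cellXY X Y i j, (F z * ((dcX w i j).eval z - liftXDeriv X σ w i j z)
          + Fx z * ((w i j).eval z - liftX X σ w i j z)))
        + ((∫ z in cellXY X Y i j, (P i j).eval z * (dcX w i j).eval z)
          - ∫ z in cellXY X Y i j, F z * (dcX w i j).eval z) := by
    intro i j
    have c1 : Continuous (fun z => liftXDeriv X σ w i j z - (dcX w i j).eval z) := by fun_prop
    have i1 : IntegrableOn (fun z => Fx z * (w i j).eval z) (cellXY X Y i j) :=
      (hFx i j).integrable_mul (hm (continuous_eval _) i j)
    have i2 : IntegrableOn (fun z => (P i j).eval z * (liftXDeriv X σ w i j z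
        - (dcX w i j).eval z) + (dcX P i j).eval z * liftX X σ w i j z) (cellXY X Y i j) :=
      integrableOn_rect (by fun_prop) _ _ _ _
    have i3 : IntegrableOn (fun z => (F z - (P i j).eval z) * liftXDeriv X σ w i j z)
        (cellXY X Y i j) := ((hF i j).sub (hm (continuous_eval _) i j)).integrable_mul
          (hm (continuous_liftXDeriv X σ w i j) i j)
    have i4 : IntegrableOn (fun z => (Fx z - (dcX P i j).eval z) * liftX X σ w i j z)
        (cellXY X Y i j) := ((hFx i j).sub (hm (continuous_eval _) i j)).integrable_mul
          (hm (continuous_liftX X σ w i j) i j)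
    have i5 : IntegrableOn (fun z => F z * ((dcX w i j).eval z - liftXDeriv X σ w i j z)
        + Fx z * ((w i j).eval z - liftX X σ w i j z)) (cellXY X Y i j) :=
      ((hF i j).integrable_mul (hm (by fun_prop) i j)).add
        ((hFx i j).integrable_mul (hm (by fun_prop) i j))
    have i6 : IntegrableOn (fun z => (P i j).eval z * (dcX w i j).eval z) (cellXY X Y i j) :=
      integrableOn_rect (by fun_prop) _ _ _ _
    have i7 : IntegrableOn (fun z => F z * (dcX w i j).eval z) (cellXY X Y i j) :=
      (hF i j).integrable_mul (hm (continuous_eval _) i j)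
    rw [← integral_sub' i1 i2, ← integral_add' i3 i4, ← integral_add' (i3.add i4) i5,
      ← integral_sub' i6 i7, ← integral_add' ((i3.add i4).add i5) (i6.sub i7)]
    congr 1; funext z
    simp only [Pi.add_apply, Pi.sub_apply]
    ring
  have hsum := sum_congr (rfl : (Finset.univ : Finset ι) = _) fun i _ =>
    sum_congr (rfl : (Finset.univ : Finset κ) = _) fun j _ => key i j
  simp only [sum_add_distrib, sum_sub_distrib] at hsum
  rw [hsum, hp, hc']
  ring

lemma cellSq_nonneg (F : ℝ × ℝ → ℝ) : 0 ≤ cellSq X Y F :=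
  sum_nonneg fun _ _ => sum_nonneg fun _ _ => integral_nonneg fun _ => sq_nonneg _

lemma jumpSq_nonneg (w : V2 ι κ k) : 0 ≤ jumpSq X Y w := sum_nonneg fun j _ =>
  intervalIntegral.integral_nonneg (Y.lt j).le fun _ _ => sum_nonneg fun _ _ => sq_nonneg _

lemma exists_consistency (k : ℕ) (ρ σ : ℝ) : ∃ C : ℝ, 0 < C ∧ ∀ n ≤ k,
    ∀ {ι κ : Type} [Fintype ι] [Fintype κ] (X : Mesh1 ι) (Y : Mesh1 κ) (h : ℝ), 0 < h →
    QuasiUnif X ρ h → QuasiUnif Y ρ h → ∀ g g' : ℕ → ℝ × ℝ → ℝ,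
    DerivChain X Y (n + 1) g → DerivChain Y X (n + 1) g' → (∀ z, g' 0 z = g 0 z.swap) →
    IsConforming X Y k σ (g 0) (g 1) → ∀ w : V2 ι κ k,
    (mom X Y (g 1) w - ip2 X Y (dxOp X σ (proj X Y k (g 0))) w) ^ 2
      ≤ C * h ^ (2 * n + 1) * (cellSq X Y (g (n + 1)) + cellSq Y X (g' (n + 1)))
        * jumpSq X Y w := by
  obtain ⟨C, hC, hproj⟩ := exists_proj_estimate k ρ
  set s : ℝ := σ ^ 2 + (1 - σ) ^ 2 with hs
  have hs0 : 0 ≤ s := by positivity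
  refine ⟨8 * C * s * (|ρ| + 1) + 1, by positivity,
    fun n hn {ι κ} _ _ X Y h hh hX hY g g' hg hg' h0 hcf w => ?_⟩
  obtain ⟨hp1, hp2⟩ := hproj n hn X Y h hX hY g g' hg hg' h0
  set N := cellSq X Y (g (n + 1)) + cellSq Y X (g' (n + 1)) with hN
  have hN0 : 0 ≤ N := add_nonneg (cellSq_nonneg _) (cellSq_nonneg _)
  have hJ0 : 0 ≤ jumpSq X Y w := jumpSq_nonneg w
  have hF := hg.memLp 0 (by omega)
  have hFx := hg.memLp 1 (by omega)
  have hm : ∀ {f : ℝ × ℝ → ℝ}, Continuous f → ∀ i j,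
      MemLp f 2 vol[cellXY X Y i j] := fun hf i j =>
    memLp_rect_of_continuous hf _ _ _ _
  -- the lifting is of size `h` times the jumps, its derivative of size `1 / h`
  have hl1 : ∑ i, ∑ j, ∫ z in cellXY X Y i j, liftXDeriv X σ w i j z ^ 2
      ≤ 2 * (2 * s * (|ρ| / h)) * jumpSq X Y w := by
    refine sum_integral_le_jumpSq X Y _ w (fun i j => by fun_prop) fun i j z hz => ?_
    have hp := sub_pos.2 (X.lt i)
    refine (X.sq_liftDeriv_le σ _ i).trans ?_
    rw [← hs]
    have e1 : 1 / (X.R i - X.L i) ≤ |ρ| / h := by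
      rw [div_le_div_iff₀ hp hh, one_mul]
      exact (hX.ge i).trans (mul_le_mul_of_nonneg_right (le_abs_self ρ) hp.le)
    calc _ = 2 * s * (1 / (X.R i - X.L i)) / (X.R i - X.L i)
          * (X.jump (sx w j z.2) i ^ 2 + X.jump (sx w j z.2) (X.next.symm i) ^ 2) := by
            field_simp
      _ ≤ _ := by gcongr
  have hl2 : ∑ i, ∑ j, ∫ z in cellXY X Y i j, liftX X σ w i j z ^ 2
      ≤ 2 * (2 * s * h) * jumpSq X Y w := by
    refine sum_integral_le_jumpSq X Y _ w (fun i j => by fun_prop) fun i j z hz => ?_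
    have hp := sub_pos.2 (X.lt i)
    refine (X.sq_lift_le σ _ i (Ioo_subset_Icc_self hz.1)).trans ?_
    rw [← hs]
    refine mul_le_mul_of_nonneg_right ?_ (by positivity)
    rw [le_div_iff₀ hp]
    exact mul_le_mul_of_nonneg_left (hX.le i) (by positivity)
  rw [consistency_identity hF hFx hcf]
  have t1 := sq_sum_integral_mul_le (X := X) (Y := Y)
    (f := fun i j z => g 0 z - (proj X Y k (g 0) i j).eval z)
    (g := fun i j => liftXDeriv X σ w i j)
    (fun i j => (hF i j).sub (hm (continuous_eval _) i j)) (fun i j => hm (by fun_prop) i j)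
  have t2 := sq_sum_integral_mul_le (X := X) (Y := Y)
    (f := fun i j z => g 1 z - (dcX (proj X Y k (g 0)) i j).eval z)
    (g := fun i j => liftX X σ w i j)
    (fun i j => (hFx i j).sub (hm (continuous_eval _) i j)) (fun i j => hm (by fun_prop) i j)
  have n1 : 0 ≤ ∑ i, ∑ j, ∫ z in cellXY X Y i j, liftXDeriv X σ w i j z ^ 2 :=
    sum_nonneg fun _ _ => sum_nonneg fun _ _ => integral_nonneg fun _ => sq_nonneg _
  have n2 : 0 ≤ ∑ i, ∑ j, ∫ z in cellXY X Y i j, liftX X σ w i j z ^ 2 :=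
    sum_nonneg fun _ _ => sum_nonneg fun _ _ => integral_nonneg fun _ => sq_nonneg _
  replace t1 := t1.trans (mul_le_mul hp1 hl1 n1 (by positivity))
  replace t2 := t2.trans (mul_le_mul hp2 hl2 n2 (by positivity))
  have e1 : C * h ^ (2 * n + 2) * N * (2 * (2 * s * (|ρ| / h)) * jumpSq X Y w)
      = 4 * C * s * |ρ| * (h ^ (2 * n + 1) * N * jumpSq X Y w) := by
    field_simp
    ring
  have e2 : C * h ^ (2 * n) * N * (2 * (2 * s * h) * jumpSq X Y w)
      = 4 * C * s * (h ^ (2 * n + 1) * N * jumpSq X Y w) := by ring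
  rw [e1] at t1
  rw [e2] at t2
  have hB : 0 ≤ h ^ (2 * n + 1) * N * jumpSq X Y w := by positivity
  set A1 := ∑ i, ∑ j, ∫ z in cellXY X Y i j,
    (g 0 z - (proj X Y k (g 0) i j).eval z) * liftXDeriv X σ w i j z
  set A2 := ∑ i, ∑ j, ∫ z in cellXY X Y i j,
    (g 1 z - (dcX (proj X Y k (g 0)) i j).eval z) * liftX X σ w i j z
  nlinarith [sq_nonneg (A1 - A2)]

end Consistency

/-! ### The elliptic projection -/

section Elliptic

variable {ι κ : Type} {k : ℕ} {X : Mesh1 ι} {Y : Mesh1 κ}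

/-- `G m n` is the broken weak derivative `∂_x^m ∂_y^n` of `G 0 0`, for `m + n ≤ r`. -/
structure BrokenSmooth (X : Mesh1 ι) (Y : Mesh1 κ) (r : ℕ) (G : ℕ → ℕ → ℝ × ℝ → ℝ) : Prop where
  memLp : ∀ m n, m + n ≤ r → CellL2 X Y (G m n)
  derivX : ∀ m n, m + n < r → ∀ i j,
    HasTensorDeriv (X.L i) (X.R i) (Y.L j) (Y.R j) (G m n) (G (m + 1) n)
  derivY : ∀ m n, m + n < r → ∀ i j,
    HasTensorDeriv (Y.L j) (Y.R j) (X.L i) (X.R i) (fun z => G m n z.swap)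
      (fun z => G m (n + 1) z.swap)

/-- Exchange of the two variables in a family of derivatives. -/
def swapG (G : ℕ → ℕ → ℝ × ℝ → ℝ) (m n : ℕ) (z : ℝ × ℝ) : ℝ := G n m z.swap

lemma CellL2.swap {F : ℝ × ℝ → ℝ} (hF : CellL2 X Y F) : CellL2 Y X (fun z => F z.swap) := by
  intro j i
  have h := hF i j
  rw [cellXY, restrict_rect] at h ⊢
  exact h.comp_measurePreserving Measure.measurePreserving_swap

lemma BrokenSmooth.swap {r : ℕ} {G : ℕ → ℕ → ℝ × ℝ → ℝ} (hG : BrokenSmooth X Y r G) :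
    BrokenSmooth Y X r (swapG G) where
  memLp m n h := (hG.memLp n m (by omega)).swap
  derivX m n h i j := hG.derivY n m (by omega) j i
  derivY m n h i j := by
    simp only [swapG, Prod.swap_swap]
    exact hG.derivX n m (by omega) j i

lemma BrokenSmooth.chainX {r n : ℕ} {G : ℕ → ℕ → ℝ × ℝ → ℝ} (hG : BrokenSmooth X Y r G) (a b : ℕ)
    (h : a + b + n ≤ r) : DerivChain X Y n (fun l => G (a + l) b) where
  memLp l hl := hG.memLp _ _ (by omega)
  deriv l hl i j := hG.derivX _ _ (by omega) i j

variable [Fintype ι] [Fintype κ]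

lemma mom_swap {F : ℝ × ℝ → ℝ} (hF : CellL2 X Y F) (w : V2 ι κ k) :
    mom Y X (fun z => F z.swap) w.swap = mom X Y F w := by
  rw [mom_apply hF, mom_apply hF.swap, sum_comm]
  refine sum_congr rfl fun i _ => sum_congr rfl fun j _ => ?_
  rw [cellXY, cellXY, integral_rect_swap]
  refine integral_congr_ae (.of_forall fun z => ?_)
  obtain ⟨x, y⟩ := z
  simp only [V2.swap, Prod.swap_prod_mk, eval_swap]

lemma proj_swap {F : ℝ × ℝ → ℝ} (hF : CellL2 X Y F) :
    proj Y X k (fun z => F z.swap) = (proj X Y k F).swap := by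
  have h : ∀ w : V2 κ ι k,
      ip2 Y X (proj Y X k (fun z => F z.swap) - (proj X Y k F).swap) w = 0 := by
    intro w
    have e : ip2 Y X (proj X Y k F).swap w = ip2 X Y (proj X Y k F) w.swap :=
      ip2_swap X Y (proj X Y k F) w.swap
    rw [map_sub, LinearMap.sub_apply, e, ip2_proj, ip2_proj, ← mom_swap hF]
    exact sub_self _
  exact sub_eq_zero.1 (ip2_definite Y X _ (h _))

variable (X Y) in
/-- The total squared norm of all derivatives up to order `r`. -/
def smoothSq (r : ℕ) (G : ℕ → ℕ → ℝ × ℝ → ℝ) : ℝ :=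
  ∑ m ∈ Finset.range (r + 1), ∑ n ∈ Finset.range (r + 1),
    if m + n ≤ r then cellSq X Y (G m n) else 0

lemma smoothSq_nonneg (r : ℕ) (G : ℕ → ℕ → ℝ × ℝ → ℝ) : 0 ≤ smoothSq X Y r G :=
  sum_nonneg fun _ _ => sum_nonneg fun _ _ => by
    split_ifs <;> [exact cellSq_nonneg _; exact le_rfl]

lemma cellSq_le_smoothSq {r m n : ℕ} (h : m + n ≤ r) (G : ℕ → ℕ → ℝ × ℝ → ℝ) :
    cellSq X Y (G m n) ≤ smoothSq X Y r G := by
  have h1 : ∀ m' n' : ℕ, 0 ≤ if m' + n' ≤ r then cellSq X Y (G m' n') else 0 := fun m' n' => by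
    split_ifs <;> [exact cellSq_nonneg _; exact le_rfl]
  have h2 := Finset.single_le_sum (f := fun m' => ∑ n' ∈ Finset.range (r + 1),
    if m' + n' ≤ r then cellSq X Y (G m' n') else 0)
    (fun m' _ => sum_nonneg fun n' _ => h1 m' n')
    (Finset.mem_range.2 (by omega : m < r + 1))
  have h3 := Finset.single_le_sum (f := fun n' => if m + n' ≤ r then cellSq X Y (G m n') else 0)
    (fun n' _ => h1 m n') (Finset.mem_range.2 (by omega : n < r + 1))
  rw [if_pos h] at h3
  exact h3.trans h2

lemma cellSq_swap (F : ℝ × ℝ → ℝ) : cellSq Y X (fun z => F z.swap) = cellSq X Y F := by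
  rw [cellSq, cellSq, sum_comm]
  exact sum_congr rfl fun i _ => sum_congr rfl fun j _ => rect_swap_integral_sq _

lemma smoothSq_swap (r : ℕ) (G : ℕ → ℕ → ℝ × ℝ → ℝ) :
    smoothSq Y X r (swapG G) = smoothSq X Y r G := by
  rw [smoothSq, smoothSq, sum_comm]
  refine sum_congr rfl fun m _ => sum_congr rfl fun n _ => ?_
  rw [add_comm n m, show swapG G n m = fun z => G m n z.swap from rfl, cellSq_swap]

/-- The part of the residual of `P u` in the elliptic problem that comes from the second
derivative in the first variable. -/
lemma exists_residual_le (k : ℕ) (ρ : ℝ) {σ₁ : ℝ} (hσ : σ₁ ≠ 1 / 2) : ∃ C : ℝ, 0 < C ∧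
    ∀ {ι κ : Type} [Fintype ι] [Fintype κ] (X : Mesh1 ι) (Y : Mesh1 κ) (h : ℝ), 0 < h →
    QuasiUnif X ρ h → QuasiUnif Y ρ h → ∀ G : ℕ → ℕ → ℝ × ℝ → ℝ,
    BrokenSmooth X Y (max (k + 1) 2) G → IsConforming X Y k σ₁ (G 0 0) (G 1 0) →
    IsConforming X Y k (1 - σ₁) (G 1 0) (G 2 0) → ∀ (σ₂ : ℝ) (φ e : V2 ι κ k),
    (∀ v, sform X Y σ₁ σ₂ φ v = ip2 X Y e v) →
    (-mom X Y (G 2 0) φ - ip2 X Y (dxOp X σ₁ (proj X Y k (G 0 0))) (dxOp X σ₁ φ)) ^ 2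
      ≤ C * h ^ (2 * k + 2) * smoothSq X Y (max (k + 1) 2) G * ip2 X Y e e := by
  have hσ' : 1 - σ₁ ≠ 1 / 2 := fun h => hσ (by linarith)
  obtain ⟨C₁, hC₁, h1⟩ := exists_consistency k ρ σ₁
  obtain ⟨C₂, hC₂, h2⟩ := exists_consistency k ρ (1 - σ₁)
  obtain ⟨C₃, hC₃, h3⟩ := exists_jumpSq_le k hσ'
  -- the jumps of `φ` gain two powers of `h` over its second derivative (one if `k = 0`)
  have h4 : ∃ C : ℝ, 0 < C ∧ ∀ {ι κ : Type} [Fintype ι] [Fintype κ] (X : Mesh1 ι) (Y : Mesh1 κ)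
      (h : ℝ), QuasiUnif X ρ h → ∀ (σ₂ : ℝ) (φ e : V2 ι κ k),
      (∀ v, sform X Y σ₁ σ₂ φ v = ip2 X Y e v) → 0 < h →
      h ^ (2 * (k - 1) + 1) * jumpSq X Y φ ≤ C * h ^ (2 * k + 2) * ip2 X Y e e := by
    rcases Nat.eq_zero_or_pos k with rfl | hk
    · obtain ⟨C, hC, hj⟩ := exists_jumpSq_le 0 hσ
      refine ⟨C, hC, fun {ι κ} _ _ X Y h hX σ₂ φ e hφ hh => ?_⟩
      have r1 := (regularity_x X Y σ₁ σ₂ hφ).1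
      have r2 := (hj X Y h hX.le φ).trans (mul_le_mul_of_nonneg_left r1 (by positivity))
      calc _ ≤ h ^ (2 * (0 - 1) + 1) * (C * h * ip2 X Y e e) :=
            mul_le_mul_of_nonneg_left r2 (by positivity)
        _ = _ := by simp; ring
    · obtain ⟨C, hC, hj⟩ := exists_jumpSq_le_deriv hk hσ
      obtain ⟨C', hC', hj'⟩ := exists_dcX_le k hσ' ρ
      refine ⟨C * C', by positivity, fun {ι κ} _ _ X Y h hX σ₂ φ e hφ hh => ?_⟩
      have r1 := (regularity_x X Y σ₁ σ₂ hφ).2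
      have r2 := (hj' X Y h hX.le hX.ge (dxOp X σ₁ φ)).trans
        (mul_le_mul_of_nonneg_left r1 hC'.le)
      have r3 := (hj X Y h hX.le φ).trans (mul_le_mul_of_nonneg_left r2 (by positivity))
      calc _ ≤ h ^ (2 * (k - 1) + 1) * (C * h ^ 3 * (C' * ip2 X Y e e)) :=
            mul_le_mul_of_nonneg_left r3 (by positivity)
        _ = C * C' * h ^ (2 * (k - 1) + 1 + 3) * ip2 X Y e e := by ring
        _ = _ := by rw [show 2 * (k - 1) + 1 + 3 = 2 * k + 2 by omega]
  obtain ⟨C₄, hC₄, h4⟩ := h4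
  refine ⟨4 * C₁ * C₃ + 4 * C₂ * C₄, by positivity,
    fun {ι κ} _ _ X Y h hh hX hY G hG hc1 hc2 σ₂ φ e hφ => ?_⟩
  set r := max (k + 1) 2 with hr
  have hr1 : k + 1 ≤ r := le_max_left _ _
  have hr2 : 2 ≤ r := le_max_right _ _
  have hr3 : k - 1 + 2 ≤ r := by omega
  set N := smoothSq X Y r G with hN
  have hN0 : 0 ≤ N := smoothSq_nonneg _ _
  set w := dxOp X σ₁ φ with hw
  have he0 := ip2_self_nonneg X Y e
  have E1 := h1 k le_rfl X Y h hh hX hY (fun l => G (0 + l) 0) (fun l => swapG G (0 + l) 0)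
    (hG.chainX 0 0 (by omega)) (hG.swap.chainX 0 0 (by omega)) (fun z => rfl) hc1 w
  have E2 := h2 (k - 1) (by omega) X Y h hh hX hY (fun l => G (1 + l) 0)
    (fun l => swapG G (0 + l) 1) (hG.chainX 1 0 (by omega)) (hG.swap.chainX 0 1 (by omega))
    (fun z => rfl) hc2 φ
  simp only [zero_add, add_zero, Nat.reduceAdd] at E1 E2
  have s1 : cellSq X Y (G (k + 1) 0) + cellSq Y X (swapG G (k + 1) 0) ≤ 2 * N := by
    have a1 := cellSq_le_smoothSq (X := X) (Y := Y) (m := k + 1) (n := 0) (r := r) (by omega) G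
    have a2 := cellSq_le_smoothSq (X := Y) (Y := X) (m := k + 1) (n := 0) (r := r) (by omega)
      (swapG G)
    rw [smoothSq_swap] at a2
    linarith
  have s2 : cellSq X Y (G (1 + (k - 1 + 1)) 0) + cellSq Y X (swapG G (k - 1 + 1) 1) ≤ 2 * N := by
    have a1 := cellSq_le_smoothSq (X := X) (Y := Y) (m := 1 + (k - 1 + 1)) (n := 0) (r := r)
      (by omega) G
    have a2 := cellSq_le_smoothSq (X := Y) (Y := X) (m := k - 1 + 1) (n := 1) (r := r) (by omega)
      (swapG G)
    rw [smoothSq_swap] at a2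
    linarith
  have hJ1 := (h3 X Y h hX.le w).trans (mul_le_mul_of_nonneg_left
    (regularity_x X Y σ₁ σ₂ hφ).2 (by positivity))
  have hJ2 := h4 X Y h hX σ₂ φ e hφ hh
  set E1' := mom X Y (G 1 0) w - ip2 X Y (dxOp X σ₁ (proj X Y k (G 0 0))) w
  set E2' := mom X Y (G 2 0) φ - ip2 X Y (dxOp X (1 - σ₁) (proj X Y k (G 1 0))) φ
  have b1 : E1' ^ 2 ≤ 2 * C₁ * C₃ * (h ^ (2 * k + 2) * N * ip2 X Y e e) :=
    calc E1' ^ 2 ≤ C₁ * h ^ (2 * k + 1) * (2 * N) * (C₃ * h * ip2 X Y e e) := by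
          refine E1.trans (mul_le_mul (mul_le_mul_of_nonneg_left s1 (by positivity)) hJ1
            (jumpSq_nonneg _)
            (by positivity))
      _ = _ := by ring
  have b2 : E2' ^ 2 ≤ 2 * C₂ * C₄ * (h ^ (2 * k + 2) * N * ip2 X Y e e) :=
    calc E2' ^ 2 ≤ C₂ * h ^ (2 * (k - 1) + 1) * (2 * N) * jumpSq X Y φ :=
          E2.trans (mul_le_mul_of_nonneg_right (mul_le_mul_of_nonneg_left s2 (by positivity))
            (jumpSq_nonneg _))
      _ = 2 * C₂ * N * (h ^ (2 * (k - 1) + 1) * jumpSq X Y φ) := by ring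
      _ ≤ 2 * C₂ * N * (C₄ * h ^ (2 * k + 2) * ip2 X Y e e) :=
          mul_le_mul_of_nonneg_left hJ2 (by positivity)
      _ = _ := by ring
  have hid : -mom X Y (G 2 0) φ - ip2 X Y (dxOp X σ₁ (proj X Y k (G 0 0))) w = E1' - E2' := by
    have : ip2 X Y (dxOp X (1 - σ₁) (proj X Y k (G 1 0))) φ = -mom X Y (G 1 0) w := by
      rw [ip2_dxOp_left, sub_sub_cancel, ip2_proj]
    simp only [E1', E2', this]; ring
  rw [hid]
  nlinarith [sq_nonneg (E1' + E2')]

/-- The elliptic projection of `u = G 0 0` is superclose to its `L²` projection. -/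
lemma exists_elliptic_estimate (k : ℕ) (ρ : ℝ) {σ₁ σ₂ : ℝ} (hσ₁ : σ₁ ≠ 1 / 2)
    (hσ₂ : σ₂ ≠ 1 / 2) : ∃ C : ℝ, 0 < C ∧
    ∀ {ι κ : Type} [Fintype ι] [Fintype κ] (X : Mesh1 ι) (Y : Mesh1 κ) (h : ℝ), 0 < h →
    QuasiUnif X ρ h → QuasiUnif Y ρ h → ∀ G : ℕ → ℕ → ℝ × ℝ → ℝ,
    BrokenSmooth X Y (max (k + 1) 2) G →
    IsConforming X Y k σ₁ (G 0 0) (G 1 0) → IsConforming X Y k (1 - σ₁) (G 1 0) (G 2 0) →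
    IsConforming Y X k σ₂ (swapG G 0 0) (swapG G 1 0) →
    IsConforming Y X k (1 - σ₂) (swapG G 1 0) (swapG G 2 0) → ∀ r : V2 ι κ k,
    (∀ v, sform X Y σ₁ σ₂ r v
      = mom X Y (G 0 0) v - mom X Y (G 2 0) v - mom X Y (G 0 2) v) →
    ip2 X Y (r - proj X Y k (G 0 0)) (r - proj X Y k (G 0 0))
      ≤ C * h ^ (2 * k + 2) * smoothSq X Y (max (k + 1) 2) G := by
  obtain ⟨C₁, hC₁, h1⟩ := exists_residual_le k ρ hσ₁
  obtain ⟨C₂, hC₂, h2⟩ := exists_residual_le k ρ hσ₂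
  refine ⟨2 * (C₁ + C₂), by positivity,
    fun {ι κ} _ _ X Y h hh hX hY G hG hx1 hx2 hy1 hy2 r hr => ?_⟩
  set P := proj X Y k (G 0 0) with hP
  set e := r - P with he
  set φ := riesz (sform X Y σ₁ σ₂) (sform_definite X Y σ₁ σ₂) (ip2 X Y e) with hφ
  have hφe : ∀ v, sform X Y σ₁ σ₂ φ v = ip2 X Y e v := fun v => riesz_apply _ _ _ _
  have hφs : ∀ v, sform Y X σ₂ σ₁ φ.swap v = ip2 Y X e.swap v := fun v => by
    have a1 := sform_swap X Y σ₁ σ₂ φ v.swap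
    have a2 := ip2_swap X Y e v.swap
    have a3 : v.swap.swap = v := rfl
    rw [a3] at a1 a2
    rw [a1, a2, hφe]
  have E1 := h1 X Y h hh hX hY G hG hx1 hx2 σ₂ φ e hφe
  have E2 := h2 Y X h hh hY hX (swapG G) hG.swap hy1 hy2 σ₁ φ.swap e.swap hφs
  rw [smoothSq_swap, ip2_swap] at E2
  have hs1 : proj Y X k (swapG G 0 0) = P.swap := proj_swap (hG.memLp 0 0 (by omega))
  have hs2 : mom Y X (swapG G 2 0) φ.swap = mom X Y (G 0 2) φ :=
    mom_swap (hG.memLp 0 2 (by simp)) φ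
  have hs3 : ip2 Y X (dxOp Y σ₂ P.swap) (dxOp Y σ₂ φ.swap)
      = ip2 X Y (dyOp Y σ₂ P) (dyOp Y σ₂ φ) := by
    rw [← swap_dyOp, ← swap_dyOp, ip2_swap]
  rw [hs1, hs2, hs3] at E2
  have key : ip2 X Y e e
      = (-mom X Y (G 2 0) φ - ip2 X Y (dxOp X σ₁ P) (dxOp X σ₁ φ))
        + (-mom X Y (G 0 2) φ - ip2 X Y (dyOp Y σ₂ P) (dyOp Y σ₂ φ)) := by
    rw [← hφe, sform_comm, he, map_sub, LinearMap.sub_apply, hr, sform_apply, hP, ip2_proj]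
    ring
  set ρ1 := -mom X Y (G 2 0) φ - ip2 X Y (dxOp X σ₁ P) (dxOp X σ₁ φ)
  set ρ2 := -mom X Y (G 0 2) φ - ip2 X Y (dyOp Y σ₂ P) (dyOp Y σ₂ φ)
  have he0 := ip2_self_nonneg X Y e
  have hN0 := smoothSq_nonneg (X := X) (Y := Y) (max (k + 1) 2) G
  have hB : 0 ≤ h ^ (2 * k + 2) * smoothSq X Y (max (k + 1) 2) G := by positivity
  set B := h ^ (2 * k + 2) * smoothSq X Y (max (k + 1) 2) G with hBdef
  have hsq : ip2 X Y e e ^ 2 ≤ 2 * (C₁ + C₂) * B * ip2 X Y e e := by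
    rw [mul_assoc C₁, mul_comm, ← mul_assoc] at E1
    rw [mul_assoc C₂, mul_comm, ← mul_assoc] at E2
    have : ip2 X Y e e ^ 2 = (ρ1 + ρ2) ^ 2 := by rw [key]
    nlinarith [sq_nonneg (ρ1 - ρ2)]
  rw [mul_assoc, ← hBdef]
  by_contra hlt
  rw [not_le] at hlt
  have hB2 : 0 ≤ 2 * (C₁ + C₂) * B := by positivity
  nlinarith

end Elliptic

/-! ### The kernel of the fractional derivative -/

section Kernel

/-- The kernel `r^{-α}` on `(0, T)`, extended by zero. -/
def ker (α T r : ℝ) : ℝ := (Ioo 0 T).indicator (fun r => r ^ (-α)) r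

lemma measurable_ker (α T : ℝ) : Measurable (ker α T) :=
  (measurable_id.pow_const (-α)).indicator measurableSet_Ioo

lemma ker_nonneg (α T r : ℝ) : 0 ≤ ker α T r :=
  indicator_nonneg (fun _ hr => Real.rpow_nonneg hr.1.le _) _

variable {α T : ℝ}

lemma ker_of_pos {r : ℝ} (h : 0 < r) (h' : r < T) : ker α T r = r ^ (-α) :=
  indicator_of_mem (show r ∈ Ioo 0 T from ⟨h, h'⟩) _

lemma intervalIntegrable_rpow_neg (hα : α < 1) (a b : ℝ) :
    IntervalIntegrable (fun r => r ^ (-α)) volume a b :=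
  intervalIntegral.intervalIntegrable_rpow' (by linarith)

lemma integrable_ker (hα : α < 1) (hT : 0 ≤ T) : Integrable (ker α T) :=
  (((intervalIntegrable_iff_integrableOn_Ioc_of_le hT).1
    (intervalIntegrable_rpow_neg hα 0 T)).mono_set Ioo_subset_Ioc_self).integrable_indicator
    measurableSet_Ioo

lemma integral_ker (hα : α < 1) (hT : 0 ≤ T) : ∫ r, ker α T r = T ^ (1 - α) / (1 - α) := by
  unfold ker
  rw [integral_indicator measurableSet_Ioo, ← integral_Ioc_eq_integral_Ioo,
    ← integral_of_le hT, integral_rpow (Or.inl (by linarith)),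
    Real.zero_rpow (by linarith), sub_zero, show -α + 1 = 1 - α by ring]

lemma lintegral_ker (hα : α < 1) (hT : 0 ≤ T) :
    ∫⁻ r, ‖ker α T r‖ₑ = ENNReal.ofReal (T ^ (1 - α) / (1 - α)) := by
  rw [← integral_ker hα hT, ofReal_integral_eq_lintegral_ofReal (integrable_ker hα hT)
    (.of_forall fun r => ker_nonneg α T r)]
  exact lintegral_congr fun r => Real.enorm_eq_ofReal (ker_nonneg α T r)

lemma ker_mul_eq (t : ℝ) (ht : t ∈ Ioo 0 T) (f : ℝ → ℝ) :
    ∫ s in Ioo 0 T, ker α T (t - s) * f s = ∫ s in (0 : ℝ)..t, (t - s) ^ (-α) * f s := by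
  have h1 : ∀ s ∈ Ioo 0 T, ker α T (t - s) * f s
      = (Iio t).indicator (fun s => (t - s) ^ (-α) * f s) s := by
    intro s hs
    by_cases h : s < t
    · rw [ker_of_pos (by linarith) (by linarith [hs.1, ht.2]),
        indicator_of_mem (show s ∈ Iio t from h)]
    · rw [ker, indicator_of_notMem (fun h' => h (by linarith [h'.1])),
        indicator_of_notMem (show s ∉ Iio t from h), zero_mul]
  rw [setIntegral_congr_fun measurableSet_Ioo h1, setIntegral_indicator measurableSet_Iio,
    integral_of_le ht.1.le, integral_Ioc_eq_integral_Ioo]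
  congr 2
  ext s
  simp only [mem_inter_iff, mem_Ioo, mem_Iio]
  exact ⟨fun h => ⟨h.1.1, h.2⟩, fun h => ⟨⟨h.1, h.2.trans ht.2⟩, h.2⟩⟩

/-- The Caputo substantial derivative of a function with derivative `f'`, in integrated form. -/
def fracD (α T κ : ℝ) (f f' : ℝ → ℝ) (t : ℝ) : ℝ :=
  (1 / Real.Gamma (1 - α)) * (exp (-κ * t)
    * ∫ s in Ioo 0 T, ker α T (t - s) * (exp (κ * s) * (f' s + κ * f s)))

lemma ae_deriv_eq {f f' : ℝ → ℝ} (hT : 0 ≤ T) (hf' : IntervalIntegrable f' volume 0 T)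
    (hf : ∀ t ∈ Icc 0 T, f t = f 0 + ∫ s in (0 : ℝ)..t, f' s) :
    ∀ᵐ t, t ∈ Ioo 0 T → HasDerivAt f (f' t) t := by
  filter_upwards [hf'.ae_hasDerivAt_integral] with t h ht
  have h1 := (h (by rw [uIcc_of_le hT]; exact Ioo_subset_Icc_self ht) 0 left_mem_uIcc).const_add
    (f 0)
  refine h1.congr_of_eventuallyEq ?_
  filter_upwards [Icc_mem_nhds ht.1 ht.2] with s hs using hf s hs

lemma substCaputo_eq_fracD {κ : ℝ} {f f' : ℝ → ℝ} (hT : 0 ≤ T)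
    (hf' : IntervalIntegrable f' volume 0 T)
    (hf : ∀ t ∈ Icc 0 T, f t = f 0 + ∫ s in (0 : ℝ)..t, f' s) {t : ℝ} (ht : t ∈ Ioo 0 T) :
    substCaputo α κ f t = fracD α T κ f f' t := by
  rw [substCaputo, caputo, fracD, ker_mul_eq t ht]
  have : ∫ τ in (0 : ℝ)..t, (t - τ) ^ (-α) * deriv (fun τ => exp (κ * τ) * f τ) τ
      = ∫ s in (0 : ℝ)..t, (t - s) ^ (-α) * (exp (κ * s) * (f' s + κ * f s)) := by
    refine intervalIntegral.integral_congr_ae ?_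
    have hne : ∀ᵐ s : ℝ, s ≠ t := by
      rw [ae_iff]; simp
    filter_upwards [ae_deriv_eq hT hf' hf, hne] with s hs hst hst'
    rw [uIoc_of_le ht.1.le] at hst'
    have h1 := hs ⟨hst'.1, hst'.2.trans_lt ht.2⟩
    have h2 : HasDerivAt (fun τ => exp (κ * τ)) (exp (κ * s) * κ) s := by
      simpa using ((hasDerivAt_id s).const_mul κ).exp
    have h3 : deriv (fun τ => exp (κ * τ) * f τ) s = _ := (h2.mul h1).deriv
    rw [h3]
    ring
  rw [this]; ring

end Kernel

/-! ### Coercivity of the fractional derivative -/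

section Coercivity

variable {α T : ℝ}

lemma continuousOn_of_primitive {g g' : ℝ → ℝ} (hT : 0 ≤ T)
    (hg' : IntervalIntegrable g' volume 0 T)
    (hg : ∀ t ∈ Icc 0 T, g t = g 0 + ∫ s in (0 : ℝ)..t, g' s) : ContinuousOn g (Icc 0 T) := by
  have h := continuousOn_primitive_interval' hg' left_mem_uIcc
  rw [uIcc_of_le hT] at h
  exact (continuousOn_const.add h).congr fun t ht => hg t ht

lemma abs_le_of_continuousOn {g : ℝ → ℝ} (hc : ContinuousOn g (Icc 0 T)) :
    ∃ G, 0 ≤ G ∧ ∀ t ∈ Icc 0 T, |g t| ≤ G := by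
  obtain ⟨G, hG⟩ := isCompact_Icc.exists_bound_of_continuousOn hc
  exact ⟨|G|, abs_nonneg _, fun t ht => (hG t ht).trans (le_abs_self _)⟩

lemma sq_of_primitive {g g' : ℝ → ℝ} (hT : 0 ≤ T) (hg' : IntervalIntegrable g' volume 0 T)
    (hg : ∀ t ∈ Icc 0 T, g t = g 0 + ∫ s in (0 : ℝ)..t, g' s) :
    ∀ t ∈ Icc 0 T, g t ^ 2 = g 0 ^ 2 + ∫ s in (0 : ℝ)..t, 2 * g s * g' s := by
  intro t ht
  have hi : IntervalIntegrable g' volume 0 t := hg'.mono_set (by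
    rw [uIcc_of_le ht.1, uIcc_of_le hT]; exact Icc_subset_Icc_right ht.2)
  have hgt : ∀ s ∈ Icc 0 t, g s = g 0 + ∫ r in (0 : ℝ)..s, g' r := fun s hs =>
    hg s ⟨hs.1, hs.2.trans ht.2⟩
  have h := integral_parts_of_primitive ht.1 hi hi hgt hgt
  simp only [mul_comm (g' _)] at h
  simp only [mul_assoc, intervalIntegral.integral_const_mul]
  linarith

/-- The kernel `r^{-α}` satisfies `k ∗ (g²)' ≤ 2 g (k ∗ g')` pointwise. The difference of the two
sides is `-∫ k(t - s) ((g(s) - g(t))²)' ds`, and here integration by parts produces only terms with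
the right sign, the boundary term at `s = t` being zero for the regularization `(r + ε)^{-α}`. -/
lemma integral_kernel_mul_le (hα : 0 < α) {g g' : ℝ → ℝ} {t : ℝ} (ht : 0 ≤ t)
    (hg' : IntervalIntegrable g' volume 0 t)
    (hg : ∀ s ∈ Icc 0 t, g s = g 0 + ∫ r in (0 : ℝ)..s, g' r)
    (hk : IntervalIntegrable (fun s => (t - s) ^ (-α) * g' s) volume 0 t) :
    ∫ s in (0 : ℝ)..t, (t - s) ^ (-α) * (2 * g s * g' s)
      ≤ 2 * g t * ∫ s in (0 : ℝ)..t, (t - s) ^ (-α) * g' s := by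
  have hc : ContinuousOn g (uIcc 0 t) := by
    rw [uIcc_of_le ht]; exact continuousOn_of_primitive ht hg' hg
  have hsub : ∀ s ∈ uIcc 0 t, 0 ≤ t - s := fun s hs => by
    rw [uIcc_of_le ht] at hs; exact sub_nonneg.2 hs.2
  have hkc : ∀ {ε : ℝ}, 0 < ε → ∀ β : ℝ, ContinuousOn (fun s => (t - s + ε) ^ β) (uIcc 0 t) :=
    fun hε β s hs => ContinuousAt.continuousWithinAt <|
      ContinuousAt.rpow_const (by fun_prop) (Or.inl (by linarith [hsub s hs]))
  have hcd : ContinuousOn (fun s => 2 * (g s - g t)) (uIcc 0 t) :=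
    continuousOn_const.mul (hc.sub continuousOn_const)
  have hreg : ∀ ε : ℝ, 0 < ε →
      ∫ s in (0 : ℝ)..t, (t - s + ε) ^ (-α) * (2 * (g s - g t) * g' s) ≤ 0 := by
    intro ε hε
    have hk' : ContinuousOn (fun s => α * (t - s + ε) ^ (-α - 1)) (uIcc 0 t) :=
      continuousOn_const.mul (hkc hε _)
    have hprim : ∀ s ∈ Icc 0 t, (t - s + ε) ^ (-α)
        = (t - 0 + ε) ^ (-α) + ∫ r in (0 : ℝ)..s, α * (t - r + ε) ^ (-α - 1) := by
      intro s hs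
      have hss : uIcc 0 s ⊆ uIcc 0 t := by
        rw [uIcc_of_le hs.1, uIcc_of_le ht]; exact Icc_subset_Icc_right hs.2
      rw [integral_eq_sub_of_hasDerivAt (f := fun s => (t - s + ε) ^ (-α))
        (fun r hr => ?_) (hk'.mono hss).intervalIntegrable]
      · ring
      · refine ((((hasDerivAt_id r).const_sub t).add_const ε).rpow_const
          (Or.inl (by simp only [id]; linarith [hsub r (hss hr)]))).congr_deriv ?_
        simp only [id]; ring
    have hsq := sq_of_primitive (g := fun s => g s - g t) ht hg' fun s hs => by
      simp only [hg s hs]; ring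
    rw [integral_parts_of_primitive ht hk'.intervalIntegrable (hg'.continuousOn_mul hcd) hprim hsq]
    have h1 : 0 ≤ ∫ s in (0 : ℝ)..t, α * (t - s + ε) ^ (-α - 1) * (g s - g t) ^ 2 :=
      intervalIntegral.integral_nonneg ht fun s hs => mul_nonneg (mul_nonneg hα.le
        (Real.rpow_nonneg (by linarith [hs.2]) _)) (sq_nonneg _)
    have h2 : 0 ≤ (t - 0 + ε) ^ (-α) * (g 0 - g t) ^ 2 :=
      mul_nonneg (Real.rpow_nonneg (by linarith) _) (sq_nonneg _)
    simp only [sub_self]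
    nlinarith
  have hlim : ∫ s in (0 : ℝ)..t, (t - s) ^ (-α) * (2 * (g s - g t) * g' s) ≤ 0 := by
    refine le_of_tendsto' (intervalIntegral.tendsto_integral_filter_of_dominated_convergence
      (F := fun (n : ℕ) s => (t - s + 1 / ((n : ℝ) + 1)) ^ (-α) * (2 * (g s - g t) * g' s))
      (l := Filter.atTop)
      (fun s => ‖(t - s) ^ (-α) * g' s * (2 * (g s - g t))‖) (.of_forall fun n => ?_)
      (.of_forall fun n => ?_) (hk.mul_continuousOn hcd).norm ?_)
      fun n => hreg _ Nat.one_div_pos_of_nat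
    · exact ((hg'.continuousOn_mul hcd).continuousOn_mul
        (hkc Nat.one_div_pos_of_nat _)).def'.aestronglyMeasurable
    all_goals
      have hne : ∀ᵐ s : ℝ, s ≠ t := by rw [ae_iff]; simp
      filter_upwards [hne] with s hs hst
      rw [uIoc_of_le ht] at hst
      have hpos : 0 < t - s := sub_pos.2 (lt_of_le_of_ne hst.2 hs)
    · have hn : 0 < 1 / ((n : ℝ) + 1) := Nat.one_div_pos_of_nat
      rw [mul_assoc (_ ^ _), mul_comm (g' s), norm_mul, norm_mul ((t - s) ^ (-α)),
        Real.norm_of_nonneg (Real.rpow_nonneg hpos.le _),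
        Real.norm_of_nonneg (Real.rpow_nonneg (by linarith) _)]
      exact mul_le_mul_of_nonneg_right
        (Real.rpow_le_rpow_of_nonpos hpos (by linarith) (by linarith)) (norm_nonneg _)
    · have h := (tendsto_const_nhds (x := t - s)).add tendsto_one_div_add_atTop_nhds_zero_nat
      rw [add_zero] at h
      exact (h.rpow_const (Or.inl hpos.ne')).mul_const _
  rw [← intervalIntegral.integral_const_mul, ← sub_nonpos, ← intervalIntegral.integral_sub]
  · convert hlim using 2
    funext s; ring
  · have h : IntervalIntegrable (fun s => 2 * g s * ((t - s) ^ (-α) * g' s)) volume 0 t :=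
      hk.continuousOn_mul (continuousOn_const.mul hc)
    simpa only [mul_left_comm (2 * g _)] using h
  · exact hk.const_mul _

/-- Lower bound for a primitive of the convolution of `r^{-α}` with the derivative of a
nonnegative function. -/
lemma integral_integral_ker_ge (hα : 0 < α) (hα1 : α < 1) (hT : 0 < T) {g g' : ℝ → ℝ}
    (hg' : IntegrableOn g' (Ioo 0 T))
    (hg : ∀ t ∈ Icc 0 T, g t = g 0 + ∫ s in (0 : ℝ)..t, g' s) (hg0 : ∀ t ∈ Icc 0 T, 0 ≤ g t)
    {τ : ℝ} (hτ : τ ∈ Icc 0 T) :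
    T ^ (-α) * (∫ t in (0 : ℝ)..τ, g t) - T ^ (1 - α) / (1 - α) * g 0
      ≤ ∫ t in (0 : ℝ)..τ, ∫ s in Ioo 0 T, ker α T (t - s) * g' s := by
  have hc := continuousOn_of_primitive hT.le (intervalIntegrable_of_Ioo hT.le hg') hg
  have hi : Integrable (fun p : ℝ × ℝ => (Ioo 0 T).indicator g' (p.1 - p.2) * ker α T p.2)
      (vol[Ioc 0 τ].prod volume) := by
    refine (Integrable.mono_measure (ν := (volume : Measure ℝ).prod volume) ?_
      (Measure.prod_mono Measure.restrict_le_self le_rfl))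
    simpa only [ContinuousLinearMap.mul_apply', mul_comm] using
      (integrable_ker hα1 hT.le).convolution_integrand (ContinuousLinearMap.mul ℝ ℝ)
        ((integrable_indicator_iff measurableSet_Ioo).2 hg')
  have h1 : ∫ t in (0 : ℝ)..τ, ∫ s in Ioo 0 T, ker α T (t - s) * g' s
      = ∫ r, ∫ t in Ioc 0 τ, (Ioo 0 T).indicator g' (t - r) * ker α T r := by
    rw [integral_of_le hτ.1]
    refine Eq.trans ?_ (integral_integral_swap hi)
    congr 1; funext t
    rw [← integral_indicator measurableSet_Ioo, ← integral_sub_left_eq_self _ volume t]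
    congr 1; funext r
    by_cases h : t - r ∈ Ioo 0 T <;> simp [h, mul_comm]
  have hgc : IntegrableOn (fun r => T ^ (-α) * g (τ - r)) (Ioo 0 τ) := by
    refine (ContinuousOn.integrableOn_compact isCompact_Icc (continuousOn_const.mul
      (hc.comp (by fun_prop) fun r hr => ?_))).mono_set Ioo_subset_Icc_self
    exact ⟨sub_nonneg.2 hr.2, by linarith [hr.1, hτ.2]⟩
  have h2 : T ^ (-α) * (∫ t in (0 : ℝ)..τ, g t) - T ^ (1 - α) / (1 - α) * g 0
      = ∫ r, ((Ioo 0 τ).indicator (fun r => T ^ (-α) * g (τ - r)) r - ker α T r * g 0) := by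
    rw [integral_sub ((integrable_indicator_iff measurableSet_Ioo).2 hgc)
      ((integrable_ker hα1 hT.le).mul_const _), integral_mul_const, integral_ker hα1 hT.le,
      integral_indicator measurableSet_Ioo, integral_const_mul, ← integral_Ioc_eq_integral_Ioo,
      ← integral_of_le hτ.1, intervalIntegral.integral_comp_sub_left]
    simp
  rw [h1, h2]
  refine integral_mono (((integrable_indicator_iff measurableSet_Ioo).2 hgc).sub
    ((integrable_ker hα1 hT.le).mul_const _)) hi.integral_prod_right fun r => ?_
  simp only [integral_mul_const]
  by_cases hr : r ∈ Ioo 0 T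
  swap
  · rw [ker, indicator_of_notMem hr, indicator_of_notMem fun h => hr ⟨h.1, h.2.trans_le hτ.2⟩]
    simp
  have h3 : ∫ t in Ioc 0 τ, (Ioo 0 T).indicator g' (t - r) = ∫ t in Ioc r τ, g' (t - r) := by
    have h4 : ∀ t, (Ioo 0 T).indicator g' (t - r)
        = (Ioo r (T + r)).indicator (fun t => g' (t - r)) t := fun t => by
      simp only [indicator, mem_Ioo, sub_pos, sub_lt_iff_lt_add]
    simp only [h4]
    rw [setIntegral_indicator measurableSet_Ioo]
    congr 2
    ext t
    simp only [mem_inter_iff, mem_Ioo, mem_Ioc]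
    exact ⟨fun h => ⟨h.2.1, h.1.2⟩, fun h => ⟨⟨hr.1.trans h.1, h.2⟩, h.1, by
      linarith [h.2, hτ.2, hr.1]⟩⟩
  have hk := ker_nonneg α T r
  rw [h3]
  by_cases h : r < τ
  · rw [← integral_of_le h.le, intervalIntegral.integral_comp_sub_right, sub_self,
      indicator_of_mem (show r ∈ Ioo 0 τ from ⟨hr.1, h⟩)]
    have h5 := hg (τ - r) ⟨by linarith, by linarith [hr.1, hτ.2]⟩
    have h6 : T ^ (-α) ≤ ker α T r := by
      rw [ker_of_pos hr.1 hr.2]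
      exact Real.rpow_le_rpow_of_nonpos hr.1 hr.2.le (by linarith)
    have h7 := mul_le_mul_of_nonneg_right h6 (hg0 (τ - r) ⟨by linarith, by linarith [hr.1, hτ.2]⟩)
    rw [h5] at h7 ⊢
    linarith
  · rw [Ioc_eq_empty h, indicator_of_notMem fun h' => h h'.2]
    have := mul_nonneg hk (hg0 0 (left_mem_Icc.2 hT.le))
    simp only [Measure.restrict_empty, integral_zero_measure]
    linarith

/-- Coercivity of convolution with `r^{-α}`, composed with differentiation. The weight is
nonincreasing, so that an integration by parts against it preserves the lower bound for the
primitive of `k ∗ (g²)'`. -/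
lemma integral_ker_ge {g g' : ℝ → ℝ} {μ : ℝ} (hα : 0 < α) (hα1 : α < 1) (hT : 0 < T)
    (hμ : 0 ≤ μ) (hg' : IntegrableOn g' (Ioo 0 T))
    (hg : ∀ t ∈ Icc 0 T, g t = g 0 + ∫ s in (0 : ℝ)..t, g' s) :
    exp (-2 * μ * T) * T ^ (-α) * (∫ t in Ioo 0 T, g t ^ 2)
        - g 0 ^ 2 * (T ^ (1 - α) / (1 - α))
      ≤ ∫ t in Ioo 0 T, exp (-2 * μ * t)
          * (2 * g t * ∫ s in Ioo 0 T, ker α T (t - s) * g' s) := by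
  have hii : IntervalIntegrable g' volume 0 T := intervalIntegrable_of_Ioo hT.le hg'
  have hc := continuousOn_of_primitive hT.le hii hg
  have hcu : ContinuousOn g (uIcc 0 T) := by rwa [uIcc_of_le hT.le]
  have hsq := sq_of_primitive hT.le hii hg
  have hsqi : IntegrableOn (fun s => 2 * g s * g' s) (Ioo 0 T) :=
    (integrableOn_Ioc_iff_integrableOn_Ioo (μ := volume)).1
      ((intervalIntegrable_iff_integrableOn_Ioc_of_le hT.le).1
        (hii.continuousOn_mul (continuousOn_const.mul hcu)))
  set A := T ^ (1 - α) / (1 - α)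
  have hconv : ∀ {f : ℝ → ℝ}, IntegrableOn f (Ioo 0 T) → Integrable (fun p : ℝ × ℝ =>
      ker α T (p.1 - p.2) * f p.2) (vol[Ioo 0 T].prod vol[Ioo 0 T]) := fun {f} hf => by
    have h := MeasureTheory.Integrable.convolution_integrand (ContinuousLinearMap.mul ℝ ℝ)
      (μ := (volume : Measure ℝ)) hf (integrable_ker hα1 hT.le)
    simpa only [ContinuousLinearMap.mul_apply', mul_comm] using
      h.mono_measure (Measure.prod_mono Measure.restrict_le_self le_rfl)
  set Q : ℝ → ℝ := fun t => ∫ s in Ioo 0 T, ker α T (t - s) * (2 * g s * g' s) with hQ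
  have hQi : IntervalIntegrable Q volume 0 T :=
    intervalIntegrable_of_Ioo hT.le (hconv hsqi).integral_prod_left
  have hw : ContinuousOn (fun t => exp (-2 * μ * t)) (uIcc 0 T) := by fun_prop
  -- the pointwise inequality
  have hpt : ∫ t in (0 : ℝ)..T, exp (-2 * μ * t) * Q t
      ≤ ∫ t in (0 : ℝ)..T, exp (-2 * μ * t)
          * (2 * g t * ∫ s in Ioo 0 T, ker α T (t - s) * g' s) := by
    have hKi : IntervalIntegrable (fun t => ∫ s in Ioo 0 T, ker α T (t - s) * g' s) volume 0 T :=
      intervalIntegrable_of_Ioo hT.le (hconv hg').integral_prod_left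
    refine intervalIntegral.integral_mono_ae_restrict hT.le (hQi.continuousOn_mul hw)
      ((hKi.continuousOn_mul (continuousOn_const.mul hcu)).continuousOn_mul hw) ?_
    rw [Measure.restrict_congr_set Ioo_ae_eq_Icc.symm]
    filter_upwards [(hconv hg').prod_right_ae, ae_restrict_mem measurableSet_Ioo] with t h ht
    refine mul_le_mul_of_nonneg_left ?_ (Real.exp_pos _).le
    simp only [hQ]
    rw [ker_mul_eq t ht, ker_mul_eq t ht]
    refine integral_kernel_mul_le hα ht.1.le (intervalIntegrable_of_Ioo ht.1.le
      (hg'.mono_set (Ioo_subset_Ioo_right ht.2.le))) (fun s hs => hg s ⟨hs.1, hs.2.trans ht.2.le⟩)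
      (intervalIntegrable_of_Ioo ht.1.le ?_)
    refine IntegrableOn.congr_fun (IntegrableOn.mono_set h (Ioo_subset_Ioo_right ht.2.le))
      (fun s hs => ?_) measurableSet_Ioo
    rw [ker_of_pos (by linarith [hs.2]) (by linarith [hs.1, ht.2])]
  -- integration by parts against the weight
  have hV : ∀ τ ∈ Icc 0 T, T ^ (-α) * (∫ t in (0 : ℝ)..τ, g t ^ 2) - A * g 0 ^ 2
      ≤ ∫ t in (0 : ℝ)..τ, Q t := fun τ hτ =>
    integral_integral_ker_ge hα hα1 hT hsqi hsq (fun _ _ => sq_nonneg _) hτ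
  have hexp : ∀ x ∈ Icc 0 T, exp (-2 * μ * x) = exp (-2 * μ * 0)
      + ∫ s in (0 : ℝ)..x, -(2 * μ * exp (-2 * μ * s)) := by
    intro x _
    rw [integral_eq_sub_of_hasDerivAt (f := fun s => exp (-2 * μ * s))
      (fun s _ => ((hasDerivAt_id s).const_mul (-2 * μ)).exp.congr_deriv (by simp only [id]; ring))
      (by apply Continuous.intervalIntegrable; fun_prop)]
    ring
  have hparts := integral_parts_of_primitive hT.le
    (by apply Continuous.intervalIntegrable; fun_prop) hQi hexp
    (g := fun x => ∫ s in (0 : ℝ)..x, Q s) (fun x _ => by simp)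
  have hlow : ∫ s in (0 : ℝ)..T, 2 * μ * exp (-2 * μ * s) * (-(A * g 0 ^ 2))
      ≤ ∫ s in (0 : ℝ)..T, 2 * μ * exp (-2 * μ * s) * ∫ r in (0 : ℝ)..s, Q r := by
    have hVc := continuousOn_primitive_interval' hQi left_mem_uIcc
    refine integral_mono_on hT.le
      (by apply Continuous.intervalIntegrable; fun_prop)
      (ContinuousOn.mul (by fun_prop) hVc).intervalIntegrable fun s hs => ?_
    refine mul_le_mul_of_nonneg_left (le_trans ?_ (hV s hs)) (by positivity)
    have : 0 ≤ ∫ t in (0 : ℝ)..s, g t ^ 2 :=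
      intervalIntegral.integral_nonneg hs.1 fun _ _ => sq_nonneg _
    have := mul_nonneg (Real.rpow_nonneg hT.le (-α)) this
    linarith
  have hone := hexp T (right_mem_Icc.2 hT.le)
  have hVT := mul_le_mul_of_nonneg_left (hV T (right_mem_Icc.2 hT.le))
    (Real.exp_pos (-2 * μ * T)).le
  rw [← integral_Ioc_eq_integral_Ioo, ← integral_Ioc_eq_integral_Ioo (f := fun t => _ * (_ * _)),
    ← integral_of_le hT.le, ← integral_of_le hT.le]
  refine le_trans ?_ hpt
  simp only [integral_same, mul_zero, sub_zero, neg_mul,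
    intervalIntegral.integral_neg, sub_neg_eq_add, Real.exp_zero] at hparts hone hVT ⊢
  simp only [intervalIntegral.integral_mul_const, neg_mul] at hlow
  rw [hparts]
  linear_combination hlow + hVT + A * g 0 ^ 2 * hone

end Coercivity

/-! ### Functions of time with a square integrable derivative -/

section TimePrimitive

variable {T : ℝ}

/-- `f` is, on `[0, T]`, a primitive of the square integrable function `f'`. -/
def IsH1 (T : ℝ) (f f' : ℝ → ℝ) : Prop :=
  MemLp f' 2 vol[Ioo 0 T] ∧ ∀ t ∈ Icc 0 T, f t = f 0 + ∫ τ in (0 : ℝ)..t, f' τ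

lemma IsH1.integrableOn {f f' : ℝ → ℝ} (hf : IsH1 T f f') : IntegrableOn f' (Ioo 0 T) :=
  hf.1.integrable one_le_two

lemma IsH1.intervalIntegrable {f f' : ℝ → ℝ} (hf : IsH1 T f f') (hT : 0 ≤ T) :
    IntervalIntegrable f' volume 0 T := intervalIntegrable_of_Ioo hT hf.integrableOn

lemma IsH1.intervalIntegrable_Icc {f f' : ℝ → ℝ} (hf : IsH1 T f f') {t : ℝ} (ht : t ∈ Icc 0 T) :
    IntervalIntegrable f' volume 0 t :=
  intervalIntegrable_of_Ioo ht.1 (hf.integrableOn.mono_set (Ioo_subset_Ioo_right ht.2))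

lemma IsH1.continuousOn {f f' : ℝ → ℝ} (hf : IsH1 T f f') (hT : 0 ≤ T) :
    ContinuousOn f (Icc 0 T) := continuousOn_of_primitive hT (hf.intervalIntegrable hT) hf.2

lemma IsH1.memLp {f f' : ℝ → ℝ} (hf : IsH1 T f f') (hT : 0 ≤ T) :
    MemLp f 2 vol[Ioo 0 T] := by
  have hc := hf.continuousOn hT
  obtain ⟨G, -, hG⟩ := abs_le_of_continuousOn hc
  refine MemLp.of_bound ((hc.mono Ioo_subset_Icc_self).aestronglyMeasurable measurableSet_Ioo) G ?_
  exact ae_restrict_of_forall_mem measurableSet_Ioo fun t ht => hG t (Ioo_subset_Icc_self ht)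

lemma IsH1.add {f f' g g' : ℝ → ℝ} (hf : IsH1 T f f') (hg : IsH1 T g g') :
    IsH1 T (fun t => f t + g t) (fun t => f' t + g' t) := by
  refine ⟨hf.1.add hg.1, fun t ht => ?_⟩
  simp only []
  rw [intervalIntegral.integral_add (hf.intervalIntegrable_Icc ht) (hg.intervalIntegrable_Icc ht),
    hf.2 t ht, hg.2 t ht]
  ring

lemma IsH1.const_mul {f f' : ℝ → ℝ} (hf : IsH1 T f f') (c : ℝ) :
    IsH1 T (fun t => c * f t) (fun t => c * f' t) := by
  refine ⟨hf.1.const_mul c, fun t ht => ?_⟩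
  simp only []
  rw [intervalIntegral.integral_const_mul, hf.2 t ht]
  ring

lemma IsH1.mul_const {f f' : ℝ → ℝ} (hf : IsH1 T f f') (c : ℝ) :
    IsH1 T (fun t => f t * c) (fun t => f' t * c) := by
  simpa only [mul_comm _ c] using hf.const_mul c

lemma IsH1.sub {f f' g g' : ℝ → ℝ} (hf : IsH1 T f f') (hg : IsH1 T g g') :
    IsH1 T (fun t => f t - g t) (fun t => f' t - g' t) := by
  simpa only [neg_mul, one_mul, ← sub_eq_add_neg] using hf.add (hg.const_mul (-1))

lemma IsH1.zero : IsH1 T (fun _ => 0) (fun _ => 0) := ⟨MemLp.zero', fun t _ => by simp⟩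

lemma IsH1.sum {ι : Type*} (s : Finset ι) {f f' : ι → ℝ → ℝ} (h : ∀ i ∈ s, IsH1 T (f i) (f' i)) :
    IsH1 T (fun t => ∑ i ∈ s, f i t) (fun t => ∑ i ∈ s, f' i t) := by
  classical
  induction s using Finset.induction_on with
  | empty => simpa using IsH1.zero
  | insert a s ha ih =>
    simp only [Finset.sum_insert ha]
    exact (h a (Finset.mem_insert_self _ _)).add
      (ih fun i hi => h i (Finset.mem_insert_of_mem hi))

/-- If a function of class `H¹` vanishes, so does its derivative. -/
lemma IsH1.deriv_eq_zero {f f' : ℝ → ℝ} (hf : IsH1 T f f') (hT : 0 < T)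
    (h : ∀ᵐ t ∂vol[Ioo 0 T], f t = 0) :
    ∀ᵐ t ∂vol[Ioo 0 T], f' t = 0 := by
  have hc := hf.continuousOn hT.le
  have h0 : ∀ t ∈ Icc 0 T, f t = 0 := by
    have h1 : EqOn f (fun _ => 0) (Ioo 0 T) := by
      refine Measure.eqOn_open_of_ae_eq (μ := volume) h isOpen_Ioo
        (hc.mono Ioo_subset_Icc_self) continuousOn_const
    have h2 : EqOn f (fun _ => 0) (closure (Ioo 0 T)) :=
      h1.of_subset_closure (by rwa [closure_Ioo hT.ne]) continuousOn_const subset_closure le_rfl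
    rw [closure_Ioo hT.ne] at h2
    exact h2
  refine ae_eq_zero_of_primitive_eq_zero hT.le (hf.intervalIntegrable hT.le) fun t ht => ?_
  have h1 := hf.2 t ht
  rw [h0 t ht, h0 0 (left_mem_Icc.2 hT.le)] at h1
  linarith

/-- The initial value is bounded by the norms of the function and its derivative. -/
lemma IsH1.sq_zero_le {f f' : ℝ → ℝ} (hf : IsH1 T f f') (hT : 0 < T) :
    f 0 ^ 2 ≤ 2 / T * (∫ t in Ioo 0 T, f t ^ 2) + 2 * T * ∫ t in Ioo 0 T, f' t ^ 2 := by
  have hcs : ∀ t ∈ Ioo 0 T, (∫ τ in (0 : ℝ)..t, f' τ) ^ 2 ≤ T * ∫ t in Ioo 0 T, f' t ^ 2 := by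
    intro t ht
    rw [integral_of_le ht.1.le, integral_Ioc_eq_integral_Ioo]
    have hsub : Ioo 0 t ⊆ Ioo 0 T := Ioo_subset_Ioo_right ht.2.le
    have h1 := sq_integral_mul_le (f := fun _ => (1 : ℝ)) (memLp_const 1)
      (hf.1.mono_measure (Measure.restrict_mono hsub le_rfl))
    simp only [one_mul, one_pow, integral_const, smul_eq_mul, mul_one,
      measureReal_restrict_apply_univ, Real.volume_real_Ioo, sub_zero, max_eq_left ht.1.le] at h1
    refine h1.trans (mul_le_mul ht.2.le ?_ (integral_nonneg fun _ => sq_nonneg _) hT.le)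
    exact setIntegral_mono_set hf.1.integrable_sq
      (.of_forall fun _ => sq_nonneg _) hsub.eventuallyLE
  have h2 : ∫ _t in Ioo 0 T, f 0 ^ 2
      ≤ ∫ t in Ioo 0 T, (2 * f t ^ 2 + 2 * (T * ∫ t in Ioo 0 T, f' t ^ 2)) := by
    refine setIntegral_mono_on (integrable_const _)
      (((hf.memLp hT.le).integrable_sq.const_mul 2).add (integrable_const _)) measurableSet_Ioo
      fun t ht => ?_
    have h3 := hcs t ht
    have h4 := hf.2 t (Ioo_subset_Icc_self ht)
    have h5 : f 0 = f t - ∫ τ in (0 : ℝ)..t, f' τ := by linarith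
    rw [h5]
    nlinarith [sq_nonneg (f t + ∫ τ in (0 : ℝ)..t, f' τ)]
  rw [integral_add ((hf.memLp hT.le).integrable_sq.const_mul 2) (integrable_const _),
    integral_const_mul] at h2
  simp only [integral_const, smul_eq_mul, measureReal_restrict_apply_univ, Real.volume_real_Ioo,
    sub_zero, max_eq_left hT.le] at h2
  have h6 : f 0 ^ 2 ≤ (2 * (∫ t in Ioo 0 T, f t ^ 2)
      + T * (2 * (T * ∫ t in Ioo 0 T, f' t ^ 2))) / T := by
    rw [le_div_iff₀ hT]; linarith
  refine h6.trans (le_of_eq ?_)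
  field_simp

end TimePrimitive

/-! ### The substantial derivative as an operator -/

section FracD

variable {α T K : ℝ}

/-- Coercivity of the substantial derivative in the norm with weight `e^{-2Kt}`. -/
lemma exists_fracD_coercive (hα : 0 < α) (hα1 : α < 1) (hT : 0 < T) (hK : 0 ≤ K) :
    ∃ c₀ C₁ : ℝ, 0 < c₀ ∧ 0 < C₁ ∧ ∀ κ : ℝ, |κ| ≤ K → ∀ f f' : ℝ → ℝ, IsH1 T f f' →
      c₀ * (∫ t in Ioo 0 T, f t ^ 2) - C₁ * f 0 ^ 2
        ≤ ∫ t in Ioo 0 T, exp (-2 * K * t) * (fracD α T κ f f' t * f t) := by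
  have hΓ : 0 < 1 / Real.Gamma (1 - α) :=
    one_div_pos.2 (Real.Gamma_pos_of_pos (by linarith))
  set c := 1 / Real.Gamma (1 - α) with hc
  have hA : 0 < T ^ (1 - α) / (1 - α) := div_pos (Real.rpow_pos_of_pos hT _) (by linarith)
  have hTa : 0 < T ^ (-α) := Real.rpow_pos_of_pos hT _
  refine ⟨c / 2 * (exp (-4 * K * T) * T ^ (-α) * exp (-2 * K * T)),
    c / 2 * (T ^ (1 - α) / (1 - α)), by positivity, by positivity, fun κ hκ f f' hf => ?_⟩
  obtain ⟨hκ1, hκ2⟩ := abs_le.1 hκ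
  set g : ℝ → ℝ := fun t => exp (κ * t) * f t with hg
  set g' : ℝ → ℝ := fun t => exp (κ * t) * (f' t + κ * f t) with hg'
  have hfm := hf.memLp hT.le
  have hexpb : ∀ᵐ t ∂vol[Ioo 0 T], ‖exp (κ * t)‖ ≤ exp (K * T) := by
    refine ae_restrict_of_forall_mem measurableSet_Ioo fun t ht => ?_
    rw [Real.norm_of_nonneg (Real.exp_pos _).le]
    exact Real.exp_le_exp.2 (by nlinarith [ht.1, ht.2])
  have hg'i : IntegrableOn g' (Ioo 0 T) :=
    Integrable.bdd_mul (c := exp (K * T))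
      (hf.integrableOn.add ((hfm.integrable one_le_two).const_mul κ)) (by fun_prop) hexpb
  have hgp : ∀ t ∈ Icc 0 T, g t = g 0 + ∫ s in (0 : ℝ)..t, g' s := by
    intro t ht
    have hcf : ContinuousOn f (Icc 0 t) :=
      (hf.continuousOn hT.le).mono (Icc_subset_Icc_right ht.2)
    have hii := hf.intervalIntegrable_Icc ht
    have hexp : ∀ x, exp (κ * x) = exp (κ * 0)
        + ∫ s in (0 : ℝ)..x, exp (κ * s) * κ := by
      intro x
      rw [integral_eq_sub_of_hasDerivAt (f := fun s => exp (κ * s))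
        (fun s _ => by simpa using ((hasDerivAt_id s).const_mul κ).exp)
        (by apply Continuous.intervalIntegrable; fun_prop)]
      ring
    have h1 := integral_parts_of_primitive (f := fun x => exp (κ * x))
      (f' := fun x => exp (κ * x) * κ) ht.1
      (by apply Continuous.intervalIntegrable; fun_prop) hii (fun x _ => hexp x)
      (fun x hx => hf.2 x ⟨hx.1, hx.2.trans ht.2⟩)
    have h2 : IntervalIntegrable (fun x => exp (κ * x) * f' x) volume 0 t :=
      hii.continuousOn_mul (by fun_prop)
    have h3 : IntervalIntegrable (fun x => exp (κ * x) * κ * f x) volume 0 t := by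
      apply ContinuousOn.intervalIntegrable
      rw [uIcc_of_le ht.1]
      exact ContinuousOn.mul (by fun_prop) hcf
    have h4 : ∫ s in (0 : ℝ)..t, g' s = (∫ s in (0 : ℝ)..t, exp (κ * s) * f' s)
        + ∫ s in (0 : ℝ)..t, exp (κ * s) * κ * f s := by
      rw [← intervalIntegral.integral_add h2 h3]
      congr 1; funext s; simp only [hg']; ring
    rw [h4, h1]
    simp only [hg]; ring
  have hμ : 0 ≤ K + κ := by linarith
  have hmain := integral_ker_ge hα hα1 hT hμ hg'i hgp
  have e1 : ∫ t in Ioo 0 T, exp (-2 * K * t) * (fracD α T κ f f' t * f t)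
      = c / 2 * ∫ t in Ioo 0 T, exp (-2 * (K + κ) * t)
          * (2 * g t * ∫ s in Ioo 0 T, ker α T (t - s) * g' s) := by
    rw [← integral_const_mul]
    congr 1; funext t
    have h1 : exp (-2 * (K + κ) * t)
        = exp (-2 * K * t) * exp (-κ * t) * exp (-κ * t) := by
      rw [← Real.exp_add, ← Real.exp_add]; ring_nf
    have h2 : exp (-κ * t) * exp (κ * t) = 1 := by
      rw [← Real.exp_add]; simp
    simp only [fracD, hg, ← hc, h1]
    set I := ∫ s in Ioo 0 T, ker α T (t - s) * g' s
    calc _ = c * (exp (-2 * K * t) * exp (-κ * t) * I * f t) * 1 := by ring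
      _ = c * (exp (-2 * K * t) * exp (-κ * t) * I * f t)
          * (exp (-κ * t) * exp (κ * t)) := by rw [h2]
      _ = _ := by ring
  rw [e1]
  refine le_trans ?_ (mul_le_mul_of_nonneg_left hmain (by positivity))
  have e2 : g 0 = f 0 := by simp [hg]
  have e3 : exp (-2 * K * T) * (∫ t in Ioo 0 T, f t ^ 2) ≤ ∫ t in Ioo 0 T, g t ^ 2 := by
    rw [← integral_const_mul]
    have hgsq : IntegrableOn (fun t => g t ^ 2) (Ioo 0 T) := by
      have hcg := (continuousOn_of_primitive hT.le (intervalIntegrable_of_Ioo hT.le hg'i) hgp).pow 2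
      exact (hcg.integrableOn_compact isCompact_Icc).mono_set Ioo_subset_Icc_self
    refine setIntegral_mono_on (hfm.integrable_sq.const_mul _) hgsq measurableSet_Ioo
      fun t ht => ?_
    simp only [hg, mul_pow]
    refine mul_le_mul_of_nonneg_right ?_ (sq_nonneg _)
    rw [← Real.exp_nat_mul]
    exact Real.exp_le_exp.2 (by push_cast; nlinarith [ht.1, ht.2])
  have e4 : exp (-4 * K * T) ≤ exp (-2 * (K + κ) * T) :=
    Real.exp_le_exp.2 (by nlinarith)
  rw [e2]
  have hI : 0 ≤ ∫ t in Ioo 0 T, f t ^ 2 := integral_nonneg fun _ => sq_nonneg _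
  have e5 : exp (-4 * K * T) * (exp (-2 * K * T) * ∫ t in Ioo 0 T, f t ^ 2)
      ≤ exp (-2 * (K + κ) * T) * ∫ t in Ioo 0 T, g t ^ 2 :=
    mul_le_mul e4 e3 (by positivity) (Real.exp_pos _).le
  have e6 := mul_le_mul_of_nonneg_left e5 (show 0 ≤ c / 2 * T ^ (-α) by positivity)
  linarith

variable {β : Type*} [MeasurableSpace β] {ν : Measure β}

/-- The substantial derivative of a function of time and space. -/
def fracDxt (α T : ℝ) (κ : β → ℝ) (w w' : ℝ → β → ℝ) (p : ℝ × β) : ℝ :=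
  fracD α T (κ p.2) (fun t => w t p.2) (fun t => w' t p.2) p.1

lemma memLp_weighted {κ : β → ℝ} (hκ : Measurable κ) (hK : 0 ≤ K) (hκb : ∀ᵐ y ∂ν, |κ y| ≤ K)
    {w w' : ℝ → β → ℝ}
    (hw : MemLp (Function.uncurry w) 2 (vol[Ioo 0 T].prod ν))
    (hw' : MemLp (Function.uncurry w') 2 (vol[Ioo 0 T].prod ν)) :
    MemLp (fun p : ℝ × β => exp (κ p.2 * p.1) * (w' p.1 p.2 + κ p.2 * w p.1 p.2)) 2
      (vol[Ioo 0 T].prod ν) ∧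
    ∫ p : ℝ × β, (exp (κ p.2 * p.1) * (w' p.1 p.2 + κ p.2 * w p.1 p.2)) ^ 2
        ∂(vol[Ioo 0 T].prod ν)
      ≤ exp (K * T) ^ 2 * (2 * (∫ p, Function.uncurry w' p ^ 2
          ∂(vol[Ioo 0 T].prod ν))
        + 2 * K ^ 2 * ∫ p, Function.uncurry w p ^ 2
          ∂(vol[Ioo 0 T].prod ν)) := by
  set P := vol[Ioo 0 T].prod ν with hP
  have hm : ∀ᵐ p ∂P, p.1 ∈ Ioo 0 T ∧ |κ p.2| ≤ K :=
    (Measure.quasiMeasurePreserving_fst.ae (ae_restrict_mem measurableSet_Ioo)).and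
      (ae_prod_snd hκb)
  have hκ2 : Measurable fun p : ℝ × β => κ p.2 := hκ.comp measurable_snd
  have hexpm : Measurable fun p : ℝ × β => exp (κ p.2 * p.1) :=
    Real.measurable_exp.comp (hκ2.mul measurable_fst)
  have h1 : MemLp (fun p : ℝ × β => κ p.2 * w p.1 p.2) 2 P := by
    refine MemLp.of_le_mul (c := K) hw (hκ2.aestronglyMeasurable.mul hw.1) ?_
    filter_upwards [hm] with p hp
    rw [norm_mul]
    exact mul_le_mul_of_nonneg_right hp.2 (norm_nonneg _)
  have h2 : MemLp (fun p : ℝ × β => w' p.1 p.2 + κ p.2 * w p.1 p.2) 2 P := hw'.add h1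
  have hb : ∀ᵐ p ∂P, exp (κ p.2 * p.1) ≤ exp (K * T) := by
    filter_upwards [hm] with p hp
    obtain ⟨ha, hb⟩ := abs_le.1 hp.2
    exact Real.exp_le_exp.2 (by nlinarith [hp.1.1, hp.1.2])
  have h3 : MemLp (fun p : ℝ × β => exp (κ p.2 * p.1) * (w' p.1 p.2 + κ p.2 * w p.1 p.2))
      2 P := by
    refine MemLp.of_le_mul (c := exp (K * T)) h2 (hexpm.aestronglyMeasurable.mul h2.1) ?_
    filter_upwards [hb] with p hp
    rw [norm_mul, Real.norm_of_nonneg (Real.exp_pos _).le]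
    exact mul_le_mul_of_nonneg_right hp (norm_nonneg _)
  refine ⟨h3, ?_⟩
  have i1 : Integrable (fun p : ℝ × β => Function.uncurry w' p ^ 2) P := hw'.integrable_sq
  have i2 : Integrable (fun p : ℝ × β => Function.uncurry w p ^ 2) P := hw.integrable_sq
  have h4 : ∫ p : ℝ × β, (exp (κ p.2 * p.1) * (w' p.1 p.2 + κ p.2 * w p.1 p.2)) ^ 2 ∂P
      ≤ ∫ p, exp (K * T) ^ 2
        * (2 * Function.uncurry w' p ^ 2 + 2 * K ^ 2 * Function.uncurry w p ^ 2) ∂P := by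
    refine integral_mono_ae h3.integrable_sq
      (((i1.const_mul 2).add (i2.const_mul (2 * K ^ 2))).const_mul _) ?_
    filter_upwards [hm, hb] with p hp hpb
    simp only [Function.uncurry_def, mul_pow]
    refine mul_le_mul (pow_le_pow_left₀ (Real.exp_pos _).le hpb 2) ?_ (sq_nonneg _) (sq_nonneg _)
    have h5 : (κ p.2 * w p.1 p.2) ^ 2 ≤ K ^ 2 * w p.1 p.2 ^ 2 := by
      rw [mul_pow]
      refine mul_le_mul_of_nonneg_right ?_ (sq_nonneg _)
      rw [← sq_abs]
      exact pow_le_pow_left₀ (abs_nonneg _) hp.2 2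
    nlinarith [sq_nonneg (w' p.1 p.2 - κ p.2 * w p.1 p.2)]
  refine h4.trans (le_of_eq ?_)
  rw [integral_const_mul, integral_add (i1.const_mul 2) (i2.const_mul _), integral_const_mul,
    integral_const_mul]

lemma exists_fracDxt_bound (hα1 : α < 1) (hT : 0 < T) (hK : 0 ≤ K) : ∃ C : ℝ, 0 < C ∧
    ∀ {β : Type} [MeasurableSpace β] (ν : Measure β) [IsFiniteMeasure ν] (κ : β → ℝ),
    Measurable κ → (∀ᵐ y ∂ν, |κ y| ≤ K) → ∀ w w' : ℝ → β → ℝ,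
    MemLp (Function.uncurry w) 2 (vol[Ioo 0 T].prod ν) →
    MemLp (Function.uncurry w') 2 (vol[Ioo 0 T].prod ν) →
    MemLp (fracDxt α T κ w w') 2 (vol[Ioo 0 T].prod ν) ∧
    (∫ p, fracDxt α T κ w w' p ^ 2 ∂(vol[Ioo 0 T].prod ν)
      ≤ C * ((∫ p, Function.uncurry w p ^ 2 ∂(vol[Ioo 0 T].prod ν))
        + ∫ p, Function.uncurry w' p ^ 2 ∂(vol[Ioo 0 T].prod ν))) ∧
    ∀ᵐ p ∂(vol[Ioo 0 T].prod ν), IntegrableOn (fun s => ker α T (p.1 - s)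
      * (exp (κ p.2 * s) * (w' s p.2 + κ p.2 * w s p.2))) (Ioo 0 T) := by
  have hA : 0 < T ^ (1 - α) / (1 - α) := div_pos (Real.rpow_pos_of_pos hT _) (by linarith)
  set A := T ^ (1 - α) / (1 - α) with hAdef
  set c := 1 / Real.Gamma (1 - α) with hc
  refine ⟨(c * exp (K * T)) ^ 2 * A ^ 2 * exp (K * T) ^ 2 * (2 + 2 * K ^ 2) + 1,
    by positivity, fun {β} _ ν _ κ hκ hκb w w' hw hw' => ?_⟩
  obtain ⟨hW, hWb⟩ := memLp_weighted hκ hK hκb hw hw'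
  have hkm : Measurable (Function.uncurry fun t s => ker α T (t - s)) :=
    (measurable_ker α T).comp (measurable_fst.sub measurable_snd)
  have hS1 : ∀ t, ∫⁻ s in Ioo 0 T, ‖ker α T (t - s)‖ₑ ≤ ENNReal.ofReal A := fun t => by
    rw [hAdef, ← lintegral_ker hα1 hT.le]
    refine (setLIntegral_le_lintegral _ _).trans (le_of_eq ?_)
    exact lintegral_sub_left_eq_self (fun r => ‖ker α T r‖ₑ) t
  have hS2 : ∀ s, ∫⁻ t in Ioo 0 T, ‖ker α T (t - s)‖ₑ ≤ ENNReal.ofReal A := fun s => by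
    rw [hAdef, ← lintegral_ker hα1 hT.le]
    refine (setLIntegral_le_lintegral _ _).trans (le_of_eq ?_)
    exact lintegral_sub_right_eq_self (fun r => ‖ker α T r‖ₑ) s
  obtain ⟨h1, h2, h3⟩ := schur_test (μ := vol[Ioo 0 T]) hkm hA.le hS1 hS2 hW
  set P := vol[Ioo 0 T].prod ν with hP
  have hκ2 : Measurable fun p : ℝ × β => κ p.2 := hκ.comp measurable_snd
  have hexpm : Measurable fun p : ℝ × β => c * exp (-κ p.2 * p.1) :=
    (Real.measurable_exp.comp (hκ2.neg.mul measurable_fst)).const_mul c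
  have hb : ∀ᵐ p ∂P, ‖c * exp (-κ p.2 * p.1)‖ ≤ |c| * exp (K * T) := by
    filter_upwards [Measure.quasiMeasurePreserving_fst.ae (ae_restrict_mem measurableSet_Ioo),
      ae_prod_snd hκb] with p hp1 hp2
    rw [norm_mul, Real.norm_eq_abs, Real.norm_of_nonneg (Real.exp_pos _).le]
    obtain ⟨ha, hb⟩ := abs_le.1 hp2
    exact mul_le_mul_of_nonneg_left (Real.exp_le_exp.2 (by nlinarith [hp1.1, hp1.2]))
      (abs_nonneg _)
  have heq : fracDxt α T κ w w' = fun p : ℝ × β => c * exp (-κ p.2 * p.1)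
      * ∫ s in Ioo 0 T, ker α T (p.1 - s)
        * (exp (κ p.2 * s) * (w' s p.2 + κ p.2 * w s p.2)) := by
    funext p
    simp only [fracDxt, fracD, ← hc]
    ring
  have hmem : MemLp (fracDxt α T κ w w') 2 P := by
    rw [heq]
    refine MemLp.of_le_mul (c := |c| * exp (K * T)) h1
      (hexpm.aestronglyMeasurable.mul h1.1) ?_
    filter_upwards [hb] with p hp
    rw [norm_mul]
    exact mul_le_mul_of_nonneg_right hp (norm_nonneg _)
  refine ⟨hmem, ?_, h3⟩
  have h4 : ∫ p, fracDxt α T κ w w' p ^ 2 ∂P ≤ ∫ p : ℝ × β, (|c| * exp (K * T)) ^ 2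
      * (∫ s in Ioo 0 T, ker α T (p.1 - s)
        * (exp (κ p.2 * s) * (w' s p.2 + κ p.2 * w s p.2))) ^ 2 ∂P := by
    refine integral_mono_ae hmem.integrable_sq (h1.integrable_sq.const_mul _) ?_
    filter_upwards [hb] with p hp
    rw [heq]
    simp only []
    rw [mul_pow]
    refine mul_le_mul_of_nonneg_right ?_ (sq_nonneg _)
    rw [← sq_abs]
    exact pow_le_pow_left₀ (abs_nonneg _) hp 2
  rw [integral_const_mul, mul_pow, sq_abs, ← mul_pow] at h4
  set N := ∫ p, Function.uncurry w p ^ 2 ∂P with hN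
  set N' := ∫ p, Function.uncurry w' p ^ 2 ∂P with hN'
  have hN0 : 0 ≤ N := integral_nonneg fun _ => sq_nonneg _
  have hN0' : 0 ≤ N' := integral_nonneg fun _ => sq_nonneg _
  refine h4.trans ?_
  have h5 := mul_le_mul_of_nonneg_left (h2.trans (mul_le_mul_of_nonneg_left hWb (sq_nonneg A)))
    (sq_nonneg (c * exp (K * T)))
  refine h5.trans ?_
  have h6 : 2 * N' + 2 * K ^ 2 * N ≤ (2 + 2 * K ^ 2) * (N + N') := by
    nlinarith [mul_nonneg (sq_nonneg K) hN0']
  have h7 := mul_le_mul_of_nonneg_left h6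
    (show 0 ≤ (c * exp (K * T)) ^ 2 * A ^ 2 * exp (K * T) ^ 2 by positivity)
  nlinarith

lemma fracD_sub {κ t : ℝ} {f f' g g' : ℝ → ℝ}
    (hf : IntegrableOn (fun s => ker α T (t - s) * (exp (κ * s) * (f' s + κ * f s)))
      (Ioo 0 T))
    (hg : IntegrableOn (fun s => ker α T (t - s) * (exp (κ * s) * (g' s + κ * g s)))
      (Ioo 0 T)) :
    fracD α T κ (fun s => f s - g s) (fun s => f' s - g' s) t
      = fracD α T κ f f' t - fracD α T κ g g' t := by
  simp only [fracD]
  rw [← mul_sub, ← mul_sub, ← integral_sub hf hg]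
  congr 3
  funext s; ring

end FracD

/-! ### Restriction to the support of test functions -/

section Tensor

variable {L R L' R' : ℝ}

lemma integral_rect_eq_of_support {a b : ℝ → ℝ} {l r l' r' : ℝ} (ha : IsTest l r a)
    (hb : IsTest l' r' b) (hl : L ≤ l) (hr : r ≤ R) (hl' : L' ≤ l') (hr' : r' ≤ R')
    (H : ℝ × ℝ → ℝ) : ∫ z in rect L R L' R', H z * (a z.1 * b z.2)
      = ∫ z in rect l r l' r', H z * (a z.1 * b z.2) := by
  refine (setIntegral_eq_of_subset_of_forall_sdiff_eq_zero (measurableSet_rect _ _ _ _)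
    (prod_mono (Ioo_subset_Ioo hl hr) (Ioo_subset_Ioo hl' hr')) fun z hz => ?_)
  obtain ⟨-, p, q, hp, hq, h⟩ := ha
  obtain ⟨-, p', q', hp', hq', h'⟩ := hb
  by_cases h1 : z.1 ∈ Icc p q
  · have h2 : z.2 ∉ Icc p' q' := fun h2 => hz.2
      ⟨⟨hp.trans_le h1.1, h1.2.trans_lt hq⟩, ⟨hp'.trans_le h2.1, h2.2.trans_lt hq'⟩⟩
    rw [h' _ h2]; ring
  · rw [h _ h1]; ring

lemma integral_strip_eq_of_support {b : ℝ → ℝ} {l' r' : ℝ}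
    (hb : IsTest l' r' b) (hl' : L' ≤ l') (hr' : r' ≤ R')
    (H : ℝ × ℝ → ℝ) : ∫ z in rect L R L' R', H z * b z.2
      = ∫ z in rect L R l' r', H z * b z.2 := by
  refine (setIntegral_eq_of_subset_of_forall_sdiff_eq_zero (measurableSet_rect _ _ _ _)
    (prod_mono le_rfl (Ioo_subset_Ioo hl' hr')) fun z hz => ?_)
  obtain ⟨-, p', q', hp', hq', h'⟩ := hb
  have h2 : z.2 ∉ Icc p' q' := fun h2 => hz.2
    ⟨hz.1.1, ⟨hp'.trans_le h2.1, h2.2.trans_lt hq'⟩⟩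
  rw [h' _ h2]; ring

end Tensor

/-! ### Periodic extension of test functions -/

section Periodic

variable {L R : ℝ}

/-- Test functions on an interval extend to smooth periodic functions. -/
lemma IsTest.exists_periodic {a : ℝ → ℝ} (ha : IsTest L R a) (hLR : L < R) :
    ∃ A : ℝ → ℝ, ContDiff ℝ ∞ A ∧ (∀ x, A (x + (R - L)) = A x) ∧ ∀ x ∈ Ioo L R, A x = a x := by
  obtain ⟨hc, l, r, hl, hr, h⟩ := ha
  have hP : 0 < R - L := sub_pos.2 hLR
  set A : ℝ → ℝ := fun x => a (toIcoMod hP L x) with hA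
  have hper : ∀ x (n : ℤ), A (x + n * (R - L)) = A x := fun x n => by
    simp only [hA]
    rw [← zsmul_eq_mul, toIcoMod_add_zsmul]
  have hin : ∀ x ∈ Ico L R, A x = a x := fun x hx => by
    simp only [hA]
    rw [(toIcoMod_eq_self hP).2 (by rwa [add_sub_cancel])]
  -- smoothness at points of the fundamental interval
  have hbase : ∀ x ∈ Ico L R, ContDiffAt ℝ ∞ A x := by
    intro x hx
    rcases eq_or_lt_of_le hx.1 with rfl | hx1
    · refine contDiffAt_const (c := (0 : ℝ)) |>.congr_of_eventuallyEq ?_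
      have h1 : Ioo (r - (R - L)) l ∈ nhds L := Ioo_mem_nhds (by linarith) hl
      have h2 : Ioo (L - (R - L)) R ∈ nhds L := Ioo_mem_nhds (by linarith) hLR
      filter_upwards [h1, h2] with y hy hy'
      rcases le_or_gt L y with hLy | hLy
      · rw [hin y ⟨hLy, hy'.2⟩]
        exact h y fun h' => absurd h'.1 (not_le.2 hy.2)
      · rw [← hper y 1, Int.cast_one, one_mul, hin _ ⟨by linarith [hy'.1], by linarith⟩]
        exact h _ fun h' => absurd h'.2 (not_le.2 (by linarith [hy.1]))
    · refine hc.contDiffAt.congr_of_eventuallyEq ?_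
      filter_upwards [Ioo_mem_nhds hx1 hx.2] with y hy using hin y (Ioo_subset_Ico_self hy)
  refine ⟨A, contDiff_iff_contDiffAt.2 fun x => ?_, fun x => ?_,
    fun x hx => hin x (Ioo_subset_Ico_self hx)⟩
  · set n := toIcoDiv hP L x with hn
    have hx : x - n * (R - L) ∈ Ico L R := by
      have := sub_toIcoDiv_zsmul_mem_Ico hP L x
      rwa [zsmul_eq_mul, add_sub_cancel] at this
    have h1 : A = A ∘ fun x => x - n * (R - L) := by
      funext y
      simp only [Function.comp]
      rw [← hper (y - n * (R - L)) n]
      congr 1; ring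
    rw [h1]
    exact (hbase _ hx).comp x (by fun_prop)
  · have := hper x 1
    rwa [Int.cast_one, one_mul] at this

lemma isPeriodicTest_mul {a₁ b₁ a₂ b₂ : ℝ} {A B : ℝ → ℝ} (hA : ContDiff ℝ ∞ A)
    (hB : ContDiff ℝ ∞ B) (hAp : ∀ x, A (x + (b₁ - a₁)) = A x)
    (hBp : ∀ x, B (x + (b₂ - a₂)) = B x) :
    IsPeriodicTest a₁ b₁ a₂ b₂ (fun z => A z.1 * B z.2) :=
  ⟨(hA.comp contDiff_fst).mul (hB.comp contDiff_snd), fun x y => by simp only [hAp],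
    fun x y => by simp only [hBp]⟩

lemma dX_mul (A B : ℝ → ℝ) : dX (fun z => A z.1 * B z.2) = fun z => deriv A z.1 * B z.2 := by
  funext z; simp [dX]

lemma dY_mul (A B : ℝ → ℝ) : dY (fun z => A z.1 * B z.2) = fun z => A z.1 * deriv B z.2 := by
  funext z; simp [dY]

lemma deriv_eq_of_eq_on_Ioo {A a : ℝ → ℝ} (h : ∀ x ∈ Ioo L R, A x = a x) :
    ∀ x ∈ Ioo L R, deriv A x = deriv a x := fun x hx =>
  Filter.EventuallyEq.deriv_eq (by
    filter_upwards [Ioo_mem_nhds hx.1 hx.2] with y hy using h y hy)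

end Periodic

/-! ### Partitions of an interval -/

section Partition

variable {N : ℕ} {x : Fin (N + 1) → ℝ}

lemma exists_mem_subinterval {t : ℝ} (h0 : x 0 < t) (h1 : t < x (Fin.last N))
    (ht : ∀ i, x i ≠ t) : ∃ i : Fin N, t ∈ Ioo (x i.castSucc) (x i.succ) := by
  by_contra hne
  push Not at hne
  have key : ∀ n (hn : n < N + 1), x ⟨n, hn⟩ < t := by
    intro n
    induction n with
    | zero => exact fun _ => h0
    | succ n ih =>
      intro hn
      have h2 := ih (by omega)
      by_contra h3
      exact hne ⟨n, by omega⟩ ⟨h2, lt_of_le_of_ne (not_lt.1 h3) (ht _).symm⟩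
  exact absurd (key N (by omega)) (not_lt.2 h1.le)

lemma pairwise_disjoint_subinterval (hx : StrictMono x) :
    Pairwise (Function.onFun Disjoint fun i : Fin N => Ioo (x i.castSucc) (x i.succ)) := by
  have key : ∀ i j : Fin N, i < j → Disjoint (Ioo (x i.castSucc) (x i.succ))
      (Ioo (x j.castSucc) (x j.succ)) := by
    intro i j hij
    rw [Set.disjoint_left]
    intro t h1 h2
    have : x i.succ ≤ x j.castSucc := hx.monotone (by
      rw [Fin.le_def, Fin.val_succ, Fin.val_castSucc]; exact hij)
    linarith [h1.2, h2.1]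
  intro i j hij
  rcases lt_or_gt_of_ne hij with h | h
  · exact key i j h
  · exact (key j i h).symm

lemma integral_strip_eq_sum (hx : StrictMono x) {L' R' : ℝ} {H : ℝ × ℝ → ℝ}
    (hH : IntegrableOn H (rect (x 0) (x (Fin.last N)) L' R')) :
    ∫ z in rect (x 0) (x (Fin.last N)) L' R', H z
      = ∑ i : Fin N, ∫ z in rect (x i.castSucc) (x i.succ) L' R', H z := by
  have hsub : ∀ i : Fin N, rect (x i.castSucc) (x i.succ) L' R'
      ⊆ rect (x 0) (x (Fin.last N)) L' R' := fun i =>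
    prod_mono (Ioo_subset_Ioo (hx.monotone (Fin.zero_le _)) (hx.monotone (Fin.le_last _))) le_rfl
  have hae : (rect (x 0) (x (Fin.last N)) L' R' : Set (ℝ × ℝ)) =ᵐ[volume]
      ⋃ i : Fin N, rect (x i.castSucc) (x i.succ) L' R' := by
    have h1 : ∀ᵐ z : ℝ × ℝ, ∀ i, x i ≠ z.1 := by
      rw [ae_all_iff]
      intro i
      have h2 : ∀ᵐ t : ℝ, x i ≠ t := by
        rw [ae_iff]; simp
      rw [Measure.volume_eq_prod]
      exact Measure.quasiMeasurePreserving_fst.ae h2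
    filter_upwards [h1] with z hz
    refine propext ⟨fun h => ?_, fun h => ?_⟩
    · obtain ⟨i, hi⟩ := exists_mem_subinterval h.1.1 h.1.2 hz
      exact mem_iUnion.2 ⟨i, hi, h.2⟩
    · obtain ⟨i, hi⟩ := mem_iUnion.1 h
      exact hsub i hi
  rw [setIntegral_congr_set hae, integral_iUnion_fintype]
  · exact fun i => measurableSet_rect _ _ _ _
  · intro i j hij
    exact Disjoint.set_prod_left (pairwise_disjoint_subinterval hx hij) _ _
  · exact fun i => hH.mono_set (hsub i)

/-- A continuous periodic piecewise smooth function is a primitive of its piecewise derivative,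
which has vanishing integral. -/
lemma piecewise_eq_primitive (hN : 0 < N) (hx : StrictMono x) {c : Fin N → ℝ → ℝ}
    (hc : ∀ i, ContDiff ℝ ∞ (c i))
    (hcont : ∀ i, c i (x i.succ) = c (finRotate N i) (x (finRotate N i).castSucc)) :
    IsTestLimit (x 0) (x (Fin.last N))
      (fun t => ∑ i, (Ioo (x i.castSucc) (x i.succ)).indicator (deriv (c i)) t) ∧
    (∫ t in x 0..x (Fin.last N),
      ∑ i, (Ioo (x i.castSucc) (x i.succ)).indicator (deriv (c i)) t) = 0 ∧
    ∀ i, ∀ t ∈ Ioo (x i.castSucc) (x i.succ),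
      c i t = c ⟨0, hN⟩ (x 0)
        + ∫ s in x 0..t, ∑ i, (Ioo (x i.castSucc) (x i.succ)).indicator (deriv (c i)) s := by
  set d : ℝ → ℝ := fun t => ∑ i, (Ioo (x i.castSucc) (x i.succ)).indicator (deriv (c i)) t with hd
  have hd' : ∀ i, ContDiff ℝ ∞ (deriv (c i)) := fun i => (contDiff_infty_iff_deriv.1 (hc i)).2
  have hmem : ∀ i, ∀ t ∈ Ioo (x i.castSucc) (x i.succ), d t = deriv (c i) t := by
    intro i t ht
    simp only [hd]
    rw [sum_eq_single i]
    · exact indicator_of_mem ht _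
    · intro j _ hj
      exact indicator_of_notMem (fun h' => Set.disjoint_left.1
        (pairwise_disjoint_subinterval hx hj) h' ht) _
    · simp
  have hint : ∀ a b, IntervalIntegrable d volume a b := by
    intro a b
    rw [intervalIntegrable_iff]
    refine integrable_finsetSum _ fun i _ => ?_
    exact Integrable.indicator (((hd' i).continuous.intervalIntegrable a b).def') measurableSet_Ioo
  have hpart : ∀ i, ∀ t ∈ Icc (x i.castSucc) (x i.succ),
      ∫ s in x i.castSucc..t, d s = c i t - c i (x i.castSucc) := by
    intro i t ht
    have h1 : ∫ s in x i.castSucc..t, d s = ∫ s in x i.castSucc..t, deriv (c i) s := by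
      rw [integral_of_le ht.1, integral_of_le ht.1,
        integral_Ioc_eq_integral_Ioo, integral_Ioc_eq_integral_Ioo]
      exact setIntegral_congr_fun measurableSet_Ioo fun s hs => hmem i s
        ⟨hs.1, hs.2.trans_le ht.2⟩
    rw [h1, integral_eq_sub_of_hasDerivAt
      (fun s _ => ((hc i).differentiable (by simp)).differentiableAt.hasDerivAt)
      ((hd' i).continuous.intervalIntegrable _ _)]
  have hleft : ∀ n (hn : n < N), ∫ s in x 0..x (Fin.castSucc ⟨n, hn⟩), d s
      = c ⟨n, hn⟩ (x (Fin.castSucc ⟨n, hn⟩)) - c ⟨0, hN⟩ (x 0) := by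
    intro n
    induction n with
    | zero =>
      intro hn
      have : (Fin.castSucc ⟨0, hn⟩ : Fin (N + 1)) = 0 := rfl
      rw [this]; simp
    | succ n ih =>
      intro hn
      have hn' : n < N := by omega
      have e1 : (Fin.castSucc ⟨n + 1, hn⟩ : Fin (N + 1)) = Fin.succ ⟨n, hn'⟩ := rfl
      have e2 : finRotate N ⟨n, hn'⟩ = ⟨n + 1, hn⟩ := by
        obtain ⟨M, rfl⟩ : ∃ M, N = M + 1 := ⟨N - 1, by omega⟩
        exact finRotate_of_lt (by omega)
      have h1 := hcont ⟨n, hn'⟩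
      rw [e2] at h1
      have h2 := hpart ⟨n, hn'⟩ _ (right_mem_Icc.2 (hx Fin.castSucc_lt_succ).le)
      rw [← integral_add_adjacent_intervals (hint _ (x (Fin.castSucc ⟨n, hn'⟩)))
        (hint _ _), ih hn', e1, h2, h1]
      rw [e1]; ring
  refine ⟨?_, ?_, fun i t ht => ?_⟩
  · exact IsTestLimit.sum _ fun i _ => isTestLimit_indicator (hx.monotone (Fin.zero_le _))
      (hx.monotone (Fin.le_last _)) (hd' i)
  · obtain ⟨M, rfl⟩ : ∃ M, N = M + 1 := ⟨N - 1, by omega⟩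
    have h1 := hleft M (by omega)
    have h2 := hpart (Fin.last M) _ (right_mem_Icc.2 (hx Fin.castSucc_lt_succ).le)
    have h3 := hcont (Fin.last M)
    rw [finRotate_last] at h3
    have e0 : x (Fin.castSucc (0 : Fin (M + 1))) = x 0 := rfl
    have e1 : x (Fin.last M).succ = x (Fin.last (M + 1)) := rfl
    have e2 : (⟨M, by omega⟩ : Fin (M + 1)) = Fin.last M := rfl
    have e3 : (⟨0, hN⟩ : Fin (M + 1)) = 0 := rfl
    rw [e2, e3] at h1
    rw [e0, e1] at h3
    rw [e1] at h2
    rw [← integral_add_adjacent_intervals (hint _ (x (Fin.castSucc (Fin.last M))))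
      (hint _ _), h1, h2, h3]
    ring
  · have h1 := hleft i i.2
    have h2 := hpart i t (Ioo_subset_Icc_self ht)
    rw [← integral_add_adjacent_intervals (hint _ (x i.castSucc)) (hint _ _),
      h2]
    change _ = _ + ((∫ s in x 0..x (Fin.castSucc ⟨i, i.2⟩), d s) + _)
    rw [h1]
    simp only [Fin.eta]; ring

end Partition

/-! ### Conformity of periodic weak derivatives -/

section Conforming

variable {L R L' R' : ℝ}

/-- `Fx` is the weak derivative of `F` in the first variable on a strip, with periodicity in the
first variable: constants are admitted as test functions in that variable. -/
def IsPeriodicDeriv (L R L' R' : ℝ) (F Fx : ℝ × ℝ → ℝ) : Prop :=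
  HasTensorDeriv L R L' R' F Fx ∧
    ∀ b, IsTest L' R' b → ∫ z in rect L R L' R', Fx z * b z.2 = 0

lemma HasTensorDeriv.mono {F Fx : ℝ × ℝ → ℝ} (h : HasTensorDeriv L R L' R' F Fx) {l r l' r' : ℝ}
    (hl : L ≤ l) (hr : r ≤ R) (hl' : L' ≤ l') (hr' : r' ≤ R') : HasTensorDeriv l r l' r' F Fx := by
  intro a b ha hb
  have := h a b (ha.mono hl hr) (hb.mono hl' hr')
  rwa [integral_rect_eq_of_support ha.deriv hb hl hr hl' hr',
    integral_rect_eq_of_support ha hb hl hr hl' hr'] at this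

lemma IsPeriodicDeriv.mono {F Fx : ℝ × ℝ → ℝ} (h : IsPeriodicDeriv L R L' R' F Fx) {l' r' : ℝ}
    (hl' : L' ≤ l') (hr' : r' ≤ R') : IsPeriodicDeriv L R l' r' F Fx := by
  refine ⟨h.1.mono le_rfl le_rfl hl' hr', fun b hb => ?_⟩
  rw [← integral_strip_eq_of_support hb hl' hr']
  exact h.2 b (hb.mono hl' hr')

lemma IsPeriodicDeriv.congr {F Fx G : ℝ × ℝ → ℝ} (h : IsPeriodicDeriv L R L' R' F Fx)
    (hG : ∀ᵐ z ∂vol[rect L R L' R'], Fx z = G z) :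
    IsPeriodicDeriv L R L' R' F G := by
  refine ⟨fun a b ha hb => ?_, fun b hb => ?_⟩
  · rw [h.1 a b ha hb]
    congr 1
    refine integral_congr_ae ?_
    filter_upwards [hG] with z hz
    rw [hz]
  · rw [← h.2 b hb]
    refine integral_congr_ae ?_
    filter_upwards [hG] with z hz
    rw [hz]

lemma IsTestLimit.exists_bound {d : ℝ → ℝ} (hd : IsTestLimit L R d) :
    ∃ C, ∀ x ∈ Ioo L R, |d x| ≤ C := by
  obtain ⟨dn, C, -, h2, h3⟩ := hd
  exact ⟨C, fun x hx => le_of_tendsto (h3 x hx).abs (.of_forall fun n => h2 n x)⟩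

variable {N : ℕ} {x : Fin (N + 1) → ℝ}

/-- A periodic weak derivative on a strip may be tested with functions which are continuous,
periodic and piecewise smooth in the first variable. -/
lemma IsPeriodicDeriv.sum_integral_eq_zero {F Fx : ℝ × ℝ → ℝ} (hN : 0 < N) (hx : StrictMono x)
    (h : IsPeriodicDeriv (x 0) (x (Fin.last N)) L' R' F Fx)
    (hF : IntegrableOn F (rect (x 0) (x (Fin.last N)) L' R'))
    (hFx : IntegrableOn Fx (rect (x 0) (x (Fin.last N)) L' R')) {c : Fin N → ℝ → ℝ}
    (hc : ∀ i, ContDiff ℝ ∞ (c i))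
    (hcont : ∀ i, c i (x i.succ) = c (finRotate N i) (x (finRotate N i).castSucc))
    {b : ℝ → ℝ} (hb : ContDiff ℝ ∞ b) :
    ∑ i : Fin N, ∫ z in rect (x i.castSucc) (x i.succ) L' R',
      (F z * (deriv (c i) z.1 * b z.2) + Fx z * (c i z.1 * b z.2)) = 0 := by
  obtain ⟨hd1, hd2, hd3⟩ := piecewise_eq_primitive hN hx hc hcont
  set d : ℝ → ℝ := fun t => ∑ i, (Ioo (x i.castSucc) (x i.succ)).indicator (deriv (c i)) t with hd
  have hLR : x 0 < x (Fin.last N) := hx (by rw [Fin.lt_def]; exact hN)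
  have hbl := isTestLimit_indicator (L := L') (R := R') (l := L') (r := R') le_rfl le_rfl hb
  have hext := h.1.extend hLR hF hFx hd1 hd2 hbl
  have hzero := integral_testLimit_snd hFx h.2 hbl
  have hind : ∀ z ∈ rect (x 0) (x (Fin.last N)) L' R', (Ioo L' R').indicator b z.2 = b z.2 :=
    fun z hz => indicator_of_mem hz.2 _
  have hms := measurableSet_rect (x 0) (x (Fin.last N)) L' R'
  have e1 : ∫ z in rect (x 0) (x (Fin.last N)) L' R', F z * (d z.1 * (Ioo L' R').indicator b z.2)
      = ∫ z in rect (x 0) (x (Fin.last N)) L' R', F z * (d z.1 * b z.2) :=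
    setIntegral_congr_fun hms fun z hz => by simp only [hind z hz]
  have e2 : ∫ z in rect (x 0) (x (Fin.last N)) L' R',
        Fx z * ((∫ s in x 0..z.1, d s) * (Ioo L' R').indicator b z.2)
      = ∫ z in rect (x 0) (x (Fin.last N)) L' R', Fx z * ((∫ s in x 0..z.1, d s) * b z.2) :=
    setIntegral_congr_fun hms fun z hz => by simp only [hind z hz]
  have e3 : ∫ z in rect (x 0) (x (Fin.last N)) L' R', Fx z * (Ioo L' R').indicator b z.2
      = ∫ z in rect (x 0) (x (Fin.last N)) L' R', Fx z * b z.2 :=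
    setIntegral_congr_fun hms fun z hz => by simp only [hind z hz]
  rw [e1, e2] at hext
  rw [e3] at hzero
  -- integrability of the products
  obtain ⟨Cd, hCd⟩ := hd1.exists_bound
  obtain ⟨Cb, hCb⟩ := hbl.exists_bound
  have hCb' : ∀ y ∈ Ioo L' R', |b y| ≤ Cb := fun y hy => by
    have := hCb y hy; rwa [indicator_of_mem hy] at this
  have hdm : Measurable d := by
    rw [hd]
    refine Finset.measurable_sum _ fun i _ => ?_
    exact ((contDiff_infty_iff_deriv.1 (hc i)).2.continuous.measurable).indicator measurableSet_Ioo
  have hCd0 : 0 ≤ Cd := (abs_nonneg _).trans (hCd ((x 0 + x (Fin.last N)) / 2)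
    ⟨by linarith, by linarith⟩)
  have i1 : IntegrableOn (fun z => F z * (d z.1 * b z.2)) (rect (x 0) (x (Fin.last N)) L' R') := by
    refine Integrable.mul_bdd (c := Cd * Cb) hF ?_ ?_
    · exact ((hdm.comp measurable_fst).mul
        (hb.continuous.measurable.comp measurable_snd)).aestronglyMeasurable
    · refine ae_restrict_of_forall_mem hms fun z hz => ?_
      rw [norm_mul]
      exact mul_le_mul (hCd _ hz.1) (hCb' _ hz.2) (norm_nonneg _) hCd0
  have i0 : IntegrableOn (fun z => Fx z * b z.2) (rect (x 0) (x (Fin.last N)) L' R') := by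
    refine Integrable.mul_bdd (c := Cb) hFx
      (hb.continuous.comp continuous_snd).aestronglyMeasurable ?_
    exact ae_restrict_of_forall_mem hms fun z hz => hCb' _ hz.2
  have hdint : IntervalIntegrable d volume (x 0) (x (Fin.last N)) := by
    rw [intervalIntegrable_iff]
    refine integrable_finsetSum _ fun i _ => ?_
    exact Integrable.indicator (((contDiff_infty_iff_deriv.1 (hc i)).2.continuous.intervalIntegrable
      _ _).def') measurableSet_Ioo
  have hPc : ContinuousOn (fun t => ∫ s in x 0..t, d s) (Icc (x 0) (x (Fin.last N))) := by
    have := continuousOn_primitive_interval' hdint left_mem_uIcc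
    rwa [uIcc_of_le hLR.le] at this
  obtain ⟨CP, hCP⟩ := isCompact_Icc.exists_bound_of_continuousOn hPc
  have i2 : IntegrableOn (fun z => Fx z * ((∫ s in x 0..z.1, d s) * b z.2))
      (rect (x 0) (x (Fin.last N)) L' R') := by
    have h1 : IntegrableOn (fun z => (Fx z * b z.2) * ∫ s in x 0..z.1, d s)
        (rect (x 0) (x (Fin.last N)) L' R') := by
      refine Integrable.mul_bdd (c := CP) i0 ?_ ?_
      · have h2 : ContinuousOn (fun z : ℝ × ℝ => ∫ s in x 0..z.1, d s)
            (rect (x 0) (x (Fin.last N)) L' R') :=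
          hPc.comp continuousOn_fst fun z hz => Ioo_subset_Icc_self hz.1
        exact h2.aestronglyMeasurable hms
      · exact ae_restrict_of_forall_mem hms fun z hz => hCP _ (Ioo_subset_Icc_self hz.1)
    refine h1.congr (.of_forall fun z => ?_)
    simp only []; ring
  set c₀ := c ⟨0, hN⟩ (x 0) with hc₀
  have hmemd : ∀ i, ∀ t ∈ Ioo (x i.castSucc) (x i.succ), d t = deriv (c i) t := by
    intro i t ht
    simp only [hd]
    rw [sum_eq_single i]
    · exact indicator_of_mem ht _
    · intro j _ hj
      exact indicator_of_notMem (fun h' => Set.disjoint_left.1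
        (pairwise_disjoint_subinterval hx hj) h' ht) _
    · simp
  have i3 : IntegrableOn (fun z => Fx z * ((∫ s in x 0..z.1, d s) * b z.2)
      + c₀ * (Fx z * b z.2)) (rect (x 0) (x (Fin.last N)) L' R') := i2.add (i0.const_mul _)
  have i23 : IntegrableOn (fun z => F z * (d z.1 * b z.2)
      + (Fx z * ((∫ s in x 0..z.1, d s) * b z.2) + c₀ * (Fx z * b z.2)))
      (rect (x 0) (x (Fin.last N)) L' R') := i1.add i3
  have htot : ∫ z in rect (x 0) (x (Fin.last N)) L' R', (F z * (d z.1 * b z.2)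
      + (Fx z * ((∫ s in x 0..z.1, d s) * b z.2) + c₀ * (Fx z * b z.2))) = 0 := by
    rw [integral_add i1 i3, integral_add i2 (i0.const_mul _), integral_const_mul, hzero, hext]
    ring
  rw [integral_strip_eq_sum hx i23] at htot
  rw [← htot]
  refine sum_congr rfl fun i _ => ?_
  refine setIntegral_congr_fun (measurableSet_rect _ _ _ _) fun z hz => ?_
  simp only [hmemd i z.1 hz.1, hd3 i z.1 hz.1]
  ring

end Conforming

section Mesh

variable {a₁ b₁ a₂ b₂ : ℝ}

/-- The partition of a mesh in the first variable, with periodic neighbours. -/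
def meshX (M : RectMesh a₁ b₁ a₂ b₂) : Mesh1 (Fin M.Nx) where
  L := M.xL
  R := M.xR
  lt _ := M.x_strictMono Fin.castSucc_lt_succ
  next := finRotate M.Nx

/-- The partition of a mesh in the second variable, with periodic neighbours. -/
def meshY (M : RectMesh a₁ b₁ a₂ b₂) : Mesh1 (Fin M.Ny) where
  L := M.yL
  R := M.yR
  lt _ := M.y_strictMono Fin.castSucc_lt_succ
  next := finRotate M.Ny

/-- The mesh with the two variables exchanged. -/
def RectMesh.swap (M : RectMesh a₁ b₁ a₂ b₂) : RectMesh a₂ b₂ a₁ b₁ where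
  Nx := M.Ny
  Ny := M.Nx
  Nx_pos := M.Ny_pos
  Ny_pos := M.Nx_pos
  x := M.y
  y := M.x
  x_strictMono := M.y_strictMono
  y_strictMono := M.x_strictMono
  x_zero := M.y_zero
  x_last := M.y_last
  y_zero := M.x_zero
  y_last := M.x_last

lemma cell_eq (M : RectMesh a₁ b₁ a₂ b₂) (i : Fin M.Nx) (j : Fin M.Ny) :
    cellXY (meshX M) (meshY M) i j = M.cell i j := rfl

variable (M : RectMesh a₁ b₁ a₂ b₂)

lemma RectMesh.le_xL (i : Fin M.Nx) : a₁ ≤ M.xL i := by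
  have := M.x_strictMono.monotone (Fin.zero_le i.castSucc)
  rwa [M.x_zero] at this

lemma RectMesh.xR_le (i : Fin M.Nx) : M.xR i ≤ b₁ := by
  have := M.x_strictMono.monotone (Fin.le_last i.succ)
  rwa [M.x_last] at this

lemma RectMesh.le_yL (j : Fin M.Ny) : a₂ ≤ M.yL j := M.swap.le_xL j

lemma RectMesh.yR_le (j : Fin M.Ny) : M.yR j ≤ b₂ := M.swap.xR_le j

lemma RectMesh.cell_subset (i : Fin M.Nx) (j : Fin M.Ny) : M.cell i j ⊆ rect a₁ b₁ a₂ b₂ :=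
  prod_mono (Ioo_subset_Ioo (M.le_xL i) (M.xR_le i)) (Ioo_subset_Ioo (M.le_yL j) (M.yR_le j))

lemma integral_strip_eq_sum_cells {L' R' : ℝ} {H : ℝ × ℝ → ℝ}
    (hH : IntegrableOn H (rect a₁ b₁ L' R')) :
    ∫ z in rect a₁ b₁ L' R', H z = ∑ i, ∫ z in rect (M.xL i) (M.xR i) L' R', H z := by
  have := integral_strip_eq_sum (L' := L') (R' := R') (H := H) M.x_strictMono
    (by rw [M.x_zero, M.x_last]; exact hH)
  rwa [M.x_zero, M.x_last] at this

lemma integral_rect_eq_sum_cells {H : ℝ × ℝ → ℝ} (hH : IntegrableOn H (rect a₁ b₁ a₂ b₂)) :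
    ∫ z in rect a₁ b₁ a₂ b₂, H z = ∑ i, ∑ j, ∫ z in M.cell i j, H z := by
  rw [integral_strip_eq_sum_cells M hH]
  refine sum_congr rfl fun i _ => ?_
  have h1 : IntegrableOn H (rect (M.xL i) (M.xR i) a₂ b₂) :=
    hH.mono_set (prod_mono (Ioo_subset_Ioo (M.le_xL i) (M.xR_le i)) le_rfl)
  rw [integral_rect_swap, integral_strip_eq_sum_cells M.swap (IntegrableOn.rect_swap h1)]
  refine sum_congr rfl fun j _ => ?_
  exact (integral_rect_swap _ _ _ _ _).symm

lemma cellL2_of_memLp {F : ℝ × ℝ → ℝ} (hF : MemLp F 2 vol[rect a₁ b₁ a₂ b₂]) :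
    CellL2 (meshX M) (meshY M) F := fun i j =>
  hF.mono_measure (Measure.restrict_mono (M.cell_subset i j) le_rfl)

lemma cellSq_eq_integral {F : ℝ × ℝ → ℝ} (hF : MemLp F 2 vol[rect a₁ b₁ a₂ b₂]) :
    cellSq (meshX M) (meshY M) F = ∫ z in rect a₁ b₁ a₂ b₂, F z ^ 2 :=
  (integral_rect_eq_sum_cells M hF.integrable_sq).symm

lemma isFiniteMeasure_rect (L R L' R' : ℝ) :
    IsFiniteMeasure ((volume : Measure (ℝ × ℝ)).restrict (rect L R L' R')) := by
  rw [restrict_rect]; infer_instance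

lemma lift_sum {ι : Type} (X : Mesh1 ι) {n : ℕ} (σ : ℝ) (t : Fin n → ℝ) (J : Fin n → ι → ℝ) (i : ι)
    (x : ℝ) : X.lift σ (fun i => ∑ l, t l * J l i) i x = ∑ l, t l * X.lift σ (J l) i x := by
  simp only [Mesh1.lift, mul_sum, sum_mul, ← sum_add_distrib]
  exact sum_congr rfl fun _ _ => by ring

lemma liftDeriv_sum {ι : Type} (X : Mesh1 ι) {n : ℕ} (σ : ℝ) (t : Fin n → ℝ) (J : Fin n → ι → ℝ)
    (i : ι) : X.liftDeriv σ (fun i => ∑ l, t l * J l i) i = ∑ l, t l * X.liftDeriv σ (J l) i := by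
  simp only [Mesh1.liftDeriv, mul_sum, ← sum_add_distrib, ← sum_neg_distrib,
    Finset.sum_div]
  exact sum_congr rfl fun _ _ => by ring

lemma jump_sx {ι κ : Type} {k : ℕ} (X : Mesh1 ι) (w : V2 ι κ k) (j : κ) (y : ℝ) :
    X.jump (sx w j y) = fun i => ∑ n : Fin (k + 1), y ^ (n : ℕ)
      * X.jump (fun i' m => w i' j m n) i := by
  funext i
  simp only [Mesh1.jump, sx, slx_eq_sum, ev_sum, mul_sub, sum_sub_distrib]

/-- Periodic weak derivatives on the rows of the mesh satisfy the conformity relation. -/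
lemma isConforming_of_strips (k : ℕ) (σ : ℝ) {F Fx : ℝ × ℝ → ℝ}
    (hF : MemLp F 2 vol[rect a₁ b₁ a₂ b₂])
    (hFx : MemLp Fx 2 vol[rect a₁ b₁ a₂ b₂])
    (h : ∀ j, IsPeriodicDeriv a₁ b₁ (M.yL j) (M.yR j) F Fx) :
    IsConforming (meshX M) (meshY M) k σ F Fx := by
  intro w
  have := isFiniteMeasure_rect a₁ b₁ a₂ b₂
  have hFi : IntegrableOn F (rect a₁ b₁ a₂ b₂) := hF.integrable one_le_two
  have hFxi : IntegrableOn Fx (rect a₁ b₁ a₂ b₂) := hFx.integrable one_le_two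
  set X := meshX M with hX
  -- the coefficient of `y ^ n` of the continuous part of `w` on the row `j`
  set c : Fin M.Ny → Fin (k + 1) → Fin M.Nx → ℝ → ℝ := fun j n i t =>
    ev (fun m => w i j m n) t - X.lift σ (X.jump fun i' m => w i' j m n) i t with hc
  have hcd : ∀ j n i t, HasDerivAt (c j n i) (ev (dc fun m => w i j m n) t
      - X.liftDeriv σ (X.jump fun i' m => w i' j m n) i) t := fun j n i t =>
    (hasDerivAt_ev _ t).sub (X.hasDerivAt_lift _ _ _ _)
  have hcs : ∀ j n i, ContDiff ℝ ∞ (c j n i) := fun j n i => by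
    refine (contDiff_ev _).sub ?_
    unfold Mesh1.lift
    fun_prop
  have hcc : ∀ j n i, c j n i (M.xR i) = c j n (finRotate M.Nx i) (M.xL (finRotate M.Nx i)) := by
    intro j n i
    have e1 := X.lift_R σ (X.jump fun i' m => w i' j m n) i
    have e2 := X.lift_L σ (X.jump fun i' m => w i' j m n) (X.next i)
    rw [Equiv.symm_apply_apply] at e2
    change ev (fun m => w i j m n) (X.R i) - X.lift _ _ i (X.R i)
      = ev (fun m => w (X.next i) j m n) (X.L (X.next i))
        - X.lift _ _ (X.next i) (X.L (X.next i))
    rw [e1, e2]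
    simp only [Mesh1.jump]; ring
  have hsum : ∀ i j (z : ℝ × ℝ),
      F z * ((dcX w i j).eval z - liftXDeriv X σ w i j z)
        + Fx z * ((w i j).eval z - liftX X σ w i j z)
      = ∑ n : Fin (k + 1), (F z * (deriv (c j n i) z.1 * z.2 ^ (n : ℕ))
        + Fx z * (c j n i z.1 * z.2 ^ (n : ℕ))) := by
    rintro i j ⟨x, y⟩
    have e1 : (w i j).eval (x, y) = ∑ n : Fin (k + 1), y ^ (n : ℕ) * ev (fun m => w i j m n) x := by
      rw [eval_eq_slx, slx_eq_sum, ev_sum]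
    have e2 : (dcX w i j).eval (x, y)
        = ∑ n : Fin (k + 1), y ^ (n : ℕ) * ev (dc fun m => w i j m n) x := by
      rw [dcX, eval_eq_slx, slx_dcx, slx_eq_sum, dc_sum Finset.univ
        (fun n : Fin (k + 1) => y ^ (n : ℕ)) (fun n m => w i j m n), ev_sum]
    have e3 : liftX X σ w i j (x, y) = ∑ n : Fin (k + 1), y ^ (n : ℕ)
        * X.lift σ (X.jump fun i' m => w i' j m n) i x := by
      rw [liftX, jump_sx, lift_sum]
    have e4 : liftXDeriv X σ w i j (x, y) = ∑ n : Fin (k + 1), y ^ (n : ℕ)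
        * X.liftDeriv σ (X.jump fun i' m => w i' j m n) i := by
      rw [liftXDeriv, jump_sx, liftDeriv_sum]
    simp only [(hcd _ _ _ _).deriv]
    rw [e1, e2, e3, e4, ← sum_sub_distrib, ← sum_sub_distrib, mul_sum,
      mul_sum, ← sum_add_distrib]
    refine sum_congr rfl fun n _ => ?_
    simp only [hc]; ring
  have hint : ∀ {f : ℝ × ℝ → ℝ}, IntegrableOn f (rect a₁ b₁ a₂ b₂) → ∀ i j {g : ℝ × ℝ → ℝ},
      Continuous g → IntegrableOn (fun z => f z * g z) (M.cell i j) := by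
    intro f hf i j g hg
    have hK : IsCompact (Icc (M.xL i) (M.xR i) ×ˢ Icc (M.yL j) (M.yR j)) :=
      isCompact_Icc.prod isCompact_Icc
    obtain ⟨C, hC⟩ := hK.exists_bound_of_continuousOn hg.continuousOn
    refine Integrable.mul_bdd (c := C) (hf.mono_set (M.cell_subset i j)) hg.aestronglyMeasurable ?_
    exact ae_restrict_of_forall_mem (measurableSet_rect _ _ _ _) fun z hz =>
      hC z (prod_mono Ioo_subset_Icc_self Ioo_subset_Icc_self hz)
  simp only [hsum]
  have hswap : ∀ i j, ∫ z in cellXY X (meshY M) i j,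
      ∑ n : Fin (k + 1), (F z * (deriv (c j n i) z.1 * z.2 ^ (n : ℕ))
        + Fx z * (c j n i z.1 * z.2 ^ (n : ℕ)))
      = ∑ n : Fin (k + 1), ∫ z in M.cell i j, (F z * (deriv (c j n i) z.1 * z.2 ^ (n : ℕ))
        + Fx z * (c j n i z.1 * z.2 ^ (n : ℕ))) := by
    intro i j
    refine integral_finsetSum _ fun n _ => ?_
    refine (hint hFi i j ?_).add (hint hFxi i j ?_)
    · exact ((contDiff_infty_iff_deriv.1 (hcs j n i)).2.continuous.comp continuous_fst).mul
        (continuous_snd.pow _)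
    · exact ((hcs j n i).continuous.comp continuous_fst).mul (continuous_snd.pow _)
  simp only [hswap]
  rw [sum_comm]
  refine sum_eq_zero fun j _ => ?_
  rw [sum_comm]
  refine sum_eq_zero fun n _ => ?_
  have hsub : rect a₁ b₁ (M.yL j) (M.yR j) ⊆ rect a₁ b₁ a₂ b₂ :=
    prod_mono le_rfl (Ioo_subset_Ioo (M.le_yL j) (M.yR_le j))
  have hj := h j
  have hF' := hFi.mono_set hsub
  have hFx' := hFxi.mono_set hsub
  refine IsPeriodicDeriv.sum_integral_eq_zero M.Nx_pos M.x_strictMono (F := F) (Fx := Fx)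
    (L' := M.yL j) (R' := M.yR j) ?_ ?_ ?_ (hcs j n) (hcc j n)
    (b := fun y => y ^ (n : ℕ)) (by fun_prop)
  all_goals rw [M.x_zero, M.x_last]; assumption

end Mesh

/-! ### The exact solution at a fixed time -/

section ExactAt

variable {a₁ b₁ a₂ b₂ : ℝ}

/-- The weak form of `(p, q) = ∇u`, `S = ∇ · (p, q)` on the torus, for products of periodic test
functions. -/
structure IsWeakPoisson (a₁ b₁ a₂ b₂ : ℝ) (u p q S : ℝ × ℝ → ℝ) : Prop where
  dx : ∀ A B : ℝ → ℝ, ContDiff ℝ ∞ A → ContDiff ℝ ∞ B → (∀ x, A (x + (b₁ - a₁)) = A x) →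
    (∀ x, B (x + (b₂ - a₂)) = B x) →
    ∫ z in rect a₁ b₁ a₂ b₂, u z * (deriv A z.1 * B z.2)
      = -∫ z in rect a₁ b₁ a₂ b₂, p z * (A z.1 * B z.2)
  dy : ∀ A B : ℝ → ℝ, ContDiff ℝ ∞ A → ContDiff ℝ ∞ B → (∀ x, A (x + (b₁ - a₁)) = A x) →
    (∀ x, B (x + (b₂ - a₂)) = B x) →
    ∫ z in rect a₁ b₁ a₂ b₂, u z * (A z.1 * deriv B z.2)
      = -∫ z in rect a₁ b₁ a₂ b₂, q z * (A z.1 * B z.2)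
  div : ∀ A B : ℝ → ℝ, ContDiff ℝ ∞ A → ContDiff ℝ ∞ B → (∀ x, A (x + (b₁ - a₁)) = A x) →
    (∀ x, B (x + (b₂ - a₂)) = B x) →
    ∫ z in rect a₁ b₁ a₂ b₂, S z * (A z.1 * B z.2)
      = -∫ z in rect a₁ b₁ a₂ b₂,
        (p z * (deriv A z.1 * B z.2) + q z * (A z.1 * deriv B z.2))

lemma IsWeakPoisson.swap {u p q S : ℝ × ℝ → ℝ} (h : IsWeakPoisson a₁ b₁ a₂ b₂ u p q S) :
    IsWeakPoisson a₂ b₂ a₁ b₁ (fun z => u z.swap) (fun z => q z.swap) (fun z => p z.swap)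
      (fun z => S z.swap) where
  dx A B hA hB hAp hBp := by
    have := h.dy B A hB hA hBp hAp
    rw [integral_rect_swap, integral_rect_swap (fun z => q z * _)] at this
    simpa only [Prod.fst_swap, Prod.snd_swap, mul_comm (B _)] using this
  dy A B hA hB hAp hBp := by
    have := h.dx B A hB hA hBp hAp
    rw [integral_rect_swap, integral_rect_swap (fun z => p z * _)] at this
    simpa only [Prod.fst_swap, Prod.snd_swap, mul_comm (B _), mul_comm (deriv B _)] using this
  div A B hA hB hAp hBp := by
    have := h.div B A hB hA hBp hAp
    rw [integral_rect_swap, integral_rect_swap (fun z => _ + _)] at this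
    simpa only [Prod.fst_swap, Prod.snd_swap, mul_comm (B _), mul_comm (deriv B _),
      add_comm (p _ * _)] using this

/-- On a set where all points lie in the rectangle, test functions and their periodic extensions
agree. -/
lemma integral_rect_congr_periodic {A B a b : ℝ → ℝ} (hA : ∀ x ∈ Ioo a₁ b₁, A x = a x)
    (hB : ∀ x ∈ Ioo a₂ b₂, B x = b x) (H : ℝ × ℝ → ℝ) :
    ∫ z in rect a₁ b₁ a₂ b₂, H z * (A z.1 * B z.2)
      = ∫ z in rect a₁ b₁ a₂ b₂, H z * (a z.1 * b z.2) :=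
  setIntegral_congr_fun (measurableSet_rect _ _ _ _) fun z hz => by
    simp only [hA _ hz.1, hB _ hz.2]

lemma IsWeakPoisson.isPeriodicDeriv {u p q S : ℝ × ℝ → ℝ}
    (h : IsWeakPoisson a₁ b₁ a₂ b₂ u p q S) (hx : a₁ < b₁) (hy : a₂ < b₂) :
    IsPeriodicDeriv a₁ b₁ a₂ b₂ u p := by
  refine ⟨fun a b ha hb => ?_, fun b hb => ?_⟩
  · obtain ⟨A, hA, hAp, hAa⟩ := ha.exists_periodic hx
    obtain ⟨B, hB, hBp, hBb⟩ := hb.exists_periodic hy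
    have := h.dx A B hA hB hAp hBp
    rwa [integral_rect_congr_periodic (deriv_eq_of_eq_on_Ioo hAa) hBb,
      integral_rect_congr_periodic hAa hBb] at this
  · obtain ⟨B, hB, hBp, hBb⟩ := hb.exists_periodic hy
    have := h.dx (fun _ => 1) B contDiff_const hB (fun _ => rfl) hBp
    rw [integral_rect_congr_periodic (a := fun _ => 1) (fun _ _ => rfl) hBb] at this
    simp only [deriv_const, zero_mul, mul_zero, integral_zero, one_mul] at this
    linarith

variable (M : RectMesh a₁ b₁ a₂ b₂)

lemma ae_rect_of_ae_cells {P : ℝ × ℝ → Prop}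
    (h : ∀ i j, ∀ᵐ z ∂vol[M.cell i j], P z) :
    ∀ᵐ z ∂vol[rect a₁ b₁ a₂ b₂], P z := by
  have h1 : ∀ᵐ z : ℝ × ℝ, (∀ i, M.x i ≠ z.1) ∧ ∀ j, M.y j ≠ z.2 := by
    have hne : ∀ c : ℝ, ∀ᵐ t : ℝ, c ≠ t := fun c => by rw [ae_iff]; simp
    rw [Measure.volume_eq_prod]
    refine Filter.Eventually.and ?_ ?_
    · rw [ae_all_iff]
      exact fun i => Measure.quasiMeasurePreserving_fst.ae (hne _)
    · rw [ae_all_iff]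
      exact fun i => Measure.quasiMeasurePreserving_snd.ae (hne _)
  have h2 : ∀ᵐ z : ℝ × ℝ, ∀ i j, z ∈ M.cell i j → P z := by
    rw [ae_all_iff]; intro i; rw [ae_all_iff]; intro j
    exact (ae_restrict_iff' (measurableSet_rect _ _ _ _)).1 (h i j)
  rw [ae_restrict_iff' (measurableSet_rect _ _ _ _)]
  filter_upwards [h1, h2] with z hz hz2 hzm
  obtain ⟨i, hi⟩ := exists_mem_subinterval (x := M.x) (by rw [M.x_zero]; exact hzm.1.1)
    (by rw [M.x_last]; exact hzm.1.2) hz.1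
  obtain ⟨j, hj⟩ := exists_mem_subinterval (x := M.y) (by rw [M.y_zero]; exact hzm.2.1)
    (by rw [M.y_last]; exact hzm.2.2) hz.2
  exact hz2 i j ⟨hi, hj⟩

/-- The flux agrees with the broken derivative. -/
lemma flux_eq_broken {u p G : ℝ × ℝ → ℝ} (hp : HasTensorDeriv a₁ b₁ a₂ b₂ u p)
    (hpi : IntegrableOn p (rect a₁ b₁ a₂ b₂)) (hGi : IntegrableOn G (rect a₁ b₁ a₂ b₂))
    (hG : ∀ i j, HasTensorDeriv (M.xL i) (M.xR i) (M.yL j) (M.yR j) u G) :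
    ∀ᵐ z ∂vol[rect a₁ b₁ a₂ b₂], p z = G z := by
  refine ae_rect_of_ae_cells M fun i j => ?_
  have hi1 := hpi.mono_set (M.cell_subset i j)
  have hi2 := hGi.mono_set (M.cell_subset i j)
  have := ae_eq_zero_of_tensor ((meshX M).lt i) ((meshY M).lt j) (hi1.sub hi2)
    (fun a b ha hb => by
      have e1 := hp.mono (M.le_xL i) (M.xR_le i) (M.le_yL j) (M.yR_le j) a b ha hb
      have e2 := hG i j a b ha hb
      rw [e1, neg_inj] at e2
      simp only [Pi.sub_apply, sub_mul]
      rw [integral_sub]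
      · exact sub_eq_zero.2 e2
      · refine (ha.integrable_mul_fst (hb.integrable_mul_snd hi1)).congr
          (.of_forall fun z => ?_)
        simp only []; ring
      · refine (ha.integrable_mul_fst (hb.integrable_mul_snd hi2)).congr
          (.of_forall fun z => ?_)
        simp only []; ring)
  filter_upwards [this] with z hz
  exact sub_eq_zero.1 hz

end ExactAt

section ExactAt

variable {a₁ b₁ a₂ b₂ : ℝ} (M : RectMesh a₁ b₁ a₂ b₂) {r : ℕ} {G : ℕ → ℕ → ℝ × ℝ → ℝ}
  {u p q S : ℝ × ℝ → ℝ}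

lemma integrableOn_mul_of_bdd {L R L' R' : ℝ} {H g : ℝ × ℝ → ℝ}
    (hH : IntegrableOn H (rect L R L' R'))
    (hg : Continuous g) : IntegrableOn (fun z => H z * g z) (rect L R L' R') := by
  obtain ⟨C, hC⟩ := (isCompact_Icc.prod isCompact_Icc :
    IsCompact (Icc L R ×ˢ Icc L' R')).exists_bound_of_continuousOn hg.continuousOn
  exact Integrable.mul_bdd (c := C) hH hg.aestronglyMeasurable
    (ae_restrict_of_forall_mem (measurableSet_rect _ _ _ _) fun z hz =>
      hC z (prod_mono Ioo_subset_Icc_self Ioo_subset_Icc_self hz))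

/-- A weak derivative in the second variable on a rectangle may be tested with products in which
only the second factor has compact support. -/
lemma HasTensorDeriv.swap_apply {L R L' R' : ℝ} {F Fy : ℝ × ℝ → ℝ}
    (h : HasTensorDeriv L' R' L R (fun z => F z.swap) (fun z => Fy z.swap))
    (hF : IntegrableOn F (rect L R L' R')) (hFy : IntegrableOn Fy (rect L R L' R'))
    {A b : ℝ → ℝ} (hA : ContDiff ℝ ∞ A) (hb : IsTest L' R' b) :
    ∫ z in rect L R L' R', (F z * (A z.1 * deriv b z.2) + Fy z * (A z.1 * b z.2)) = 0 := by
  have i1 := hb.deriv.integrable_mul_snd hF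
  have i2 := hb.integrable_mul_snd hFy
  have i3 : IntegrableOn (fun z => F z * deriv b z.2 + Fy z * b z.2) (rect L R L' R') := i1.add i2
  have key := integral_testLimit_fst i3 (fun a ha => by
    have := h b a hb ha
    rw [integral_rect_swap, integral_rect_swap (fun z => Fy z.swap * _)] at this
    simp only [Prod.swap_swap, Prod.fst_swap, Prod.snd_swap] at this
    have j1 : IntegrableOn (fun z => F z * (deriv b z.2 * a z.1)) (rect L R L' R') :=
      (ha.integrable_mul_fst i1).congr (.of_forall fun z => by
        simp only []; ring)
    have j2 : IntegrableOn (fun z => Fy z * (b z.2 * a z.1)) (rect L R L' R') :=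
      (ha.integrable_mul_fst i2).congr (.of_forall fun z => by
        simp only []; ring)
    have e : ∀ z : ℝ × ℝ, (F z * deriv b z.2 + Fy z * b z.2) * a z.1
      = F z * (deriv b z.2 * a z.1) + Fy z * (b z.2 * a z.1) := fun z => by ring
    simp only [e]
    rw [integral_add j1 j2, this]; ring)
    (isTestLimit_indicator (l := L) (r := R) le_rfl le_rfl hA)
  rw [← key]
  refine setIntegral_congr_fun (measurableSet_rect _ _ _ _) fun z hz => ?_
  simp only [indicator_of_mem hz.1]
  ring

/-- The divergence of the flux is the sum of the broken second derivatives. -/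
lemma IsWeakPoisson.divergence_eq (h : IsWeakPoisson a₁ b₁ a₂ b₂ u p q S) (hx : a₁ < b₁)
    (hy : a₂ < b₂) (hG : BrokenSmooth (meshX M) (meshY M) r G) (hr : 2 ≤ r)
    (hpG : ∀ᵐ z ∂vol[rect a₁ b₁ a₂ b₂], p z = G 1 0 z)
    (hqG : ∀ᵐ z ∂vol[rect a₁ b₁ a₂ b₂], q z = G 0 1 z)
    (hS : IntegrableOn S (rect a₁ b₁ a₂ b₂)) :
    ∀ᵐ z ∂vol[rect a₁ b₁ a₂ b₂], S z = G 2 0 z + G 0 2 z := by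
  refine ae_rect_of_ae_cells M fun i j => ?_
  have hsub : vol[M.cell i j] ≤ vol[rect a₁ b₁ a₂ b₂] :=
    Measure.restrict_mono (M.cell_subset i j) le_rfl
  have hfin := isFiniteMeasure_rect (M.xL i) (M.xR i) (M.yL j) (M.yR j)
  have hGi : ∀ m n, m + n ≤ r →
      IntegrableOn (G m n) (rect (M.xL i) (M.xR i) (M.yL j) (M.yR j)) :=
    fun m n hmn => (show MemLp (G m n) 2 vol[rect (M.xL i) (M.xR i) (M.yL j)
      (M.yR j)] from hG.memLp m n hmn i j).integrable one_le_two
  have hSi := hS.mono_set (M.cell_subset i j)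
  have hZ : IntegrableOn (fun z => S z - (G 2 0 z + G 0 2 z))
      (rect (M.xL i) (M.xR i) (M.yL j) (M.yR j)) :=
    hSi.sub ((hGi 2 0 (by omega)).add (hGi 0 2 (by omega)))
  have key := ae_eq_zero_of_tensor (L := M.xL i) (R := M.xR i) (L' := M.yL j) (R' := M.yR j)
      ((meshX M).lt i) ((meshY M).lt j) hZ fun a b ha hb => by
    obtain ⟨A, hA, hAp, hAa⟩ := (ha.mono (M.le_xL i) (M.xR_le i)).exists_periodic hx
    obtain ⟨B, hB, hBp, hBb⟩ := (hb.mono (M.le_yL j) (M.yR_le j)).exists_periodic hy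
    have e := h.div A B hA hB hAp hBp
    have e1 : ∫ z in rect a₁ b₁ a₂ b₂, (p z * (deriv A z.1 * B z.2) + q z * (A z.1 * deriv B z.2))
        = ∫ z in rect a₁ b₁ a₂ b₂, (G 1 0 z * (deriv a z.1 * b z.2)
          + G 0 1 z * (a z.1 * deriv b z.2)) := by
      refine integral_congr_ae ?_
      filter_upwards [hpG, hqG, ae_restrict_mem (measurableSet_rect a₁ b₁ a₂ b₂)] with z h1 h2 hz
      rw [h1, h2, hAa _ hz.1, hBb _ hz.2, deriv_eq_of_eq_on_Ioo hAa _ hz.1,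
        deriv_eq_of_eq_on_Ioo hBb _ hz.2]
    have e2 : ∫ z in rect a₁ b₁ a₂ b₂, (G 1 0 z * (deriv a z.1 * b z.2)
          + G 0 1 z * (a z.1 * deriv b z.2))
        = ∫ z in rect (M.xL i) (M.xR i) (M.yL j) (M.yR j), (G 1 0 z * (deriv a z.1 * b z.2)
          + G 0 1 z * (a z.1 * deriv b z.2)) := by
      refine setIntegral_eq_of_subset_of_forall_sdiff_eq_zero (measurableSet_rect _ _ _ _)
        (M.cell_subset i j) fun z hz => ?_
      obtain ⟨-, l, r, hl, hr, h0⟩ := id ha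
      obtain ⟨-, l', r', hl', hr', h0'⟩ := id hb
      obtain ⟨-, m, s, hm, hs, h1⟩ := ha.deriv
      obtain ⟨-, m', s', hm', hs', h1'⟩ := hb.deriv
      by_cases hz1 : z.1 ∈ Ioo (M.xL i) (M.xR i)
      · have hz2 : z.2 ∉ Ioo (M.yL j) (M.yR j) := fun h2 => hz.2 ⟨hz1, h2⟩
        rw [h0' _ fun h => hz2 ⟨hl'.trans_le h.1, h.2.trans_lt hr'⟩,
          h1' _ fun h => hz2 ⟨hm'.trans_le h.1, h.2.trans_lt hs'⟩]; ring
      · rw [h0 _ fun h => hz1 ⟨hl.trans_le h.1, h.2.trans_lt hr⟩,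
          h1 _ fun h => hz1 ⟨hm.trans_le h.1, h.2.trans_lt hs⟩]; ring
    rw [integral_rect_congr_periodic hAa hBb, integral_rect_eq_of_support ha hb (M.le_xL i)
      (M.xR_le i) (M.le_yL j) (M.yR_le j), e1, e2] at e
    have d1 := hG.derivX 1 0 (by omega) i j a b ha hb
    have d2 := hG.derivY 0 1 (by omega) i j
    have d3 : ∫ z in rect (M.xL i) (M.xR i) (M.yL j) (M.yR j),
        (G 0 1 z * (a z.1 * deriv b z.2) + G 0 2 z * (a z.1 * b z.2)) = 0 :=
      d2.swap_apply (hGi 0 1 (by omega)) (hGi 0 2 (by omega)) ha.1 hb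
    have k : ∀ {H : ℝ × ℝ → ℝ} {c d : ℝ → ℝ},
        IntegrableOn H (rect (M.xL i) (M.xR i) (M.yL j) (M.yR j)) → Continuous c → Continuous d →
        IntegrableOn (fun z => H z * (c z.1 * d z.2))
          (rect (M.xL i) (M.xR i) (M.yL j) (M.yR j)) := fun hH hc hd =>
      integrableOn_mul_of_bdd hH ((hc.comp continuous_fst).mul (hd.comp continuous_snd))
    have ca := ha.1.continuous
    have cb := hb.1.continuous
    have ca' := ha.deriv.1.continuous
    have cb' := hb.deriv.1.continuous
    have e3 : ∀ z : ℝ × ℝ, (S z - (G 2 0 z + G 0 2 z)) * (a z.1 * b z.2)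
      = S z * (a z.1 * b z.2) - (G 2 0 z * (a z.1 * b z.2) + G 0 2 z * (a z.1 * b z.2)) :=
      fun z => by ring
    simp only [e3]
    have k1 := k (hGi 2 0 (by omega)) ca cb
    have k2 := k (hGi 0 2 (by omega)) ca cb
    have k12 : IntegrableOn (fun z => G 2 0 z * (a z.1 * b z.2) + G 0 2 z * (a z.1 * b z.2))
      (rect (M.xL i) (M.xR i) (M.yL j) (M.yR j)) := k1.add k2
    rw [integral_sub (k hSi ca cb) k12, integral_add k1 k2]
    rw [integral_add (k (hGi 1 0 (by omega)) ca' cb) (k (hGi 0 1 (by omega)) ca cb')] at e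
    rw [integral_add (k (hGi 0 1 (by omega)) ca cb') k2] at d3
    have d1' : ∫ z in rect (M.xL i) (M.xR i) (M.yL j) (M.yR j), G 1 0 z * (deriv a z.1 * b z.2)
      = -∫ z in rect (M.xL i) (M.xR i) (M.yL j) (M.yR j), G 2 0 z * (a z.1 * b z.2) := d1
    linarith
  filter_upwards [key] with z hz
  linarith

/-- On every row of the mesh, the flux has a periodic weak derivative in the first variable. -/
lemma IsWeakPoisson.isPeriodicDeriv_flux (h : IsWeakPoisson a₁ b₁ a₂ b₂ u p q S)
    (hx : a₁ < b₁) (hy : a₂ < b₂) (hG : BrokenSmooth (meshX M) (meshY M) r G) (hr : 2 ≤ r)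
    (hpi : IntegrableOn p (rect a₁ b₁ a₂ b₂))
    (hG1 : IntegrableOn (G 0 1) (rect a₁ b₁ a₂ b₂))
    (hG20 : IntegrableOn (G 2 0) (rect a₁ b₁ a₂ b₂))
    (hG02 : IntegrableOn (G 0 2) (rect a₁ b₁ a₂ b₂))
    (hqG : ∀ᵐ z ∂vol[rect a₁ b₁ a₂ b₂], q z = G 0 1 z)
    (hS : ∀ᵐ z ∂vol[rect a₁ b₁ a₂ b₂], S z = G 2 0 z + G 0 2 z) (j : Fin M.Ny) :
    IsPeriodicDeriv a₁ b₁ (M.yL j) (M.yR j) p (G 2 0) := by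
  have hsub : rect a₁ b₁ (M.yL j) (M.yR j) ⊆ rect a₁ b₁ a₂ b₂ :=
    prod_mono le_rfl (Ioo_subset_Ioo (M.le_yL j) (M.yR_le j))
  have main : ∀ A b : ℝ → ℝ, ContDiff ℝ ∞ A → (∀ x, A (x + (b₁ - a₁)) = A x) →
      IsTest (M.yL j) (M.yR j) b →
      ∫ z in rect a₁ b₁ (M.yL j) (M.yR j), p z * (deriv A z.1 * b z.2)
        = -∫ z in rect a₁ b₁ (M.yL j) (M.yR j), G 2 0 z * (A z.1 * b z.2) := by
    intro A b hA hAp hb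
    obtain ⟨B, hB, hBp, hBb⟩ := (hb.mono (M.le_yL j) (M.yR_le j)).exists_periodic hy
    have e := h.div A B hA hB hAp hBp
    have ca := hA.continuous
    have ca' := (contDiff_infty_iff_deriv.1 hA).2.continuous
    have cb := hb.1.continuous
    have cb' := hb.deriv.1.continuous
    have hout : ∀ z ∈ rect a₁ b₁ a₂ b₂ \ rect a₁ b₁ (M.yL j) (M.yR j),
        b z.2 = 0 ∧ deriv b z.2 = 0 := by
      intro z hz
      have hz2 : z.2 ∉ Ioo (M.yL j) (M.yR j) := fun h2 => hz.2 ⟨hz.1.1, h2⟩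
      obtain ⟨-, l', r', hl', hr', h0'⟩ := id hb
      obtain ⟨-, m', s', hm', hs', h1'⟩ := hb.deriv
      exact ⟨h0' _ fun h => hz2 ⟨hl'.trans_le h.1, h.2.trans_lt hr'⟩,
        h1' _ fun h => hz2 ⟨hm'.trans_le h.1, h.2.trans_lt hs'⟩⟩
    have e1 : ∫ z in rect a₁ b₁ a₂ b₂, S z * (A z.1 * B z.2)
        = ∫ z in rect a₁ b₁ (M.yL j) (M.yR j),
          (G 2 0 z * (A z.1 * b z.2) + G 0 2 z * (A z.1 * b z.2)) := by
      rw [← setIntegral_eq_of_subset_of_forall_sdiff_eq_zero (measurableSet_rect _ _ _ _) hsub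
        fun z hz => by rw [(hout z hz).1]; ring]
      refine integral_congr_ae ?_
      filter_upwards [hS, ae_restrict_mem (measurableSet_rect a₁ b₁ a₂ b₂)] with z h1 hz
      rw [h1, hBb _ hz.2]; ring
    have e2 : ∫ z in rect a₁ b₁ a₂ b₂, (p z * (deriv A z.1 * B z.2) + q z * (A z.1 * deriv B z.2))
        = ∫ z in rect a₁ b₁ (M.yL j) (M.yR j),
          (p z * (deriv A z.1 * b z.2) + G 0 1 z * (A z.1 * deriv b z.2)) := by
      rw [← setIntegral_eq_of_subset_of_forall_sdiff_eq_zero (measurableSet_rect _ _ _ _) hsub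
        fun z hz => by rw [(hout z hz).1, (hout z hz).2]; ring]
      refine integral_congr_ae ?_
      filter_upwards [hqG, ae_restrict_mem (measurableSet_rect a₁ b₁ a₂ b₂)] with z h1 hz
      rw [h1, hBb _ hz.2, deriv_eq_of_eq_on_Ioo hBb _ hz.2]
    have k : ∀ {H : ℝ × ℝ → ℝ} {c d : ℝ → ℝ},
        IntegrableOn H (rect a₁ b₁ a₂ b₂) → Continuous c → Continuous d →
        IntegrableOn (fun z => H z * (c z.1 * d z.2))
          (rect a₁ b₁ (M.yL j) (M.yR j)) := fun hH hc hd =>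
      integrableOn_mul_of_bdd (hH.mono_set hsub)
        ((hc.comp continuous_fst).mul (hd.comp continuous_snd))
    have hz : ∫ z in rect a₁ b₁ (M.yL j) (M.yR j),
        (G 0 1 z * (A z.1 * deriv b z.2) + G 0 2 z * (A z.1 * b z.2)) = 0 := by
      have k3 : IntegrableOn (fun z => G 0 1 z * (A z.1 * deriv b z.2)
        + G 0 2 z * (A z.1 * b z.2)) (rect a₁ b₁ (M.yL j) (M.yR j)) :=
        (k hG1 ca cb').add (k hG02 ca cb)
      rw [integral_strip_eq_sum_cells M k3]
      refine sum_eq_zero fun i _ => ?_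
      exact (hG.derivY 0 1 (by omega) i j).swap_apply
        (hG1.mono_set (M.cell_subset i j)) (hG02.mono_set (M.cell_subset i j)) hA hb
    rw [e1, e2, integral_add (k hG20 ca cb) (k hG02 ca cb),
      integral_add (k hpi ca' cb) (k hG1 ca cb')] at e
    rw [integral_add (k hG1 ca cb') (k hG02 ca cb)] at hz
    linarith
  refine ⟨fun a b ha hb => ?_, fun b hb => ?_⟩
  · obtain ⟨A, hA, hAp, hAa⟩ := ha.exists_periodic hx
    have := main A b hA hAp hb
    rwa [integral_rect_congr_periodic (deriv_eq_of_eq_on_Ioo hAa) (fun _ _ => rfl),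
      integral_rect_congr_periodic hAa (fun _ _ => rfl)] at this
  · have := main (fun _ => 1) b contDiff_const (fun _ => rfl) hb
    simp only [deriv_const, zero_mul, mul_zero, integral_zero, one_mul] at this
    linarith

end ExactAt

section ExactAt

/-- The conformity relations, in both variables, between the members of a family of derivatives
that enter the elliptic projection. -/
structure ConformingFamily {ι κ : Type} [Fintype ι] [Fintype κ] (X : Mesh1 ι) (Y : Mesh1 κ) (k : ℕ)
    (σ₁ σ₂ : ℝ) (G : ℕ → ℕ → ℝ × ℝ → ℝ) : Prop where
  x₁ : IsConforming X Y k σ₁ (G 0 0) (G 1 0)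
  x₂ : IsConforming X Y k (1 - σ₁) (G 1 0) (G 2 0)
  y₁ : IsConforming Y X k σ₂ (swapG G 0 0) (swapG G 1 0)
  y₂ : IsConforming Y X k (1 - σ₂) (swapG G 1 0) (swapG G 2 0)

variable {a₁ b₁ a₂ b₂ : ℝ} (M : RectMesh a₁ b₁ a₂ b₂) {r : ℕ} {G : ℕ → ℕ → ℝ × ℝ → ℝ}
  {u p q S : ℝ × ℝ → ℝ}

lemma ae_rect_swap {P : ℝ × ℝ → Prop} (h : ∀ᵐ z ∂vol[rect a₁ b₁ a₂ b₂], P z) :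
    ∀ᵐ z ∂vol[rect a₂ b₂ a₁ b₁], P z.swap := by
  rw [restrict_rect] at h ⊢
  exact Measure.measurePreserving_swap.quasiMeasurePreserving.ae h

lemma memLp_rect_swap {F : ℝ × ℝ → ℝ} (h : MemLp F 2 vol[rect a₁ b₁ a₂ b₂]) :
    MemLp (fun z => F z.swap) 2 vol[rect a₂ b₂ a₁ b₁] := by
  rw [restrict_rect] at h ⊢
  exact h.comp_measurePreserving Measure.measurePreserving_swap

/-- The conformity relations in the first variable at a fixed time. -/
lemma IsWeakPoisson.conforming_x (k : ℕ) (σ : ℝ) (h : IsWeakPoisson a₁ b₁ a₂ b₂ u p q S)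
    (hx : a₁ < b₁) (hy : a₂ < b₂) (hG : BrokenSmooth (meshX M) (meshY M) r G) (hr : 2 ≤ r)
    (hGm : ∀ m n, m + n ≤ r → MemLp (G m n) 2 vol[rect a₁ b₁ a₂ b₂])
    (hu : G 0 0 = u)
    (hpG : ∀ᵐ z ∂vol[rect a₁ b₁ a₂ b₂], p z = G 1 0 z)
    (hqG : ∀ᵐ z ∂vol[rect a₁ b₁ a₂ b₂], q z = G 0 1 z)
    (hS : ∀ᵐ z ∂vol[rect a₁ b₁ a₂ b₂], S z = G 2 0 z + G 0 2 z) :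
    IsConforming (meshX M) (meshY M) k σ (G 0 0) (G 1 0) ∧
      IsConforming (meshX M) (meshY M) k (1 - σ) (G 1 0) (G 2 0) := by
  have := isFiniteMeasure_rect a₁ b₁ a₂ b₂
  have hGi : ∀ m n, m + n ≤ r → IntegrableOn (G m n) (rect a₁ b₁ a₂ b₂) := fun m n hmn =>
    (hGm m n hmn).integrable one_le_two
  have hpi : IntegrableOn p (rect a₁ b₁ a₂ b₂) :=
    (hGi 1 0 (by omega)).congr (by filter_upwards [hpG] with z hz using hz.symm)
  refine ⟨isConforming_of_strips M k σ (hGm 0 0 (by omega)) (hGm 1 0 (by omega)) fun j => ?_,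
    isConforming_of_strips M k (1 - σ) (hGm 1 0 (by omega)) (hGm 2 0 (by omega)) fun j => ?_⟩
  · rw [hu]
    exact ((h.isPeriodicDeriv hx hy).congr hpG).mono (M.le_yL j) (M.yR_le j)
  · have hP := h.isPeriodicDeriv_flux M hx hy hG hr hpi (hGi 0 1 (by omega)) (hGi 2 0 (by omega))
      (hGi 0 2 (by omega)) hqG hS j
    have hpj : ∀ᵐ z ∂vol[rect a₁ b₁ (M.yL j) (M.yR j)], p z = G 1 0 z :=
      ae_mono (Measure.restrict_mono (prod_mono le_rfl
        (Ioo_subset_Ioo (M.le_yL j) (M.yR_le j))) le_rfl) hpG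
    refine ⟨fun a b ha hb => ?_, hP.2⟩
    rw [← hP.1 a b ha hb]
    refine integral_congr_ae ?_
    filter_upwards [hpj] with z hz
    rw [hz]

/-- At a fixed time, the divergence of the flux is the sum of the second broken derivatives, and
the broken derivatives of a periodic solution satisfy the conformity relations. -/
lemma IsWeakPoisson.conforming (k : ℕ) (σ₁ σ₂ : ℝ) (h : IsWeakPoisson a₁ b₁ a₂ b₂ u p q S)
    (hx : a₁ < b₁) (hy : a₂ < b₂) (hG : BrokenSmooth (meshX M) (meshY M) r G) (hr : 2 ≤ r)
    (hGm : ∀ m n, m + n ≤ r → MemLp (G m n) 2 vol[rect a₁ b₁ a₂ b₂])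
    (hu : G 0 0 = u) (hp : IntegrableOn p (rect a₁ b₁ a₂ b₂))
    (hq : IntegrableOn q (rect a₁ b₁ a₂ b₂)) (hSi : IntegrableOn S (rect a₁ b₁ a₂ b₂)) :
    (∀ᵐ z ∂vol[rect a₁ b₁ a₂ b₂], S z = G 2 0 z + G 0 2 z) ∧
      ConformingFamily (meshX M) (meshY M) k σ₁ σ₂ G := by
  have := isFiniteMeasure_rect a₁ b₁ a₂ b₂
  have hGi : ∀ m n, m + n ≤ r → IntegrableOn (G m n) (rect a₁ b₁ a₂ b₂) := fun m n hmn =>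
    (hGm m n hmn).integrable one_le_two
  have hpG := flux_eq_broken M (h.isPeriodicDeriv hx hy).1 hp (hGi 1 0 (by omega)) fun i j => by
    have := hG.derivX 0 0 (by omega) i j
    rwa [hu] at this
  have hqG' := flux_eq_broken M.swap (h.swap.isPeriodicDeriv hy hx).1 (IntegrableOn.rect_swap hq)
    (IntegrableOn.rect_swap (hGi 0 1 (by omega))) fun i j => by
      have := hG.derivY 0 0 (by omega) j i
      rwa [hu] at this
  have hqG : ∀ᵐ z ∂vol[rect a₁ b₁ a₂ b₂], q z = G 0 1 z := ae_rect_swap hqG'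
  have hS := h.divergence_eq M hx hy hG hr hpG hqG hSi
  obtain ⟨c1, c2⟩ := h.conforming_x M k σ₁ hx hy hG hr hGm hu hpG hqG hS
  obtain ⟨c3, c4⟩ := h.swap.conforming_x M.swap k σ₂ hy hx hG.swap hr
    (fun m n hmn => memLp_rect_swap (hGm n m (by omega))) (by funext z; simp only [swapG, hu])
    hqG' (ae_rect_swap hpG) (by
      filter_upwards [ae_rect_swap hS] with z hz
      rw [hz]; simp only [swapG]; ring)
  exact ⟨hS, c1, c2, c3, c4⟩

end ExactAt

/-! ### Functions of time with values in `L²` -/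

/-- The function with given time derivative and given value at time `t₀`. -/
def anchored {β : Type} (t₀ : ℝ) (c : β → ℝ) (f' : ℝ → β → ℝ) (t : ℝ) (z : β) : ℝ :=
  c z - (∫ τ in (0 : ℝ)..t₀, f' τ z) + ∫ τ in (0 : ℝ)..t, f' τ z

lemma anchored_self {β : Type} (t₀ : ℝ) (c : β → ℝ) (f' : ℝ → β → ℝ) : anchored t₀ c f' t₀ = c := by
  funext z; simp [anchored]

section TimeL2

variable {β : Type} [MeasurableSpace β] {ν : Measure β} {T : ℝ}

/-- `f ∈ H¹(0,T; L²(ν))` with time derivative `f'`, for the representative that is absolutely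
continuous in time at almost every point. -/
structure IsH1L2 (T : ℝ) (ν : Measure β) (f f' : ℝ → β → ℝ) : Prop where
  zero : MemLp (f 0) 2 ν
  deriv : MemLp (Function.uncurry f') 2 (vol[Ioo 0 T].prod ν)
  primitive : ∀ᵐ z ∂ν, ∀ t ∈ Icc 0 T, f t z = f 0 z + ∫ τ in (0 : ℝ)..t, f' τ z

lemma ae_memLp_slice [SFinite ν] {μ : Measure ℝ} [SFinite μ] {f : ℝ → β → ℝ}
    (hf : MemLp (Function.uncurry f) 2 (μ.prod ν)) : ∀ᵐ t ∂μ, MemLp (f t) 2 ν := by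
  filter_upwards [hf.1.prodMk_left, hf.integrable_sq.prod_right_ae] with t h1 h2
  exact (memLp_two_iff_integrable_sq h1).2 h2

lemma ae_memLp_slice_fst [SFinite ν] {μ : Measure ℝ} [SFinite μ] {f : ℝ → β → ℝ}
    (hf : MemLp (Function.uncurry f) 2 (μ.prod ν)) : ∀ᵐ z ∂ν, MemLp (fun t => f t z) 2 μ := by
  have h : MemLp (fun p : β × ℝ => f p.2 p.1) 2 (ν.prod μ) :=
    hf.comp_measurePreserving Measure.measurePreserving_swap
  filter_upwards [h.1.prodMk_left, h.integrable_sq.prod_right_ae] with t h1 h2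
  exact (memLp_two_iff_integrable_sq h1).2 h2

lemma memLp_integral_zero_to [SFinite ν] {f' : ℝ → β → ℝ}
    (hf : MemLp (Function.uncurry f') 2 (vol[Ioo 0 T].prod ν)) {t : ℝ}
    (ht : t ∈ Icc 0 T) : MemLp (fun z => ∫ τ in (0 : ℝ)..t, f' τ z) 2 ν := by
  have hsub : Ioo 0 t ⊆ Ioo 0 T := Ioo_subset_Ioo_right ht.2
  have hft : MemLp (Function.uncurry f') 2 (vol[Ioo 0 t].prod ν) :=
    hf.mono_measure (Measure.prod_mono (Measure.restrict_mono hsub le_rfl) le_rfl)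
  have e : ∀ z, ∫ τ in (0 : ℝ)..t, f' τ z = ∫ τ in Ioo 0 t, f' τ z := fun z => by
    rw [integral_of_le ht.1, integral_Ioc_eq_integral_Ioo]
  simp only [e]
  have hsw : MemLp (fun p : β × ℝ => f' p.2 p.1) 2 (ν.prod vol[Ioo 0 t]) :=
    hft.comp_measurePreserving Measure.measurePreserving_swap
  have hm : AEStronglyMeasurable (fun z => ∫ τ in Ioo 0 t, f' τ z) ν :=
    hsw.1.integral_prod_right'
  refine (memLp_two_iff_integrable_sq hm).2 ?_
  have hi := (hsw.integrable_sq.integral_prod_left).const_mul t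
  refine hi.mono' (hm.pow 2) ?_
  filter_upwards [ae_memLp_slice_fst hft] with z hz
  have h1 := sq_integral_mul_le (f := fun _ => (1 : ℝ)) (memLp_const 1) hz
  simp only [one_mul, one_pow, integral_const, smul_eq_mul, mul_one,
    measureReal_restrict_apply_univ, Real.volume_real_Ioo, sub_zero, max_eq_left ht.1] at h1
  rw [Real.norm_of_nonneg (sq_nonneg _)]
  exact h1

variable {f f' g g' : ℝ → β → ℝ}

lemma IsH1L2.memLp_at [SFinite ν] (hf : IsH1L2 T ν f f') {t : ℝ} (ht : t ∈ Icc 0 T) :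
    MemLp (f t) 2 ν := by
  refine (memLp_congr_ae ?_).1 (hf.zero.add (memLp_integral_zero_to hf.deriv ht))
  filter_upwards [hf.primitive] with z hz
  rw [hz t ht]; rfl

lemma ae_prod_of_ae [SFinite ν] {P : ℝ → β → Prop} (h : ∀ᵐ z ∂ν, ∀ t ∈ Icc 0 T, P t z) :
    ∀ᵐ p ∂(vol[Ioo 0 T].prod ν), P p.1 p.2 := by
  have h1 : ∀ᵐ p : ℝ × β ∂(vol[Ioo 0 T].prod ν), p.1 ∈ Ioo 0 T :=
    Measure.quasiMeasurePreserving_fst.ae (ae_restrict_mem measurableSet_Ioo)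
  filter_upwards [h1, ae_prod_snd h] with p hp h2
  exact h2 _ (Ioo_subset_Icc_self hp)

lemma memLp_const_in_time [SFinite ν] {c : β → ℝ} (hc : MemLp c 2 ν) :
    MemLp (fun p : ℝ × β => c p.2) 2 (vol[Ioo 0 T].prod ν) := hc.comp_snd _

lemma IsH1L2.memLp [SFinite ν] (hT : 0 ≤ T) (hf : IsH1L2 T ν f f') :
    MemLp (Function.uncurry f) 2 (vol[Ioo 0 T].prod ν) := by
  refine (memLp_congr_ae ?_).1 ((memLp_const_in_time hf.zero).add (memLp_primitive hT hf.deriv).1)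
  filter_upwards [ae_prod_of_ae hf.primitive] with p hp
  simp only [Function.uncurry, hp]; rfl

lemma IsH1L2.ae_isH1 [SFinite ν] (hf : IsH1L2 T ν f f') :
    ∀ᵐ z ∂ν, IsH1 T (fun t => f t z) (fun t => f' t z) := by
  filter_upwards [hf.primitive, ae_memLp_slice_fst hf.deriv] with z h1 h2
  exact ⟨h2, h1⟩

lemma IsH1L2.mono_measure {ν' : Measure β} [SFinite ν] [SFinite ν'] (hf : IsH1L2 T ν f f')
    (h : ν' ≤ ν) : IsH1L2 T ν' f f' where
  zero := hf.zero.mono_measure h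
  deriv := hf.deriv.mono_measure (Measure.prod_mono le_rfl h)
  primitive := ae_mono h hf.primitive

lemma IsH1L2.sub [SFinite ν] (hf : IsH1L2 T ν f f') (hg : IsH1L2 T ν g g') :
    IsH1L2 T ν (fun t z => f t z - g t z) (fun t z => f' t z - g' t z) where
  zero := hf.zero.sub hg.zero
  deriv := hf.deriv.sub hg.deriv
  primitive := by
    filter_upwards [hf.ae_isH1, hg.ae_isH1] with z h1 h2
    exact (h1.sub h2).2

/-- Pairing with a fixed square integrable function. -/
lemma IsH1L2.integral_mul [IsFiniteMeasure ν] (hf : IsH1L2 T ν f f') {ψ : β → ℝ}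
    (hψ : MemLp ψ 2 ν) :
    IsH1 T (fun t => ∫ z, f t z * ψ z ∂ν) (fun t => ∫ z, f' t z * ψ z ∂ν) := by
  have hψt : MemLp (fun p : ℝ × β => ψ p.2) 2 (vol[Ioo 0 T].prod ν) :=
    memLp_const_in_time hψ
  have hprod : Integrable (fun p : ℝ × β => f' p.1 p.2 * ψ p.2)
    (vol[Ioo 0 T].prod ν) := hf.deriv.integrable_mul hψt
  refine ⟨?_, fun t ht => ?_⟩
  · have hm : AEStronglyMeasurable (fun t => ∫ z, f' t z * ψ z ∂ν) vol[Ioo 0 T] :=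
      hprod.1.integral_prod_right'
    refine (memLp_two_iff_integrable_sq hm).2 ?_
    have hi := (hf.deriv.integrable_sq.integral_prod_left).mul_const (∫ z, ψ z ^ 2 ∂ν)
    refine hi.mono' (hm.pow 2) ?_
    filter_upwards [ae_memLp_slice hf.deriv] with t ht
    rw [Real.norm_of_nonneg (sq_nonneg _)]
    exact sq_integral_mul_le ht hψ
  · have hsub : Ioo 0 t ⊆ Ioo 0 T := Ioo_subset_Ioo_right ht.2
    have hprod' : Integrable (fun p : ℝ × β => f' p.1 p.2 * ψ p.2)
        (vol[Ioo 0 t].prod ν) :=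
      hprod.mono_measure (Measure.prod_mono (Measure.restrict_mono hsub le_rfl) le_rfl)
    have i0 : Integrable (fun z => f 0 z * ψ z) ν := hf.zero.integrable_mul hψ
    have i1 : Integrable (fun z => (∫ τ in (0 : ℝ)..t, f' τ z) * ψ z) ν :=
      (memLp_integral_zero_to hf.deriv ht).integrable_mul hψ
    have e1 : ∫ z, f t z * ψ z ∂ν
        = (∫ z, f 0 z * ψ z ∂ν) + ∫ z, (∫ τ in (0 : ℝ)..t, f' τ z) * ψ z ∂ν := by
      rw [← integral_add i0 i1]
      refine integral_congr_ae ?_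
      filter_upwards [hf.primitive] with z hz
      rw [hz t ht]; ring
    simp only []
    rw [e1]
    congr 1
    rw [integral_of_le ht.1, integral_Ioc_eq_integral_Ioo,
      integral_integral_swap hprod']
    refine integral_congr_ae (.of_forall fun z => ?_)
    simp only []
    rw [integral_of_le ht.1, integral_Ioc_eq_integral_Ioo, integral_mul_const]

/-- A function with square integrable time derivative and square integrable values at almost all
times belongs to `H¹(0,T; L²)`. -/
lemma IsH1L2.of_memLp [IsFiniteMeasure ν] (hT : 0 < T)
    (hf : MemLp (Function.uncurry f) 2 (vol[Ioo 0 T].prod ν))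
    (hf' : MemLp (Function.uncurry f') 2 (vol[Ioo 0 T].prod ν))
    (h : ∀ᵐ z ∂ν, ∀ t ∈ Icc 0 T, f t z = f 0 z + ∫ τ in (0 : ℝ)..t, f' τ z) :
    IsH1L2 T ν f f' := by
  refine ⟨?_, hf', h⟩
  have : NeZero (vol[Ioo 0 T] : Measure ℝ) := ⟨by
    rw [Ne, Measure.restrict_eq_zero, Real.volume_Ioo]; simpa using hT⟩
  refine memLp_of_comp_snd (μ := vol[Ioo 0 T]) ?_
  refine (memLp_congr_ae ?_).1 (hf.sub (memLp_primitive hT.le hf').1)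
  filter_upwards [ae_prod_of_ae h] with p hp
  simp only [Function.uncurry, Pi.sub_apply, hp]; ring

lemma isH1L2_anchored [SFinite ν] {t₀ : ℝ} (ht₀ : t₀ ∈ Icc 0 T) {c : β → ℝ} (hc : MemLp c 2 ν)
    (hf' : MemLp (Function.uncurry f') 2 (vol[Ioo 0 T].prod ν)) :
    IsH1L2 T ν (anchored t₀ c f') f' where
  zero := by
    have h : anchored t₀ c f' 0 = fun z => c z - ∫ τ in (0 : ℝ)..t₀, f' τ z := by
      funext z; simp [anchored]
    rw [h]
    exact hc.sub (memLp_integral_zero_to hf' ht₀)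
  deriv := hf'
  primitive := .of_forall fun z t _ => by simp [anchored]

end TimeL2

/-! ### Broken Sobolev regularity in space and time -/

section Weak

/-- `G` is the weak derivative `∂_x^m ∂_y^n F` on a rectangle, tested with products `a(x) b(y)`
only. -/
def HasTensorWeakDeriv (L R L' R' : ℝ) (m n : ℕ) (F G : ℝ × ℝ → ℝ) : Prop :=
  ∀ a b, IsTest L R a → IsTest L' R' b →
    ∫ z in rect L R L' R', F z * (deriv^[m] a z.1 * deriv^[n] b z.2)
      = (-1) ^ (m + n) * ∫ z in rect L R L' R', G z * (a z.1 * b z.2)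

variable {L R L' R' : ℝ}

lemma IsTest.iterate_deriv {a : ℝ → ℝ} (ha : IsTest L R a) (m : ℕ) :
    IsTest L R (_root_.deriv^[m] a) := by
  induction m with
  | zero => exact ha
  | succ m ih => rw [Function.iterate_succ_apply']; exact ih.deriv

lemma dX_iterate_mul (A B : ℝ → ℝ) (m : ℕ) :
    dX^[m] (fun z => A z.1 * B z.2) = fun z => deriv^[m] A z.1 * B z.2 := by
  induction m with
  | zero => rfl
  | succ m ih => rw [Function.iterate_succ_apply', ih, dX_mul, Function.iterate_succ_apply']

lemma dY_iterate_mul (A B : ℝ → ℝ) (n : ℕ) :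
    dY^[n] (fun z => A z.1 * B z.2) = fun z => A z.1 * deriv^[n] B z.2 := by
  induction n with
  | zero => rfl
  | succ m ih => rw [Function.iterate_succ_apply', ih, dY_mul, Function.iterate_succ_apply']

lemma HasWeakDeriv.tensor {m n : ℕ} {F G : ℝ × ℝ → ℝ} (h : HasWeakDeriv (rect L R L' R') m n F G) :
    HasTensorWeakDeriv L R L' R' m n F G := by
  intro a b ha hb
  obtain ⟨hac, l, r, hl, hr, ha0⟩ := id ha
  obtain ⟨hbc, l', r', hl', hr', hb0⟩ := id hb
  have hsupp : tsupport (fun z : ℝ × ℝ => a z.1 * b z.2) ⊆ Icc l r ×ˢ Icc l' r' := by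
    refine closure_minimal (fun z hz => ?_) (isClosed_Icc.prod isClosed_Icc)
    by_contra hz'
    apply hz
    simp only [mem_prod, not_and_or] at hz'
    rcases hz' with h' | h'
    · simp only [ha0 _ h', zero_mul]
    · simp only [hb0 _ h', mul_zero]
  have := h (fun z => a z.1 * b z.2) ((hac.comp contDiff_fst).mul (hbc.comp contDiff_snd))
    (HasCompactSupport.of_support_subset_isCompact (isCompact_Icc.prod isCompact_Icc)
      (subset_closure.trans hsupp))
    (hsupp.trans (prod_mono (Icc_subset_Ioo hl hr) (Icc_subset_Ioo hl' hr')))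
  rwa [dY_iterate_mul, dX_iterate_mul] at this

lemma HasTensorWeakDeriv.congr {m n : ℕ} {F F₁ G : ℝ × ℝ → ℝ}
    (h : HasTensorWeakDeriv L R L' R' m n F G)
    (hF : ∀ᵐ z ∂vol[rect L R L' R'], F z = F₁ z) :
    HasTensorWeakDeriv L R L' R' m n F₁ G := by
  intro a b ha hb
  rw [← h a b ha hb]
  refine integral_congr_ae ?_
  filter_upwards [hF] with z hz
  rw [hz]

lemma HasTensorWeakDeriv.mono {m n : ℕ} {F G : ℝ × ℝ → ℝ}
    (h : HasTensorWeakDeriv L R L' R' m n F G) {l r l' r' : ℝ}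
    (hl : L ≤ l) (hr : r ≤ R) (hl' : L' ≤ l') (hr' : r' ≤ R') :
    HasTensorWeakDeriv l r l' r' m n F G := by
  intro a b ha hb
  have := h a b (ha.mono hl hr) (hb.mono hl' hr')
  rwa [integral_rect_eq_of_support (ha.iterate_deriv m) (hb.iterate_deriv n) hl hr hl' hr',
    integral_rect_eq_of_support ha hb hl hr hl' hr'] at this

lemma HasTensorWeakDeriv.step_fst {m n : ℕ} {F G H : ℝ × ℝ → ℝ}
    (hG : HasTensorWeakDeriv L R L' R' m n F G) (hH : HasTensorWeakDeriv L R L' R' (m + 1) n F H) :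
    HasTensorDeriv L R L' R' G H := by
  intro a b ha hb
  have h1 := hG (deriv a) b ha.deriv hb
  have h2 := hH a b ha hb
  rw [Function.iterate_succ_apply] at h2
  rw [h2, show m + 1 + n = m + n + 1 by ring, pow_succ, mul_assoc] at h1
  have := mul_left_cancel₀ (pow_ne_zero (m + n) (by norm_num : (-1 : ℝ) ≠ 0)) h1
  rw [← this]; ring

lemma HasTensorWeakDeriv.step_snd {m n : ℕ} {F G H : ℝ × ℝ → ℝ}
    (hG : HasTensorWeakDeriv L R L' R' m n F G) (hH : HasTensorWeakDeriv L R L' R' m (n + 1) F H) :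
    HasTensorDeriv L' R' L R (fun z => G z.swap) (fun z => H z.swap) := by
  intro b a hb ha
  have h1 := hG a (deriv b) ha hb.deriv
  have h2 := hH a b ha hb
  rw [Function.iterate_succ_apply] at h2
  rw [h2, ← add_assoc, pow_succ, mul_assoc] at h1
  have h3 := mul_left_cancel₀ (pow_ne_zero (m + n) (by norm_num : (-1 : ℝ) ≠ 0)) h1
  rw [integral_rect_swap, integral_rect_swap (fun z => H z.swap * _)]
  simp only [Prod.swap_swap, Prod.fst_swap, Prod.snd_swap, mul_comm (b _), mul_comm (deriv b _)]
  rw [← h3]; ring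

lemma HasTensorWeakDeriv.unique (hLR : L < R) (hLR' : L' < R') {m n : ℕ} {F G H : ℝ × ℝ → ℝ}
    (hG : HasTensorWeakDeriv L R L' R' m n F G) (hH : HasTensorWeakDeriv L R L' R' m n F H)
    (hGi : IntegrableOn G (rect L R L' R')) (hHi : IntegrableOn H (rect L R L' R')) :
    ∀ᵐ z ∂vol[rect L R L' R'], G z = H z := by
  have key := ae_eq_zero_of_tensor hLR hLR' (Z := fun z => G z - H z) (hGi.sub hHi)
    fun a b ha hb => by
      have h1 := hG a b ha hb
      rw [hH a b ha hb] at h1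
      have h2 := mul_left_cancel₀ (pow_ne_zero (m + n) (by norm_num : (-1 : ℝ) ≠ 0)) h1
      have hc : Continuous fun z : ℝ × ℝ => a z.1 * b z.2 :=
        (ha.1.continuous.comp continuous_fst).mul (hb.1.continuous.comp continuous_snd)
      simp only [sub_mul]
      rw [integral_sub (integrableOn_mul_of_bdd hGi hc) (integrableOn_mul_of_bdd hHi hc), h2,
        sub_self]
  filter_upwards [key] with z hz
  linarith

variable {a₁ b₁ a₂ b₂ : ℝ}

/-- `G m n` is the broken weak derivative `∂_x^m ∂_y^n u`, for all orders `m + n ≤ r`. -/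
structure WeakFamily (M : RectMesh a₁ b₁ a₂ b₂) (r : ℕ) (u : ℝ × ℝ → ℝ)
    (G : ℕ → ℕ → ℝ × ℝ → ℝ) : Prop where
  memLp : ∀ m n, m + n ≤ r → MemLp (G m n) 2 vol[rect a₁ b₁ a₂ b₂]
  weak : ∀ m n, m + n ≤ r → ∀ i j,
    HasTensorWeakDeriv (M.xL i) (M.xR i) (M.yL j) (M.yR j) m n u (G m n)

lemma WeakFamily.brokenSmooth {M : RectMesh a₁ b₁ a₂ b₂} {r : ℕ} {u : ℝ × ℝ → ℝ}
    {G : ℕ → ℕ → ℝ × ℝ → ℝ} (h : WeakFamily M r u G) :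
    BrokenSmooth (meshX M) (meshY M) r G where
  memLp m n hmn := cellL2_of_memLp M (h.memLp m n hmn)
  derivX m n hmn i j := (h.weak m n hmn.le i j).step_fst (h.weak (m + 1) n (by omega) i j)
  derivY m n hmn i j := (h.weak m n hmn.le i j).step_snd (h.weak m (n + 1) (by omega) i j)

/-- Broken weak derivatives do not depend on the mesh. -/
lemma WeakFamily.unique {M M₀ : RectMesh a₁ b₁ a₂ b₂} {r : ℕ} {u : ℝ × ℝ → ℝ}
    {G G₀ : ℕ → ℕ → ℝ × ℝ → ℝ} (h : WeakFamily M r u G) (h₀ : WeakFamily M₀ r u G₀) {m n : ℕ}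
    (hmn : m + n ≤ r) : ∀ᵐ z ∂vol[rect a₁ b₁ a₂ b₂], G m n z = G₀ m n z := by
  have := isFiniteMeasure_rect a₁ b₁ a₂ b₂
  refine ae_rect_of_ae_cells M fun i j => ?_
  have key : ∀ᵐ z ∂vol[rect a₁ b₁ a₂ b₂], z ∈ M.cell i j → G m n z = G₀ m n z := by
    refine ae_rect_of_ae_cells M₀ fun i₀ j₀ => ?_
    have hint : M₀.cell i₀ j₀ ∩ M.cell i j
        = rect (max (M₀.xL i₀) (M.xL i)) (min (M₀.xR i₀) (M.xR i))
        (max (M₀.yL j₀) (M.yL j)) (min (M₀.yR j₀) (M.yR j)) := by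
      simp only [RectMesh.cell, rect, prod_inter_prod, Ioo_inter_Ioo]
    have hms : MeasurableSet (M.cell i j) := measurableSet_rect _ _ _ _
    rw [← ae_restrict_iff' hms, Measure.restrict_restrict hms, inter_comm, hint]
    by_cases h1 : max (M₀.xL i₀) (M.xL i) < min (M₀.xR i₀) (M.xR i)
    · by_cases h2 : max (M₀.yL j₀) (M.yL j) < min (M₀.yR j₀) (M.yR j)
      · have hsub := hint.symm.subset.trans (inter_subset_right.trans (M.cell_subset i j))
        exact ((h.weak m n hmn i j).mono (le_max_right _ _) (min_le_right _ _) (le_max_right _ _)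
          (min_le_right _ _)).unique h1 h2 ((h₀.weak m n hmn i₀ j₀).mono (le_max_left _ _)
          (min_le_left _ _) (le_max_left _ _) (min_le_left _ _))
          (((h.memLp m n hmn).integrable one_le_two).mono_measure
            (Measure.restrict_mono hsub le_rfl))
          (((h₀.memLp m n hmn).integrable one_le_two).mono_measure
            (Measure.restrict_mono hsub le_rfl))
      · rw [rect, Ioo_eq_empty h2, prod_empty, Measure.restrict_empty]; simp
    · rw [rect, Ioo_eq_empty h1, empty_prod, Measure.restrict_empty]; simp
  have h1 := ae_mono (Measure.restrict_mono (M.cell_subset i j) le_rfl) key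
  filter_upwards [h1, ae_restrict_mem (measurableSet_rect _ _ _ _)] with z hz hz2 using hz hz2

end Weak

section TimeFamily

variable {a₁ b₁ a₂ b₂ T : ℝ}

/-- The time derivatives of the same function agree almost everywhere. -/
lemma ae_eq_of_timeDeriv (hT : 0 < T) {u u' v' : ℝ → ℝ × ℝ → ℝ}
    (h : HasTimeDeriv a₁ b₁ a₂ b₂ T u u') (hu : MemL2 a₁ b₁ a₂ b₂ T u')
    (h' : HasTimeDeriv a₁ b₁ a₂ b₂ T u v') (hv : MemL2 a₁ b₁ a₂ b₂ T v') :
    ∀ᵐ t ∂vol[Ioo 0 T], ∀ᵐ z ∂vol[rect a₁ b₁ a₂ b₂],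
      v' t z = u' t z := by
  have := isFiniteMeasure_rect a₁ b₁ a₂ b₂
  have key := ae_eq_zero_of_ae_ae (f := fun p : ℝ × (ℝ × ℝ) => v' p.1 p.2 - u' p.1 p.2)
    (ν := vol[rect a₁ b₁ a₂ b₂]) (μ := vol[Ioo 0 T])
    (hv.1.sub hu.1) (by
      filter_upwards [h, h'] with z hz hz'
      refine ae_eq_zero_of_primitive_eq_zero hT.le (hz'.1.sub hz.1) fun t ht => ?_
      have hsub : uIcc 0 t ⊆ uIcc 0 T := by
        rw [uIcc_of_le ht.1, uIcc_of_le hT.le]; exact Icc_subset_Icc_right ht.2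
      rw [intervalIntegral.integral_sub (hz'.1.mono_set hsub) (hz.1.mono_set hsub)]
      linarith [hz.2 t ht, hz'.2 t ht])
  filter_upwards [Measure.ae_ae_of_ae_prod key] with t ht
  filter_upwards [ht] with z hz
  exact sub_eq_zero.1 hz

/-- A family of broken derivatives of `u` and of its time derivative `u'`, such that the former are
the primitives in time of the latter. -/
structure TimeFamily (M : RectMesh a₁ b₁ a₂ b₂) (T : ℝ) (r : ℕ) (u u' : ℝ → ℝ × ℝ → ℝ)
    (G G' : ℕ → ℕ → ℝ → ℝ × ℝ → ℝ) : Prop where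
  isH1 : ∀ m n, m + n ≤ r → IsH1L2 T vol[rect a₁ b₁ a₂ b₂] (G m n) (G' m n)
  weak : ∀ t ∈ Icc 0 T, WeakFamily M r (u t) (fun m n => G m n t)
  weak' : ∀ᵐ t ∂vol[Ioo 0 T], WeakFamily M r (u' t) (fun m n => G' m n t)
  eq_zero : G 0 0 = u
  eq_zero' : G' 0 0 = u'

lemma exists_deriv_in_time (M : RectMesh a₁ b₁ a₂ b₂) (hT : 0 < T) {u u' g g' : ℝ → ℝ × ℝ → ℝ}
    {m n : ℕ} (hu : IsH1L2 T vol[rect a₁ b₁ a₂ b₂] u u')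
    (hg : MemL2 a₁ b₁ a₂ b₂ T g) (hg' : MemL2 a₁ b₁ a₂ b₂ T g')
    (h : ∀ᵐ t ∂vol[Ioo 0 T], ∀ i j,
      HasTensorWeakDeriv (M.xL i) (M.xR i) (M.yL j) (M.yR j) m n (u t) (g t))
    (h' : ∀ᵐ t ∂vol[Ioo 0 T], ∀ i j,
      HasTensorWeakDeriv (M.xL i) (M.xR i) (M.yL j) (M.yR j) m n (u' t) (g' t)) :
    ∃ G : ℝ → ℝ × ℝ → ℝ, IsH1L2 T vol[rect a₁ b₁ a₂ b₂] G g' ∧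
      ∀ t ∈ Icc 0 T, ∀ i j,
        HasTensorWeakDeriv (M.xL i) (M.xR i) (M.yL j) (M.yR j) m n (u t) (G t) := by
  have := isFiniteMeasure_rect a₁ b₁ a₂ b₂
  have hne : (ae (vol[Ioo 0 T] : Measure ℝ)).NeBot := by
    rw [ae_neBot, Ne, Measure.restrict_eq_zero, Real.volume_Ioo]; simpa using hT
  obtain ⟨t₀, ⟨ht₀, hgt₀⟩, hmem⟩ :=
    ((h.and (ae_memLp_slice hg)).and (ae_restrict_mem measurableSet_Ioo)).exists
  have ht₀I : t₀ ∈ Icc 0 T := Ioo_subset_Icc_self hmem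
  have hG := isH1L2_anchored ht₀I hgt₀ hg'
  refine ⟨anchored t₀ (g t₀) g', hG, fun t ht i j a b ha hb => ?_⟩
  have hfin := isFiniteMeasure_rect (M.xL i) (M.xR i) (M.yL j) (M.yR j)
  have hle : vol[rect (M.xL i) (M.xR i) (M.yL j) (M.yR j)]
      ≤ vol[rect a₁ b₁ a₂ b₂] := Measure.restrict_mono (M.cell_subset i j) le_rfl
  have hc : ∀ {c d : ℝ → ℝ}, Continuous c → Continuous d → MemLp (fun z : ℝ × ℝ => c z.1 * d z.2) 2
      vol[rect (M.xL i) (M.xR i) (M.yL j) (M.yR j)] := fun hc hd =>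
    memLp_rect_of_continuous ((hc.comp continuous_fst).mul (hd.comp continuous_snd)) _ _ _ _
  have I := (hu.mono_measure hle).integral_mul
    (hc (ha.iterate_deriv m).1.continuous (hb.iterate_deriv n).1.continuous)
  have J := ((hG.mono_measure hle).integral_mul
    (hc ha.1.continuous hb.1.continuous)).const_mul ((-1) ^ (m + n))
  have hd : ∀ s ∈ Icc 0 T, ∫ τ in (0 : ℝ)..s, (∫ z in rect (M.xL i) (M.xR i) (M.yL j) (M.yR j),
        u' τ z * (deriv^[m] a z.1 * deriv^[n] b z.2))
      = ∫ τ in (0 : ℝ)..s, (-1) ^ (m + n) * (∫ z in rect (M.xL i) (M.xR i) (M.yL j) (M.yR j),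
        g' τ z * (a z.1 * b z.2)) := by
    intro s hs
    rw [integral_of_le hs.1, integral_of_le hs.1,
      integral_Ioc_eq_integral_Ioo, integral_Ioc_eq_integral_Ioo]
    refine integral_congr_ae ?_
    filter_upwards [ae_mono (Measure.restrict_mono (Ioo_subset_Ioo_right hs.2) le_rfl) h'] with τ hτ
    exact hτ i j a b ha hb
  have e1 := I.2 t ht
  have e2 := J.2 t ht
  have e3 := I.2 t₀ ht₀I
  have e4 := J.2 t₀ ht₀I
  simp only [anchored_self] at e4
  have e5 := ht₀ i j a b ha hb
  rw [hd t ht] at e1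
  rw [hd t₀ ht₀I] at e3
  simp only [] at e1 e2 e3 e4
  rw [e1, e2]
  linarith

lemma exists_timeFamily (M : RectMesh a₁ b₁ a₂ b₂) (hT : 0 < T) (r : ℕ) {u u' : ℝ → ℝ × ℝ → ℝ}
    (hu : MemL2 a₁ b₁ a₂ b₂ T u) (hu' : MemL2 a₁ b₁ a₂ b₂ T u')
    (hd : HasTimeDeriv a₁ b₁ a₂ b₂ T u u') (hM : MemH1Broken M T r u) :
    ∃ G G' : ℕ → ℕ → ℝ → ℝ × ℝ → ℝ, TimeFamily M T r u u' G G' := by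
  have := isFiniteMeasure_rect a₁ b₁ a₂ b₂
  obtain ⟨⟨-, hg⟩, v', hdv, hv', hgv⟩ := hM
  have hvu := ae_eq_of_timeDeriv hT hd hu' hdv hv'
  have hH1 : IsH1L2 T vol[rect a₁ b₁ a₂ b₂] u u' :=
    IsH1L2.of_memLp hT hu hu' (by filter_upwards [hd] with z hz using hz.2)
  have key : ∀ m n, ∃ G G' : ℝ → ℝ × ℝ → ℝ, (m + n ≤ r →
      IsH1L2 T vol[rect a₁ b₁ a₂ b₂] G G' ∧
      (∀ t ∈ Icc 0 T, ∀ i j,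
        HasTensorWeakDeriv (M.xL i) (M.xR i) (M.yL j) (M.yR j) m n (u t) (G t)) ∧
      ∀ᵐ t ∂vol[Ioo 0 T], ∀ i j,
        HasTensorWeakDeriv (M.xL i) (M.xR i) (M.yL j) (M.yR j) m n (u' t) (G' t)) ∧
      (m = 0 → n = 0 → G = u ∧ G' = u') := by
    intro m n
    by_cases h0 : m = 0 ∧ n = 0
    · obtain ⟨rfl, rfl⟩ := h0
      refine ⟨u, u', fun _ => ⟨hH1, fun t _ i j a b _ _ => by simp,
        .of_forall fun t i j a b _ _ => by simp⟩, fun _ _ => ⟨rfl, rfl⟩⟩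
    · by_cases hmn : m + n ≤ r
      · obtain ⟨g, hg1, hg2⟩ := hg m n hmn
        obtain ⟨g', hg1', hg2'⟩ := hgv m n hmn
        have h2 : ∀ᵐ t ∂vol[Ioo 0 T], ∀ i j,
            HasTensorWeakDeriv (M.xL i) (M.xR i) (M.yL j) (M.yR j) m n (u' t) (g' t) := by
          filter_upwards [hg2', hvu] with t ht ht' i j
          exact (ht i j).tensor.congr
            (ae_mono (Measure.restrict_mono (M.cell_subset i j) le_rfl) ht')
        obtain ⟨G, hG1, hG2⟩ := exists_deriv_in_time M hT hH1 hg1 hg1'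
          (by filter_upwards [hg2] with t ht i j using (ht i j).tensor) h2
        exact ⟨G, g', fun _ => ⟨hG1, hG2, h2⟩, fun h1 h2 => absurd ⟨h1, h2⟩ h0⟩
      · exact ⟨u, u', fun h => absurd h hmn, fun h1 h2 => absurd ⟨h1, h2⟩ h0⟩
  choose G G' h1 h2 using key
  refine ⟨G, G', fun m n hmn => (h1 m n hmn).1, fun t ht => ⟨fun m n hmn =>
    (h1 m n hmn).1.memLp_at ht, fun m n hmn => (h1 m n hmn).2.1 t ht⟩, ?_,
    (h2 0 0 rfl rfl).1, (h2 0 0 rfl rfl).2⟩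
  have h3 : ∀ᵐ t ∂vol[Ioo 0 T], ∀ m n, m + n ≤ r → ∀ i j,
      HasTensorWeakDeriv (M.xL i) (M.xR i) (M.yL j) (M.yR j) m n (u' t) (G' m n t) := by
    rw [ae_all_iff]; intro m; rw [ae_all_iff]; intro n
    by_cases hmn : m + n ≤ r
    · filter_upwards [(h1 m n hmn).2.2] with t ht _ using ht
    · exact .of_forall fun t h => absurd h hmn
  have h4 : ∀ᵐ t ∂vol[Ioo 0 T], ∀ m n, m + n ≤ r →
      MemLp (G' m n t) 2 vol[rect a₁ b₁ a₂ b₂] := by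
    rw [ae_all_iff]; intro m; rw [ae_all_iff]; intro n
    by_cases hmn : m + n ≤ r
    · filter_upwards [ae_memLp_slice (h1 m n hmn).1.deriv] with t ht _ using ht
    · exact .of_forall fun t h => absurd h hmn
  filter_upwards [h3, h4] with t ht ht' using ⟨ht', ht⟩

end TimeFamily

section ConfFunctional

variable {ι κ : Type} {X : Mesh1 ι} {Y : Mesh1 κ} {k : ℕ}

/-- The integrand of the conformity relation. -/
def confIntegrand (X : Mesh1 ι) (σ : ℝ) (F Fx : ℝ × ℝ → ℝ) (w : V2 ι κ k) (i : ι) (j : κ)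
    (z : ℝ × ℝ) : ℝ :=
  F z * ((dcX w i j).eval z - liftXDeriv X σ w i j z)
    + Fx z * ((w i j).eval z - liftX X σ w i j z)

lemma confIntegrand_add (σ : ℝ) (F Fx : ℝ × ℝ → ℝ) (v w : V2 ι κ k) (i : ι) (j : κ) (z : ℝ × ℝ) :
    confIntegrand X σ F Fx (v + w) i j z
      = confIntegrand X σ F Fx v i j z + confIntegrand X σ F Fx w i j z := by
  have h1 : (dcX (v + w) i j).eval z = (dcX v i j).eval z + (dcX w i j).eval z := by
    rw [← eval_add]; congr 1; funext m n
    exact congrFun (dc_add (fun m' => v i j m' n) fun m' => w i j m' n) m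
  have h2 : ((v + w) i j).eval z = (v i j).eval z + (w i j).eval z := eval_add _ _ _
  simp only [confIntegrand]
  rw [h1, h2]
  simp only [liftX, liftXDeriv, sx_add, Mesh1.lift, Mesh1.liftDeriv,
    Mesh1.jump, Pi.add_apply, ev_add]
  ring

lemma confIntegrand_smul (σ : ℝ) (F Fx : ℝ × ℝ → ℝ) (r : ℝ) (w : V2 ι κ k) (i : ι) (j : κ)
    (z : ℝ × ℝ) :
    confIntegrand X σ F Fx (r • w) i j z = r * confIntegrand X σ F Fx w i j z := by
  have h1 : (dcX (r • w) i j).eval z = r * (dcX w i j).eval z := by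
    rw [← eval_smul]; congr 1; funext m n
    exact congrFun (dc_smul r fun m' => w i j m' n) m
  have h2 : ((r • w) i j).eval z = r * (w i j).eval z := eval_smul _ _ _
  simp only [confIntegrand]
  rw [h1, h2]
  simp only [liftX, liftXDeriv, sx_smul, Mesh1.lift, Mesh1.liftDeriv,
    Mesh1.jump, Pi.smul_apply, ev_smul]
  ring

lemma integrable_confIntegrand {F Fx : ℝ × ℝ → ℝ} (hF : CellL2 X Y F) (hFx : CellL2 X Y Fx) (σ : ℝ)
    (w : V2 ι κ k) (i : ι) (j : κ) :
    IntegrableOn (confIntegrand X σ F Fx w i j) (cellXY X Y i j) := by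
  have hm : ∀ {f : ℝ × ℝ → ℝ}, Continuous f → MemLp f 2 vol[cellXY X Y i j] :=
    fun hf => memLp_rect_of_continuous hf _ _ _ _
  exact ((hF i j).integrable_mul (hm (by fun_prop : Continuous fun z =>
    (dcX w i j).eval z - liftXDeriv X σ w i j z))).add
    ((hFx i j).integrable_mul (hm (by fun_prop : Continuous fun z =>
    (w i j).eval z - liftX X σ w i j z)))

variable [Fintype ι] [Fintype κ]

/-- It suffices to verify the conformity relation on a basis. -/
lemma isConforming_of_basis {F Fx : ℝ × ℝ → ℝ} (hF : CellL2 X Y F) (hFx : CellL2 X Y Fx) (σ : ℝ)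
    {ι' : Type*} (b : Module.Basis ι' ℝ (V2 ι κ k))
    (h : ∀ l, ∑ i, ∑ j, ∫ z in cellXY X Y i j, confIntegrand X σ F Fx (b l) i j z = 0) :
    IsConforming X Y k σ F Fx := by
  have hi := integrable_confIntegrand (k := k) hF hFx σ
  let Λ : V2 ι κ k →ₗ[ℝ] ℝ :=
    { toFun := fun w => ∑ i, ∑ j, ∫ z in cellXY X Y i j, confIntegrand X σ F Fx w i j z
      map_add' := fun v w => by
        simp only [confIntegrand_add, integral_add (hi v _ _) (hi w _ _), sum_add_distrib]
      map_smul' := fun r w => by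
        simp only [confIntegrand_smul, integral_const_mul, mul_sum, RingHom.id_apply,
          smul_eq_mul] }
  have h0 : Λ = 0 := b.ext fun l => h l
  exact fun w => LinearMap.congr_fun h0 w

variable {T : ℝ}

/-- Conformity passes to the time derivatives. -/
lemma ae_isConforming_deriv (hT : 0 < T) (σ : ℝ) {F F' Fx Fx' : ℝ → ℝ × ℝ → ℝ}
    (hF : ∀ i j, IsH1L2 T vol[cellXY X Y i j] F F')
    (hFx : ∀ i j, IsH1L2 T vol[cellXY X Y i j] Fx Fx')
    (h : ∀ᵐ t ∂vol[Ioo 0 T], IsConforming X Y k σ (F t) (Fx t)) :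
    ∀ᵐ t ∂vol[Ioo 0 T], IsConforming X Y k σ (F' t) (Fx' t) := by
  have hfin : ∀ i j, IsFiniteMeasure vol[cellXY X Y i j] :=
    fun i j => isFiniteMeasure_rect (X.L i) (X.R i) (Y.L j) (Y.R j)
  have hm : ∀ {f : ℝ × ℝ → ℝ}, Continuous f → ∀ i j,
      MemLp f 2 vol[cellXY X Y i j] :=
    fun hf i j => memLp_rect_of_continuous hf _ _ _ _
  set b := Module.finBasis ℝ (V2 ι κ k) with hb
  have hL : ∀ᵐ t ∂vol[Ioo 0 T], CellL2 X Y (F' t) ∧ CellL2 X Y (Fx' t) := by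
    refine Filter.Eventually.and ?_ ?_
    · exact ae_all_iff.2 fun i => ae_all_iff.2 fun j => ae_memLp_slice (hF i j).deriv
    · exact ae_all_iff.2 fun i => ae_all_iff.2 fun j => ae_memLp_slice (hFx i j).deriv
  have hbasis : ∀ l, ∀ᵐ t ∂vol[Ioo 0 T],
      ∑ i, ∑ j, ∫ z in cellXY X Y i j, confIntegrand X σ (F' t) (Fx' t) (b l) i j z = 0 := by
    intro l
    have c1 : ∀ i j, Continuous fun z => (dcX (b l) i j).eval z - liftXDeriv X σ (b l) i j z :=
      fun i j => by fun_prop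
    have c2 : ∀ i j, Continuous fun z => (b l i j).eval z - liftX X σ (b l) i j z :=
      fun i j => by fun_prop
    have hH : IsH1 T
        (fun t => ∑ i, ∑ j, ((∫ z in cellXY X Y i j, F t z *
          ((dcX (b l) i j).eval z - liftXDeriv X σ (b l) i j z))
          + ∫ z in cellXY X Y i j, Fx t z * ((b l i j).eval z - liftX X σ (b l) i j z)))
        (fun t => ∑ i, ∑ j, ((∫ z in cellXY X Y i j, F' t z *
          ((dcX (b l) i j).eval z - liftXDeriv X σ (b l) i j z))
          + ∫ z in cellXY X Y i j, Fx' t z * ((b l i j).eval z - liftX X σ (b l) i j z))) := by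
      refine IsH1.sum _ fun i _ => IsH1.sum _ fun j _ => ?_
      have := hfin i j
      exact ((hF i j).integral_mul (hm (c1 i j) i j)).add
        ((hFx i j).integral_mul (hm (c2 i j) i j))
    have hsplit : ∀ {F Fx : ℝ × ℝ → ℝ}, CellL2 X Y F → CellL2 X Y Fx →
        ∑ i, ∑ j, ∫ z in cellXY X Y i j, confIntegrand X σ F Fx (b l) i j z
        = ∑ i, ∑ j, ((∫ z in cellXY X Y i j, F z *
          ((dcX (b l) i j).eval z - liftXDeriv X σ (b l) i j z))
          + ∫ z in cellXY X Y i j, Fx z * ((b l i j).eval z - liftX X σ (b l) i j z)) := by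
      intro F Fx hF hFx
      refine sum_congr rfl fun i _ => sum_congr rfl fun j _ => ?_
      exact integral_add ((hF i j).integrable_mul (hm (c1 i j) i j))
        ((hFx i j).integrable_mul (hm (c2 i j) i j))
    have hz := hH.deriv_eq_zero hT (by
      filter_upwards [h, ae_restrict_mem measurableSet_Ioo] with t ht htm
      rw [← hsplit (fun i j => (hF i j).memLp_at (Ioo_subset_Icc_self htm))
        (fun i j => (hFx i j).memLp_at (Ioo_subset_Icc_self htm))]
      exact ht (b l))
    filter_upwards [hz, hL] with t ht hLt
    rw [hsplit hLt.1 hLt.2]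
    exact ht
  filter_upwards [ae_all_iff.2 hbasis, hL] with t ht hLt
  exact isConforming_of_basis hLt.1 hLt.2 σ b ht

end ConfFunctional

section Exact

variable {a₁ b₁ a₂ b₂ T α : ℝ} {κ : ℝ × ℝ → ℝ}

/-- The equation at almost every time, for products of periodic test functions. -/
lemma ae_isWeakPoisson (hT : 0 < T) {u u' p q : ℝ → ℝ × ℝ → ℝ}
    (hd : HasTimeDeriv a₁ b₁ a₂ b₂ T u u')
    (h : ∀ᵐ t ∂vol[Ioo 0 T], ∀ φ, IsPeriodicTest a₁ b₁ a₂ b₂ φ →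
      ((∫ z in rect a₁ b₁ a₂ b₂, u t z * dX φ z) = -∫ z in rect a₁ b₁ a₂ b₂, p t z * φ z) ∧
      ((∫ z in rect a₁ b₁ a₂ b₂, u t z * dY φ z) = -∫ z in rect a₁ b₁ a₂ b₂, q t z * φ z) ∧
      ((∫ z in rect a₁ b₁ a₂ b₂, substCaputo α (κ z) (fun τ => u τ z) t * φ z)
        = -∫ z in rect a₁ b₁ a₂ b₂, (p t z * dX φ z + q t z * dY φ z))) :
    ∀ᵐ t ∂vol[Ioo 0 T], IsWeakPoisson a₁ b₁ a₂ b₂ (u t) (p t) (q t)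
      (fun z => fracDxt α T κ u u' (t, z)) := by
  filter_upwards [h, ae_restrict_mem measurableSet_Ioo] with t ht htm
  have hS : ∀ φ : ℝ × ℝ → ℝ, ∫ z in rect a₁ b₁ a₂ b₂, fracDxt α T κ u u' (t, z) * φ z
      = ∫ z in rect a₁ b₁ a₂ b₂, substCaputo α (κ z) (fun τ => u τ z) t * φ z := fun φ => by
    refine integral_congr_ae ?_
    filter_upwards [hd] with z hz
    rw [substCaputo_eq_fracD hT.le hz.1 hz.2 htm, fracDxt]
  refine ⟨fun A B hA hB hAp hBp => ?_, fun A B hA hB hAp hBp => ?_, fun A B hA hB hAp hBp => ?_⟩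
  · have := (ht _ (isPeriodicTest_mul hA hB hAp hBp)).1
    rwa [dX_mul] at this
  · have := (ht _ (isPeriodicTest_mul hA hB hAp hBp)).2.1
    rwa [dY_mul] at this
  · have := (ht _ (isPeriodicTest_mul hA hB hAp hBp)).2.2
    rw [dX_mul, dY_mul, ← hS] at this
    exact this

lemma isH1L2_swap {f f' : ℝ → ℝ × ℝ → ℝ} {L R L' R' : ℝ}
    (h : IsH1L2 T vol[rect L R L' R'] f f') :
    IsH1L2 T vol[rect L' R' L R] (fun t z => f t z.swap)
      (fun t z => f' t z.swap) where
  zero := memLp_rect_swap h.zero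
  deriv := by
    have := h.deriv
    rw [restrict_rect] at this ⊢
    exact this.comp_measurePreserving
      ((MeasurePreserving.id _).prod Measure.measurePreserving_swap)
  primitive := ae_rect_swap h.primitive

/-- The conformity relations and the equation, at almost every time, for the broken derivatives of
the exact solution and of its time derivative. -/
lemma ae_conforming (M : RectMesh a₁ b₁ a₂ b₂) (hx : a₁ < b₁) (hy : a₂ < b₂) (hT : 0 < T) (k : ℕ)
    (σ₁ σ₂ : ℝ) {r : ℕ} (hr : 2 ≤ r) {u u' p q : ℝ → ℝ × ℝ → ℝ}
    {G G' : ℕ → ℕ → ℝ → ℝ × ℝ → ℝ} (hG : TimeFamily M T r u u' G G')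
    (hp : MemL2 a₁ b₁ a₂ b₂ T p) (hq : MemL2 a₁ b₁ a₂ b₂ T q)
    (hS : MemLp (fracDxt α T κ u u') 2
      (vol[Ioo 0 T].prod vol[rect a₁ b₁ a₂ b₂]))
    (h : ∀ᵐ t ∂vol[Ioo 0 T], IsWeakPoisson a₁ b₁ a₂ b₂ (u t) (p t) (q t)
      (fun z => fracDxt α T κ u u' (t, z))) :
    ∀ᵐ t ∂vol[Ioo 0 T],
      (∀ᵐ z ∂vol[rect a₁ b₁ a₂ b₂],
        fracDxt α T κ u u' (t, z) = G 2 0 t z + G 0 2 t z) ∧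
      ConformingFamily (meshX M) (meshY M) k σ₁ σ₂ (fun m n => G m n t) ∧
      ConformingFamily (meshX M) (meshY M) k σ₁ σ₂ (fun m n => G' m n t) := by
  have := isFiniteMeasure_rect a₁ b₁ a₂ b₂
  have h1 : ∀ᵐ t ∂vol[Ioo 0 T],
      (∀ᵐ z ∂vol[rect a₁ b₁ a₂ b₂],
        fracDxt α T κ u u' (t, z) = G 2 0 t z + G 0 2 t z) ∧
      ConformingFamily (meshX M) (meshY M) k σ₁ σ₂ (fun m n => G m n t) := by
    filter_upwards [h, ae_memLp_slice hp, ae_memLp_slice hq,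
      ae_memLp_slice (f := fun t z => fracDxt α T κ u u' (t, z)) hS,
      ae_restrict_mem measurableSet_Ioo] with t ht hpt hqt hSt htm
    have hw := hG.weak t (Ioo_subset_Icc_self htm)
    exact ht.conforming M k σ₁ σ₂ hx hy hw.brokenSmooth hr hw.memLp
      (by simp only [hG.eq_zero]) (hpt.integrable one_le_two) (hqt.integrable one_le_two)
      (hSt.integrable one_le_two)
  have hc : ∀ m n, m + n ≤ r → ∀ i j,
      IsH1L2 T vol[cellXY (meshX M) (meshY M) i j] (G m n) (G' m n) :=
    fun m n hmn i j => by
      have h1 := isFiniteMeasure_rect (M.xL i) (M.xR i) (M.yL j) (M.yR j)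
      exact (hG.isH1 m n hmn).mono_measure (Measure.restrict_mono (M.cell_subset i j) le_rfl)
  have hcs : ∀ m n, m + n ≤ r → ∀ j i,
      IsH1L2 T vol[cellXY (meshY M) (meshX M) j i] (fun t z => G m n t z.swap)
        (fun t z => G' m n t z.swap) := fun m n hmn j i => isH1L2_swap (hc m n hmn i j)
  have x1 := ae_isConforming_deriv (k := k) hT σ₁ (hc 0 0 (by omega)) (hc 1 0 (by omega))
    (h1.mono fun t ht => ht.2.x₁)
  have x2 := ae_isConforming_deriv (k := k) hT (1 - σ₁) (hc 1 0 (by omega)) (hc 2 0 (by omega))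
    (h1.mono fun t ht => ht.2.x₂)
  have y1 := ae_isConforming_deriv (k := k) hT σ₂ (hcs 0 0 (by omega)) (hcs 0 1 (by omega))
    (h1.mono fun t ht => ht.2.y₁)
  have y2 := ae_isConforming_deriv (k := k) hT (1 - σ₂) (hcs 0 1 (by omega)) (hcs 0 2 (by omega))
    (h1.mono fun t ht => ht.2.y₂)
  filter_upwards [h1, x1, x2, y1, y2] with t ht e1 e2 e3 e4
  exact ⟨ht.1, ht.2, e1, e2, e3, e4⟩

end Exact

/-! ### The energy estimate in time -/

section Energy

variable {α T K : ℝ}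

/-- The energy estimate: a function whose fractional derivative, tested with the function itself,
is controlled by `H`, is bounded by its initial value and by `H`. -/
lemma exists_energy_bound (hα : 0 < α) (hα1 : α < 1) (hT : 0 < T) (hK : 0 ≤ K) :
    ∃ C : ℝ, 0 < C ∧ ∀ {ι : Type} [Fintype ι] {β : Type} [MeasurableSpace β] (ν : ι → Measure β)
      [∀ i, IsFiniteMeasure (ν i)] (κ : β → ℝ), Measurable κ → (∀ i, ∀ᵐ y ∂(ν i), |κ y| ≤ K) →
      ∀ (e e' : ι → ℝ → β → ℝ) (H : ι → ℝ × β → ℝ), (∀ i, IsH1L2 T (ν i) (e i) (e' i)) →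
      (∀ i, MemLp (H i) 2 (vol[Ioo 0 T].prod (ν i))) →
      (∀ᵐ t ∂vol[Ioo 0 T],
        ∑ i, ∫ z, fracDxt α T κ (e i) (e' i) (t, z) * e i t z ∂(ν i)
          ≤ ∑ i, ∫ z, H i (t, z) * e i t z ∂(ν i)) →
      ∑ i, ∫ p : ℝ × β, e i p.1 p.2 ^ 2 ∂(vol[Ioo 0 T].prod (ν i))
        ≤ C * ((∑ i, ∫ z, e i 0 z ^ 2 ∂(ν i))
          + ∑ i, ∫ p, H i p ^ 2 ∂(vol[Ioo 0 T].prod (ν i))) := by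
  obtain ⟨c₀, C₁, hc₀, hC₁, hco⟩ := exists_fracD_coercive hα hα1 hT hK
  obtain ⟨C₂, hC₂, hbd⟩ := exists_fracDxt_bound (α := α) hα1 hT hK
  refine ⟨2 / c₀ * (C₁ + 1 / (2 * c₀)), by positivity, ?_⟩
  intro ι _ β _ ν _ κ hκm hκ e e' H he hH hle
  set μ : Measure ℝ := vol[Ioo 0 T] with hμ
  have hL := fun i => (he i).memLp hT.le
  have hD := fun i => (hbd (ν i) κ hκm (hκ i) (e i) (e' i) (hL i) (he i).deriv).1
  have hw1 : ∀ (ν : Measure β) [IsFiniteMeasure ν],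
      ∀ᵐ p : ℝ × β ∂(μ.prod ν), exp (-2 * K * p.1) ≤ 1 := fun ν _ => by
    refine (Measure.quasiMeasurePreserving_fst.ae (ae_restrict_mem measurableSet_Ioo)).mono
      fun p hp => Real.exp_le_one_iff.2 ?_
    have := mul_nonneg hK hp.1.le
    linarith
  have hw : ∀ (ν : Measure β) [IsFiniteMeasure ν] {f : ℝ × β → ℝ}, Integrable f (μ.prod ν) →
      Integrable (fun p => exp (-2 * K * p.1) * f p) (μ.prod ν) := by
    intro ν _ f hf
    have hm : AEStronglyMeasurable (fun p : ℝ × β => exp (-2 * K * p.1)) (μ.prod ν) :=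
      (by fun_prop : Measurable fun p : ℝ × β => exp (-2 * K * p.1)).aestronglyMeasurable
    refine hf.bdd_mul (c := 1) hm ((hw1 ν).mono fun p hp => ?_)
    rwa [Real.norm_of_nonneg (Real.exp_nonneg _)]
  have hDe : ∀ i, Integrable (fun p : ℝ × β => fracDxt α T κ (e i) (e' i) p * e i p.1 p.2)
      (μ.prod (ν i)) := fun i => (hD i).integrable_mul (hL i)
  have hHe : ∀ i, Integrable (fun p : ℝ × β => H i p * e i p.1 p.2) (μ.prod (ν i)) :=
    fun i => (hH i).integrable_mul (hL i)
  -- coercivity, pointwise in space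
  have hA : ∀ i, c₀ * (∫ p : ℝ × β, e i p.1 p.2 ^ 2 ∂(μ.prod (ν i)))
      - C₁ * ∫ z, e i 0 z ^ 2 ∂(ν i)
      ≤ ∫ p : ℝ × β, exp (-2 * K * p.1)
        * (fracDxt α T κ (e i) (e' i) p * e i p.1 p.2) ∂(μ.prod (ν i)) := by
    intro i
    have i1 : Integrable (fun p : ℝ × β => e i p.1 p.2 ^ 2) (μ.prod (ν i)) := (hL i).integrable_sq
    have i2 := (he i).zero.integrable_sq
    rw [integral_prod_symm _ i1, integral_prod_symm _ (hw _ (hDe i)), ← integral_const_mul,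
      ← integral_const_mul, ← integral_sub (i1.integral_prod_right.const_mul _) (i2.const_mul _)]
    refine integral_mono_ae ((i1.integral_prod_right.const_mul _).sub (i2.const_mul _))
      (hw _ (hDe i)).integral_prod_right ?_
    filter_upwards [hκ i, (he i).ae_isH1] with z hz1 hz2
    exact hco (κ z) hz1 _ _ hz2
  have hB : ∀ i, ∫ p : ℝ × β, exp (-2 * K * p.1) * (H i p * e i p.1 p.2) ∂(μ.prod (ν i))
      ≤ c₀ / 2 * (∫ p : ℝ × β, e i p.1 p.2 ^ 2 ∂(μ.prod (ν i)))
        + 1 / (2 * c₀) * ∫ p, H i p ^ 2 ∂(μ.prod (ν i)) := by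
    intro i
    have i1 : Integrable (fun p : ℝ × β => e i p.1 p.2 ^ 2) (μ.prod (ν i)) := (hL i).integrable_sq
    have i2 := (hH i).integrable_sq
    rw [← integral_const_mul, ← integral_const_mul,
      ← integral_add (i1.const_mul _) (i2.const_mul _)]
    refine integral_mono_ae (hw _ (hHe i)) ((i1.const_mul _).add (i2.const_mul _)) ?_
    filter_upwards [hw1 (ν i)] with p hx1
    have hyoung : |H i p * e i p.1 p.2| ≤ c₀ / 2 * e i p.1 p.2 ^ 2 + 1 / (2 * c₀) * H i p ^ 2 := by
      have h2 : c₀ / 2 * e i p.1 p.2 ^ 2 + 1 / (2 * c₀) * H i p ^ 2 - |H i p| * |e i p.1 p.2|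
          = (c₀ * |e i p.1 p.2| - |H i p|) ^ 2 / (2 * c₀) := by
        rw [← sq_abs (e i p.1 p.2), ← sq_abs (H i p)]; field_simp; ring
      rw [abs_mul]
      have : 0 ≤ (c₀ * |e i p.1 p.2| - |H i p|) ^ 2 / (2 * c₀) := by positivity
      linarith
    calc exp (-2 * K * p.1) * (H i p * e i p.1 p.2)
        ≤ exp (-2 * K * p.1) * |H i p * e i p.1 p.2| :=
          mul_le_mul_of_nonneg_left (le_abs_self _) (Real.exp_nonneg _)
      _ ≤ 1 * |H i p * e i p.1 p.2| := mul_le_mul_of_nonneg_right hx1 (abs_nonneg _)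
      _ ≤ _ := by rw [one_mul]; exact hyoung
  -- the assumed inequality, integrated in time
  have hAB : ∑ i, ∫ p : ℝ × β, exp (-2 * K * p.1)
        * (fracDxt α T κ (e i) (e' i) p * e i p.1 p.2) ∂(μ.prod (ν i))
      ≤ ∑ i, ∫ p : ℝ × β, exp (-2 * K * p.1) * (H i p * e i p.1 p.2) ∂(μ.prod (ν i)) := by
    have e1 : ∀ i, ∀ {f : ℝ × β → ℝ}, Integrable f (μ.prod (ν i)) →
        ∫ p : ℝ × β, exp (-2 * K * p.1) * f p ∂(μ.prod (ν i))
          = ∫ t, exp (-2 * K * t) * ∫ z, f (t, z) ∂(ν i) ∂μ := by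
      intro i f hf
      rw [integral_prod _ (hw _ hf)]
      simp only [integral_const_mul]
    have e2 : ∀ i, ∀ {f : ℝ × β → ℝ}, Integrable f (μ.prod (ν i)) →
        Integrable (fun t => exp (-2 * K * t) * ∫ z, f (t, z) ∂(ν i)) μ := by
      intro i f hf
      have := (hw _ hf).integral_prod_left
      simpa only [integral_const_mul] using this
    simp only [fun i => e1 i (hDe i), fun i => e1 i (hHe i)]
    rw [← integral_finsetSum _ fun i _ => e2 i (hDe i),
      ← integral_finsetSum _ fun i _ => e2 i (hHe i)]
    refine integral_mono_ae (integrable_finsetSum _ fun i _ => e2 i (hDe i))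
      (integrable_finsetSum _ fun i _ => e2 i (hHe i)) ?_
    filter_upwards [hle] with t ht
    simp only [← mul_sum]
    exact mul_le_mul_of_nonneg_left ht (Real.exp_nonneg _)
  have hA' := sum_le_sum fun i (_ : i ∈ Finset.univ) => hA i
  have hB' := sum_le_sum fun i (_ : i ∈ Finset.univ) => hB i
  simp only [sum_sub_distrib, sum_add_distrib, ← mul_sum] at hA' hB'
  set E := ∑ i, ∫ p : ℝ × β, e i p.1 p.2 ^ 2 ∂(μ.prod (ν i)) with hE
  set E₀ := ∑ i, ∫ z, e i 0 z ^ 2 ∂(ν i) with hE₀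
  set N := ∑ i, ∫ p, H i p ^ 2 ∂(μ.prod (ν i)) with hN
  have hE₀0 : 0 ≤ E₀ := sum_nonneg fun i _ => integral_nonneg fun _ => sq_nonneg _
  have hN0 : 0 ≤ N := sum_nonneg fun i _ => integral_nonneg fun _ => sq_nonneg _
  have hmain : c₀ / 2 * E ≤ C₁ * E₀ + 1 / (2 * c₀) * N := by linarith
  have h1 : C₁ * E₀ + 1 / (2 * c₀) * N ≤ (C₁ + 1 / (2 * c₀)) * (E₀ + N) := by
    have h2 : 0 ≤ 1 / (2 * c₀) * E₀ := by positivity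
    have h3 : 0 ≤ C₁ * N := by positivity
    nlinarith
  calc E = 2 / c₀ * (c₀ / 2 * E) := by field_simp
    _ ≤ 2 / c₀ * ((C₁ + 1 / (2 * c₀)) * (E₀ + N)) :=
        mul_le_mul_of_nonneg_left (hmain.trans h1) (by positivity)
    _ = _ := by ring

end Energy

/-! ### The semi-discrete scheme in operator form -/

section Scheme

variable {a₁ b₁ a₂ b₂ T α σ₁ σ₂ : ℝ} {k : ℕ}

lemma avgX_eq_flux (M : RectMesh a₁ b₁ a₂ b₂) (σ : ℝ) (v : Vh M k) (i : Fin M.Nx) (j : Fin M.Ny)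
    (y : ℝ) : avgX σ v i j y = (meshX M).flux σ (sx v j y) i := by
  simp only [avgX, eval_eq_slx]; rfl

lemma avgY_eq_avgX (M : RectMesh a₁ b₁ a₂ b₂) (σ : ℝ) (v : Vh M k) (i : Fin M.Nx) (j : Fin M.Ny)
    (x : ℝ) : avgY σ v i j x = avgX (M := M.swap) σ (V2.swap v) j i x := by
  simp only [avgY, avgX, V2.swap, eval_swap]; rfl

lemma bdryY_eq_bdryX (M : RectMesh a₁ b₁ a₂ b₂) (σ : ℝ) (v : Vh M k) (i : Fin M.Nx) (j : Fin M.Ny)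
    (w : Qk k) : bdryY σ v i j w = bdryX (M := M.swap) σ (V2.swap v) j i w.swap := by
  simp only [bdryY, bdryX, avgY_eq_avgX, eval_swap]; rfl

lemma continuous_dX_eval (w : Qk k) : Continuous (dX w.eval) := by
  rw [dX_eval]; exact continuous_eval _

lemma dY_eval_swap (w : Qk k) (z : ℝ × ℝ) : dY w.eval z.swap = dX w.swap.eval z := by
  rw [dY_eval, dX_eval]; rfl

lemma continuous_dY_eval (w : Qk k) : Continuous (dY w.eval) := by
  have h : dY w.eval = fun z => dX w.swap.eval z.swap := by
    funext z; rw [← dY_eval_swap, Prod.swap_swap]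
  rw [h]; exact (continuous_dX_eval _).comp continuous_swap

/-- The weak form of the discrete derivative, cell by cell. -/
lemma ip2_dxOp_eq_sum (M : RectMesh a₁ b₁ a₂ b₂) (σ : ℝ) (v w : Vh M k) :
    ip2 (meshX M) (meshY M) (dxOp (meshX M) σ v) w
      = ∑ i, ∑ j, (-(∫ z in M.cell i j, (v i j).eval z * dX (w i j).eval z)
        + bdryX σ v i j (w i j)) := by
  have hcell : ∀ i j, ∫ z in M.cell i j, (v i j).eval z * dX (w i j).eval z
      = ∫ y in M.yL j..M.yR j, ∫ x in M.xL i..M.xR i,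
        ev (sx v j y i) x * ev (dc (sx w j y i)) x := by
    intro i j
    rw [RectMesh.cell, integral_rect (f := fun z => (v i j).eval z * dX (w i j).eval z)
      ((continuous_eval _).mul (continuous_dX_eval _))
      (show M.xL i ≤ M.xR i from ((meshX M).lt i).le)
      (show M.yL j ≤ M.yR j from ((meshY M).lt j).le)]
    simp only [dX_eval, eval_eq_slx, slx_dcx]
    rfl
  have hc1 : ∀ i j, Continuous fun y => ∫ x in M.xL i..M.xR i,
      ev (sx v j y i) x * ev (dc (sx w j y i)) x := by
    intro i j
    have : ∀ y x, ev (sx v j y i) x * ev (dc (sx w j y i)) x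
        = (v i j).eval (x, y) * dX (w i j).eval (x, y) := by
      intro y x
      rw [dX_eval, eval_eq_slx, eval_eq_slx, slx_dcx]; rfl
    simp only [this]
    refine continuous_parametric_intervalIntegral_of_continuous' ?_ _ _
    exact ((continuous_eval (v i j)).comp continuous_swap).mul
      ((continuous_dX_eval (w i j)).comp continuous_swap)
  have hc2 : ∀ i j, Continuous fun y => (meshX M).flux σ (sx v j y) i * ev (sx w j y i) (M.xR i)
      - (meshX M).flux σ (sx v j y) ((meshX M).next.symm i) * ev (sx w j y i) (M.xL i) := by
    intro i j
    simp only [Mesh1.flux, sx]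
    fun_prop
  rw [ip2_eq_sum_ip, sum_comm (γ := Fin M.Nx)]
  refine sum_congr rfl fun j _ => ?_
  simp only [sx_dxOp, Mesh1.ip_D, Mesh1.bform_apply]
  rw [intervalIntegral.integral_finsetSum]
  · refine sum_congr rfl fun i _ => ?_
    rw [hcell, bdryX, ← intervalIntegral.integral_neg, ← intervalIntegral.integral_add]
    · simp only [avgX_eq_flux, eval_eq_slx]
      rfl
    · exact (hc1 i j).neg.intervalIntegrable _ _
    · refine Continuous.intervalIntegrable ?_ _ _
      simp only [avgX_eq_flux, eval_eq_slx]
      exact hc2 i j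
  · intro i _
    exact ((hc1 i j).neg.add (hc2 i j)).intervalIntegrable _ _

lemma ip2_dyOp_eq_sum (M : RectMesh a₁ b₁ a₂ b₂) (σ : ℝ) (v w : Vh M k) :
    ip2 (meshX M) (meshY M) (dyOp (meshY M) σ v) w
      = ∑ i, ∑ j, (-(∫ z in M.cell i j, (v i j).eval z * dY (w i j).eval z)
        + bdryY σ v i j (w i j)) := by
  have key : ∀ (j : Fin M.Ny) (i : Fin M.Nx),
      -(∫ z in rect (M.yL j) (M.yR j) (M.xL i) (M.xR i),
          (v i j).swap.eval z * dX (w i j).swap.eval z)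
        + bdryX (M := M.swap) σ (V2.swap v) j i (w i j).swap
      = -(∫ z in M.cell i j, (v i j).eval z * dY (w i j).eval z) + bdryY σ v i j (w i j) := by
    intro j i
    rw [bdryY_eq_bdryX, RectMesh.cell, integral_rect_swap _ (M.xL i) (M.xR i) (M.yL j) (M.yR j)]
    congr 2
    refine integral_congr_ae (.of_forall fun z => ?_)
    obtain ⟨x, y⟩ := z
    simp only [eval_swap, Prod.swap_prod_mk]
    rw [← dY_eval_swap, Prod.swap_prod_mk]
  rw [← ip2_swap, swap_dyOp, sum_comm]
  refine (ip2_dxOp_eq_sum M.swap σ (V2.swap v) (V2.swap w)).trans ?_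
  exact sum_congr rfl fun j _ => sum_congr rfl fun i _ => key j i

variable {M : RectMesh a₁ b₁ a₂ b₂} {κ u₀ : ℝ × ℝ → ℝ} {uh ph qh : ℝ → Vh M k}

lemma eq_of_ip2_eq {ι κ : Type} [Fintype ι] [Fintype κ] (X : Mesh1 ι) (Y : Mesh1 κ)
    {v w : V2 ι κ k} (h : ∀ φ, ip2 X Y v φ = ip2 X Y w φ) : v = w := by
  refine sub_eq_zero.1 (ip2_definite X Y _ ?_)
  rw [LinearMap.map_sub₂, h, sub_self]

/-- The scheme, with the discrete gradient eliminated. -/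
lemma IsLDGSolution.ae_operator_form (h : IsLDGSolution M k T α σ₁ σ₂ κ u₀ uh ph qh) :
    ∀ᵐ t ∂vol[Ioo 0 T], ∀ v : Vh M k,
      (∑ i, ∑ j, ∫ z in M.cell i j,
        substCaputo α (κ z) (fun τ => (uh τ i j).eval z) t * (v i j).eval z)
      + ip2 (meshX M) (meshY M) (dxOp (meshX M) σ₁ (uh t)) (dxOp (meshX M) σ₁ v)
      + ip2 (meshX M) (meshY M) (dyOp (meshY M) σ₂ (uh t)) (dyOp (meshY M) σ₂ v) = 0 := by
  filter_upwards [h.evolution, h.gradient] with t h1 h2 v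
  have hz : (0 : Qk k).eval = fun _ => 0 := by funext z; simp [Qk.eval]
  have hdX0 : dX (0 : Qk k).eval = fun _ => 0 := by funext z; rw [hz]; simp [dX]
  have hdY0 : dY (0 : Qk k).eval = fun _ => 0 := by funext z; rw [hz]; simp [dY]
  have hbX : ∀ σ (f : Vh M k) i j, bdryX σ f i j 0 = 0 := fun σ f i j => by
    simp [bdryX]
  have hbY : ∀ σ (f : Vh M k) i j, bdryY σ f i j 0 = 0 := fun σ f i j => by
    simp [bdryY]
  have hp : ph t = dxOp (meshX M) σ₁ (uh t) := by
    refine eq_of_ip2_eq (meshX M) (meshY M) fun w => ?_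
    rw [ip2_dxOp_eq_sum, ip2_apply]
    refine sum_congr rfl fun i _ => sum_congr rfl fun j _ => ?_
    have := h2 i j (w i j) 0
    simp only [eval_zero, hdY0, hbY, mul_zero, add_zero] at this
    rw [cell_eq]; linarith
  have hq : qh t = dyOp (meshY M) σ₂ (uh t) := by
    refine eq_of_ip2_eq (meshX M) (meshY M) fun w => ?_
    rw [ip2_dyOp_eq_sum, ip2_apply]
    refine sum_congr rfl fun i _ => sum_congr rfl fun j _ => ?_
    have := h2 i j 0 (w i j)
    simp only [eval_zero, hdX0, hbX, mul_zero, zero_add] at this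
    rw [cell_eq]; linarith
  have e1 := ip2_dxOp_eq_sum M (1 - σ₁) (ph t) v
  have e2 := ip2_dyOp_eq_sum M (1 - σ₂) (qh t) v
  rw [ip2_dxOp_left, sub_sub_cancel] at e1
  rw [ip2_dyOp_left, sub_sub_cancel] at e2
  have e3 : ∑ i, ∑ j, ((∫ z in M.cell i j,
        substCaputo α (κ z) (fun τ => (uh τ i j).eval z) t * (v i j).eval z)
      - ((-(∫ z in M.cell i j, (ph t i j).eval z * dX (v i j).eval z)
          + bdryX (1 - σ₁) (ph t) i j (v i j))
        + (-(∫ z in M.cell i j, (qh t i j).eval z * dY (v i j).eval z)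
          + bdryY (1 - σ₂) (qh t) i j (v i j)))) = 0 := by
    refine sum_eq_zero fun i _ => sum_eq_zero fun j _ => ?_
    have := h1 i j (v i j)
    have i1 : IntegrableOn (fun z => (ph t i j).eval z * dX (v i j).eval z) (M.cell i j) :=
      integrableOn_rect ((continuous_eval _).mul (continuous_dX_eval _)) _ _ _ _
    have i2 : IntegrableOn (fun z => (qh t i j).eval z * dY (v i j).eval z) (M.cell i j) :=
      integrableOn_rect ((continuous_eval _).mul (continuous_dY_eval _)) _ _ _ _
    rw [integral_add i1 i2] at this
    linarith
  simp only [sum_sub_distrib, sum_add_distrib] at e1 e2 e3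
  rw [← hp, ← hq]
  linarith

end Scheme

/-! ### Piecewise polynomials depending on time -/

section DiscreteTime

variable {T : ℝ} {k : ℕ}

/-- A polynomial whose coefficients are of class `H¹` in time. -/
lemma isH1L2_eval {v v' : ℝ → Qk k} (h : ∀ m n, IsH1 T (fun t => v t m n) (fun t => v' t m n))
    (L R L' R' : ℝ) :
    IsH1L2 T vol[rect L R L' R'] (fun t z => (v t).eval z)
      (fun t z => (v' t).eval z) where
  zero := memLp_eval _
  deriv := by
    have := isFiniteMeasure_rect L R L' R'
    have hterm : ∀ m n : Fin (k + 1), MemLp (fun p : ℝ × ℝ × ℝ =>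
        v' p.1 m n * (p.2.1 ^ (m : ℕ) * p.2.2 ^ (n : ℕ))) 2
        (vol[Ioo 0 T].prod vol[rect L R L' R']) := by
      intro m n
      have hψ : MemLp (fun z : ℝ × ℝ => z.1 ^ (m : ℕ) * z.2 ^ (n : ℕ)) 2
        vol[rect L R L' R'] := memLp_rect_of_continuous (by fun_prop) _ _ _ _
      have hm := ((h m n).1.1.comp_fst (ν := vol[rect L R L' R'])).mul
        (hψ.1.comp_snd (μ := vol[Ioo 0 T]))
      refine (memLp_two_iff_integrable_sq hm).2 ?_
      have := (h m n).1.integrable_sq.mul_prod hψ.integrable_sq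
      simpa only [mul_pow, Pi.mul_apply] using this
    have e : (Function.uncurry fun t z => (v' t).eval z) = fun p : ℝ × ℝ × ℝ =>
        ∑ m : Fin (k + 1), ∑ n : Fin (k + 1),
          v' p.1 m n * (p.2.1 ^ (m : ℕ) * p.2.2 ^ (n : ℕ)) := by
      funext p
      simp only [Function.uncurry, Qk.eval, mul_assoc]
    rw [e]
    exact memLp_finsetSum _ fun m _ => memLp_finsetSum _ fun n _ => hterm m n
  primitive := .of_forall fun z => by
    have h1 : IsH1 T (fun t => (v t).eval z) (fun t => (v' t).eval z) := by
      simp only [Qk.eval, mul_assoc]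
      exact IsH1.sum _ fun m _ => IsH1.sum _ fun n _ => (h m n).mul_const _
    exact h1.2

/-- Functionals depending on time in class `H¹` are of class `H¹` after application of a linear
map on the dual space. -/
lemma isH1_linear_dual {V : Type*} [AddCommGroup V] [Module ℝ V] [FiniteDimensional ℝ V]
    {l l' : ℝ → V →ₗ[ℝ] ℝ} (h : ∀ w, IsH1 T (fun t => l t w) (fun t => l' t w))
    (φ : (V →ₗ[ℝ] ℝ) →ₗ[ℝ] ℝ) : IsH1 T (fun t => φ (l t)) (fun t => φ (l' t)) := by
  set b := Module.finBasis ℝ V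
  have e : ∀ f : V →ₗ[ℝ] ℝ, φ f = ∑ i, f (b i) * φ (b.coord i) := fun f => by
    conv_lhs => rw [← b.sum_dual_apply_smul_coord f]
    simp only [map_sum, map_smul, smul_eq_mul]
  simp only [e (l _), e (l' _)]
  exact IsH1.sum _ fun i _ => (h _).mul_const _

variable {ι κ : Type} [Fintype ι] [Fintype κ] {X : Mesh1 ι} {Y : Mesh1 κ}

lemma isH1_riesz {B : V2 ι κ k →ₗ[ℝ] V2 ι κ k →ₗ[ℝ] ℝ} (hB : ∀ v, B v v = 0 → v = 0)
    {l l' : ℝ → V2 ι κ k →ₗ[ℝ] ℝ} (h : ∀ w, IsH1 T (fun t => l t w) (fun t => l' t w))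
    (i : ι) (j : κ) (m n : Fin (k + 1)) :
    IsH1 T (fun t => riesz B hB (l t) i j m n) (fun t => riesz B hB (l' t) i j m n) :=
  isH1_linear_dual h ((LinearMap.proj n ∘ₗ LinearMap.proj m ∘ₗ LinearMap.proj j ∘ₗ
    LinearMap.proj i : V2 ι κ k →ₗ[ℝ] ℝ) ∘ₗ riesz B hB)

lemma isH1_mom {F F' : ℝ → ℝ × ℝ → ℝ}
    (hF : ∀ i j, IsH1L2 T vol[cellXY X Y i j] F F') (w : V2 ι κ k) :
    IsH1 T (fun t => mom X Y (F t) w) (fun t => mom X Y (F' t) w) := by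
  refine IsH1.sum _ fun i _ => IsH1.sum _ fun j _ => IsH1.sum _ fun m _ => IsH1.sum _ fun n _ => ?_
  have : IsFiniteMeasure vol[cellXY X Y i j] := isFiniteMeasure_rect _ _ _ _
  exact ((hF i j).integral_mul (memLp_rect_of_continuous
    (by fun_prop : Continuous fun z : ℝ × ℝ => z.1 ^ (m : ℕ) * z.2 ^ (n : ℕ)) _ _ _ _)).const_mul _

end DiscreteTime

section Helpers

variable {T : ℝ} {β : Type} [MeasurableSpace β]

/-- The trace inequality in time. -/
lemma IsH1L2.integral_sq_zero_le {ν : Measure β} [SFinite ν] {f f' : ℝ → β → ℝ} (hT : 0 < T)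
    (hf : IsH1L2 T ν f f') :
    ∫ z, f 0 z ^ 2 ∂ν
      ≤ 2 / T * (∫ p : ℝ × β, f p.1 p.2 ^ 2 ∂(vol[Ioo 0 T].prod ν))
        + 2 * T * ∫ p : ℝ × β, f' p.1 p.2 ^ 2 ∂(vol[Ioo 0 T].prod ν) := by
  have i1 : Integrable (fun p : ℝ × β => f p.1 p.2 ^ 2) (vol[Ioo 0 T].prod ν) :=
    (hf.memLp hT.le).integrable_sq
  have i2 : Integrable (fun p : ℝ × β => f' p.1 p.2 ^ 2) (vol[Ioo 0 T].prod ν) :=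
    hf.deriv.integrable_sq
  rw [integral_prod_symm _ i1, integral_prod_symm _ i2, ← integral_const_mul, ← integral_const_mul,
    ← integral_add (i1.integral_prod_right.const_mul _) (i2.integral_prod_right.const_mul _)]
  refine integral_mono_ae hf.zero.integrable_sq
    ((i1.integral_prod_right.const_mul _).add (i2.integral_prod_right.const_mul _)) ?_
  filter_upwards [hf.ae_isH1] with z hz
  exact hz.sq_zero_le hT

lemma integral_sub_sq_le {ν : Measure β} {f g : β → ℝ} (hf : MemLp f 2 ν) (hg : MemLp g 2 ν) :
    ∫ z, (f z - g z) ^ 2 ∂ν ≤ 2 * (∫ z, f z ^ 2 ∂ν) + 2 * ∫ z, g z ^ 2 ∂ν := by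
  rw [← integral_const_mul, ← integral_const_mul,
    ← integral_add (hf.integrable_sq.const_mul _) (hg.integrable_sq.const_mul _)]
  refine integral_mono (hf.sub hg).integrable_sq
    ((hf.integrable_sq.const_mul _).add (hg.integrable_sq.const_mul _)) fun z => ?_
  simp only []
  nlinarith [sq_nonneg (f z + g z)]

variable {ι κ : Type} [Fintype ι] [Fintype κ] {ν : ι → κ → Measure β} [∀ i j, SFinite (ν i j)]

/-- Integration in time of a bound on a sum over cells. -/
lemma sum_integral_sq_prod {f : ι → κ → ℝ → β → ℝ} (hf : ∀ i j, MemLp (Function.uncurry (f i j)) 2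
      (vol[Ioo 0 T].prod (ν i j))) :
    Integrable (fun t => ∑ i, ∑ j, ∫ z, f i j t z ^ 2 ∂(ν i j)) vol[Ioo 0 T] ∧
    ∑ i, ∑ j, ∫ p : ℝ × β, f i j p.1 p.2 ^ 2 ∂(vol[Ioo 0 T].prod (ν i j))
      = ∫ t in Ioo 0 T, ∑ i, ∑ j, ∫ z, f i j t z ^ 2 ∂(ν i j) := by
  have i1 : ∀ i j, Integrable (fun p : ℝ × β => f i j p.1 p.2 ^ 2)
    (vol[Ioo 0 T].prod (ν i j)) := fun i j => (hf i j).integrable_sq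
  have i2 : ∀ i j, Integrable (fun t => ∫ z, f i j t z ^ 2 ∂(ν i j)) vol[Ioo 0 T] :=
    fun i j => (i1 i j).integral_prod_left
  refine ⟨integrable_finsetSum _ fun i _ => integrable_finsetSum _ fun j _ => i2 i j, ?_⟩
  rw [integral_finsetSum _ fun i _ => integrable_finsetSum _ fun j _ => i2 i j]
  refine sum_congr rfl fun i _ => ?_
  rw [integral_finsetSum _ fun j _ => i2 i j]
  exact sum_congr rfl fun j _ => integral_prod _ (i1 i j)

end Helpers

/-! ### The error of the elliptic projection -/

section EllipticError

/-- The functional `v ↦ (u - Δu, v)` defining the elliptic projection. -/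
def ellipticFun {ι κ : Type} [Fintype ι] [Fintype κ] (X : Mesh1 ι) (Y : Mesh1 κ) (k : ℕ)
    (G : ℕ → ℕ → ℝ × ℝ → ℝ) : V2 ι κ k →ₗ[ℝ] ℝ :=
  mom X Y (G 0 0) - mom X Y (G 2 0) - mom X Y (G 0 2)

/-- The elliptic projection of `u = G 0 0` on the piecewise polynomials. -/
def ellipticProj {ι κ : Type} [Fintype ι] [Fintype κ] (X : Mesh1 ι) (Y : Mesh1 κ) (k : ℕ)
    (σ₁ σ₂ : ℝ) (G : ℕ → ℕ → ℝ × ℝ → ℝ) : V2 ι κ k :=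
  riesz (sform X Y σ₁ σ₂) (sform_definite X Y σ₁ σ₂) (ellipticFun X Y k G)

lemma sform_ellipticProj {ι κ : Type} [Fintype ι] [Fintype κ] (X : Mesh1 ι) (Y : Mesh1 κ) (k : ℕ)
    (σ₁ σ₂ : ℝ) (G : ℕ → ℕ → ℝ × ℝ → ℝ) (v : V2 ι κ k) :
    sform X Y σ₁ σ₂ (ellipticProj X Y k σ₁ σ₂ G) v
      = mom X Y (G 0 0) v - mom X Y (G 2 0) v - mom X Y (G 0 2) v :=
  riesz_apply _ _ _ _

/-- The elliptic projection approximates to optimal order, and is superclose to the `L²`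
projection. -/
lemma exists_ellipticProj_error (k : ℕ) (ρ : ℝ) {σ₁ σ₂ : ℝ} (hσ₁ : σ₁ ≠ 1 / 2)
    (hσ₂ : σ₂ ≠ 1 / 2) : ∃ C : ℝ, 0 < C ∧
    ∀ {ι κ : Type} [Fintype ι] [Fintype κ] (X : Mesh1 ι) (Y : Mesh1 κ) (h : ℝ), 0 < h →
    QuasiUnif X ρ h → QuasiUnif Y ρ h → ∀ G : ℕ → ℕ → ℝ × ℝ → ℝ,
    BrokenSmooth X Y (max (k + 1) 2) G → ConformingFamily X Y k σ₁ σ₂ G →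
    (∑ i, ∑ j, ∫ z in cellXY X Y i j,
        (G 0 0 z - (ellipticProj X Y k σ₁ σ₂ G i j).eval z) ^ 2)
      ≤ C * h ^ (2 * k + 2) * smoothSq X Y (max (k + 1) 2) G ∧
    (∑ i, ∑ j, ∫ z in cellXY X Y i j, ((ellipticProj X Y k σ₁ σ₂ G i j).eval z
        - (proj X Y k (G 0 0) i j).eval z) ^ 2)
      ≤ C * h ^ (2 * k + 2) * smoothSq X Y (max (k + 1) 2) G := by
  obtain ⟨C₁, hC₁, h1⟩ := exists_proj_estimate k ρ
  obtain ⟨C₂, hC₂, h2⟩ := exists_elliptic_estimate k ρ hσ₁ hσ₂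
  refine ⟨4 * C₁ + 2 * C₂, by positivity, fun {ι κ} _ _ X Y h hh hX hY G hG hc => ?_⟩
  set r := max (k + 1) 2 with hr
  have hr1 : k + 1 ≤ r := le_max_left _ _
  set N := smoothSq X Y r G with hN
  have hN0 : 0 ≤ N := smoothSq_nonneg _ _
  set R := ellipticProj X Y k σ₁ σ₂ G with hR
  set P := proj X Y k (G 0 0) with hP
  have E2 : ∑ i, ∑ j, ∫ z in cellXY X Y i j, ((R i j).eval z - (P i j).eval z) ^ 2
      ≤ C₂ * h ^ (2 * k + 2) * N := by
    have := h2 X Y h hh hX hY G hG hc.x₁ hc.x₂ hc.y₁ hc.y₂ R (sform_ellipticProj X Y k σ₁ σ₂ G)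
    rw [ip2_self] at this
    simpa only [Pi.sub_apply, eval_sub] using this
  have E1 := (h1 k le_rfl X Y h hX hY (fun l => G (0 + l) 0) (fun l => swapG G (0 + l) 0)
    (hG.chainX 0 0 (by omega)) (hG.swap.chainX 0 0 (by omega)) (fun z => rfl)).1
  simp only [zero_add, add_zero] at E1
  have s1 : cellSq X Y (G (k + 1) 0) + cellSq Y X (swapG G (k + 1) 0) ≤ 2 * N := by
    have a1 := cellSq_le_smoothSq (X := X) (Y := Y) (m := k + 1) (n := 0) (r := r) (by omega) G
    have a2 := cellSq_le_smoothSq (X := Y) (Y := X) (m := k + 1) (n := 0) (r := r) (by omega)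
      (swapG G)
    rw [smoothSq_swap] at a2
    linarith
  have E1' := E1.trans (mul_le_mul_of_nonneg_left s1 (by positivity))
  have hH : 0 ≤ h ^ (2 * k + 2) * N := by positivity
  constructor
  · have hsplit : ∑ i, ∑ j, ∫ z in cellXY X Y i j, (G 0 0 z - (R i j).eval z) ^ 2
        ≤ 2 * (∑ i, ∑ j, ∫ z in cellXY X Y i j, (G 0 0 z - (P i j).eval z) ^ 2)
          + 2 * ∑ i, ∑ j, ∫ z in cellXY X Y i j, ((R i j).eval z - (P i j).eval z) ^ 2 := by
      simp only [mul_sum, ← sum_add_distrib]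
      refine sum_le_sum fun i _ => sum_le_sum fun j _ => ?_
      have := integral_sub_sq_le ((hG.memLp 0 0 (by omega) i j).sub (memLp_eval (P i j)))
        ((memLp_eval (R i j)).sub (memLp_eval (P i j)))
      simp only [Pi.sub_apply, sub_sub_sub_cancel_right] at this
      exact this
    calc _ ≤ _ := hsplit
      _ ≤ 2 * (C₁ * h ^ (2 * k + 2) * (2 * N)) + 2 * (C₂ * h ^ (2 * k + 2) * N) := by linarith
      _ = _ := by ring
  · have : 0 ≤ 4 * C₁ * (h ^ (2 * k + 2) * N) + C₂ * (h ^ (2 * k + 2) * N) := by positivity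
    calc _ ≤ _ := E2
      _ ≤ _ := by linarith

end EllipticError

section FamilyNorm

variable {a₁ b₁ a₂ b₂ T : ℝ}

/-- The squared norm of a family of derivatives in space and time. -/
def familySq (a₁ b₁ a₂ b₂ T : ℝ) (r : ℕ) (G : ℕ → ℕ → ℝ → ℝ × ℝ → ℝ) : ℝ :=
  ∑ m ∈ Finset.range (r + 1), ∑ n ∈ Finset.range (r + 1), if m + n ≤ r then
    ∫ p : ℝ × ℝ × ℝ, G m n p.1 p.2 ^ 2
      ∂(vol[Ioo 0 T].prod vol[rect a₁ b₁ a₂ b₂]) else 0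

lemma integral_smoothSq (M : RectMesh a₁ b₁ a₂ b₂) {r : ℕ} {G : ℕ → ℕ → ℝ → ℝ × ℝ → ℝ}
    (hG : ∀ m n, m + n ≤ r → MemL2 a₁ b₁ a₂ b₂ T (G m n)) :
    Integrable (fun t => smoothSq (meshX M) (meshY M) r fun m n => G m n t)
        vol[Ioo 0 T] ∧
      ∫ t in Ioo 0 T, smoothSq (meshX M) (meshY M) r (fun m n => G m n t)
        = familySq a₁ b₁ a₂ b₂ T r G := by
  have := isFiniteMeasure_rect a₁ b₁ a₂ b₂
  have key : ∀ m n, Integrable (fun t => if m + n ≤ r then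
        cellSq (meshX M) (meshY M) (G m n t) else 0) vol[Ioo 0 T] ∧
      ∫ t in Ioo 0 T, (if m + n ≤ r then cellSq (meshX M) (meshY M) (G m n t) else 0)
        = if m + n ≤ r then ∫ p : ℝ × ℝ × ℝ, G m n p.1 p.2 ^ 2
          ∂(vol[Ioo 0 T].prod vol[rect a₁ b₁ a₂ b₂]) else 0 := by
    intro m n
    by_cases hmn : m + n ≤ r
    · simp only [if_pos hmn]
      have h1 : Integrable (fun p : ℝ × ℝ × ℝ => G m n p.1 p.2 ^ 2)
        (vol[Ioo 0 T].prod vol[rect a₁ b₁ a₂ b₂]) :=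
        (hG m n hmn).integrable_sq
      have h2 : (fun t => cellSq (meshX M) (meshY M) (G m n t)) =ᵐ[vol[Ioo 0 T]]
          fun t => ∫ z in rect a₁ b₁ a₂ b₂, G m n t z ^ 2 := by
        filter_upwards [ae_memLp_slice (hG m n hmn)] with t ht using cellSq_eq_integral M ht
      exact ⟨h1.integral_prod_left.congr h2.symm, by
        rw [integral_congr_ae h2, integral_prod _ h1]⟩
    · simp only [if_neg hmn]
      exact ⟨integrable_zero _ _ _, integral_zero _ _⟩
  refine ⟨integrable_finsetSum _ fun m _ => integrable_finsetSum _ fun n _ => (key m n).1, ?_⟩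
  simp only [smoothSq, familySq]
  rw [integral_finsetSum _ fun m _ => integrable_finsetSum _ fun n _ => (key m n).1]
  refine sum_congr rfl fun m _ => ?_
  rw [integral_finsetSum _ fun n _ => (key m n).1]
  exact sum_congr rfl fun n _ => (key m n).2

lemma familySq_nonneg (r : ℕ) (G : ℕ → ℕ → ℝ → ℝ × ℝ → ℝ) : 0 ≤ familySq a₁ b₁ a₂ b₂ T r G :=
  sum_nonneg fun _ _ => sum_nonneg fun _ _ => by
    split_ifs <;> [exact integral_nonneg fun _ => sq_nonneg _; exact le_rfl]

/-- The norm of the broken derivatives does not depend on the mesh. -/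
lemma familySq_eq {M M₀ : RectMesh a₁ b₁ a₂ b₂} {r : ℕ} {u : ℝ → ℝ × ℝ → ℝ}
    {G G₀ : ℕ → ℕ → ℝ → ℝ × ℝ → ℝ} (hG : ∀ m n, m + n ≤ r → MemL2 a₁ b₁ a₂ b₂ T (G m n))
    (hG₀ : ∀ m n, m + n ≤ r → MemL2 a₁ b₁ a₂ b₂ T (G₀ m n))
    (h : ∀ᵐ t ∂vol[Ioo 0 T], WeakFamily M r (u t) (fun m n => G m n t))
    (h₀ : ∀ᵐ t ∂vol[Ioo 0 T], WeakFamily M₀ r (u t) (fun m n => G₀ m n t)) :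
    familySq a₁ b₁ a₂ b₂ T r G = familySq a₁ b₁ a₂ b₂ T r G₀ := by
  have := isFiniteMeasure_rect a₁ b₁ a₂ b₂
  refine sum_congr rfl fun m _ => sum_congr rfl fun n _ => ?_
  split_ifs with hmn
  · have e1 : Integrable (fun p : ℝ × ℝ × ℝ => G m n p.1 p.2 ^ 2)
      (vol[Ioo 0 T].prod vol[rect a₁ b₁ a₂ b₂]) :=
      (hG m n hmn).integrable_sq
    have e2 : Integrable (fun p : ℝ × ℝ × ℝ => G₀ m n p.1 p.2 ^ 2)
      (vol[Ioo 0 T].prod vol[rect a₁ b₁ a₂ b₂]) :=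
      (hG₀ m n hmn).integrable_sq
    rw [integral_prod _ e1, integral_prod _ e2]
    refine integral_congr_ae ?_
    filter_upwards [h, h₀] with t ht ht₀
    refine integral_congr_ae ?_
    filter_upwards [ht.unique ht₀ hmn] with z hz
    simp only [hz]
  · rfl

lemma TimeFamily.mono {M : RectMesh a₁ b₁ a₂ b₂} {r r' : ℕ} {u u' : ℝ → ℝ × ℝ → ℝ}
    {G G' : ℕ → ℕ → ℝ → ℝ × ℝ → ℝ} (h : TimeFamily M T r u u' G G') (hr : r' ≤ r) :
    TimeFamily M T r' u u' G G' where
  isH1 m n hmn := h.isH1 m n (hmn.trans hr)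
  weak t ht := ⟨fun m n hmn => (h.weak t ht).memLp m n (hmn.trans hr),
    fun m n hmn => (h.weak t ht).weak m n (hmn.trans hr)⟩
  weak' := by
    filter_upwards [h.weak'] with t ht
    exact ⟨fun m n hmn => ht.memLp m n (hmn.trans hr), fun m n hmn => ht.weak m n (hmn.trans hr)⟩
  eq_zero := h.eq_zero
  eq_zero' := h.eq_zero'

end FamilyNorm

section MeshSize

variable {a₁ b₁ a₂ b₂ ρ : ℝ} (M : RectMesh a₁ b₁ a₂ b₂)

lemma RectMesh.le_h (i : Fin M.Nx) (j : Fin M.Ny) :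
    max (M.xR i - M.xL i) (M.yR j - M.yL j) ≤ M.h :=
  le_ciSup (f := fun ij : Fin M.Nx × Fin M.Ny =>
    max (M.xR ij.1 - M.xL ij.1) (M.yR ij.2 - M.yL ij.2)) (Set.finite_range _).bddAbove (i, j)

lemma RectMesh.h_pos : 0 < M.h := by
  have h1 := M.le_h ⟨0, M.Nx_pos⟩ ⟨0, M.Ny_pos⟩
  have h2 : 0 < M.xR ⟨0, M.Nx_pos⟩ - M.xL ⟨0, M.Nx_pos⟩ := sub_pos.2 ((meshX M).lt _)
  exact h2.trans_le ((le_max_left _ _).trans h1)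

lemma RectMesh.QuasiUniform.meshX (h : M.QuasiUniform ρ) : QuasiUnif (meshX M) ρ M.h where
  le i := (le_max_left _ _).trans (M.le_h i ⟨0, M.Ny_pos⟩)
  ge := h.1

lemma RectMesh.QuasiUniform.meshY (h : M.QuasiUniform ρ) : QuasiUnif (meshY M) ρ M.h where
  le j := (le_max_right _ _).trans (M.le_h ⟨0, M.Nx_pos⟩ j)
  ge := h.2

end MeshSize

/-! ### The error equation -/

section ErrorEquation

variable {a₁ b₁ a₂ b₂ T α K : ℝ} {M : RectMesh a₁ b₁ a₂ b₂} {k : ℕ} {σ₁ σ₂ : ℝ}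
  {κ u₀ : ℝ × ℝ → ℝ} {u u' : ℝ → ℝ × ℝ → ℝ}

lemma restrict_cell_le (M : RectMesh a₁ b₁ a₂ b₂) (i : Fin M.Nx) (j : Fin M.Ny) :
    (volume : Measure (ℝ × ℝ)).restrict (M.cell i j) ≤ vol[rect a₁ b₁ a₂ b₂] :=
  Measure.restrict_mono (M.cell_subset i j) le_rfl

lemma ae_memLp_prodMk {β : Type} [MeasurableSpace β] {ν : Measure β} [SFinite ν]
    {F : ℝ × β → ℝ} (hF : MemLp F 2 (vol[Ioo 0 T].prod ν)) :
    ∀ᵐ t ∂vol[Ioo 0 T], MemLp (fun z => F (t, z)) 2 ν :=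
  ae_memLp_slice (f := fun t z => F (t, z)) hF

/-- The discrete initial value is the `L²` projection of the exact one. -/
lemma IsLDGSolution.zero_eq_proj {uh ph qh : ℝ → Vh M k}
    (h : IsLDGSolution M k T α σ₁ σ₂ κ u₀ uh ph qh)
    (h0 : ∀ᵐ z ∂vol[rect a₁ b₁ a₂ b₂], u 0 z = u₀ z)
    (hu : MemLp (u 0) 2 vol[rect a₁ b₁ a₂ b₂]) :
    uh 0 = proj (meshX M) (meshY M) k (u 0) := by
  refine eq_of_ip2_eq (meshX M) (meshY M) fun φ => ?_
  rw [ip2_proj, mom_apply (cellL2_of_memLp M hu), ip2_apply]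
  refine sum_congr rfl fun i _ => sum_congr rfl fun j _ => ?_
  rw [cell_eq, h.initial i j (φ i j)]
  refine integral_congr_ae ?_
  filter_upwards [ae_mono (restrict_cell_le M i j) h0] with z hz
  rw [hz]

/-- The error between the discrete solution and a discrete function `R`, elliptically projected
from a solution of the equation, satisfies an energy inequality whose right-hand side is the
projection error. -/
lemma IsLDGSolution.ae_energy_inequality (hα1 : α < 1) (hT : 0 < T) (hK : 0 ≤ K)
    (hκm : Measurable κ) (hκb : ∀ᵐ z ∂vol[rect a₁ b₁ a₂ b₂], |κ z| ≤ K)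
    {uh ph qh uh' R R' : ℝ → Vh M k} (h : IsLDGSolution M k T α σ₁ σ₂ κ u₀ uh ph qh)
    (huh : ∀ i j m n, IsH1 T (fun t => uh t i j m n) (fun t => uh' t i j m n))
    (hR : ∀ i j m n, IsH1 T (fun t => R t i j m n) (fun t => R' t i j m n))
    (hu : IsH1L2 T vol[rect a₁ b₁ a₂ b₂] u u') {f g : ℝ → ℝ × ℝ → ℝ}
    (hf : MemL2 a₁ b₁ a₂ b₂ T f) (hg : MemL2 a₁ b₁ a₂ b₂ T g)
    (hRs : ∀ t v, sform (meshX M) (meshY M) σ₁ σ₂ (R t) v = mom (meshX M) (meshY M) (u t) v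
      - mom (meshX M) (meshY M) (f t) v - mom (meshX M) (meshY M) (g t) v)
    (heq : ∀ᵐ t ∂vol[Ioo 0 T], ∀ᵐ z ∂vol[rect a₁ b₁ a₂ b₂],
      fracDxt α T κ u u' (t, z) = f t z + g t z) :
    ∀ᵐ t ∂vol[Ioo 0 T],
      ∑ i, ∑ j, ∫ z in M.cell i j, fracDxt α T κ
          (fun t z => (uh t i j).eval z - (R t i j).eval z)
          (fun t z => (uh' t i j).eval z - (R' t i j).eval z) (t, z)
          * ((uh t i j).eval z - (R t i j).eval z)
        ≤ ∑ i, ∑ j, ∫ z in M.cell i j, (fracDxt α T κ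
          (fun t z => u t z - (R t i j).eval z)
          (fun t z => u' t z - (R' t i j).eval z) (t, z) - (u t z - (R t i j).eval z))
          * ((uh t i j).eval z - (R t i j).eval z) := by
  have hfin := isFiniteMeasure_rect a₁ b₁ a₂ b₂
  have hfc : ∀ i j, IsFiniteMeasure ((volume : Measure (ℝ × ℝ)).restrict (M.cell i j)) :=
    fun i j => isFiniteMeasure_rect _ _ _ _
  obtain ⟨C, -, hC⟩ := exists_fracDxt_bound (α := α) hα1 hT hK
  set A : Fin M.Nx → Fin M.Ny → ℝ × ℝ × ℝ → ℝ := fun i j =>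
    fracDxt α T κ (fun t z => (uh t i j).eval z - (R t i j).eval z)
      (fun t z => (uh' t i j).eval z - (R' t i j).eval z)
  set B : Fin M.Nx → Fin M.Ny → ℝ × ℝ × ℝ → ℝ := fun i j =>
    fracDxt α T κ (fun t z => u t z - (R t i j).eval z) (fun t z => u' t z - (R' t i j).eval z)
  -- the identity between the time derivatives and their integrability, cell by cell
  have hcell : ∀ i j, ∀ᵐ t ∂vol[Ioo 0 T],
      (∀ᵐ z ∂vol[M.cell i j],
        A i j (t, z)
        = B i j (t, z)
          + substCaputo α (κ z) (fun τ => (uh τ i j).eval z) t - f t z - g t z) ∧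
      MemLp (fun z => B i j (t, z)) 2 vol[M.cell i j] ∧
      MemLp (fun z => substCaputo α (κ z) (fun τ => (uh τ i j).eval z) t) 2
        vol[M.cell i j] := by
    intro i j
    have hκb' := ae_mono (restrict_cell_le M i j) hκb
    have e1 : IsH1L2 T vol[M.cell i j] (fun t z => (uh t i j).eval z)
        (fun t z => (uh' t i j).eval z) := isH1L2_eval (huh i j) _ _ _ _
    have e2 : IsH1L2 T vol[M.cell i j] (fun t z => (R t i j).eval z)
        (fun t z => (R' t i j).eval z) := isH1L2_eval (hR i j) _ _ _ _
    have e3 := hu.mono_measure (restrict_cell_le M i j)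
    have e4 := e3.sub e2
    obtain ⟨m1, -, i1⟩ := hC _ κ hκm hκb' _ _ (e1.memLp hT.le) e1.deriv
    obtain ⟨-, -, i2⟩ := hC _ κ hκm hκb' _ _ (e2.memLp hT.le) e2.deriv
    obtain ⟨-, -, i3⟩ := hC _ κ hκm hκb' _ _ (e3.memLp hT.le) e3.deriv
    obtain ⟨m4, -, -⟩ := hC _ κ hκm hκb' _ _ (e4.memLp hT.le) e4.deriv
    filter_upwards [Measure.ae_ae_of_ae_prod i1, Measure.ae_ae_of_ae_prod i2,
      Measure.ae_ae_of_ae_prod i3, heq,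
      ae_memLp_prodMk m1, ae_memLp_prodMk m4,
      ae_restrict_mem measurableSet_Ioo] with t h1 h2 h3 h4 h5 h6 ht
    have hs : ∀ᵐ z ∂vol[M.cell i j],
        fracDxt α T κ (fun t z => (uh t i j).eval z) (fun t z => (uh' t i j).eval z) (t, z)
          = substCaputo α (κ z) (fun τ => (uh τ i j).eval z) t := by
      filter_upwards [e1.ae_isH1] with z hz
      rw [substCaputo_eq_fracD hT.le (hz.intervalIntegrable hT.le) hz.2 ht, fracDxt]
    refine ⟨?_, h6, (memLp_congr_ae hs).1 h5⟩
    filter_upwards [h1, h2, h3, ae_mono (restrict_cell_le M i j) h4, hs] with z z1 z2 z3 z4 z5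
    rw [← z5]
    simp only [A, B, fracDxt] at z4 ⊢
    rw [fracD_sub z1 z2, fracD_sub z3 z2]
    linarith
  filter_upwards [ae_all_iff.2 fun i => ae_all_iff.2 (hcell i), h.ae_operator_form,
    ae_memLp_slice hf, ae_memLp_slice hg, ae_restrict_mem measurableSet_Ioo]
    with t hc hop hft hgt ht
  have hut := hu.memLp_at (Ioo_subset_Icc_self ht)
  set w : Vh M k := uh t - R t with hw
  have hwz : ∀ i j z, (uh t i j).eval z - (R t i j).eval z = (w i j).eval z := fun i j z =>
    (eval_sub _ _ _).symm
  have hkey : ∀ i j, ∫ z in M.cell i j, A i j (t, z) * (w i j).eval z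
        = (∫ z in M.cell i j, (B i j (t, z) - (u t z - (R t i j).eval z))
          * (w i j).eval z)
        + (∫ z in M.cell i j,
            substCaputo α (κ z) (fun τ => (uh τ i j).eval z) t * (w i j).eval z)
        - (∫ z in M.cell i j, f t z * (w i j).eval z)
        - (∫ z in M.cell i j, g t z * (w i j).eval z)
        + (∫ z in M.cell i j, u t z * (w i j).eval z)
        - ∫ z in M.cell i j, (R t i j).eval z * (w i j).eval z := by
    intro i j
    obtain ⟨c1, c2, c3⟩ := hc i j
    have hwm : MemLp (w i j).eval 2 vol[M.cell i j] := memLp_eval _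
    have hRm : MemLp (R t i j).eval 2 vol[M.cell i j] := memLp_eval _
    have hum := hut.mono_measure (restrict_cell_le M i j)
    have j1 : Integrable (fun z => (B i j (t, z) - (u t z - (R t i j).eval z))
          * (w i j).eval z) vol[M.cell i j] :=
      (c2.sub (hum.sub hRm)).integrable_mul hwm
    have j2 : Integrable (fun z => substCaputo α (κ z) (fun τ => (uh τ i j).eval z) t
      * (w i j).eval z) vol[M.cell i j] := c3.integrable_mul hwm
    have j3 : Integrable (fun z => f t z * (w i j).eval z) vol[M.cell i j] :=
      (hft.mono_measure (restrict_cell_le M i j)).integrable_mul hwm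
    have j4 : Integrable (fun z => g t z * (w i j).eval z) vol[M.cell i j] :=
      (hgt.mono_measure (restrict_cell_le M i j)).integrable_mul hwm
    have j5 : Integrable (fun z => u t z * (w i j).eval z) vol[M.cell i j] :=
      hum.integrable_mul hwm
    have j6 : Integrable (fun z => (R t i j).eval z * (w i j).eval z)
      vol[M.cell i j] := hRm.integrable_mul hwm
    have k2 := j1.add j2
    have k3 := k2.sub j3
    have k4 := k3.sub j4
    have k5 := k4.add j5
    have hsum := integral_sub' k5 j6
    rw [integral_add' k4 j5, integral_sub' k3 j4, integral_sub' k2 j3, integral_add' j1 j2] at hsum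
    refine Eq.trans (integral_congr_ae ?_) hsum
    filter_upwards [c1] with z hz
    simp only [Pi.add_apply, Pi.sub_apply]
    rw [hz]; ring
  change ∑ i, ∑ j, ∫ z in M.cell i j, A i j (t, z) * _
    ≤ ∑ i, ∑ j, ∫ z in M.cell i j, (B i j (t, z) - _) * _
  simp only [hwz, hkey, sum_add_distrib, sum_sub_distrib]
  have h1 := hop w
  have h2 := hRs t w
  rw [sform_apply, mom_apply (cellL2_of_memLp M hut), mom_apply (cellL2_of_memLp M hft),
    mom_apply (cellL2_of_memLp M hgt), ip2_apply] at h2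
  simp only [cell_eq] at h2
  have h3 : uh t = w + R t := by rw [hw]; abel
  rw [h3] at h1
  simp only [map_add, LinearMap.add_apply] at h1
  have p1 := ip2_self_nonneg (meshX M) (meshY M) (dxOp (meshX M) σ₁ w)
  have p2 := ip2_self_nonneg (meshX M) (meshY M) (dyOp (meshY M) σ₂ w)
  linarith

end ErrorEquation

/-! ### The error estimate -/

section Estimate

variable {a₁ b₁ a₂ b₂ T α K : ℝ} {M : RectMesh a₁ b₁ a₂ b₂} {k r : ℕ} {σ₁ σ₂ : ℝ}
  {κ u₀ : ℝ × ℝ → ℝ} {u u' : ℝ → ℝ × ℝ → ℝ} {G G' : ℕ → ℕ → ℝ → ℝ × ℝ → ℝ}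

lemma TimeFamily.isH1_ellipticProj (hG : TimeFamily M T r u u' G G') (hr : 2 ≤ r)
    (i : Fin M.Nx) (j : Fin M.Ny) (m n : Fin (k + 1)) :
    IsH1 T (fun t => ellipticProj (meshX M) (meshY M) k σ₁ σ₂ (fun m n => G m n t) i j m n)
      (fun t => ellipticProj (meshX M) (meshY M) k σ₁ σ₂ (fun m n => G' m n t) i j m n) := by
  have hm : ∀ m n, m + n ≤ r → ∀ w : V2 (Fin M.Nx) (Fin M.Ny) k,
      IsH1 T (fun t => mom (meshX M) (meshY M) (G m n t) w)
        (fun t => mom (meshX M) (meshY M) (G' m n t) w) := fun m n hmn =>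
    isH1_mom fun i j => (hG.isH1 m n hmn).mono_measure (restrict_cell_le M i j)
  exact isH1_riesz (sform_definite (meshX M) (meshY M) σ₁ σ₂)
    (l := fun t => ellipticFun (meshX M) (meshY M) k fun m n => G m n t)
    (l' := fun t => ellipticFun (meshX M) (meshY M) k fun m n => G' m n t)
    (fun w => ((hm 0 0 (by omega) w).sub (hm 2 0 (by omega) w)).sub (hm 0 2 (by omega) w)) i j m n

lemma IsH1L2.isH1_proj (hu : IsH1L2 T vol[rect a₁ b₁ a₂ b₂] u u')
    (i : Fin M.Nx) (j : Fin M.Ny) (m n : Fin (k + 1)) :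
    IsH1 T (fun t => proj (meshX M) (meshY M) k (u t) i j m n)
      (fun t => proj (meshX M) (meshY M) k (u' t) i j m n) :=
  isH1_riesz (ip2_definite (meshX M) (meshY M)) (l := fun t => mom (meshX M) (meshY M) (u t))
    (l' := fun t => mom (meshX M) (meshY M) (u' t))
    (fun w => isH1_mom (X := meshX M) (Y := meshY M)
      (fun i j => hu.mono_measure (restrict_cell_le M i j)) w) i j m n

lemma sum_integral_sq_prod_le {f : Fin M.Nx → Fin M.Ny → ℝ → ℝ × ℝ → ℝ}
    (hf : ∀ i j, MemLp (Function.uncurry (f i j)) 2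
      (vol[Ioo 0 T].prod vol[M.cell i j])) {c : ℝ}
    (hG : ∀ m n, m + n ≤ r → MemL2 a₁ b₁ a₂ b₂ T (G m n))
    (h : ∀ᵐ t ∂vol[Ioo 0 T], ∑ i, ∑ j, ∫ z in M.cell i j, f i j t z ^ 2
      ≤ c * smoothSq (meshX M) (meshY M) r fun m n => G m n t) :
    ∑ i, ∑ j, ∫ p : ℝ × ℝ × ℝ, f i j p.1 p.2 ^ 2
        ∂(vol[Ioo 0 T].prod vol[M.cell i j])
      ≤ c * familySq a₁ b₁ a₂ b₂ T r G := by
  obtain ⟨h1, h2⟩ := sum_integral_sq_prod hf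
  obtain ⟨h3, h4⟩ := integral_smoothSq M hG
  rw [h2, ← h4, ← integral_const_mul]
  exact integral_mono_ae h1 (h3.const_mul c) h

/-- The error estimate on a single mesh, with a constant that depends neither on the mesh nor on
the solution. -/
lemma exists_error_estimate (hα : 0 < α) (hα1 : α < 1) (hT : 0 < T) (hK : 0 ≤ K) (k : ℕ) (ρ : ℝ)
    (hσ₁ : σ₁ ≠ 1 / 2) (hσ₂ : σ₂ ≠ 1 / 2) : ∃ C : ℝ, 0 < C ∧
    ∀ (κ : ℝ × ℝ → ℝ), Measurable κ →
    (∀ᵐ z ∂vol[rect a₁ b₁ a₂ b₂], |κ z| ≤ K) →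
    ∀ (M : RectMesh a₁ b₁ a₂ b₂), M.QuasiUniform ρ →
    ∀ (u₀ : ℝ × ℝ → ℝ) (u u' : ℝ → ℝ × ℝ → ℝ) (G G' : ℕ → ℕ → ℝ → ℝ × ℝ → ℝ),
    TimeFamily M T (max (k + 1) 2) u u' G G' →
    (∀ᵐ z ∂vol[rect a₁ b₁ a₂ b₂], u 0 z = u₀ z) →
    (∀ᵐ t ∂vol[Ioo 0 T],
      (∀ᵐ z ∂vol[rect a₁ b₁ a₂ b₂],
        fracDxt α T κ u u' (t, z) = G 2 0 t z + G 0 2 t z) ∧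
      ConformingFamily (meshX M) (meshY M) k σ₁ σ₂ (fun m n => G m n t) ∧
      ConformingFamily (meshX M) (meshY M) k σ₁ σ₂ (fun m n => G' m n t)) →
    ∀ uh ph qh : ℝ → Vh M k, IsLDGSolution M k T α σ₁ σ₂ κ u₀ uh ph qh →
    ∫ t in (0 : ℝ)..T, sqErr (u t) (uh t) ≤ C * M.h ^ (2 * k + 2)
      * (familySq a₁ b₁ a₂ b₂ T (max (k + 1) 2) G
        + familySq a₁ b₁ a₂ b₂ T (max (k + 1) 2) G') := by
  obtain ⟨C₁, hC₁, hproj⟩ := exists_ellipticProj_error k ρ hσ₁ hσ₂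
  obtain ⟨C₂, hC₂, hfrac⟩ := exists_fracDxt_bound (α := α) hα1 hT hK
  obtain ⟨C₃, hC₃, hen⟩ := exists_energy_bound hα hα1 hT hK
  refine ⟨2 * C₁ + 2 * (C₃ * ((2 / T + 2 * T) * C₁ + (2 * C₂ + 2) * C₁)), by positivity, ?_⟩
  intro κ hκm hκb M hM u₀ u u' G G' hG h0 hae uh ph qh hh
  have hfin := isFiniteMeasure_rect a₁ b₁ a₂ b₂
  have hfc : ∀ i j, IsFiniteMeasure ((volume : Measure (ℝ × ℝ)).restrict (M.cell i j)) :=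
    fun i j => isFiniteMeasure_rect _ _ _ _
  set X := meshX M
  set Y := meshY M
  set m : Fin M.Nx → Fin M.Ny → Measure (ℝ × ℝ × ℝ) := fun i j =>
    vol[Ioo 0 T].prod vol[M.cell i j]
  set N := max (k + 1) 2
  have hN2 : 2 ≤ N := le_max_right _ _
  set Φ := familySq a₁ b₁ a₂ b₂ T N G
  set Φ' := familySq a₁ b₁ a₂ b₂ T N G'
  have hΦ0 : 0 ≤ Φ := familySq_nonneg _ _
  have hΦ0' : 0 ≤ Φ' := familySq_nonneg _ _
  set H := M.h ^ (2 * k + 2)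
  have hH0 : 0 < H := pow_pos M.h_pos _
  have hu : IsH1L2 T vol[rect a₁ b₁ a₂ b₂] u u' := by
    have := hG.isH1 0 0 (by omega)
    rwa [hG.eq_zero, hG.eq_zero'] at this
  have hGm : ∀ m n, m + n ≤ N → MemL2 a₁ b₁ a₂ b₂ T (G m n) := fun m n hmn =>
    (hG.isH1 m n hmn).memLp hT.le
  have hGm' : ∀ m n, m + n ≤ N → MemL2 a₁ b₁ a₂ b₂ T (G' m n) := fun m n hmn =>
    (hG.isH1 m n hmn).deriv
  set R : ℝ → Vh M k := fun t => ellipticProj X Y k σ₁ σ₂ fun m n => G m n t with hR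
  set R' : ℝ → Vh M k := fun t => ellipticProj X Y k σ₁ σ₂ fun m n => G' m n t
  set P : ℝ → Vh M k := fun t => proj X Y k (u t)
  set P' : ℝ → Vh M k := fun t => proj X Y k (u' t)
  have hRH : ∀ i j m n, IsH1 T (fun t => R t i j m n) (fun t => R' t i j m n) :=
    hG.isH1_ellipticProj hN2
  have hPH : ∀ i j m n, IsH1 T (fun t => P t i j m n) (fun t => P' t i j m n) := hu.isH1_proj
  choose uhd huh1 huh2 using hh.uh_mem
  set uh' : ℝ → Vh M k := fun t i j m n => uhd i j m n t
  have hUH : ∀ i j m n, IsH1 T (fun t => uh t i j m n) (fun t => uh' t i j m n) :=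
    fun i j m n => ⟨huh1 i j m n, huh2 i j m n⟩
  have iR : ∀ i j, IsH1L2 T vol[M.cell i j] (fun t z => (R t i j).eval z)
      (fun t z => (R' t i j).eval z) := fun i j => isH1L2_eval (hRH i j) _ _ _ _
  have iP : ∀ i j, IsH1L2 T vol[M.cell i j] (fun t z => (P t i j).eval z)
      (fun t z => (P' t i j).eval z) := fun i j => isH1L2_eval (hPH i j) _ _ _ _
  have iU : ∀ i j, IsH1L2 T vol[M.cell i j] (fun t z => (uh t i j).eval z)
      (fun t z => (uh' t i j).eval z) := fun i j => isH1L2_eval (hUH i j) _ _ _ _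
  have iu : ∀ i j, IsH1L2 T vol[M.cell i j] u u' := fun i j =>
    hu.mono_measure (restrict_cell_le M i j)
  -- `η` is the error of the elliptic projection, `ε` its distance to the `L²` projection
  have iη := fun i j => (iu i j).sub (iR i j)
  have iε := fun i j => (iR i j).sub (iP i j)
  have ie := fun i j => (iU i j).sub (iR i j)
  have hest : ∀ᵐ t ∂vol[Ioo 0 T],
      ((∑ i, ∑ j, ∫ z in M.cell i j, (u t z - (R t i j).eval z) ^ 2)
        ≤ C₁ * H * smoothSq X Y N (fun m n => G m n t)) ∧
      (∑ i, ∑ j, ∫ z in M.cell i j, ((R t i j).eval z - (P t i j).eval z) ^ 2)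
        ≤ C₁ * H * smoothSq X Y N (fun m n => G m n t) := by
    filter_upwards [hae, ae_restrict_mem measurableSet_Ioo] with t ht htm
    have := hproj X Y M.h M.h_pos hM.meshX hM.meshY _
      (hG.weak t (Ioo_subset_Icc_self htm)).brokenSmooth ht.2.1
    rw [hG.eq_zero] at this
    exact this
  have hest' : ∀ᵐ t ∂vol[Ioo 0 T],
      ((∑ i, ∑ j, ∫ z in M.cell i j, (u' t z - (R' t i j).eval z) ^ 2)
        ≤ C₁ * H * smoothSq X Y N (fun m n => G' m n t)) ∧
      (∑ i, ∑ j, ∫ z in M.cell i j, ((R' t i j).eval z - (P' t i j).eval z) ^ 2)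
        ≤ C₁ * H * smoothSq X Y N (fun m n => G' m n t) := by
    filter_upwards [hae, hG.weak'] with t ht htm
    have := hproj X Y M.h M.h_pos hM.meshX hM.meshY _ htm.brokenSmooth ht.2.2
    rw [hG.eq_zero'] at this
    exact this
  have bη := sum_integral_sq_prod_le (fun i j => (iη i j).memLp hT.le) hGm
    (hest.mono fun t ht => ht.1)
  have bε := sum_integral_sq_prod_le (fun i j => (iε i j).memLp hT.le) hGm
    (hest.mono fun t ht => ht.2)
  have bη' := sum_integral_sq_prod_le (fun i j => (iη i j).deriv) hGm'
    (hest'.mono fun t ht => ht.1)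
  have bε' := sum_integral_sq_prod_le (fun i j => (iε i j).deriv) hGm'
    (hest'.mono fun t ht => ht.2)
  -- the initial error
  have hinit : ∑ i, ∑ j, ∫ z in M.cell i j, ((uh 0 i j).eval z - (R 0 i j).eval z) ^ 2
      ≤ 2 / T * (C₁ * H * Φ) + 2 * T * (C₁ * H * Φ') := by
    have h1 : ∑ i, ∑ j, ∫ z in M.cell i j, ((uh 0 i j).eval z - (R 0 i j).eval z) ^ 2
        = ∑ i, ∑ j, ∫ z in M.cell i j, ((R 0 i j).eval z - (P 0 i j).eval z) ^ 2 := by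
      have : uh 0 = P 0 := hh.zero_eq_proj h0 hu.zero
      rw [this]
      refine sum_congr rfl fun i _ => sum_congr rfl fun j _ => ?_
      congr 1; funext z; ring
    have h2 := sum_le_sum fun i (_ : i ∈ Finset.univ) =>
      sum_le_sum fun j (_ : j ∈ Finset.univ) => (iε i j).integral_sq_zero_le hT
    simp only [sum_add_distrib, ← mul_sum] at h2
    rw [h1]
    have h3 := mul_le_mul_of_nonneg_left bε (by positivity : 0 ≤ 2 / T)
    have h4 := mul_le_mul_of_nonneg_left bε' (by positivity : 0 ≤ 2 * T)
    linarith
  -- the right-hand side of the energy inequality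
  set D : Fin M.Nx → Fin M.Ny → ℝ × ℝ × ℝ → ℝ := fun i j p =>
    fracDxt α T κ (fun t z => u t z - (R t i j).eval z)
      (fun t z => u' t z - (R' t i j).eval z) p
  have hDb := fun i j => hfrac vol[M.cell i j] κ hκm
    (ae_mono (restrict_cell_le M i j) hκb) _ _ ((iη i j).memLp hT.le) (iη i j).deriv
  have hHm : ∀ i j, MemLp (fun p : ℝ × ℝ × ℝ => D i j p - (u p.1 p.2 - (R p.1 i j).eval p.2)) 2
      (m i j) := fun i j =>
    (hDb i j).1.sub ((iη i j).memLp hT.le)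
  have hHb : ∑ i, ∑ j, ∫ p : ℝ × ℝ × ℝ, (D i j p - (u p.1 p.2 - (R p.1 i j).eval p.2)) ^ 2
        ∂(m i j)
      ≤ 2 * (C₂ * (C₁ * H * Φ + C₁ * H * Φ')) + 2 * (C₁ * H * Φ) := by
    have h1 : ∀ i j, ∫ p : ℝ × ℝ × ℝ, (D i j p - (u p.1 p.2 - (R p.1 i j).eval p.2)) ^ 2
          ∂(m i j)
        ≤ 2 * (C₂ * ((∫ p : ℝ × ℝ × ℝ, (u p.1 p.2 - (R p.1 i j).eval p.2) ^ 2
            ∂(m i j))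
          + ∫ p : ℝ × ℝ × ℝ, (u' p.1 p.2 - (R' p.1 i j).eval p.2) ^ 2
            ∂(m i j)))
          + 2 * ∫ p : ℝ × ℝ × ℝ, (u p.1 p.2 - (R p.1 i j).eval p.2) ^ 2
            ∂(m i j) := fun i j =>
      (integral_sub_sq_le (hDb i j).1 ((iη i j).memLp hT.le)).trans
        (add_le_add_left (mul_le_mul_of_nonneg_left (hDb i j).2.1 zero_le_two) _)
    have h2 := sum_le_sum fun i (_ : i ∈ Finset.univ) =>
      sum_le_sum fun j (_ : j ∈ Finset.univ) => h1 i j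
    simp only [sum_add_distrib, ← mul_sum] at h2
    have h3 := mul_le_mul_of_nonneg_left (add_le_add bη bη') hC₂.le
    linarith
  -- the energy estimate for `e`
  have hineq := hh.ae_energy_inequality hα1 hT hK hκm hκb hUH hRH hu (hGm 2 0 (by omega))
    (hGm 0 2 (by omega)) (fun t v => by
      rw [hR, sform_ellipticProj, hG.eq_zero]) (hae.mono fun t ht => ht.1)
  have bound_e := hen (fun ij : Fin M.Nx × Fin M.Ny => vol[M.cell ij.1 ij.2]) κ hκm
    (fun ij => ae_mono (restrict_cell_le M ij.1 ij.2) hκb)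
    (fun ij t z => (uh t ij.1 ij.2).eval z - (R t ij.1 ij.2).eval z)
    (fun ij t z => (uh' t ij.1 ij.2).eval z - (R' t ij.1 ij.2).eval z)
    (fun ij p => D ij.1 ij.2 p - (u p.1 p.2 - (R p.1 ij.1 ij.2).eval p.2))
    (fun ij => ie ij.1 ij.2) (fun ij => hHm ij.1 ij.2) (by
      filter_upwards [hineq] with t ht
      rw [Fintype.sum_prod_type, Fintype.sum_prod_type]
      exact ht)
  rw [Fintype.sum_prod_type, Fintype.sum_prod_type, Fintype.sum_prod_type] at bound_e
  have hfinal : ∫ t in (0 : ℝ)..T, sqErr (u t) (uh t)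
      ≤ 2 * (∑ i, ∑ j, ∫ p : ℝ × ℝ × ℝ, (u p.1 p.2 - (R p.1 i j).eval p.2) ^ 2
          ∂(m i j))
        + 2 * ∑ i, ∑ j, ∫ p : ℝ × ℝ × ℝ, ((uh p.1 i j).eval p.2 - (R p.1 i j).eval p.2) ^ 2
          ∂(m i j) := by
    have h1 := (sum_integral_sq_prod fun i j => ((iu i j).sub (iU i j)).memLp hT.le).2
    rw [integral_of_le hT.le, integral_Ioc_eq_integral_Ioo]
    change ∫ t in Ioo 0 T, ∑ i, ∑ j, ∫ z in M.cell i j, (u t z - (uh t i j).eval z) ^ 2 ≤ _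
    rw [← h1]
    simp only [mul_sum, ← sum_add_distrib]
    refine sum_le_sum fun i _ => sum_le_sum fun j _ => ?_
    have := integral_sub_sq_le ((iη i j).memLp hT.le) ((ie i j).memLp hT.le)
    simp only [Function.uncurry, sub_sub_sub_cancel_right] at this
    exact this
  have hb := mul_le_mul_of_nonneg_left (add_le_add hinit hHb) hC₃.le
  have q1 : 0 ≤ H * Φ := by positivity
  have q2 : 0 ≤ H * Φ' := by positivity
  have n1 : 0 ≤ C₃ * (2 / T) * C₁ * (H * Φ') := by positivity
  have n2 : 0 ≤ C₃ * (2 * T) * C₁ * (H * Φ) := by positivity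
  have n3 : 0 ≤ C₁ * (H * Φ') := by positivity
  have n4 : 0 ≤ C₃ * C₁ * (H * Φ') := by positivity
  calc _ ≤ _ := hfinal
    _ ≤ 2 * (C₁ * H * Φ) + 2 * (C₃ * ((2 / T * (C₁ * H * Φ) + 2 * T * (C₁ * H * Φ'))
        + (2 * (C₂ * (C₁ * H * Φ + C₁ * H * Φ')) + 2 * (C₁ * H * Φ)))) :=
      add_le_add (mul_le_mul_of_nonneg_left bη zero_le_two)
        (mul_le_mul_of_nonneg_left (bound_e.trans hb) zero_le_two)
    _ ≤ _ := by
      rw [← sub_nonneg]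
      have : 0 ≤ 2 * (C₃ * (2 / T) * C₁ * (H * Φ')) + 2 * (C₃ * (2 * T) * C₁ * (H * Φ))
        + 2 * (C₁ * (H * Φ')) + 4 * (C₃ * C₁ * (H * Φ')) := by linarith
      convert this using 1
      ring

end Estimate

end LDG

end

open LDG

theorem theorem3p2
    (a₁ b₁ a₂ b₂ T α : ℝ) (hx : a₁ < b₁) (hy : a₂ < b₂) (hT : 0 < T)
    (hα0 : 0 < α) (hα1 : α < 1)
    (κ : ℝ × ℝ → ℝ) (hκm : Measurable κ)
    (hκb : ∃ Cκ : ℝ, ∀ z ∈ LDG.rect a₁ b₁ a₂ b₂, |κ z| ≤ Cκ)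
    (k s : ℕ) (hks : k ≤ s)
    (σ₁ σ₂ : ℝ) (hσ₁ : σ₁ ≠ 1 / 2) (hσ₂ : σ₂ ≠ 1 / 2) (ρ : ℝ)
    (u₀ : ℝ × ℝ → ℝ) (u : ℝ → ℝ × ℝ → ℝ)
    (hu : LDG.IsExactSolution a₁ b₁ a₂ b₂ T α κ u₀ u) :
    ∃ C : ℝ, 0 < C ∧
      ∀ M : LDG.RectMesh a₁ b₁ a₂ b₂, M.QuasiUniform ρ →
        LDG.MemH1Broken M T (max (s + 1) 2) u →
        ∀ uh ph qh : ℝ → LDG.Vh M k,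
          LDG.IsLDGSolution M k T α σ₁ σ₂ κ u₀ uh ph qh →
          ∫ t in (0 : ℝ)..T, LDG.sqErr (u t) (uh t) ≤ C * M.h ^ (2 * k + 2) := by
  obtain ⟨⟨hu1, u', hd, hu'⟩, h0, p, q, hp, hq, hpde⟩ := hu
  obtain ⟨K, hKb⟩ := hκb
  have hfin := isFiniteMeasure_rect a₁ b₁ a₂ b₂
  have hK : 0 ≤ max K 0 := le_max_right _ _
  have hκ : ∀ᵐ z ∂(volume.restrict (rect a₁ b₁ a₂ b₂)), |κ z| ≤ max K 0 :=
    ae_restrict_of_forall_mem (measurableSet_rect _ _ _ _) fun z hz =>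
      (hKb z hz).trans (le_max_left _ _)
  obtain ⟨C, hC, hest⟩ := exists_error_estimate (a₁ := a₁) (b₁ := b₁) (a₂ := a₂) (b₂ := b₂)
    hα0 hα1 hT hK k ρ hσ₁ hσ₂
  obtain ⟨_, -, hfrac⟩ := exists_fracDxt_bound (α := α) hα1 hT hK
  have hS := (hfrac _ κ hκm hκ u u' hu1 hu').1
  -- only the derivatives up to order `max (k + 1) 2` enter the estimate
  have hr : max (k + 1) 2 ≤ max (s + 1) 2 := by omega
  -- if no mesh is admissible, there is nothing to estimate
  by_cases hex : ∃ M₀ : RectMesh a₁ b₁ a₂ b₂, MemH1Broken M₀ T (max (s + 1) 2) u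
  -- `N + 1` rather than `N` keeps the constant positive when `u` vanishes
  · obtain ⟨M₀, hM₀⟩ := hex
    obtain ⟨G₀, G₀', hG₀⟩ := exists_timeFamily M₀ hT _ hu1 hu' hd hM₀
    replace hG₀ := hG₀.mono hr
    set N := familySq a₁ b₁ a₂ b₂ T (max (k + 1) 2) G₀
      + familySq a₁ b₁ a₂ b₂ T (max (k + 1) 2) G₀' with hN
    have hN0 : 0 ≤ N := add_nonneg (familySq_nonneg _ _) (familySq_nonneg _ _)
    refine ⟨C * (N + 1), by positivity, fun M hM hMu uh ph qh hh => ?_⟩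
    obtain ⟨G, G', hG⟩ := exists_timeFamily M hT _ hu1 hu' hd hMu
    replace hG := hG.mono hr
    -- the norms of the broken derivatives may be computed on any admissible mesh
    have e1 : familySq a₁ b₁ a₂ b₂ T (max (k + 1) 2) G
        = familySq a₁ b₁ a₂ b₂ T (max (k + 1) 2) G₀ :=
      familySq_eq (fun m n h => (hG.isH1 m n h).memLp hT.le)
        (fun m n h => (hG₀.isH1 m n h).memLp hT.le)
        ((ae_restrict_mem measurableSet_Ioo).mono fun t ht => hG.weak t (Ioo_subset_Icc_self ht))
        ((ae_restrict_mem measurableSet_Ioo).mono fun t ht => hG₀.weak t (Ioo_subset_Icc_self ht))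
    have e2 : familySq a₁ b₁ a₂ b₂ T (max (k + 1) 2) G'
        = familySq a₁ b₁ a₂ b₂ T (max (k + 1) 2) G₀' :=
      familySq_eq (fun m n h => (hG.isH1 m n h).deriv) (fun m n h => (hG₀.isH1 m n h).deriv)
        hG.weak' hG₀.weak'
    have := hest κ hκm hκ M hM u₀ u u' G G' hG h0
      (ae_conforming M hx hy hT k σ₁ σ₂ (le_max_right _ _) hG hp hq hS
        (ae_isWeakPoisson hT hd hpde)) uh ph qh hh
    rw [e1, e2, ← hN] at this
    refine this.trans ?_
    have hh0 : 0 ≤ C * M.h ^ (2 * k + 2) := mul_nonneg hC.le (pow_nonneg M.h_pos.le _)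
    linarith
  · exact ⟨1, one_pos, fun M _ hMu => absurd ⟨M, hMu⟩ hex⟩
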